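/- **Setting.** A Calabi–Yau structure $(J,\omega,\Omega)$ on a 6-manifold is a torsion-free $SU(3)$-structure ($J,\omega,\Omega$ smooth, $d\omega=0$, $d\Omega=0$, pointwise isomorphic to the standard structure on $\mathbb C^3$), with metric $g(u,v)=\omega(u,Jv)$. A 3-fold in it is special Lagrangian (SL) if it is an embedded 3-dimensional submanifold on which $\omega$ and $\operatorname{Im}\Omega$ vanish. For $i=1,\dots,n$ let $\Gamma_i$ be a compact connected 5-manifold and $V_i'=\Gamma_i\times(0,\infty)$ a Calabi–Yau cone, i.e. a Calabi–Yau structure with $g_{V_i}=r^2g_{V_i}|_{\Gamma_i}+dr^2$, $\omega_{V_i}=r^2\omega_{V_i}|_{\Gamma_i}+r\,dr\wedge\alpha_i$, $\Omega_{V_i}=r^3\Omega_{V_i}|_{\Gamma_i}+r^2dr\wedge\beta_i$ (with a real 1-form $\alpha_i$ and a complex 2-form $\beta_i$ on $\Gamma_i$). Norms and $\nabla$ below are those of the cone metrics, and estimates hold for all $k\ge 0$. * $M_0$ is a compact Hausdorff space with distinct points $x_1,\dots,x_n$ such that $M_0\setminus\{x_1,\dots,x_n\}$ is a 6-manifold with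 a Calabi–Yau structure $(J_0,\omega_0,\Omega_0)$. There are $\epsilon,\nu>0$ and diffeomorphisms $\Phi_i:\Gamma_i\times(0,\epsilon)\to S_i\setminus\{x_i\}$, with disjoint open neighbourhoods $S_i$ of $x_i$, such that $r\to 0$ corresponds to $x_i$ (the sets $\{x_i\}\cup\Phi_i(\Gamma_i\times(0,\delta))$, $0<\delta\le\epsilon$, are a basis of neighbourhoods of $x_i$), $\Phi_i^*\omega_0=\omega_{V_i}$ and $|\nabla^k(\Phi_i^*\Omega_0-\Omega_{V_i})|=O(r^{\nu-k})$ as $r\to0$. * $(Y_i,J_{Y_i},\omega_{Y_i},\Omega_{Y_i})$ is a complete asymptotically conical Calabi–Yau 3-fold of rate $\lambda_i<-3$: there are $R>0$, a compact $K_i\subset Y_i$ and a diffeomorphism $\Upsilon_i:\Gamma_i\times(R,\infty)\to Y_i\setminus K_i$, with $r\to\infty$ corresponding to infinity in $Y_i$ (the sets $\Upsilon_i(\Gamma_i\times(s,\infty))$, $s\ge R$, are a basis of the neighbourhoods of infinity), such that $\Upsilon_i^*\omega_{Y_i}=\omega_{V_i}$ and $|\nabla^k(\Upsilon_i^*\Omega_{Y_i}-\Omega_{V_i})|=O(r^{\lambda_i-k})$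 as $r\to\infty$. * $\Sigma_i\subset\Gamma_i$ is a compact embedded surface such that $C_i'=\Sigma_i\times(0,\infty)$ is SL in $V_i'$, with induced metric $g_{C_i}$. $\Psi_{C_i}:U_{C_i}\to V_i'$ is an embedding of an open neighbourhood $U_{C_i}$ of the zero section of $T^*(\Sigma_i\times(0,\infty))$ that is the inclusion on the zero section, pulls $\omega_{V_i}$ back to the canonical symplectic form, and intertwines the actions $(\sigma,r,\eta,c)\mapsto(\sigma,tr,t^2\eta,tc)$, under which $U_{C_i}$ is invariant, and $(\gamma,r)\mapsto(\gamma,tr)$, $t>0$. $\Gamma(\chi)$ denotes the graph of a 1-form $\chi$. * $N_0\subset M_0$ is compact, contains the $x_i$, and $N_0\setminus\{x_1,\dots,x_n\}$ is SL. There are $\mu\in(1,\nu+1)$, $\epsilon'\in(0,\epsilon)$ and smooth functions $a_i$ on $\Sigma_i\times(0,\epsilon')$ with $|\nabla^ka_i|_{g_{C_i}}=O(r^{\mu+1-k})$ as $r\to0$, such that $T_i=\{x_i\}\cup\Phi_i\circ\Psi_{C_i}(\Gamma(da_i))$ is an open neighbourhood of $x_i$ in $N_0$, and remains one when $\epsilon'$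 is replaced by a smaller positive number. * $L_i\subset Y_i$ is an SL 3-fold. There are $\kappa_i\in(\lambda_i+1,-1)$, $R'>R$, $H_i\subset L_i$ and a smooth function $b_i$ on $\Sigma_i\times(R',\infty)$ with $|\nabla^kb_i|_{g_{C_i}}=O(r^{\kappa_i+1-k})$ as $r\to\infty$, such that $L_i\setminus H_i=\Upsilon_i\circ\Psi_{C_i}(\Gamma(db_i))$, where $H_i$ is compact and the complement in $L_i$ of this image remains compact when $R'$ is replaced by a larger number. **Construction.** Fix $\alpha\in(0,1)$, a smooth increasing $F:\mathbb R\to[0,1]$ with $F(s)=0$ for $s\le1$ and $F(s)=1$ for $s\ge2$, and smooth complex 2-forms $A_i$ on $\Gamma_i\times(0,\epsilon)$ and $B_i$ on $\Gamma_i\times(R,\infty)$ with $\Phi_i^*\Omega_0=\Omega_{V_i}+dA_i$, $|\nabla^kA_i|=O(r^{\nu+1-k})$ as $r\to 0$, and $\Upsilon_i^*\Omega_{Y_i}=\Omega_{V_i}+dB_i$, $|\nabla^kB_i|=O(r^{\lambda_i+1-k})$ as $r\to\infty$. Let $t>0$ satisfy $tR<t^\alpha$ and $2t^\alpha<\epsilon$,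 and put $\Upsilon_{t,i}(\gamma,r)=\Upsilon_i(\gamma,t^{-1}r)$. The space $M_t$ is obtained from $Q_t=M_0\setminus\bigcup_i\big(\{x_i\}\cup\Phi_i(\Gamma_i\times(0,t^\alpha])\big)$ and $P_{t,i}=K_i\cup\Upsilon_{t,i}(\Gamma_i\times(tR,2t^\alpha))$ by identifying $\Phi_i(\gamma,r)$ with $\Upsilon_{t,i}(\gamma,r)$ for $t^\alpha<r<2t^\alpha$. The form $\omega_t$ is $\omega_0$ on $Q_t$ and $t^2\omega_{Y_i}$ on $P_{t,i}$. The form $\Omega_t$ is $\Omega_{V_i}+d[F(t^{-\alpha}r)A_i+t^3(1-F(t^{-\alpha}r))\,\delta_t^*B_i]$ on $P_{t,i}\cap Q_t\cong\Gamma_i\times(t^\alpha,2t^\alpha)$, where $\delta_t(\gamma,r)=(\gamma,t^{-1}r)$; it is $\Omega_0$ on the rest of $Q_t$ and $t^3\Omega_{Y_i}$ on the rest of $P_{t,i}$. On $\Sigma_i\times(tR',\epsilon')$ let $$u_{t,i}(\sigma,r)=F(t^{-\alpha}r)\,a_i(\sigma,r)+t^2(1-F(t^{-\alpha}r))\,b_i(\sigma,t^{-1}r),$$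 and let $N_t\subset M_t$ be the union of $N_0\setminus\bigcup_iT_i\subset Q_t$, of the sets $\Psi_{C_i}(\Gamma(du_{t,i}))\subset\Gamma_i\times(tR,\epsilon)$, and of the $H_i\subset P_{t,i}$; here $\Gamma_i\times(tR,\epsilon)$ is mapped to $M_t$ by $\Phi_i$ where $r>t^\alpha$ and by $\Upsilon_{t,i}$ where $r<2t^\alpha$. A pair $(\omega,\Omega=\theta_1+i\theta_2)$ of a smooth closed real 2-form and a smooth closed complex 3-form on a 6-manifold is a *nearly Calabi–Yau structure* with constant $\epsilon_0\in(0,1]$ if $\theta_1$ has stabilizer $SL(3,\mathbb C)$ at each point, so that there are an almost complex structure $J'$ and a real 3-form $\theta_2'$ with $\theta_1+i\theta_2'$ of type $(3,0)$; $\omega^{(1,1)}$ is positive with respect to $J'$; and, for some $\epsilon\in(0,\epsilon_0]$, $|\theta_2-\theta_2'|<\epsilon$, $|\omega^{(2,0)}|<\epsilon$ and $|\omega^3-\tfrac32\theta_1\wedge\theta_2|<\epsilon$ in the metric of $J'$ and $f^{-1/3}\omega^{(1,1)}$, where $f>0$ and $(\omega^{(1,1)})^3=f\cdot\tfrac32\theta_1\wedge\theta_2'$.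 **Proposition 7.1.** Let $\epsilon_0\in(0,1]$. For all sufficiently small $t>0$: $M_t$ is defined and is a compact Hausdorff smooth 6-manifold, $(\omega_t,\Omega_t)$ is a nearly Calabi–Yau structure on $M_t$ with constant $\epsilon_0$, the pieces of $N_t$ fit in $M_t$ as indicated (with $tR'<t^\alpha$, $2t^\alpha<\epsilon'$ and $\Gamma(du_{t,i})\subset U_{C_i}$), and $N_t$ is a compact embedded 3-dimensional submanifold of $M_t$ with $\omega_t|_{N_t}=0$, i.e. a Lagrangian 3-fold in $(M_t,\omega_t,\Omega_t)$. -/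

import Mathlib

open scoped Manifold Topology
open Set Bundle

/-- The order of smoothness of `C^∞` maps. -/
local notation "∞" => ((⊤ : ℕ∞) : WithTop ℕ∞)

noncomputable section

namespace SLGluing

/-! ### Differential forms on manifolds -/

section Forms

variable {E H M E' H' M' F : Type*}
  [NormedAddCommGroup E] [NormedSpace ℝ E] [TopologicalSpace H] {I : ModelWithCorners ℝ E H}
  [TopologicalSpace M] [ChartedSpace H M]
  [NormedAddCommGroup E'] [NormedSpace ℝ E'] [TopologicalSpace H'] {I' : ModelWithCorners ℝ E' H'}
  [TopologicalSpace M'] [ChartedSpace H' M']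
  [NormedAddCommGroup F] [NormedSpace ℝ F]

/-- A (not necessarily continuous) `F`-valued differential `k`-form on `M`. -/
abbrev DForm (I : ModelWithCorners ℝ E H) (M : Type*) [TopologicalSpace M] [ChartedSpace H M]
    (F : Type*) [NormedAddCommGroup F] [NormedSpace ℝ F] (k : ℕ) :=
  ∀ x : M, TangentSpace I x [⋀^Fin k]→L[ℝ] F

/-- The coordinate expression of a form in the preferred chart at `p`. -/
def DForm.inChart {k : ℕ} (ω : DForm I M F k) (p : M) (y : E) : E [⋀^Fin k]→L[ℝ] F :=
  (ω ((extChartAt I p).symm y)).compContinuousLinearMap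
    (mfderiv 𝓘(ℝ, E) I (extChartAt I p).symm y)

/-- Smoothness at every point of `U`, tested in coordinates. -/
def DForm.SmoothOn {k : ℕ} (ω : DForm I M F k) (U : Set M) : Prop :=
  ∀ p ∈ U, ContDiffAt ℝ ∞ (ω.inChart p) (extChartAt I p p)

/-- The exterior derivative, computed at `p` in the preferred chart at `p`. -/
def DForm.d {k : ℕ} (ω : DForm I M F k) : DForm I M F (k + 1) := fun p ↦
  (extDeriv (ω.inChart p) (extChartAt I p p)).compContinuousLinearMap
    (mfderiv I 𝓘(ℝ, E) (extChartAt I p) p)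

/-- The pullback `f^* ω`. -/
def DForm.pullback {k : ℕ} (f : M → M') (ω : DForm I' M' F k) : DForm I M F k := fun x ↦
  (ω (f x)).compContinuousLinearMap (mfderiv I I' f x)

/-- For a local diffeomorphism `f`, the form on `T_{f x} M'` that corresponds under `df_x` to a
given form on `T_x M`. -/
def pushAt {k : ℕ} (f : M → M') (x : M) (η : TangentSpace I x [⋀^Fin k]→L[ℝ] F) :
    TangentSpace I' (f x) [⋀^Fin k]→L[ℝ] F :=
  η.compContinuousLinearMap (mfderiv I I' f x).inverse

end Forms

/-! ### Covariant derivatives of covariant tensors -/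

section Covariant

variable {E H M F : Type*}
  [NormedAddCommGroup E] [NormedSpace ℝ E] [TopologicalSpace H] (I : ModelWithCorners ℝ E H)
  [TopologicalSpace M] [ChartedSpace H M] [NormedAddCommGroup F] [NormedSpace ℝ F]

open Classical in
/-- The Christoffel symbol `Γ(v, w)` of a metric `g` on (an open subset of) a vector space:
`g(Γ(v, w), z) = ½ (∂_v g(w, z) + ∂_w g(v, z) - ∂_z g(v, w))` for all `z`. -/
def christoffel (g : E → E → E → ℝ) (y v w : E) : E :=
  if h : ∃ c : E, ∀ z : E, g y c z =
      (1 / 2) * (fderiv ℝ (fun y' ↦ g y' w z) y v + fderiv ℝ (fun y' ↦ g y' v z) y w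
        - fderiv ℝ (fun y' ↦ g y' v w) y z)
  then h.choose else 0

/-- The Levi-Civita covariant derivative of a covariant tensor field `T`; the new slot is the
first one: `(∇T)(v, w₁, …) = ∂_v (T(w₁, …)) - ∑ⱼ T(…, Γ(v, wⱼ), …)`. -/
def covDeriv {m : ℕ} (g : E → E → E → ℝ) (T : E → (Fin m → E) → F) :
    E → (Fin (m + 1) → E) → F := fun y w ↦
  fderiv ℝ (fun y' ↦ T y' (Fin.tail w)) y (w 0)
    - ∑ j : Fin m, T y (Function.update (Fin.tail w) j (christoffel g y (w 0) (w j.succ)))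

/-- `∇^k T`. -/
def iterCovDeriv {m : ℕ} (g : E → E → E → ℝ) (T : E → (Fin m → E) → F) :
    (k : ℕ) → E → (Fin (m + k) → E) → F
  | 0 => T
  | k + 1 => covDeriv g (iterCovDeriv g T k)

/-- A Riemannian metric in the preferred chart at `p`. -/
def metricInChart (g : ∀ x : M, TangentSpace I x → TangentSpace I x → ℝ) (p : M) :
    E → E → E → ℝ := fun y v w ↦
  g ((extChartAt I p).symm y) (mfderiv 𝓘(ℝ, E) I (extChartAt I p).symm y v)
    (mfderiv 𝓘(ℝ, E) I (extChartAt I p).symm y w)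

/-- A covariant tensor field in the preferred chart at `p`. -/
def tensorInChart {m : ℕ} (T : ∀ x : M, (Fin m → TangentSpace I x) → F) (p : M) :
    E → (Fin m → E) → F := fun y w ↦
  T ((extChartAt I p).symm y) (fun j ↦ mfderiv 𝓘(ℝ, E) I (extChartAt I p).symm y (w j))

/-- `|∇^k T|_g ≤ C` at the point `p` (norm of `∇^k T` as a multilinear form). -/
def CovNormLE {m : ℕ} (g : ∀ x : M, TangentSpace I x → TangentSpace I x → ℝ)
    (T : ∀ x : M, (Fin m → TangentSpace I x) → F) (k : ℕ) (p : M) (C : ℝ) : Prop :=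
  ∀ w : Fin (m + k) → E,
    ‖iterCovDeriv (metricInChart I g p) (tensorInChart I T p) k (extChartAt I p p) w‖ ≤
      C * ∏ j, √(metricInChart I g p (extChartAt I p p) (w j) (w j))

end Covariant

section Decay

variable {E H X F : Type*}
  [NormedAddCommGroup E] [NormedSpace ℝ E] [TopologicalSpace H] (I : ModelWithCorners ℝ E H)
  [TopologicalSpace X] [ChartedSpace H X] [NormedAddCommGroup F] [NormedSpace ℝ F]

/-- `|∇^k T|_g = O(r^{s-k})` as `r → 0` for all `k ≥ 0`, on `X × (0, ∞)`. -/
def DecaysAtZero {m : ℕ}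
    (g : ∀ p : X × ℝ, TangentSpace (I.prod 𝓘(ℝ, ℝ)) p → TangentSpace (I.prod 𝓘(ℝ, ℝ)) p → ℝ)
    (T : ∀ p : X × ℝ, (Fin m → TangentSpace (I.prod 𝓘(ℝ, ℝ)) p) → F) (s : ℝ) : Prop :=
  ∀ k : ℕ, ∃ C : ℝ, ∃ δ > 0, ∀ p : X × ℝ, 0 < p.2 → p.2 < δ →
    CovNormLE (I.prod 𝓘(ℝ, ℝ)) g T k p (C * p.2 ^ (s - k))

/-- `|∇^k T|_g = O(r^{s-k})` as `r → ∞` for all `k ≥ 0`, on `X × (0, ∞)`. -/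
def DecaysAtInfinity {m : ℕ}
    (g : ∀ p : X × ℝ, TangentSpace (I.prod 𝓘(ℝ, ℝ)) p → TangentSpace (I.prod 𝓘(ℝ, ℝ)) p → ℝ)
    (T : ∀ p : X × ℝ, (Fin m → TangentSpace (I.prod 𝓘(ℝ, ℝ)) p) → F) (s : ℝ) : Prop :=
  ∀ k : ℕ, ∃ C : ℝ, ∃ ρ : ℝ, ∀ p : X × ℝ, 0 < p.2 → ρ < p.2 →
    CovNormLE (I.prod 𝓘(ℝ, ℝ)) g T k p (C * p.2 ^ (s - k))

end Decay

/-! ### Calabi-Yau and nearly Calabi-Yau structures in complex dimension three -/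

/-- The standard Kähler form `(i/2) ∑ dz_j ∧ dz̄_j` on `ℂ³`. -/
def stdOmega (u v : Fin 3 → ℂ) : ℝ := ∑ j, (starRingEnd ℂ (u j) * v j).im

/-- The standard holomorphic volume form `dz₁ ∧ dz₂ ∧ dz₃` on `ℂ³`. -/
def stdVol (w : Fin 3 → Fin 3 → ℂ) : ℂ := (Matrix.of w).det

section CY

variable {E H M : Type*}
  [NormedAddCommGroup E] [NormedSpace ℝ E] [TopologicalSpace H]

/-- A triple `(J, ω, Ω)`. -/
structure Triple (I : ModelWithCorners ℝ E H) (M : Type*) [TopologicalSpace M]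
    [ChartedSpace H M] where
  J : ∀ x : M, TangentSpace I x →L[ℝ] TangentSpace I x
  ω : DForm I M ℝ 2
  Ω : DForm I M ℂ 3

variable {I : ModelWithCorners ℝ E H} [TopologicalSpace M] [ChartedSpace H M]

/-- `g(u, v) = ω(u, Jv)`. -/
def Triple.metric (S : Triple I M) (x : M) (u v : TangentSpace I x) : ℝ := S.ω x ![u, S.J x v]

/-- `J` in the preferred chart at `p`. -/
def Triple.JInChart (S : Triple I M) (p : M) (y : E) : E →L[ℝ] E :=
  (mfderiv I 𝓘(ℝ, E) (extChartAt I p) ((extChartAt I p).symm y)).comp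
    ((S.J ((extChartAt I p).symm y)).comp (mfderiv 𝓘(ℝ, E) I (extChartAt I p).symm y))

/-- `(J, ω, Ω)` is a Calabi-Yau structure on the open set `U`, i.e. a torsion-free
`SU(3)`-structure: `J`, `ω`, `Ω` are smooth, `ω` and `Ω` are closed, and each tangent space is
isomorphic to `ℂ³` with its standard structure. (Then `J` is integrable because `dΩ = 0`, and
`ω³ = (3i/4) Ω ∧ Ω̄`.) -/
def Triple.IsCalabiYauOn (S : Triple I M) (U : Set M) : Prop :=
  (∀ p ∈ U, ContDiffAt ℝ ∞ (S.JInChart p) (extChartAt I p p)) ∧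
  S.ω.SmoothOn U ∧ S.Ω.SmoothOn U ∧ (∀ x ∈ U, S.ω.d x = 0) ∧ (∀ x ∈ U, S.Ω.d x = 0) ∧
  ∀ x ∈ U, ∃ A : TangentSpace I x ≃L[ℝ] (Fin 3 → ℂ),
    (∀ v, A (S.J x v) = Complex.I • A v) ∧
    (∀ u v, S.ω x ![u, v] = stdOmega (A u) (A v)) ∧
    (∀ w, S.Ω x w = stdVol (fun j ↦ A (w j)))

/-- The standard real orthonormal basis `e_j, i e_j` of `ℂ³`. -/
def stdBasis (s : Fin 3 × Fin 2) : Fin 3 → ℂ := Pi.single s.1 (if s.2 = 0 then 1 else Complex.I)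

/-- The norm of an alternating `k`-form, `|T|² = ∑_{s₁ < … < s_k} |T(e_{s₁}, …, e_{s_k})|²`, for the
metric that makes `A` an isometry onto `ℂ³`. -/
def formNorm {T G : Type*} [AddCommGroup T] [Module ℝ T] [TopologicalSpace T]
    [NormedAddCommGroup G] {k : ℕ} (A : T ≃L[ℝ] (Fin 3 → ℂ)) (θ : (Fin k → T) → G) : ℝ :=
  √((∑ s : Fin k → Fin 3 × Fin 2, ‖θ (fun j ↦ A.symm (stdBasis (s j)))‖ ^ 2) / k.factorial)

/-- `ω ∧ ω ∧ ω`. -/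
def wedgeCube {T : Type*} (ω : (Fin 2 → T) → ℝ) (w : Fin 6 → T) : ℝ :=
  (1 / 8) * ∑ σ : Equiv.Perm (Fin 6), ((Equiv.Perm.sign σ : ℤ) : ℝ) *
    (ω ![w (σ 0), w (σ 1)] * ω ![w (σ 2), w (σ 3)] * ω ![w (σ 4), w (σ 5)])

/-- `θ ∧ θ'` for two 3-forms. -/
def wedge33 {T : Type*} (θ θ' : (Fin 3 → T) → ℝ) (w : Fin 6 → T) : ℝ :=
  (1 / 36) * ∑ σ : Equiv.Perm (Fin 6), ((Equiv.Perm.sign σ : ℤ) : ℝ) *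
    (θ ![w (σ 0), w (σ 1), w (σ 2)] * θ' ![w (σ 3), w (σ 4), w (σ 5)])

/-- `(ω, Ω)`, with `Ω = θ₁ + iθ₂`, is a nearly Calabi-Yau structure with constant `ε₀`.
At each point the `SU(3)`-structure `(J', ω', Ω' = θ₁ + iθ₂')` attached to `(ω, Ω)` is given by a
real isomorphism `A` from the tangent space to `ℂ³`: `Re (dz₁ ∧ dz₂ ∧ dz₃)` corresponds to `θ₁`, so
that `θ₁` has stabilizer `SL(3, ℂ)`, `J'` and `θ₂'` correspond to `i` and to
`Im (dz₁ ∧ dz₂ ∧ dz₃)`; and the (1,1)-part of `ω` with respect to `J'` is `f^{1/3} ω'` with `f > 0`,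
where `ω'` corresponds to the standard Kähler form. The metric `g_M` of `(J', ω')` makes `A` an
isometry. The manifold is oriented by `J'`. -/
def IsNearlyCalabiYau (ε₀ : ℝ) (ω : DForm I M ℝ 2) (Ω : DForm I M ℂ 3) : Prop :=
  ω.SmoothOn univ ∧ Ω.SmoothOn univ ∧ (∀ x, ω.d x = 0) ∧ (∀ x, Ω.d x = 0) ∧
  ∃ ε : ℝ, 0 < ε ∧ ε ≤ ε₀ ∧ ∀ x, ∃ A : TangentSpace I x ≃L[ℝ] (Fin 3 → ℂ),
    ∃ J' : TangentSpace I x → TangentSpace I x, ∃ θ₂' : (Fin 3 → TangentSpace I x) → ℝ,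
    ∃ f : ℝ, 0 < f ∧
      (∀ v, A (J' v) = Complex.I • A v) ∧
      (∀ w, (Ω x w).re = (stdVol (fun j ↦ A (w j))).re) ∧
      (∀ w, θ₂' w = (stdVol (fun j ↦ A (w j))).im) ∧
      (∀ u v, (1 / 2) * (ω x ![u, v] + ω x ![J' u, J' v]) =
        f ^ (1 / 3 : ℝ) * stdOmega (A u) (A v)) ∧
      formNorm A (fun w : Fin 3 → TangentSpace I x ↦ (Ω x w).im - θ₂' w) < ε ∧
      -- the (2,0)-part of `ω` with respect to `J'`
      formNorm A (fun w : Fin 2 → TangentSpace I x ↦ (1 / 4 : ℂ) *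
        (((ω x ![w 0, w 1] - ω x ![J' (w 0), J' (w 1)] : ℝ) : ℂ)
          - Complex.I * ((ω x ![J' (w 0), w 1] + ω x ![w 0, J' (w 1)] : ℝ) : ℂ))) < ε ∧
      formNorm A (fun w : Fin 6 → TangentSpace I x ↦ wedgeCube (ω x) w -
        (3 / 2) * wedge33 (fun z ↦ (Ω x z).re) (fun z ↦ (Ω x z).im) w) < ε

end CY

/-! ### Submanifolds -/

/-- `ℝ^d`. -/
abbrev Eu (d : ℕ) := EuclideanSpace ℝ (Fin d)

section Sub

variable {M : Type*} [TopologicalSpace M] [ChartedSpace (Eu 6) M]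

/-- `N` is a smooth embedded 3-dimensional submanifold of the 6-manifold `M`: around each of its
points there is a smooth chart of `M` in which `N` is `ℝ³ × {0}`. -/
def IsSubmanifold3 (N : Set M) : Prop :=
  ∀ p ∈ N, ∃ e ∈ IsManifold.maximalAtlas (𝓡 6) ∞ M, p ∈ e.source ∧
    e '' (e.source ∩ N) = {y ∈ e.target | ∀ j : Fin 6, 3 ≤ j.val → y j = 0}

/-- The tangent vectors at `p` to a subset `N`: the velocities of smooth curves in `N`. For a
submanifold this is the tangent space. -/
def tangentVectors (N : Set M) (p : M) : Set (TangentSpace (𝓡 6) p) :=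
  {v | ∃ c : ℝ → M, c 0 = p ∧ ContMDiffAt 𝓘(ℝ, ℝ) (𝓡 6) ∞ c 0 ∧ (∀ᶠ s in 𝓝 0, c s ∈ N) ∧
    (v : Eu 6) = (mfderiv 𝓘(ℝ, ℝ) (𝓡 6) c 0 (1 : ℝ) : Eu 6)}

/-- `N` is a Lagrangian 3-fold for the 2-form `ω`: an embedded 3-dimensional submanifold with
`ω|_N = 0`. -/
def IsLagrangian3 (ω : DForm (𝓡 6) M ℝ 2) (N : Set M) : Prop :=
  IsSubmanifold3 N ∧
    ∀ p ∈ N, ∀ u ∈ tangentVectors N p, ∀ v ∈ tangentVectors N p, ω p ![u, v] = 0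

/-- `N` is a (nonsingular) special Lagrangian 3-fold: `ω|_N = 0` and `Im Ω|_N = 0`. -/
def IsSpecialLagrangian3 (S : Triple (𝓡 6) M) (N : Set M) : Prop :=
  IsLagrangian3 S.ω N ∧ ∀ p ∈ N, ∀ w : Fin 3 → TangentSpace (𝓡 6) p,
    (∀ j, w j ∈ tangentVectors N p) → (S.Ω p w).im = 0

end Sub

/-! ### Cones -/

/-- The model of `Γ × ℝ` for a manifold `Γ` of dimension `d`. The cone `Γ × (0, ∞)` is the open
subset `{r > 0}`. -/
abbrev coneModel (d : ℕ) := (𝓡 d).prod 𝓘(ℝ, ℝ)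

section Cone

variable {Γ : Type*} [TopologicalSpace Γ] [ChartedSpace (Eu 5) Γ]

/-- `(J_V, ω_V, Ω_V)` is a Calabi-Yau cone structure on `Γ × (0, ∞)`:
`g_V = r² g_V|_Γ + dr²`, `ω_V = r² ω_V|_Γ + r dr ∧ α`, `Ω_V = r³ Ω_V|_Γ + r² dr ∧ β`, where `Γ` is
identified with `Γ × {1}`. -/
structure IsCalabiYauCone (V : Triple (coneModel 5) (Γ × ℝ)) : Prop where
  cy : V.IsCalabiYauOn {p | 0 < p.2}
  metric_eq : ∀ (γ : Γ) (r : ℝ), 0 < r → ∀ (ξ η : Eu 5) (a b : ℝ),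
    V.metric (γ, r) ((ξ, a) : Eu 5 × ℝ) ((η, b) : Eu 5 × ℝ) =
      r ^ 2 * V.metric (γ, 1) ((ξ, 0) : Eu 5 × ℝ) ((η, 0) : Eu 5 × ℝ) + a * b
  omega_eq : ∃ α : ∀ γ : Γ, TangentSpace (𝓡 5) γ →L[ℝ] ℝ, ∀ (γ : Γ) (r : ℝ), 0 < r →
    ∀ (ξ : Fin 2 → Eu 5) (a : Fin 2 → ℝ),
      V.ω (γ, r) (fun j ↦ ((ξ j, a j) : Eu 5 × ℝ)) =
        r ^ 2 * V.ω (γ, 1) (fun j ↦ ((ξ j, 0) : Eu 5 × ℝ))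
          + r * (a 0 * α γ (ξ 1) - a 1 * α γ (ξ 0))
  Omega_eq : ∃ β : ∀ γ : Γ, TangentSpace (𝓡 5) γ [⋀^Fin 2]→L[ℝ] ℂ, ∀ (γ : Γ) (r : ℝ), 0 < r →
    ∀ (ξ : Fin 3 → Eu 5) (a : Fin 3 → ℝ),
      V.Ω (γ, r) (fun j ↦ ((ξ j, a j) : Eu 5 × ℝ)) =
        (r : ℂ) ^ 3 * V.Ω (γ, 1) (fun j ↦ ((ξ j, 0) : Eu 5 × ℝ))
          + (r : ℂ) ^ 2 * ((a 0 : ℂ) * β γ ![ξ 1, ξ 2] - (a 1 : ℂ) * β γ ![ξ 0, ξ 2]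
            + (a 2 : ℂ) * β γ ![ξ 0, ξ 1])

variable {Sg : Type*} [TopologicalSpace Sg] [ChartedSpace (Eu 2) Sg]

/-- The inclusion `(σ, r) ↦ (ι σ, r)` of the cone over `Σ` into the cone over `Γ`. -/
def coneMap (ι : Sg → Γ) (p : Sg × ℝ) : Γ × ℝ := (ι p.1, p.2)

/-- `ι` embeds the compact surface `Σ` in `Γ`, and `C' = Σ × (0, ∞)` is special Lagrangian in
`Γ × (0, ∞)`. -/
structure IsSLCone (V : Triple (coneModel 5) (Γ × ℝ)) (ι : Sg → Γ) : Prop where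
  embedding : Manifold.IsSmoothEmbedding (𝓡 2) (𝓡 5) ∞ ι
  lagrangian : ∀ p : Sg × ℝ, 0 < p.2 →
    (V.ω.pullback (I := coneModel 2) (coneMap ι)) p = 0
  special : ∀ p : Sg × ℝ, 0 < p.2 → ∀ w,
    ((V.Ω.pullback (I := coneModel 2) (coneMap ι)) p w).im = 0

/-- The cone metric `g_C`, the restriction of `g_V` to `Σ × (0, ∞)`. -/
def slConeMetric (V : Triple (coneModel 5) (Γ × ℝ)) (ι : Sg → Γ) (p : Sg × ℝ)
    (u v : TangentSpace (coneModel 2) p) : ℝ :=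
  V.metric (coneMap ι p) (mfderiv (coneModel 2) (coneModel 5) (coneMap ι) p u)
    (mfderiv (coneModel 2) (coneModel 5) (coneMap ι) p v)

end Cone

/-! ### Cotangent bundles and Lagrangian neighbourhoods -/

section Cotangent

variable {E H : Type*} [NormedAddCommGroup E] [NormedSpace ℝ E] [TopologicalSpace H]

/-- The cotangent bundle `T^*X`. -/
abbrev Cot (I : ModelWithCorners ℝ E H) (X : Type*) [TopologicalSpace X] [ChartedSpace H X] :=
  TotalSpace (E →L[ℝ] ℝ) (fun x : X ↦ TangentSpace I x →L[ℝ] ℝ)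

variable {I : ModelWithCorners ℝ E H} {X : Type*} [TopologicalSpace X] [ChartedSpace H X]

/-- The graph over `D` of the 1-form `du`. -/
def graphD (u : X → ℝ) (D : Set X) : Set (Cot I X) :=
  (fun x ↦ (⟨x, mfderiv I 𝓘(ℝ, ℝ) u x⟩ : Cot I X)) '' D

variable [IsManifold I ∞ X]

/-- The tautological 1-form `λ` on `T^*X`: `λ_{(x, ξ)} (v) = ξ (dπ v)`. -/
def tautForm : DForm (I.prod 𝓘(ℝ, E →L[ℝ] ℝ)) (Cot I X) ℝ 1 := fun p ↦
  ContinuousAlternatingMap.ofSubsingleton ℝ _ _ 0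
    ((p.2 : E →L[ℝ] ℝ).comp
      (mfderiv (I.prod 𝓘(ℝ, E →L[ℝ] ℝ)) I (TotalSpace.proj : Cot I X → X) p :
        (E × (E →L[ℝ] ℝ)) →L[ℝ] E))

/-- The canonical symplectic form `-dλ = ∑ dx_j ∧ dξ_j` on `T^*X`. -/
def canForm : DForm (I.prod 𝓘(ℝ, E →L[ℝ] ℝ)) (Cot I X) ℝ 2 := fun p ↦ -(tautForm.d p)

end Cotangent

/-! ### Gluing manifolds along open sets -/

section Gluing

variable {d n : ℕ}

/-- Data to glue open subsets `P i ⊆ Z i` to an open subset `Q ⊆ X`, along homeomorphisms `φ i`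
between open subsets of `Q` and of `P i`. -/
structure GlueData (X : Type*) [TopologicalSpace X] (Z : Fin n → Type*)
    [∀ i, TopologicalSpace (Z i)] where
  Q : TopologicalSpace.Opens X
  P : ∀ i, TopologicalSpace.Opens (Z i)
  φ : ∀ i, OpenPartialHomeomorph X (Z i)
  source_sub : ∀ i, (φ i).source ⊆ Q
  target_sub : ∀ i, (φ i).target ⊆ P i

variable {X : Type*} [TopologicalSpace X] {Z : Fin n → Type*} [∀ i, TopologicalSpace (Z i)]
  (G : GlueData X Z)

namespace GlueData

open Classical in
/-- Replace a point of `P i` that has a partner in `Q` by this partner. -/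
def rep : (G.Q ⊕ (Σ i, G.P i)) → (G.Q ⊕ (Σ i, G.P i))
  | .inl x => .inl x
  | .inr z => if h : (z.2 : Z z.1) ∈ (G.φ z.1).target then
      .inl ⟨(G.φ z.1).symm z.2, G.source_sub z.1 ((G.φ z.1).map_target h)⟩ else .inr z

/-- The quotient of the disjoint union of `Q` and the `P i` by the equivalence relation generated by
`x ∼ φ i x`. -/
def Glued := Quotient (Setoid.ker G.rep)

instance : TopologicalSpace G.Glued :=
  inferInstanceAs (TopologicalSpace (Quotient (Setoid.ker G.rep)))

/-- The quotient map. -/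
def proj (a : G.Q ⊕ (Σ i, G.P i)) : G.Glued := Quotient.mk (Setoid.ker G.rep) a

/-- The inclusion of `Q`. -/
def jQ (x : G.Q) : G.Glued := G.proj (.inl x)

/-- The inclusion of `P i`. -/
def jP (i : Fin n) (z : G.P i) : G.Glued := G.proj (.inr ⟨i, z⟩)

theorem proj_eq {a b : G.Q ⊕ (Σ i, G.P i)} : G.proj a = G.proj b ↔ G.rep a = G.rep b :=
  Quotient.eq (r := Setoid.ker G.rep)

theorem rep_of_mem {i : Fin n} {z : G.P i} (h : (z : Z i) ∈ (G.φ i).target) :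
    G.rep (.inr ⟨i, z⟩) =
      .inl ⟨(G.φ i).symm z, G.source_sub i ((G.φ i).map_target h)⟩ := dif_pos h

theorem rep_of_notMem {i : Fin n} {z : G.P i} (h : (z : Z i) ∉ (G.φ i).target) :
    G.rep (.inr ⟨i, z⟩) = .inr ⟨i, z⟩ := dif_neg h

theorem jQ_eq_jP {x : G.Q} {i : Fin n} {z : G.P i} :
    G.jQ x = G.jP i z ↔ (x : X) ∈ (G.φ i).source ∧ G.φ i x = z := by
  rw [jQ, jP, proj_eq]
  by_cases h : (z : Z i) ∈ (G.φ i).target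
  · rw [rep_of_mem G h]
    change Sum.inl x = Sum.inl _ ↔ _
    rw [Sum.inl.injEq, Subtype.ext_iff]
    constructor
    · rintro e
      simp only at e
      rw [e]
      exact ⟨(G.φ i).map_target h, (G.φ i).right_inv h⟩
    · rintro ⟨h1, h2⟩
      simp only
      rw [← h2, (G.φ i).left_inv h1]
  · rw [rep_of_notMem G h]
    constructor
    · intro e
      change Sum.inl x = Sum.inr _ at e
      cases e
    · rintro ⟨h1, h2⟩
      exact absurd (h2 ▸ (G.φ i).map_source h1) h

theorem jQ_injective : Function.Injective G.jQ := by
  intro x y h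
  have h := G.proj_eq.1 h
  exact Sum.inl_injective h

theorem jP_injective (i : Fin n) : Function.Injective (G.jP i) := by
  intro z w h
  have h' := G.proj_eq.1 h
  by_cases hz : (z : Z i) ∈ (G.φ i).target <;> by_cases hw : (w : Z i) ∈ (G.φ i).target
  · rw [rep_of_mem G hz, rep_of_mem G hw] at h'
    have := congrArg Subtype.val (Sum.inl_injective h')
    exact Subtype.ext ((G.φ i).symm.injOn hz hw this)
  · rw [rep_of_mem G hz, rep_of_notMem G hw] at h'; cases h'
  · rw [rep_of_notMem G hz, rep_of_mem G hw] at h'; cases h'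
  · rw [rep_of_notMem G hz, rep_of_notMem G hw] at h'
    simpa using h'

theorem continuous_proj : Continuous G.proj := continuous_quotient_mk'

theorem isOpen_iff {U : Set G.Glued} :
    IsOpen U ↔ IsOpen (G.jQ ⁻¹' U) ∧ ∀ i, IsOpen (G.jP i ⁻¹' U) := by
  have : IsOpen U ↔ IsOpen (G.proj ⁻¹' U) :=
    (isQuotientMap_quotient_mk' (s := Setoid.ker G.rep)).isOpen_preimage.symm
  rw [this, isOpen_sum_iff, isOpen_sigma_iff]
  rfl

theorem isOpenEmbedding_jQ : Topology.IsOpenEmbedding G.jQ := by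
  refine .of_continuous_injective_isOpenMap (G.continuous_proj.comp continuous_inl) G.jQ_injective ?_
  intro U hU
  rw [isOpen_iff]
  refine ⟨by rwa [preimage_image_eq _ G.jQ_injective], fun i ↦ ?_⟩
  obtain ⟨V, hV, rfl⟩ := isOpen_induced_iff.1 hU
  have : G.jP i ⁻¹' (G.jQ '' (Subtype.val ⁻¹' V)) =
      Subtype.val ⁻¹' ((G.φ i).target ∩ (G.φ i).symm ⁻¹' V) := by
    ext z
    constructor
    · rintro ⟨x, hx, e⟩
      obtain ⟨h1, h2⟩ := G.jQ_eq_jP.1 e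
      refine ⟨h2 ▸ (G.φ i).map_source h1, ?_⟩
      change (G.φ i).symm z ∈ V
      rw [← h2, (G.φ i).left_inv h1]
      exact hx
    · rintro ⟨h1, h2⟩
      exact ⟨⟨(G.φ i).symm z, G.source_sub i ((G.φ i).map_target h1)⟩, h2,
        G.jQ_eq_jP.2 ⟨(G.φ i).map_target h1, (G.φ i).right_inv h1⟩⟩
  rw [this]
  exact ((G.φ i).symm.isOpen_inter_preimage hV).preimage continuous_subtype_val

theorem jP_eq_jP_of_ne {i j : Fin n} (hij : i ≠ j) {z : G.P i} {w : G.P j}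
    (h : G.jP i z = G.jP j w) : ∃ x : G.Q, G.jQ x = G.jP i z := by
  by_cases hz : (z : Z i) ∈ (G.φ i).target
  · exact ⟨⟨(G.φ i).symm z, G.source_sub i ((G.φ i).map_target hz)⟩,
      G.jQ_eq_jP.2 ⟨(G.φ i).map_target hz, (G.φ i).right_inv hz⟩⟩
  · exfalso
    have h' := G.proj_eq.1 h
    rw [rep_of_notMem G hz] at h'
    by_cases hw : (w : Z j) ∈ (G.φ j).target
    · rw [rep_of_mem G hw] at h'; cases h'
    · rw [rep_of_notMem G hw] at h'
      have := Sum.inr_injective h'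
      exact hij (congrArg Sigma.fst this)

theorem isOpenEmbedding_jP (i : Fin n) : Topology.IsOpenEmbedding (G.jP i) := by
  refine .of_continuous_injective_isOpenMap
    (G.continuous_proj.comp (continuous_inr.comp continuous_sigmaMk)) (G.jP_injective i) ?_
  intro U hU
  have key : IsOpen (G.jQ ⁻¹' (G.jP i '' U)) := by
    obtain ⟨V, hV, rfl⟩ := isOpen_induced_iff.1 hU
    have : G.jQ ⁻¹' (G.jP i '' (Subtype.val ⁻¹' V)) =
        Subtype.val ⁻¹' ((G.φ i).source ∩ (G.φ i) ⁻¹' V) := by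
      ext x
      constructor
      · rintro ⟨z, hz, e⟩
        obtain ⟨h1, h2⟩ := G.jQ_eq_jP.1 e.symm
        refine ⟨h1, ?_⟩
        change G.φ i x ∈ V
        rw [h2]
        exact hz
      · rintro ⟨h1, h2⟩
        exact ⟨⟨G.φ i x, G.target_sub i ((G.φ i).map_source h1)⟩, h2,
          (G.jQ_eq_jP.2 ⟨h1, rfl⟩).symm⟩
    rw [this]
    exact ((G.φ i).isOpen_inter_preimage hV).preimage continuous_subtype_val
  rw [isOpen_iff]
  refine ⟨key, fun j ↦ ?_⟩
  by_cases hij : i = j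
  · subst hij
    rwa [preimage_image_eq _ (G.jP_injective i)]
  · have : G.jP j ⁻¹' (G.jP i '' U) = G.jP j ⁻¹' (G.jQ '' (G.jQ ⁻¹' (G.jP i '' U))) := by
      ext w
      constructor
      · rintro ⟨z, hz, e⟩
        obtain ⟨x, hx⟩ := G.jP_eq_jP_of_ne hij e
        exact ⟨x, ⟨z, hz, hx.symm⟩, hx.trans e⟩
      · rintro ⟨x, hx, e⟩
        have hx' : G.jQ x ∈ G.jP i '' U := hx
        rw [e] at hx'
        exact hx'
    rw [this]
    exact (G.isOpenEmbedding_jQ.isOpenMap _ key).preimage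
      (G.continuous_proj.comp (continuous_inr.comp continuous_sigmaMk))

theorem exists_rep (q : G.Glued) : (∃ x, G.jQ x = q) ∨ ∃ z : (Σ i, G.P i), G.jP z.1 z.2 = q := by
  obtain ⟨a, rfl⟩ := Quotient.exists_rep q
  rcases a with x | z
  · exact .inl ⟨x, rfl⟩
  · exact .inr ⟨z, rfl⟩

variable [ChartedSpace (Eu d) X] [∀ i, ChartedSpace (Eu d) (Z i)]

open Classical in
/-- The charts of the glued space are the charts of `Q` and of the `P i`. -/
instance : ChartedSpace (Eu d) G.Glued where
  atlas := {e | (∃ e' ∈ atlas (Eu d) G.Q, e = e'.lift_openEmbedding G.isOpenEmbedding_jQ) ∨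
    ∃ i, ∃ e' ∈ atlas (Eu d) (G.P i), e = e'.lift_openEmbedding (G.isOpenEmbedding_jP i)}
  chartAt q := if h : ∃ x, G.jQ x = q then
      (chartAt (Eu d) h.choose).lift_openEmbedding G.isOpenEmbedding_jQ
    else
      (chartAt (Eu d) ((G.exists_rep q).resolve_left h).choose.2).lift_openEmbedding
        (G.isOpenEmbedding_jP ((G.exists_rep q).resolve_left h).choose.1)
  mem_chart_source q := by
    by_cases h : ∃ x, G.jQ x = q
    · rw [dif_pos h, OpenPartialHomeomorph.lift_openEmbedding_source]
      exact ⟨h.choose, mem_chart_source _ _, h.choose_spec⟩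
    · rw [dif_neg h, OpenPartialHomeomorph.lift_openEmbedding_source]
      exact ⟨((G.exists_rep q).resolve_left h).choose.2, mem_chart_source _ _,
        ((G.exists_rep q).resolve_left h).choose_spec⟩
  chart_mem_atlas q := by
    by_cases h : ∃ x, G.jQ x = q
    · rw [dif_pos h]
      exact .inl ⟨_, chart_mem_atlas _ _, rfl⟩
    · rw [dif_neg h]
      exact .inr ⟨_, _, chart_mem_atlas _ _, rfl⟩

open Classical in
/-- The form on the glued space that is given by `η` on `Q` and by `ζ i` on the rest of `P i`. -/
def form {F : Type*} [NormedAddCommGroup F] [NormedSpace ℝ F] {k : ℕ}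
    (η : DForm (𝓡 d) X F k) (ζ : ∀ i, DForm (𝓡 d) (Z i) F k) : DForm (𝓡 d) G.Glued F k := fun q ↦
  if h : ∃ x, G.jQ x = q then
    pushAt (I := 𝓡 d) (I' := 𝓡 d) G.jQ h.choose
      (η.pullback (I := 𝓡 d) (Subtype.val : G.Q → X) h.choose)
  else
    let z := ((G.exists_rep q).resolve_left h).choose
    pushAt (I := 𝓡 d) (I' := 𝓡 d) (G.jP z.1) z.2
      ((ζ z.1).pullback (I := 𝓡 d) (Subtype.val : G.P z.1 → Z z.1) z.2)

end GlueData

end Gluing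

/-! ### Conically singular and asymptotically conical Calabi-Yau 3-folds -/

/-- The complement of the points `x i`. -/
abbrev Reg {M₀ : Type*} {n : ℕ} (x : Fin n → M₀) := {p : M₀ // ∀ i, p ≠ x i}

section Geometry

variable {n : ℕ} {M₀ : Type*} [TopologicalSpace M₀] {x : Fin n → M₀} [ChartedSpace (Eu 6) (Reg x)]
  {Γ : Fin n → Type*} [∀ i, TopologicalSpace (Γ i)] [∀ i, ChartedSpace (Eu 5) (Γ i)]
  {Y : Fin n → Type*} [∀ i, TopologicalSpace (Y i)] [∀ i, ChartedSpace (Eu 6) (Y i)]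
  {Sg : Fin n → Type*} [∀ i, TopologicalSpace (Sg i)] [∀ i, ChartedSpace (Eu 2) (Sg i)]

/-- A Calabi-Yau 3-fold `(M₀, J₀, ω₀, Ω₀)` with conical singularities `x i` of rate `ν`, modelled on
the cones `V i`, with coordinates `Φ i : Γ i × (0, ε) → S i \ {x i}` that are Darboux coordinates:
`Φ i^* ω₀ = ω_{V i}`. -/
structure ConicalCY (x : Fin n → M₀) [ChartedSpace (Eu 6) (Reg x)]
    (V : ∀ i, Triple (coneModel 5) (Γ i × ℝ)) where
  S : Triple (𝓡 6) (Reg x)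
  cy : S.IsCalabiYauOn univ
  x_injective : Function.Injective x
  ν : ℝ
  ν_pos : 0 < ν
  ε : ℝ
  ε_pos : 0 < ε
  Φ : ∀ i, OpenPartialHomeomorph (Γ i × ℝ) (Reg x)
  Φ_source : ∀ i, (Φ i).source = {p | 0 < p.2 ∧ p.2 < ε}
  Φ_smooth : ∀ i, ContMDiffOn (coneModel 5) (𝓡 6) ∞ (Φ i) (Φ i).source
  Φ_symm_smooth : ∀ i, ContMDiffOn (𝓡 6) (coneModel 5) ∞ (Φ i).symm (Φ i).target
  /-- The neighbourhoods `S i = {x i} ∪ Φ i (Γ i × (0, ε))` are disjoint. -/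
  Φ_disjoint : ∀ i j, i ≠ j → Disjoint (Φ i).target (Φ j).target
  /-- `r → 0` corresponds to `x i`: the sets `{x i} ∪ Φ i (Γ i × (0, δ))` are a basis of
  neighbourhoods of `x i` in `M₀`. -/
  Φ_basis : ∀ i, (𝓝 (x i)).HasBasis (fun δ : ℝ ↦ 0 < δ ∧ δ ≤ ε)
    (fun δ ↦ insert (x i) ((fun p ↦ (Φ i p : M₀)) '' {p | 0 < p.2 ∧ p.2 < δ}))
  symplectic : ∀ i, ∀ p ∈ (Φ i).source, S.ω.pullback (I := coneModel 5) (Φ i) p = (V i).ω p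
  Omega_decay : ∀ i, DecaysAtZero (𝓡 5) (V i).metric
    (fun p w ↦ S.Ω.pullback (I := coneModel 5) (Φ i) p w - (V i).Ω p w) ν

/-- An asymptotically conical Calabi-Yau 3-fold `(Y, J_Y, ω_Y, Ω_Y)` of rate `λ < -3`, modelled on
the cone `V`, with coordinates `Υ : Γ × (R, ∞) → Y \ K` such that `Υ^* ω_Y = ω_V`. -/
structure ACCY {Γ : Type*} [TopologicalSpace Γ] [ChartedSpace (Eu 5) Γ]
    (V : Triple (coneModel 5) (Γ × ℝ)) (Y : Type*) [TopologicalSpace Y] [ChartedSpace (Eu 6) Y]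
    (R : ℝ) where
  S : Triple (𝓡 6) Y
  cy : S.IsCalabiYauOn univ
  rate : ℝ
  rate_lt : rate < -3
  R_pos : 0 < R
  Υ : OpenPartialHomeomorph (Γ × ℝ) Y
  Υ_source : Υ.source = {p | R < p.2}
  Υ_smooth : ContMDiffOn (coneModel 5) (𝓡 6) ∞ Υ Υ.source
  Υ_symm_smooth : ContMDiffOn (𝓡 6) (coneModel 5) ∞ Υ.symm Υ.target
  /-- `r → ∞` corresponds to leaving every compact subset of `Y`: the sets `Υ (Γ × (s, ∞))` are a
  basis of the neighbourhoods of infinity. In particular `K = Y \ Υ (Γ × (R, ∞))` is compact. As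
  `g_Y` is asymptotic to the cone metric, this says precisely that `g_Y` is complete. -/
  end_basis : (Filter.cocompact Y).HasBasis (fun s : ℝ ↦ R ≤ s) (fun s ↦ Υ '' {p | s < p.2})
  symplectic : ∀ p ∈ Υ.source, S.ω.pullback (I := coneModel 5) Υ p = V.ω p
  Omega_decay : DecaysAtInfinity (𝓡 5) V.metric
    (fun p w ↦ S.Ω.pullback (I := coneModel 5) Υ p w - V.Ω p w) rate

/-- The dilation `(γ, r) ↦ (γ, t⁻¹ r)`. -/
def shrink {X : Type*} (t : ℝ) (p : X × ℝ) : X × ℝ := (p.1, t⁻¹ * p.2)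

/-- The compact set `K = Y \ Υ (Γ × (R, ∞))`. -/
def ACCY.K {Γ : Type*} [TopologicalSpace Γ] [ChartedSpace (Eu 5) Γ]
    {V : Triple (coneModel 5) (Γ × ℝ)} {Y : Type*} [TopologicalSpace Y] [ChartedSpace (Eu 6) Y]
    {R : ℝ} (Z : ACCY V Y R) : Set Y := Z.Υ.targetᶜ

/-- `Υ_t (γ, r) = Υ (γ, t⁻¹ r)`. -/
def ACCY.Υt {Γ : Type*} [TopologicalSpace Γ] [ChartedSpace (Eu 5) Γ]
    {V : Triple (coneModel 5) (Γ × ℝ)} {Y : Type*} [TopologicalSpace Y] [ChartedSpace (Eu 6) Y]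
    {R : ℝ} (Z : ACCY V Y R) (t : ℝ) (p : Γ × ℝ) : Y := Z.Υ (shrink t p)

/-! ### Lagrangian neighbourhoods and special Lagrangian 3-folds -/

/-- A Lagrangian neighbourhood of the special Lagrangian cone `Σ × (0, ∞)`: a symplectic embedding
`Ψ` of an open neighbourhood `U` (the source of `Ψ`) of the zero section of `T^*(Σ × (0, ∞))` in
`Γ × (0, ∞)`, equivariant for `t · (σ, r, η, c) = (σ, t r, t² η, t c)`. -/
structure LagNbhd {Γ : Type*} [TopologicalSpace Γ] [ChartedSpace (Eu 5) Γ]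
    (V : Triple (coneModel 5) (Γ × ℝ)) {Sg : Type*} [TopologicalSpace Sg] [ChartedSpace (Eu 2) Sg]
    [IsManifold (𝓡 2) ∞ Sg] (ι : Sg → Γ) where
  Ψ : OpenPartialHomeomorph (Cot (coneModel 2) (Sg × ℝ)) (Γ × ℝ)
  Ψ_smooth : ContMDiffOn ((coneModel 2).prod 𝓘(ℝ, (Eu 2 × ℝ) →L[ℝ] ℝ)) (coneModel 5) ∞ Ψ Ψ.source
  Ψ_symm_smooth : ContMDiffOn (coneModel 5) ((coneModel 2).prod 𝓘(ℝ, (Eu 2 × ℝ) →L[ℝ] ℝ)) ∞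
    Ψ.symm Ψ.target
  source_pos : ∀ p ∈ Ψ.source, 0 < p.proj.2
  target_pos : ∀ p ∈ Ψ.target, 0 < p.2
  zero_mem : ∀ p : Sg × ℝ, 0 < p.2 → (⟨p, 0⟩ : Cot (coneModel 2) (Sg × ℝ)) ∈ Ψ.source
  zero_eq : ∀ p : Sg × ℝ, 0 < p.2 → Ψ ⟨p, 0⟩ = coneMap ι p
  symplectic : ∀ p ∈ Ψ.source,
    V.ω.pullback (I := (coneModel 2).prod 𝓘(ℝ, (Eu 2 × ℝ) →L[ℝ] ℝ)) Ψ p = canForm p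
  /-- Here `q = t · p`. -/
  equivariant : ∀ p ∈ Ψ.source, ∀ q : Cot (coneModel 2) (Sg × ℝ), ∀ t : ℝ, 0 < t →
    q.proj = (p.proj.1, t * p.proj.2) →
    (∀ (ξ : Eu 2) (a : ℝ), (q.2 : (Eu 2 × ℝ) →L[ℝ] ℝ) (ξ, a) =
      t ^ 2 * (p.2 : (Eu 2 × ℝ) →L[ℝ] ℝ) (ξ, 0) + t * (p.2 : (Eu 2 × ℝ) →L[ℝ] ℝ) (0, a)) →
    q ∈ Ψ.source ∧ Ψ q = ((Ψ p).1, t * (Ψ p).2)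

/-- A function on `Σ × ℝ` as a 0-tensor. -/
def asTensor {Sg : Type*} [TopologicalSpace Sg] [ChartedSpace (Eu 2) Sg] (u : Sg × ℝ → ℝ)
    (p : Sg × ℝ) (_ : Fin 0 → TangentSpace (coneModel 2) p) : ℝ := u p

variable [∀ i, IsManifold (𝓡 2) ∞ (Sg i)]
  {V : ∀ i, Triple (coneModel 5) (Γ i × ℝ)} {ι : ∀ i, Sg i → Γ i}

/-- A compact special Lagrangian 3-fold `N₀` in `M₀` with conical singularities at the `x i` of rate
`μ`, modelled on the special Lagrangian cones over `Σ i`: near `x i` it is the graph of `d a i`. -/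
structure ConicalSL (X : ConicalCY x V) (L : ∀ i, LagNbhd (V i) (ι i)) (ε' : ℝ) where
  N : Set M₀
  isCompact : IsCompact N
  x_mem : ∀ i, x i ∈ N
  isSL : IsSpecialLagrangian3 X.S {q : Reg x | (q : M₀) ∈ N}
  μ : ℝ
  one_lt_μ : 1 < μ
  μ_lt : μ < X.ν + 1
  ε'_pos : 0 < ε'
  ε'_lt : ε' < X.ε
  a : ∀ i, Sg i × ℝ → ℝ
  a_smooth : ∀ i, ContMDiffOn (coneModel 2) 𝓘(ℝ, ℝ) ∞ (a i) {p | 0 < p.2 ∧ p.2 < ε'}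
  a_decay : ∀ i, DecaysAtZero (𝓡 2) (slConeMetric (V i) (ι i)) (asTensor (a i)) (μ + 1)
  graph_sub : ∀ i, graphD (a i) {p | 0 < p.2 ∧ p.2 < ε'} ⊆ (L i).Ψ.source
  graph_sub' : ∀ i, (L i).Ψ '' graphD (a i) {p | 0 < p.2 ∧ p.2 < ε'} ⊆ (X.Φ i).source
  /-- The set `T i = {x i} ∪ Φ i (Ψ i (Γ (d a i)))` is an open neighbourhood of `x i` in `N₀`, and
  remains so when `ε'` is made smaller: on `N₀`, `r → 0` corresponds to `x i`. -/
  nhd : ∀ i, ∀ δ, 0 < δ → δ ≤ ε' → ∃ W : Set M₀, IsOpen W ∧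
    W ∩ N = insert (x i) ((fun p ↦ (X.Φ i p : M₀)) ''
      ((L i).Ψ '' graphD (a i) {p | 0 < p.2 ∧ p.2 < δ}))

/-- The neighbourhood `T i` of `x i` in `N₀`. -/
def ConicalSL.T {X : ConicalCY x V} {L : ∀ i, LagNbhd (V i) (ι i)} {ε' : ℝ}
    (N₀ : ConicalSL X L ε') (i : Fin n) : Set M₀ :=
  insert (x i) ((fun p ↦ (X.Φ i p : M₀)) ''
    ((L i).Ψ '' graphD (N₀.a i) {p | 0 < p.2 ∧ p.2 < ε'}))

/-- An asymptotically conical special Lagrangian 3-fold `L` in `Y` of rate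
`κ ∈ (λ + 1, -1)`, modelled on the special Lagrangian cone over `Σ`: outside a compact subset `H` it
is the graph of `d b`. -/
structure ACSL {Γ : Type*} [TopologicalSpace Γ] [ChartedSpace (Eu 5) Γ]
    {V : Triple (coneModel 5) (Γ × ℝ)} {Y : Type*} [TopologicalSpace Y] [ChartedSpace (Eu 6) Y]
    {R : ℝ} (Z : ACCY V Y R)
    {Sg : Type*} [TopologicalSpace Sg] [ChartedSpace (Eu 2) Sg]
    [IsManifold (𝓡 2) ∞ Sg] {ι : Sg → Γ} (L : LagNbhd V ι) (R' : ℝ) where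
  carrier : Set Y
  isSL : IsSpecialLagrangian3 Z.S carrier
  H : Set Y
  H_sub : H ⊆ carrier
  κ : ℝ
  lt_κ : Z.rate + 1 < κ
  κ_lt : κ < -1
  R_lt : R < R'
  b : Sg × ℝ → ℝ
  b_smooth : ContMDiffOn (coneModel 2) 𝓘(ℝ, ℝ) ∞ b {p | R' < p.2}
  b_decay : DecaysAtInfinity (𝓡 2) (slConeMetric V ι) (asTensor b) (κ + 1)
  graph_sub : graphD b {p | R' < p.2} ⊆ L.Ψ.source
  graph_sub' : L.Ψ '' graphD b {p | R' < p.2} ⊆ Z.Υ.source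
  outside : carrier \ H = Z.Υ '' (L.Ψ '' graphD b {p | R' < p.2})
  /-- `H = L \ Υ (Ψ (Γ (d b)))` is compact, and remains so when `R'` is made larger: on `L`, `r → ∞`
  corresponds to infinity. In particular `L` is closed in `Y`, without boundary. -/
  compact : ∀ ρ, R' ≤ ρ → IsCompact (carrier \ Z.Υ '' (L.Ψ '' graphD b {p | ρ < p.2}))

/-! ### The glued 6-fold -/

variable {R : ℝ}

theorem ConicalCY.isClosed_image [T2Space M₀] [∀ i, CompactSpace (Γ i)] (X : ConicalCY x V)
    (i : Fin n) {c : ℝ} (hc : c < X.ε) : IsClosed (X.Φ i '' {p | 0 < p.2 ∧ p.2 ≤ c}) := by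
  rw [← isOpen_compl_iff, isOpen_iff_mem_nhds]
  intro q hq
  obtain ⟨U, W, hU, hW, hqU, hxW, hUW⟩ := t2_separation (q.2 i)
  obtain ⟨δ, ⟨hδ, -⟩, hδW⟩ := (X.Φ_basis i).mem_iff.1 (hW.mem_nhds hxW)
  have hcomp : IsCompact (X.Φ i '' ((univ : Set (Γ i)) ×ˢ Icc δ c)) := by
    refine (isCompact_univ.prod isCompact_Icc).image_of_continuousOn
      ((X.Φ i).continuousOn.mono ?_)
    rintro p ⟨-, h1, h2⟩
    rw [X.Φ_source i]
    exact ⟨hδ.trans_le h1, h2.trans_lt hc⟩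
  have h1 : (X.Φ i '' ((univ : Set (Γ i)) ×ˢ Icc δ c))ᶜ ∈ 𝓝 q := by
    refine hcomp.isClosed.isOpen_compl.mem_nhds fun ⟨p, ⟨_, h1, h2⟩, e⟩ ↦ ?_
    exact hq ⟨p, ⟨hδ.trans_le h1, h2⟩, e⟩
  have h2 : (Subtype.val ⁻¹' U : Set (Reg x)) ∈ 𝓝 q :=
    (hU.preimage continuous_subtype_val).mem_nhds hqU
  filter_upwards [h1, h2] with y hy1 hy2
  rintro ⟨p, ⟨hp0, hpc⟩, rfl⟩
  rcases lt_or_ge p.2 δ with h | h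
  · exact Set.disjoint_left.1 hUW hy2 (hδW (.inr ⟨p, ⟨hp0, h⟩, rfl⟩))
  · exact hy1 ⟨p, ⟨mem_univ _, h, hpc⟩, rfl⟩

theorem ACCY.isClosed_image {Γ : Type*} [TopologicalSpace Γ] [ChartedSpace (Eu 5) Γ]
    {V : Triple (coneModel 5) (Γ × ℝ)} {Y : Type*} [TopologicalSpace Y] [ChartedSpace (Eu 6) Y]
    [T2Space Y] [CompactSpace Γ] (Z : ACCY V Y R) {s : ℝ} (hs : R < s) :
    IsClosed (Z.Υ '' {p | s ≤ p.2}) := by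
  rw [← isOpen_compl_iff, isOpen_iff_mem_nhds]
  intro y hy
  have : LocallyCompactSpace Y := ChartedSpace.locallyCompactSpace (Eu 6) Y
  obtain ⟨W, hWc, hW⟩ := exists_compact_mem_nhds y
  obtain ⟨s', -, hs'⟩ := Z.end_basis.mem_iff.1 hWc.compl_mem_cocompact
  have hcomp : IsCompact (Z.Υ '' ((univ : Set Γ) ×ˢ Icc s s')) := by
    refine (isCompact_univ.prod isCompact_Icc).image_of_continuousOn (Z.Υ.continuousOn.mono ?_)
    rintro p ⟨-, h1, -⟩
    rw [Z.Υ_source]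
    exact hs.trans_le h1
  have h1 : (Z.Υ '' ((univ : Set Γ) ×ˢ Icc s s'))ᶜ ∈ 𝓝 y := by
    refine hcomp.isClosed.isOpen_compl.mem_nhds fun ⟨p, ⟨_, h1, _⟩, e⟩ ↦ ?_
    exact hy ⟨p, h1, e⟩
  filter_upwards [h1, hW] with z hz1 hz2
  rintro ⟨p, hp, rfl⟩
  rcases lt_or_ge s' p.2 with h | h
  · exact hs' ⟨p, h, rfl⟩ hz2
  · exact hz1 ⟨p, ⟨mem_univ _, hp, h⟩, rfl⟩

/-- The range of parameters for which `M_t` is defined. -/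
structure Admissible (R ε α t : ℝ) : Prop where
  pos : 0 < t
  left : t * R < t ^ α
  right : 2 * t ^ α < ε

/-- `(γ, r) ↦ (γ, t⁻¹ r)` as a homeomorphism. -/
def shrinkHomeo (X : Type*) [TopologicalSpace X] {t : ℝ} (ht : 0 < t) : (X × ℝ) ≃ₜ (X × ℝ) :=
  (Homeomorph.refl X).prodCongr (Homeomorph.mulLeft₀ t⁻¹ (inv_ne_zero ht.ne'))

/-- The annulus `Γ × (t^α, 2t^α)`. -/
def annulus (X : Type*) (α t : ℝ) : Set (X × ℝ) := {p | t ^ α < p.2 ∧ p.2 < 2 * t ^ α}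

theorem isOpen_annulus (X : Type*) [TopologicalSpace X] (α t : ℝ) : IsOpen (annulus X α t) :=
  (isOpen_lt continuous_const continuous_snd).inter (isOpen_lt continuous_snd continuous_const)

/-- The identification of the annuli, `Φ i (γ, r) ↦ Υ_t (γ, r)` for `t^α < r < 2t^α`. -/
def annulusMap (X : ConicalCY x V) (Z : ∀ i, ACCY (V i) (Y i) R) (α : ℝ) {t : ℝ} (ht : 0 < t)
    (i : Fin n) : OpenPartialHomeomorph (Reg x) (Y i) :=
  (((X.Φ i).symm.trans (OpenPartialHomeomorph.ofSet _ (isOpen_annulus (Γ i) α t))).trans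
    (shrinkHomeo (Γ i) ht).toOpenPartialHomeomorph).trans (Z i).Υ

/-- The gluing data of `M_t`: `Q_t` is `M₀` without the `x i` and the `Φ i (Γ i × (0, t^α])`, and
`P_{t,i} = K i ∪ Υ_{t,i} (Γ i × (tR, 2t^α))`. -/
def glueData [T2Space M₀] [∀ i, CompactSpace (Γ i)] [∀ i, T2Space (Y i)]
    (X : ConicalCY x V) (Z : ∀ i, ACCY (V i) (Y i) R) {α t : ℝ} (ht : Admissible R X.ε α t) :
    GlueData (Reg x) Y where
  Q := ⟨{q | ∀ i, q ∉ X.Φ i '' {p | 0 < p.2 ∧ p.2 ≤ t ^ α}}, by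
    rw [ofPred_forall]
    refine isOpen_iInter_of_finite fun i ↦ (X.isClosed_image i ?_).isOpen_compl
    have := Real.rpow_pos_of_pos ht.pos α
    linarith [ht.right]⟩
  P i := ⟨(Z i).K ∪ (Z i).Υt t '' {p | t * R < p.2 ∧ p.2 < 2 * t ^ α}, by
    have h0 := Real.rpow_pos_of_pos ht.pos α
    have hs : R < 2 * t ^ α / t := by
      rw [lt_div_iff₀ ht.pos]
      linarith [ht.left, mul_comm R t]
    have : (Z i).K ∪ (Z i).Υt t '' {p | t * R < p.2 ∧ p.2 < 2 * t ^ α} =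
        ((Z i).Υ '' {p | 2 * t ^ α / t ≤ p.2})ᶜ := by
      ext y
      constructor
      · rintro (hy | ⟨p, ⟨hp1, hp2⟩, rfl⟩) ⟨q, hq, e⟩
        · apply hy
          rw [← e]
          refine (Z i).Υ.map_source ?_
          rw [(Z i).Υ_source]
          exact hs.trans_le hq
        · have h1 : shrink t p ∈ (Z i).Υ.source := by
            rw [(Z i).Υ_source]
            change R < t⁻¹ * p.2
            rw [lt_inv_mul_iff₀ ht.pos]
            exact hp1
          have h2 : q ∈ (Z i).Υ.source := by
            rw [(Z i).Υ_source]
            exact hs.trans_le hq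
          have h3 := (Z i).Υ.injOn h2 h1 e
          rw [h3] at hq
          have hq' : 2 * t ^ α / t ≤ t⁻¹ * p.2 := hq
          rw [div_eq_inv_mul] at hq'
          have := le_of_mul_le_mul_left hq' (inv_pos.2 ht.pos)
          linarith
      · intro hy
        by_cases hK : y ∈ (Z i).Υ.target
        · right
          have hsrc := (Z i).Υ.map_target hK
          rw [(Z i).Υ_source] at hsrc
          have hsrc' : R < ((Z i).Υ.symm y).2 := hsrc
          refine ⟨(((Z i).Υ.symm y).1, t * ((Z i).Υ.symm y).2), ⟨?_, ?_⟩, ?_⟩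
          · exact mul_lt_mul_of_pos_left hsrc' ht.pos
          · by_contra hcon
            refine hy ⟨(Z i).Υ.symm y, ?_, (Z i).Υ.right_inv hK⟩
            change 2 * t ^ α / t ≤ ((Z i).Υ.symm y).2
            rw [div_le_iff₀ ht.pos, mul_comm ((Z i).Υ.symm y).2]
            exact not_lt.1 hcon
          · change (Z i).Υ (_, t⁻¹ * (t * _)) = y
            rw [inv_mul_cancel_left₀ ht.pos.ne']
            exact (Z i).Υ.right_inv hK
        · exact .inl hK
    rw [this]
    exact ((Z i).isClosed_image hs).isOpen_compl⟩
  φ i := annulusMap X Z α ht.pos i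
  source_sub i := by
    intro q hq
    simp only [annulusMap, OpenPartialHomeomorph.trans_source] at hq
    obtain ⟨⟨⟨hq1, hq2⟩, -⟩, -⟩ := hq
    intro j hj
    obtain ⟨p, ⟨hp0, hp1⟩, e⟩ := hj
    have h0 := Real.rpow_pos_of_pos ht.pos α
    have hp : p ∈ (X.Φ j).source := by
      rw [X.Φ_source j]
      exact ⟨hp0, by linarith [ht.right]⟩
    by_cases hij : i = j
    · subst hij
      have hq2' : t ^ α < ((X.Φ i).symm q).2 := hq2.1
      rw [← e, (X.Φ i).left_inv hp] at hq2'
      linarith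
    · exact Set.disjoint_left.1 (X.Φ_disjoint i j hij) hq1 (e ▸ (X.Φ j).map_source hp)
  target_sub i := by
    intro y hy
    simp only [annulusMap, OpenPartialHomeomorph.trans_target] at hy
    obtain ⟨hy1, -, ⟨hy2, -⟩⟩ := hy
    right
    refine ⟨_, ⟨ht.left.trans hy2.1, hy2.2⟩, ?_⟩
    change (Z i).Υ ((shrinkHomeo (Γ i) ht.pos) ((shrinkHomeo (Γ i) ht.pos).symm _)) = y
    rw [Homeomorph.apply_symm_apply]
    exact (Z i).Υ.right_inv hy1

/-- The 6-fold `M_t`. -/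
abbrev Mt [T2Space M₀] [∀ i, CompactSpace (Γ i)] [∀ i, T2Space (Y i)]
    (X : ConicalCY x V) (Z : ∀ i, ACCY (V i) (Y i) R) {α t : ℝ} (ht : Admissible R X.ε α t) :=
  (glueData X Z ht).Glued

/-- The 2-form `ω_t`: it is `ω₀` on `Q_t` and `t² ω_{Y i}` on `P_{t,i}`. -/
def omegaT [T2Space M₀] [∀ i, CompactSpace (Γ i)] [∀ i, T2Space (Y i)]
    (X : ConicalCY x V) (Z : ∀ i, ACCY (V i) (Y i) R) {α t : ℝ} (ht : Admissible R X.ε α t) :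
    DForm (𝓡 6) (Mt X Z ht) ℝ 2 :=
  (glueData X Z ht).form X.S.ω (fun i y ↦ t ^ 2 • (Z i).S.ω y)

/-- The choices in the construction: the exponent `α`, the cut-off function `F`, and the primitives
`A i` of `Φ i^* Ω₀ - Ω_{V i}` and `B i` of `Υ i^* Ω_{Y i} - Ω_{V i}`. -/
structure Choices (X : ConicalCY x V) (Z : ∀ i, ACCY (V i) (Y i) R) where
  α : ℝ
  α_pos : 0 < α
  α_lt_one : α < 1
  F : ℝ → ℝ
  F_smooth : ContDiff ℝ ∞ F
  F_mono : Monotone F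
  F_zero : ∀ s ≤ 1, F s = 0
  F_one : ∀ s, 2 ≤ s → F s = 1
  A : ∀ i, DForm (coneModel 5) (Γ i × ℝ) ℂ 2
  A_smooth : ∀ i, (A i).SmoothOn {p | 0 < p.2 ∧ p.2 < X.ε}
  dA : ∀ i, ∀ p : Γ i × ℝ, 0 < p.2 → p.2 < X.ε →
    X.S.Ω.pullback (I := coneModel 5) (X.Φ i) p = (V i).Ω p + (A i).d p
  A_decay : ∀ i, DecaysAtZero (𝓡 5) (V i).metric (fun p w ↦ A i p w) (X.ν + 1)
  B : ∀ i, DForm (coneModel 5) (Γ i × ℝ) ℂ 2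
  B_smooth : ∀ i, (B i).SmoothOn {p | R < p.2}
  dB : ∀ i, ∀ p : Γ i × ℝ, R < p.2 →
    (Z i).S.Ω.pullback (I := coneModel 5) (Z i).Υ p = (V i).Ω p + (B i).d p
  B_decay : ∀ i, DecaysAtInfinity (𝓡 5) (V i).metric (fun p w ↦ B i p w) ((Z i).rate + 1)

/-- The 3-form `Ω_V + d[F(t^{-α} r) A + t³ (1 - F(t^{-α} r)) B(γ, t⁻¹ r)]` on the annulus, where
`B(γ, t⁻¹ r)` is the pullback of `B` under the dilation `(γ, r) ↦ (γ, t⁻¹ r)`. -/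
def Choices.annulusForm {X : ConicalCY x V} {Z : ∀ i, ACCY (V i) (Y i) R} (C : Choices X Z) (t : ℝ)
    (i : Fin n) : DForm (coneModel 5) (Γ i × ℝ) ℂ 3 := fun p ↦
  (V i).Ω p + DForm.d (I := coneModel 5) (M := Γ i × ℝ) (F := ℂ) (k := 2) (fun q ↦
    C.F (t ^ (-C.α) * q.2) • C.A i q + (t ^ 3 * (1 - C.F (t ^ (-C.α) * q.2))) •
      (C.B i).pullback (I := coneModel 5) (shrink t) q) p

open Classical in
/-- The 3-form on `Q_t`: the interpolating form on the annuli and `Ω₀` elsewhere. -/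
def Choices.OmegaQ {X : ConicalCY x V} {Z : ∀ i, ACCY (V i) (Y i) R} (C : Choices X Z) (t : ℝ) :
    DForm (𝓡 6) (Reg x) ℂ 3 := fun q ↦
  if h : ∃ z : (Σ i, Γ i × ℝ), z.2 ∈ annulus (Γ z.1) C.α t ∧ X.Φ z.1 z.2 = q then
    pushAt (I := coneModel 5) (I' := 𝓡 6) (X.Φ h.choose.1) h.choose.2
      (C.annulusForm t h.choose.1 h.choose.2)
  else X.S.Ω q

/-- The 3-form `Ω_t`: it is `t³ Ω_{Y i}` on `P_{t,i} \ Q_t`, the interpolating form on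
`P_{t,i} ∩ Q_t`, and `Ω₀` on the rest of `Q_t`. -/
def Choices.OmegaT [T2Space M₀] [∀ i, CompactSpace (Γ i)] [∀ i, T2Space (Y i)]
    {X : ConicalCY x V} {Z : ∀ i, ACCY (V i) (Y i) R} (C : Choices X Z) {t : ℝ}
    (ht : Admissible R X.ε C.α t) : DForm (𝓡 6) (Mt X Z ht) ℂ 3 :=
  (glueData X Z ht).form (C.OmegaQ t) (fun i y ↦ t ^ 3 • (Z i).S.Ω y)

/-! ### The glued 3-fold -/

/-- The image in `M_t` of a subset of `Γ i × (tR, ε)`: points with `r > t^α` are mapped to `Q_t` by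
`Φ i`, points with `r < 2t^α` are mapped to `P_{t,i}` by `Υ_{t,i}`. -/
def neckImage [T2Space M₀] [∀ i, CompactSpace (Γ i)] [∀ i, T2Space (Y i)]
    (X : ConicalCY x V) (Z : ∀ i, ACCY (V i) (Y i) R) {α t : ℝ} (ht : Admissible R X.ε α t)
    (i : Fin n) (W : Set (Γ i × ℝ)) : Set (Mt X Z ht) :=
  (glueData X Z ht).jQ '' {q | ∃ p ∈ W, t ^ α < p.2 ∧ p.2 < X.ε ∧ X.Φ i p = q} ∪
    (glueData X Z ht).jP i '' {y | ∃ p ∈ W, t * R < p.2 ∧ p.2 < 2 * t ^ α ∧ (Z i).Υt t p = y}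

section Nt

variable {X : ConicalCY x V} {Z : ∀ i, ACCY (V i) (Y i) R} {L : ∀ i, LagNbhd (V i) (ι i)}
  {ε' R' : ℝ} (C : Choices X Z) (N₀ : ConicalSL X L ε') (A : ∀ i, ACSL (Z i) (L i) R')

/-- `u_{t,i}(σ, r) = F(t^{-α} r) a_i(σ, r) + t² (1 - F(t^{-α} r)) b_i(σ, t⁻¹ r)`. -/
def uT (t : ℝ) (i : Fin n) (p : Sg i × ℝ) : ℝ :=
  C.F (t ^ (-C.α) * p.2) * N₀.a i p
    + t ^ 2 * (1 - C.F (t ^ (-C.α) * p.2)) * (A i).b (shrink t p)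

/-- The graph `Γ(du_{t,i})` over `Σ i × (tR', ε')`. -/
def graphT (t : ℝ) (i : Fin n) : Set (Cot (coneModel 2) (Sg i × ℝ)) :=
  graphD (uT C N₀ A t i) {p | t * R' < p.2 ∧ p.2 < ε'}

variable [T2Space M₀] [∀ i, CompactSpace (Γ i)] [∀ i, T2Space (Y i)]

/-- The 3-fold `N_t`: the union of `N₀ \ ⋃ T i`, of the `Ψ i (Γ(du_{t,i}))`, and of the `H i`. -/
def Nt {t : ℝ} (ht : Admissible R X.ε C.α t) : Set (Mt X Z ht) :=
  (glueData X Z ht).jQ '' {q | (q : M₀) ∈ N₀.N ∧ ∀ i, (q : M₀) ∉ N₀.T i} ∪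
    (⋃ i, neckImage X Z ht i ((L i).Ψ '' graphT C N₀ A t i)) ∪
    ⋃ i, (glueData X Z ht).jP i '' {y | (y : Y i) ∈ (A i).H}

/-- The pieces of `N_t` fit in `M_t`: `tR' < t^α` and `2t^α < ε'`, the set `N₀ \ ⋃ T i` lies in
`Q_t`, the graph of `du_{t,i}` lies in the domain of `Ψ i` and is mapped to `Γ i × (tR, ε)`, and `H i`
lies in `P_{t,i}`. -/
def PiecesFit {t : ℝ} (ht : Admissible R X.ε C.α t) : Prop :=
  (t * R' < t ^ C.α ∧ 2 * t ^ C.α < ε') ∧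
  (∀ q : Reg x, (q : M₀) ∈ N₀.N → (∀ i, (q : M₀) ∉ N₀.T i) → q ∈ (glueData X Z ht).Q) ∧
  (∀ i, graphT C N₀ A t i ⊆ (L i).Ψ.source) ∧
  (∀ i, ∀ p ∈ (L i).Ψ '' graphT C N₀ A t i, t * R < p.2 ∧ p.2 < X.ε) ∧
  ∀ i, (A i).H ⊆ (glueData X Z ht).P i

end Nt

end Geometry

end SLGluing

end

open SLGluing

set_option linter.unusedSectionVars false

noncomputable section

namespace SLGluing

/-! ### Calculus of differential forms -/

section FormCalculus

variable {E H M E' H' M' E'' H'' M'' F : Type*}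
  [NormedAddCommGroup E] [NormedSpace ℝ E] [TopologicalSpace H] {I : ModelWithCorners ℝ E H}
  [TopologicalSpace M] [ChartedSpace H M]
  [NormedAddCommGroup E'] [NormedSpace ℝ E'] [TopologicalSpace H'] {I' : ModelWithCorners ℝ E' H'}
  [TopologicalSpace M'] [ChartedSpace H' M']
  [NormedAddCommGroup E''] [NormedSpace ℝ E''] [TopologicalSpace H'']
  {I'' : ModelWithCorners ℝ E'' H''} [TopologicalSpace M''] [ChartedSpace H'' M'']
  [NormedAddCommGroup F] [NormedSpace ℝ F] {k : ℕ}

/-! All the work takes place on the necks, and it is governed by the two lengths `t ^ α` and `t ^ α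
/ t`. Since 0 < α < 1, the former tends to 0 and the latter to infinity as t → 0. So the annulus r ~
t^α lies deep in the conical end of `M₀` and, measured on the scale of `Y i`, far out in its
asymptotically conical end. Both geometries differ from the cone there by errors that tend to 0.

The glued space is a manifold because the gluing maps are diffeomorphisms between open sets. It is
Hausdorff and compact because the pieces overlap in a whole annulus: a level of r inside it
separates the two sides, and cutting both pieces off inside it leaves compact sets that still cover
(`t2Space_Mt`, `compactSpace_Mt`).

The 2-forms agree on the overlap, since both pull back to `ω_V`: t² cancels the homogeneity of
degree 2. The 3-form is Ω_V plus an exact form on the neck, hence closed, and at either end of the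
annulus the cut-off is constant and it becomes the given form (`annulusForm_inner`,
`annulusForm_outer`). Its difference from Ω_V consists of F dA, dF ∧ A and the corresponding terms
in B. These are O(t^{αν}) and O((t^{α-1})^λ) (`eventually_annulusForm_close`).

To be nearly Calabi-Yau is then an open condition at the standard structure of ℂ³. The group GL(6,
ℝ), together with a rescaling of ω and the addition of a form with vanishing (1,1)-part, moves (Re
Ω, ω) onto a full neighbourhood of the standard pair, because the infinitesimal action is onto
(`map_deform_nhds`). This produces the frame that the definition asks for. The frame can be taken
close to the identity, and the three error terms are continuous and vanish for the standard
structure; for the last of them this is ω³ = (3/2) Re Ω ∧ Im Ω. The resulting tolerance is a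
statement about ℂ³, hence the same at all points (`exists_isNearlyAt`).

For the 3-fold, equivariance of `Ψ` and compactness of Σ give one constant δ such that covectors of
length at most δr lie in the domain of `Ψ` and are mapped to points whose radius is within a factor
2 of r (`LagNbhd.exists_small`). The differential of a is O(r^μ) with μ > 1 and that of b is O(r^κ)
with κ < -1, so both satisfy this in the relevant ranges, and so does their interpolation on the
annulus. The resulting control of radii, recorded in `NeckBounds`, keeps the three kinds of pieces
from interfering: near each point of `M_t`, the set `N_t` is N₀, or the graph of du, or L i
(`local_model`). N₀ and L i are Lagrangian by assumption. The graph is Lagrangian because `Ψ` is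
symplectic and (du)^*(-dλ) = -d(du) = 0. The same local description shows that `N_t` is closed,
hence compact. -/

theorem DForm.pullback_congr {f g : M → M'} {x : M} (h : f =ᶠ[𝓝 x] g) (ω : DForm I' M' F k) :
    ω.pullback (I := I) f x = ω.pullback (I := I) g x := by
  have h1 : f x = g x := h.eq_of_nhds
  have h2 : (mfderiv I I' f x : E →L[ℝ] E') = mfderiv I I' g x := h.mfderiv_eq
  let ω' : M' → E' [⋀^Fin k]→L[ℝ] F := ω
  change (ω' (f x)).compContinuousLinearMap (mfderiv I I' f x : E →L[ℝ] E') =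
    (ω' (g x)).compContinuousLinearMap (mfderiv I I' g x : E →L[ℝ] E')
  rw [h1, h2]

theorem DForm.pullback_comp {g : M' → M''} {f : M → M'} {x : M} (ω : DForm I'' M'' F k)
    (hg : MDifferentiableAt I' I'' g (f x)) (hf : MDifferentiableAt I I' f x) :
    ω.pullback (I := I) (g ∘ f) x = (ω.pullback (I := I') g).pullback (I := I) f x := by
  ext w
  simp only [DForm.pullback, ContinuousAlternatingMap.compContinuousLinearMap_apply]
  rw [mfderiv_comp x hg hf]
  rfl

theorem DForm.inChart_eq_pullback (ω : DForm I M F k) (p : M) :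
    ω.inChart p = ω.pullback (I := 𝓘(ℝ, E)) (extChartAt I p).symm := rfl

section Chart

variable [I.Boundaryless]

theorem eventually_extChartAt_symm {p : M} {P : M → Prop} (h : ∀ᶠ x in 𝓝 p, P x) :
    ∀ᶠ y in 𝓝 (extChartAt I p p), P ((extChartAt I p).symm y) := by
  have := (continuousAt_extChartAt_symm (I := I) p)
  rw [ContinuousAt, extChartAt_to_inv] at this
  exact this.eventually h

/-- The tangent space at `p` is the model space, identified by means of the preferred chart at `p`.
So at `p` itself this chart has the identity as its differential, and the changes of frame in
`DForm.inChart` and `DForm.d` disappear there. -/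
theorem mfderiv_extChartAt_symm_self [IsManifold I 1 M] (p : M) :
    (mfderiv 𝓘(ℝ, E) I (extChartAt I p).symm (extChartAt I p p) : E →L[ℝ] E) =
      ContinuousLinearMap.id ℝ E := by
  have hd : MDifferentiableAt 𝓘(ℝ, E) I (extChartAt I p).symm (extChartAt I p p) :=
    ((contMDiffOn_extChartAt_symm (n := 1) p).contMDiffAt
      (extChartAt_target_mem_nhds p)).mdifferentiableAt one_ne_zero
  refine hd.mfderiv.trans ?_
  have : writtenInExtChartAt 𝓘(ℝ, E) I (extChartAt I p p) (extChartAt I p).symm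
      =ᶠ[𝓝 (extChartAt I p p)] id := by
    filter_upwards [extChartAt_target_mem_nhds (I := I) p] with y hy
    simp only [writtenInExtChartAt, extChartAt_to_inv, Function.comp, extChartAt_model_space_eq_id]
    exact (extChartAt I p).right_inv hy
  simp only [modelWithCornersSelf_coe, range_id, fderivWithin_univ, extChartAt_model_space_eq_id,
    PartialEquiv.refl_coe, id]
  rw [this.fderiv_eq]
  exact fderiv_id

theorem mfderiv_extChartAt_self [IsManifold I 1 M] (p : M) :
    (mfderiv I 𝓘(ℝ, E) (extChartAt I p) p : E →L[ℝ] E) = ContinuousLinearMap.id ℝ E := by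
  have hd : MDifferentiableAt I 𝓘(ℝ, E) (extChartAt I p) p :=
    mdifferentiableAt_extChartAt (mem_chart_source H p)
  refine hd.mfderiv.trans ?_
  have : writtenInExtChartAt I 𝓘(ℝ, E) p (extChartAt I p) =ᶠ[𝓝 (extChartAt I p p)] id := by
    filter_upwards [extChartAt_target_mem_nhds (I := I) p] with y hy
    simp only [writtenInExtChartAt, Function.comp, extChartAt_model_space_eq_id]
    exact (extChartAt I p).right_inv hy
  rw [I.range_eq_univ, fderivWithin_univ, this.fderiv_eq]
  exact fderiv_id

theorem DForm.inChart_self [IsManifold I 1 M] (ω : DForm I M F k) (p : M) :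
    ω.inChart p (extChartAt I p p) = ω p := by
  let ω' : M → E [⋀^Fin k]→L[ℝ] F := ω
  change (ω' ((extChartAt I p).symm (extChartAt I p p))).compContinuousLinearMap
    (mfderiv 𝓘(ℝ, E) I (extChartAt I p).symm (extChartAt I p p) : E →L[ℝ] E) = ω' p
  rw [mfderiv_extChartAt_symm_self, extChartAt_to_inv]
  rfl

theorem DForm.d_eq [IsManifold I 1 M] (ω : DForm I M F k) (p : M) :
    ω.d p = extDeriv (ω.inChart p) (extChartAt I p p) := by
  change (extDeriv (ω.inChart p) (extChartAt I p p)).compContinuousLinearMap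
    (mfderiv I 𝓘(ℝ, E) (extChartAt I p) p : E →L[ℝ] E) = _
  rw [mfderiv_extChartAt_self]
  rfl

/-- Functoriality of pullback, applied to the two factorizations of `f ∘ φ⁻¹` near the point:
through `φ⁻¹`, and through the coordinate expression of `f` followed by the inverse chart of the
target. This reduces the calculus of forms on manifolds to that on vector spaces. -/
theorem DForm.inChart_pullback [I'.Boundaryless] [IsManifold I 1 M] [IsManifold I' 1 M']
    {f : M → M'} {p : M} (hf : ContMDiffAt I I' ∞ f p) (ω : DForm I' M' F k) :
    (ω.pullback (I := I) f).inChart p =ᶠ[𝓝 (extChartAt I p p)] fun y ↦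
      (ω.inChart (f p) (writtenInExtChartAt I I' p f y)).compContinuousLinearMap
        (fderiv ℝ (writtenInExtChartAt I I' p f) y) := by
  have hf1 : ∀ᶠ x in 𝓝 p, ContMDiffAt I I' 1 f x :=
    (contMDiffAt_iff_contMDiffAt_nhds (by simp)).1 (hf.of_le (by exact_mod_cast le_top))
  have h1 := eventually_extChartAt_symm (I := I) hf1
  have h2 := eventually_extChartAt_symm (I := I)
    (hf.continuousAt.eventually (extChartAt_source_mem_nhds (I := I') (f p))).eventually_nhds
  filter_upwards [h1, h2, extChartAt_target_mem_nhds (I := I) p] with y hy1 hy2 hy3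
  have hφ : ContMDiffAt 𝓘(ℝ, E) I 1 (extChartAt I p).symm y :=
    (contMDiffOn_extChartAt_symm p).contMDiffAt ((isOpen_extChartAt_target p).mem_nhds hy3)
  have hfφ : ContMDiffAt 𝓘(ℝ, E) I' 1 (f ∘ (extChartAt I p).symm) y := hy1.comp y hφ
  have hψ : ContMDiffAt I' 𝓘(ℝ, E') 1 (extChartAt I' (f p)) (f ((extChartAt I p).symm y)) :=
    contMDiffAt_extChartAt' (by rw [← extChartAt_source I']; exact hy2.self_of_nhds)
  have hF : ContMDiffAt 𝓘(ℝ, E) 𝓘(ℝ, E') 1 (writtenInExtChartAt I I' p f) y :=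
    hψ.comp y hfφ
  have hψs : ContMDiffAt 𝓘(ℝ, E') I' 1 (extChartAt I' (f p)).symm
      (writtenInExtChartAt I I' p f y) :=
    (contMDiffOn_extChartAt_symm (f p)).contMDiffAt ((isOpen_extChartAt_target (f p)).mem_nhds
      ((extChartAt I' (f p)).map_source hy2.self_of_nhds))
  have e : f ∘ (extChartAt I p).symm =ᶠ[𝓝 y]
      (extChartAt I' (f p)).symm ∘ writtenInExtChartAt I I' p f := by
    filter_upwards [hφ.continuousAt.eventually hy2] with z hz
    exact ((extChartAt I' (f p)).left_inv hz).symm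
  rw [DForm.inChart_eq_pullback, ← DForm.pullback_comp ω (hy1.mdifferentiableAt one_ne_zero)
    (hφ.mdifferentiableAt one_ne_zero), DForm.pullback_congr e,
    DForm.pullback_comp ω (hψs.mdifferentiableAt one_ne_zero) (hF.mdifferentiableAt one_ne_zero),
    ← DForm.inChart_eq_pullback, ← mfderiv_eq_fderiv]
  rfl

/-- Smoothness at a point. -/
def DForm.SmoothAt (ω : DForm I M F k) (p : M) : Prop :=
  ContDiffAt ℝ ∞ (ω.inChart p) (extChartAt I p p)

theorem DForm.inChart_congr {ω η : DForm I M F k} {p : M} (h : ∀ᶠ x in 𝓝 p, ω x = η x) :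
    ω.inChart p =ᶠ[𝓝 (extChartAt I p p)] η.inChart p := by
  filter_upwards [eventually_extChartAt_symm (I := I) h] with y hy
  simp only [DForm.inChart, hy]

theorem DForm.SmoothAt.congr {ω η : DForm I M F k} {p : M} (hω : ω.SmoothAt p)
    (h : ∀ᶠ x in 𝓝 p, η x = ω x) : η.SmoothAt p :=
  ContDiffAt.congr_of_eventuallyEq hω (DForm.inChart_congr h)

theorem DForm.d_congr {ω η : DForm I M F k} {p : M} (h : ∀ᶠ x in 𝓝 p, ω x = η x) :
    ω.d p = η.d p := by
  simp only [DForm.d, (DForm.inChart_congr h).extDeriv_eq]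

theorem minSmoothness_le_infty : minSmoothness ℝ 2 ≤ ∞ := by
  rw [minSmoothness_of_isRCLikeNormedField]
  exact WithTop.coe_le_coe.2 (le_top : (2 : ℕ∞) ≤ ⊤)

theorem contDiffAt_writtenInExtChartAt [I'.Boundaryless] [IsManifold I ∞ M] [IsManifold I' ∞ M']
    {f : M → M'} {p : M} (hf : ContMDiffAt I I' ∞ f p) :
    ContDiffAt ℝ ∞ (writtenInExtChartAt I I' p f) (extChartAt I p p) := by
  have := (contMDiffAt_iff.1 hf).2
  rwa [I.range_eq_univ, contDiffWithinAt_univ] at this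

end Chart

/-- Alternatization as a continuous linear map. -/
def alternatizationCLM (E F : Type*) [NormedAddCommGroup E] [NormedSpace ℝ E]
    [NormedAddCommGroup F] [NormedSpace ℝ F] (k : ℕ) :
    ContinuousMultilinearMap ℝ (fun _ : Fin k ↦ E) F →L[ℝ] E [⋀^Fin k]→L[ℝ] F :=
  LinearMap.mkContinuous
    { toFun := fun f ↦ ContinuousMultilinearMap.alternatization f
      map_add' := fun f g ↦ map_add _ f g
      map_smul' := fun c f ↦ by
        ext v
        simp [ContinuousMultilinearMap.alternatization_apply_apply, Finset.smul_sum,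
          smul_comm c] } (Fintype.card (Equiv.Perm (Fin k))) fun f ↦ by
    refine ContinuousAlternatingMap.opNorm_le_bound _ (by positivity) fun v ↦ ?_
    change ‖ContinuousMultilinearMap.alternatization f v‖ ≤ _
    rw [ContinuousMultilinearMap.alternatization_apply_apply]
    refine (norm_sum_le_of_le (f := fun σ : Equiv.Perm (Fin k) ↦ Equiv.Perm.sign σ • f (v ∘ σ))
      _ (n := fun _ ↦ ‖f‖ * ∏ i, ‖v i‖) fun σ _ ↦ ?_).trans_eq ?_
    · have h1 : ‖Equiv.Perm.sign σ • f (v ∘ σ)‖ = ‖f (v ∘ σ)‖ := by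
        rcases Int.units_eq_one_or (Equiv.Perm.sign σ) with h | h <;> simp [h]
      rw [h1, ← Equiv.prod_comp σ]
      exact f.le_opNorm _
    · simp [mul_assoc]

/-- Pulling back alternating maps is smooth. -/
theorem contDiff_compContinuousLinearMap :
    ContDiff ℝ ∞ (fun q : (E' [⋀^Fin k]→L[ℝ] F) × (E →L[ℝ] E') ↦
      q.1.compContinuousLinearMap q.2) := by
  have h1 : ContDiff ℝ ∞ (fun q : (E' [⋀^Fin k]→L[ℝ] F) × (E →L[ℝ] E') ↦
      ContinuousMultilinearMap.compContinuousLinearMapContinuousMultilinear ℝ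
        (fun _ : Fin k ↦ E) (fun _ ↦ E') F (fun _ ↦ q.2)) :=
    (ContinuousMultilinearMap.contDiff _).comp (contDiff_pi.2 fun _ ↦ contDiff_snd)
  have h2 : ContDiff ℝ ∞ (fun q : (E' [⋀^Fin k]→L[ℝ] F) × (E →L[ℝ] E') ↦
      ContinuousAlternatingMap.toContinuousMultilinearMapCLM ℝ q.1) :=
    (ContinuousLinearMap.contDiff _).comp contDiff_fst
  have h3 := ((alternatizationCLM E F k).contDiff (n := ∞)).comp (h1.clm_apply h2)
  -- Composition is smooth as a map into multilinear maps. Alternatization brings it back to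
  -- alternating maps, and on a map that is already alternating it is multiplication by k!.
  have h4 := h3.const_smul ((k.factorial : ℝ)⁻¹)
  convert! h4 using 1
  ext q v
  have hk : (k.factorial : ℝ) ≠ 0 := by positivity
  change q.1.compContinuousLinearMap q.2 v = (k.factorial : ℝ)⁻¹ • ContinuousMultilinearMap.alternatization
    (q.1.compContinuousLinearMap q.2).toContinuousMultilinearMap v
  rw [ContinuousMultilinearMap.alternatization_apply_apply]
  have : ∀ σ : Equiv.Perm (Fin k), Equiv.Perm.sign σ •
      (q.1.compContinuousLinearMap q.2).toContinuousMultilinearMap (v ∘ σ) =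
        q.1.compContinuousLinearMap q.2 v := fun σ ↦ by
    have : (q.1.compContinuousLinearMap q.2) (v ∘ σ) = Equiv.Perm.sign σ •
        (q.1.compContinuousLinearMap q.2) v :=
      (q.1.compContinuousLinearMap q.2).toAlternatingMap.map_perm v σ
    change Equiv.Perm.sign σ • (q.1.compContinuousLinearMap q.2) (v ∘ σ) = _
    rw [this, smul_smul, Int.units_mul_self, one_smul]
  simp only [this]
  rw [Finset.sum_const, Finset.card_univ, Fintype.card_perm, Fintype.card_fin,
    ← Nat.cast_smul_eq_nsmul ℝ, smul_smul, inv_mul_cancel₀ hk, one_smul]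

section Chart

variable [I.Boundaryless] [I'.Boundaryless] [IsManifold I ∞ M] [IsManifold I' ∞ M']

theorem DForm.SmoothAt.pullback {f : M → M'} {p : M} {ω : DForm I' M' F k}
    (hω : ω.SmoothAt (f p)) (hf : ContMDiffAt I I' ∞ f p) :
    (ω.pullback (I := I) f).SmoothAt p := by
  have hW := contDiffAt_writtenInExtChartAt hf
  have h1 : writtenInExtChartAt I I' p f (extChartAt I p p) = extChartAt I' (f p) (f p) := by
    simp [writtenInExtChartAt]
  refine ContDiffAt.congr_of_eventuallyEq ?_ (DForm.inChart_pullback hf ω)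
  have hω' : ContDiffAt ℝ ∞ (ω.inChart (f p))
      (writtenInExtChartAt I I' p f (extChartAt I p p)) := by rw [h1]; exact hω
  have h2 : ContDiffAt ℝ ∞ (fun y ↦ (ω.inChart (f p) (writtenInExtChartAt I I' p f y),
      fderiv ℝ (writtenInExtChartAt I I' p f) y)) (extChartAt I p p) :=
    (hω'.comp _ hW).prodMk (hW.fderiv_right (m := ∞) (by simp))
  exact (contDiff_compContinuousLinearMap (E := E) (E' := E') (F := F)
    (k := k)).contDiffAt.comp _ h2

/-- Naturality of `d`: in coordinates this is the corresponding fact for `extDeriv`, which may be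
applied because `DForm.inChart_pullback` is an equality of germs. -/
theorem DForm.d_pullback {f : M → M'} {p : M} {ω : DForm I' M' F k}
    (hω : ω.SmoothAt (f p)) (hf : ContMDiffAt I I' ∞ f p) :
    (ω.pullback (I := I) f).d p = (ω.d).pullback (I := I) f p := by
  have hW := contDiffAt_writtenInExtChartAt hf
  have h1 : writtenInExtChartAt I I' p f (extChartAt I p p) = extChartAt I' (f p) (f p) := by
    simp [writtenInExtChartAt]
  have h2 : (mfderiv I I' f p : E →L[ℝ] E') =
      fderiv ℝ (writtenInExtChartAt I I' p f) (extChartAt I p p) := by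
    refine (hf.mdifferentiableAt (by simp)).mfderiv.trans ?_
    rw [I.range_eq_univ, fderivWithin_univ]
  rw [DForm.d_eq, (DForm.inChart_pullback hf ω).extDeriv_eq,
    extDeriv_pullback (by rw [h1]; exact ContDiffAt.differentiableAt hω (by simp)) hW
      minSmoothness_le_infty]
  change _ = (ω.d (f p)).compContinuousLinearMap (mfderiv I I' f p : E →L[ℝ] E')
  rw [h2, DForm.d_eq, h1]
  rfl

theorem DForm.inChart_model (η : DForm 𝓘(ℝ, E) E F k) (y : E) : η.inChart y = η := by
  have h1 : ((extChartAt 𝓘(ℝ, E) y).symm : E → E) = id := by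
    rw [extChartAt_model_space_eq_id]; rfl
  rw [DForm.inChart_eq_pullback, h1]
  ext z w
  change η z (fun j ↦ (mfderiv 𝓘(ℝ, E) 𝓘(ℝ, E) (id : E → E) z : E →L[ℝ] E) (w j)) = η z w
  have : (mfderiv 𝓘(ℝ, E) 𝓘(ℝ, E) (id : E → E) z : E →L[ℝ] E) = ContinuousLinearMap.id ℝ E :=
    mfderiv_id
  rw [this]
  rfl

/-- The definition of `d` uses a different chart at each point. Naturality under the inverse of one
fixed chart shows that the result does not depend on this, so smoothness of `ω.d` and `d ∘ d = 0`
can be checked in a single chart. -/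
theorem DForm.d_inChart {ω : DForm I M F k} {p : M} (h : ∀ᶠ x in 𝓝 p, ω.SmoothAt x) :
    ω.d.inChart p =ᶠ[𝓝 (extChartAt I p p)] extDeriv (ω.inChart p) := by
  filter_upwards [eventually_extChartAt_symm (I := I) h, extChartAt_target_mem_nhds (I := I) p]
    with y hy1 hy2
  have hφ : ContMDiffAt 𝓘(ℝ, E) I ∞ (extChartAt I p).symm y :=
    (contMDiffOn_extChartAt_symm p).contMDiffAt ((isOpen_extChartAt_target p).mem_nhds hy2)
  rw [DForm.inChart_eq_pullback, ← DForm.d_pullback hy1 hφ, DForm.d_eq,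
    DForm.inChart_eq_pullback ω]
  rw [DForm.inChart_model, extChartAt_model_space_eq_id]
  rfl

set_option synthInstance.maxHeartbeats 200000 in
theorem DForm.smoothAt_d {ω : DForm I M F k} {p : M} (h : ∀ᶠ x in 𝓝 p, ω.SmoothAt x) :
    ω.d.SmoothAt p := by
  refine ContDiffAt.congr_of_eventuallyEq ?_ (DForm.d_inChart h)
  have h0 : ContDiffAt ℝ ∞ (ω.inChart p) (extChartAt I p p) := h.self_of_nhds
  have h1 : ContDiffAt ℝ ∞ (fderiv ℝ (ω.inChart p)) (extChartAt I p p) :=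
    h0.fderiv_right (m := ∞) (by simp)
  exact (ContinuousAlternatingMap.alternatizeUncurryFinCLM ℝ E F
    (n := k)).contDiff.contDiffAt.comp _ h1

theorem DForm.d_d {ω : DForm I M F k} {p : M} (h : ∀ᶠ x in 𝓝 p, ω.SmoothAt x) :
    ω.d.d p = 0 := by
  have h0 : ContDiffAt ℝ ∞ (ω.inChart p) (extChartAt I p p) := h.self_of_nhds
  rw [DForm.d_eq, (DForm.d_inChart h).extDeriv_eq]
  exact extDeriv_extDeriv_apply h0 minSmoothness_le_infty

end Chart

end FormCalculus

/-! ### Sums and multiples of forms, and the Leibniz rule. -/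

section FormAlgebra

variable {E H M E' H' M' E'' H'' M'' F : Type*}
  [NormedAddCommGroup E] [NormedSpace ℝ E] [TopologicalSpace H] {I : ModelWithCorners ℝ E H}
  [TopologicalSpace M] [ChartedSpace H M]
  [NormedAddCommGroup E'] [NormedSpace ℝ E'] [TopologicalSpace H'] {I' : ModelWithCorners ℝ E' H'}
  [TopologicalSpace M'] [ChartedSpace H' M']
  [NormedAddCommGroup E''] [NormedSpace ℝ E''] [TopologicalSpace H'']
  {I'' : ModelWithCorners ℝ E'' H''} [TopologicalSpace M''] [ChartedSpace H'' M'']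
  [NormedAddCommGroup F] [NormedSpace ℝ F] {k : ℕ}

theorem DForm.SmoothAt.add {ω η : DForm I M F k} {p : M} (hω : ω.SmoothAt p) (hη : η.SmoothAt p) :
    DForm.SmoothAt (I := I) (fun q ↦ ω q + η q) p :=
  ContDiffAt.add hω hη

theorem DForm.d_add {ω η : DForm I M F k} {p : M} (hω : ω.SmoothAt p) (hη : η.SmoothAt p) :
    DForm.d (I := I) (fun q ↦ ω q + η q) p = ω.d p + η.d p := by
  have h : extDeriv (ω.inChart p + η.inChart p) (extChartAt I p p) =
    extDeriv (ω.inChart p) (extChartAt I p p) + extDeriv (η.inChart p) (extChartAt I p p) :=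
    extDeriv_add (ContDiffAt.differentiableAt hω (by simp))
      (ContDiffAt.differentiableAt hη (by simp))
  change (extDeriv (ω.inChart p + η.inChart p) (extChartAt I p p)).compContinuousLinearMap _ = _
  rw [h]
  rfl

theorem DForm.SmoothAt.const_smul {ω : DForm I M F k} {p : M} (hω : ω.SmoothAt p) (c : ℝ) :
    DForm.SmoothAt (I := I) (fun q ↦ c • ω q) p :=
  ContDiffAt.const_smul c hω

theorem DForm.d_const_smul (ω : DForm I M F k) (p : M) (c : ℝ) :
    DForm.d (I := I) (fun q ↦ c • ω q) p = c • ω.d p := by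
  change (extDeriv (c • ω.inChart p) (extChartAt I p p)).compContinuousLinearMap _ = _
  rw [extDeriv_smul]
  rfl

variable (I) in
/-- The differential of a real function, as a linear form on the model space. -/
def dFun (f : M → ℝ) (p : M) : E →L[ℝ] ℝ := mfderiv I 𝓘(ℝ, ℝ) f p

/-- The term `df ∧ ω` is kept as an explicit alternating sum over the slot that `df` occupies, the
shape in which it is estimated later. -/
theorem extDeriv_smul_apply {f : E → ℝ} {ω : E → E [⋀^Fin k]→L[ℝ] F} {y : E}
    (hf : DifferentiableAt ℝ f y) (hω : DifferentiableAt ℝ ω y) (w : Fin (k + 1) → E) :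
    extDeriv (fun z ↦ f z • ω z) y w = f y • extDeriv ω y w +
      ∑ i : Fin (k + 1), (-1 : ℝ) ^ (i : ℕ) • (fderiv ℝ f y (w i)) • ω y (i.removeNth w) := by
  rw [extDeriv, extDeriv, fderiv_fun_smul hf hω]
  simp only [ContinuousAlternatingMap.alternatizeUncurryFin_apply, Finset.smul_sum,
    ← Finset.sum_add_distrib]
  refine Finset.sum_congr rfl fun i _ ↦ ?_
  simp only [_root_.add_apply, _root_.smul_apply,
    ContinuousLinearMap.smulRight_apply, ContinuousAlternatingMap.add_apply,
    ContinuousAlternatingMap.smul_apply, smul_add]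
  congr 1
  · rw [smul_comm]
  · rcases Nat.even_or_odd (i : ℕ) with h | h <;> simp [h.neg_one_pow]

variable [I.Boundaryless] [IsManifold I ∞ M]

theorem contDiffAt_comp_extChartAt_symm {f : M → ℝ} {p : M} (hf : ContMDiffAt I 𝓘(ℝ, ℝ) ∞ f p) :
    ContDiffAt ℝ ∞ (f ∘ (extChartAt I p).symm) (extChartAt I p p) := by
  have := contDiffAt_writtenInExtChartAt hf
  rwa [writtenInExtChartAt, extChartAt_model_space_eq_id, PartialEquiv.refl_coe,
    Function.id_comp] at this

theorem dFun_eq_fderiv {f : M → ℝ} {p : M}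
    (hf : MDifferentiableAt I 𝓘(ℝ, ℝ) f p) :
    dFun I f p = fderiv ℝ (f ∘ (extChartAt I p).symm) (extChartAt I p p) := by
  refine hf.mfderiv.trans ?_
  rw [I.range_eq_univ, fderivWithin_univ, writtenInExtChartAt, extChartAt_model_space_eq_id,
    PartialEquiv.refl_coe, Function.id_comp]

theorem DForm.SmoothAt.smul {f : M → ℝ} {ω : DForm I M F k} {p : M}
    (hf : ContMDiffAt I 𝓘(ℝ, ℝ) ∞ f p) (hω : ω.SmoothAt p) :
    DForm.SmoothAt (I := I) (fun q ↦ f q • ω q) p :=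
  ContDiffAt.smul (contDiffAt_comp_extChartAt_symm hf) hω

theorem DForm.d_smul_apply {f : M → ℝ} {ω : DForm I M F k} {p : M}
    (hf : ContMDiffAt I 𝓘(ℝ, ℝ) ∞ f p) (hω : ω.SmoothAt p) (w : Fin (k + 1) → E) :
    (DForm.d (I := I) (fun q ↦ f q • ω q) p : E [⋀^Fin (k + 1)]→L[ℝ] F) w =
      f p • (ω.d p : E [⋀^Fin (k + 1)]→L[ℝ] F) w +
        ∑ i : Fin (k + 1), (-1 : ℝ) ^ (i : ℕ) • (dFun I f p (w i)) •
          (ω p : E [⋀^Fin k]→L[ℝ] F) (i.removeNth w) := by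
  have hω' : DifferentiableAt ℝ (ω.inChart p) (extChartAt I p p) :=
    ContDiffAt.differentiableAt hω (by simp)
  have hf' : DifferentiableAt ℝ (f ∘ (extChartAt I p).symm) (extChartAt I p p) :=
    (contDiffAt_comp_extChartAt_symm hf).differentiableAt (by simp)
  rw [DForm.d_eq, DForm.d_eq, dFun_eq_fderiv
    (hf.mdifferentiableAt (by simp))]
  have h1 : DForm.inChart (I := I) (fun q ↦ f q • ω q) p =
    fun y ↦ (f ∘ (extChartAt I p).symm) y • ω.inChart p y := rfl
  rw [h1]
  refine (extDeriv_smul_apply hf' hω' w).trans ?_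
  have h2 : (f ∘ (extChartAt I p).symm) (extChartAt I p p) = f p := by simp
  have h3 : ω.inChart p (extChartAt I p p) = ω p := DForm.inChart_self ω p
  rw [h2, h3]
  rfl

end FormAlgebra

/-! ### Local diffeomorphisms -/

section Diffeo

variable {E H M E' H' M' E'' H'' M'' F : Type*}
  [NormedAddCommGroup E] [NormedSpace ℝ E] [TopologicalSpace H] {I : ModelWithCorners ℝ E H}
  [TopologicalSpace M] [ChartedSpace H M]
  [NormedAddCommGroup E'] [NormedSpace ℝ E'] [TopologicalSpace H'] {I' : ModelWithCorners ℝ E' H'}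
  [TopologicalSpace M'] [ChartedSpace H' M']
  [NormedAddCommGroup E''] [NormedSpace ℝ E''] [TopologicalSpace H'']
  {I'' : ModelWithCorners ℝ E'' H''} [TopologicalSpace M''] [ChartedSpace H'' M'']
  [NormedAddCommGroup F] [NormedSpace ℝ F] {k : ℕ}

variable (I I') in
/-- `e` is a diffeomorphism between open subsets. -/
structure IsDiffeo (e : OpenPartialHomeomorph M M') : Prop where
  smooth : ContMDiffOn I I' ∞ e e.source
  symm_smooth : ContMDiffOn I' I ∞ e.symm e.target

namespace IsDiffeo

variable {e : OpenPartialHomeomorph M M'} {e' : OpenPartialHomeomorph M' M''}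

theorem symm (he : IsDiffeo I I' e) : IsDiffeo I' I e.symm := ⟨he.symm_smooth, he.smooth⟩

theorem trans (he : IsDiffeo I I' e) (he' : IsDiffeo I' I'' e') :
    IsDiffeo I I'' (e.trans e') := by
  constructor
  · exact he'.smooth.comp (he.smooth.mono fun x hx ↦ hx.1) fun x hx ↦ hx.2
  · refine he.symm_smooth.comp (he'.symm_smooth.mono fun x hx ↦ ?_) fun x hx ↦ ?_
    · exact ((e.trans_target e') ▸ hx).1
    · exact ((e.trans_target e') ▸ hx).2

theorem ofSet {U : Set M} (hU : IsOpen U) : IsDiffeo I I (OpenPartialHomeomorph.ofSet U hU) :=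
  ⟨contMDiffOn_id, contMDiffOn_id⟩

theorem contMDiffAt (he : IsDiffeo I I' e) {x : M} (hx : x ∈ e.source) :
    ContMDiffAt I I' ∞ e x := he.smooth.contMDiffAt (e.open_source.mem_nhds hx)

theorem mdifferentiableAt (he : IsDiffeo I I' e) {x : M} (hx : x ∈ e.source) :
    MDifferentiableAt I I' e x := (he.contMDiffAt hx).mdifferentiableAt (by simp)

theorem mfderiv_symm_comp (he : IsDiffeo I I' e) {x : M} (hx : x ∈ e.source) :
    (mfderiv I' I e.symm (e x) : E' →L[ℝ] E).comp (mfderiv I I' e x : E →L[ℝ] E') =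
      ContinuousLinearMap.id ℝ E := by
  have h1 := mfderiv_comp x (he.symm.mdifferentiableAt (e.map_source hx)) (he.mdifferentiableAt hx)
  have h2 : e.symm ∘ e =ᶠ[𝓝 x] id := by
    filter_upwards [e.open_source.mem_nhds hx] with y hy using e.left_inv hy
  have h3 : (mfderiv I I (e.symm ∘ e) x : E →L[ℝ] E) = ContinuousLinearMap.id ℝ E :=
    (h2.mfderiv_eq).trans mfderiv_id
  rw [← h3]
  exact h1.symm

theorem mfderiv_comp_symm (he : IsDiffeo I I' e) {x : M} (hx : x ∈ e.source) :
    (mfderiv I I' e x : E →L[ℝ] E').comp (mfderiv I' I e.symm (e x) : E' →L[ℝ] E) =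
      ContinuousLinearMap.id ℝ E' := by
  have h := he.symm.mfderiv_symm_comp (e.map_source hx)
  have h1 : e.symm (e x) = x := e.left_inv hx
  have h2 : e.symm.symm (e.symm (e x)) = e x := e.right_inv (e.map_source hx)
  rw [OpenPartialHomeomorph.symm_symm, h1] at h
  exact h

/-- The derivative of a diffeomorphism. -/
def equiv (he : IsDiffeo I I' e) {x : M} (hx : x ∈ e.source) : E ≃L[ℝ] E' :=
  ContinuousLinearEquiv.equivOfInverse (mfderiv I I' e x : E →L[ℝ] E')
    (mfderiv I' I e.symm (e x) : E' →L[ℝ] E)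
    (fun v ↦ DFunLike.congr_fun (he.mfderiv_symm_comp hx) v)
    (fun v ↦ DFunLike.congr_fun (he.mfderiv_comp_symm hx) v)

/-- The forms on the glued space are defined through `pushAt`, while all arguments use pullbacks.
This is the passage from one to the other; it rests on the differential of a diffeomorphism being
invertible, so that `inverse` does not take its default value. -/
theorem pullback_of_eq_pushAt (he : IsDiffeo I I' e) {x : M} (hx : x ∈ e.source)
    {ω : DForm I' M' F k} {η : TangentSpace I x [⋀^Fin k]→L[ℝ] F}
    (h : ω (e x) = pushAt (I := I) (I' := I') e x η) : ω.pullback (I := I) e x = η := by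
  have h1 : (mfderiv I I' e x).inverse = ((he.equiv hx).symm : E' →L[ℝ] E) := by
    have : (mfderiv I I' e x : E →L[ℝ] E') = (he.equiv hx : E →L[ℝ] E') := rfl
    exact (congrArg ContinuousLinearMap.inverse this).trans
      (ContinuousLinearMap.inverse_equiv _)
  ext w
  change (ω (e x)) (fun j ↦ mfderiv I I' e x (w j)) = _
  rw [h]
  change η (fun j ↦ (mfderiv I I' e x).inverse (mfderiv I I' e x (w j))) = η w
  rw [h1]
  congr 1
  ext j
  exact (he.equiv hx).symm_apply_apply (w j)

/-- If `e^* ω = η` near `x` then `ω` is the pullback of `η` under `e⁻¹` near `e x`. -/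
theorem eventually_eq_pullback_symm (he : IsDiffeo I I' e) {x : M} (hx : x ∈ e.source)
    {ω : DForm I' M' F k} {η : DForm I M F k}
    (h : ∀ᶠ y in 𝓝 x, ω.pullback (I := I) e y = η y) :
    ∀ᶠ z in 𝓝 (e x), ω z = η.pullback (I := I') e.symm z := by
  have hc := (e.symm.continuousAt (e.map_source hx))
  rw [ContinuousAt, e.left_inv hx] at hc
  filter_upwards [hc.eventually h, e.open_target.mem_nhds (e.map_source hx)] with z hz hzt
  have h1 : η.pullback (I := I') e.symm z = (ω.pullback (I := I) e).pullback (I := I') e.symm z := by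
    simp only [DForm.pullback] at hz ⊢
    rw [← hz]
  have hd : MDifferentiableAt I I' e (e.symm z) := he.mdifferentiableAt (e.map_target hzt)
  rw [h1, ← DForm.pullback_comp ω hd (he.symm.mdifferentiableAt hzt)]
  have h2 : e ∘ e.symm =ᶠ[𝓝 z] id := by
    filter_upwards [e.open_target.mem_nhds hzt] with y hy using e.right_inv hy
  rw [DForm.pullback_congr h2]
  ext w
  change _ = ω z (fun j ↦ (mfderiv I' I' (id : M' → M') z : E' →L[ℝ] E') (w j))
  have : (mfderiv I' I' (id : M' → M') z : E' →L[ℝ] E') = ContinuousLinearMap.id ℝ E' := mfderiv_id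
  rw [this]
  rfl

variable [I.Boundaryless] [I'.Boundaryless] [IsManifold I ∞ M] [IsManifold I' ∞ M']

theorem smoothAt (he : IsDiffeo I I' e) {x : M} (hx : x ∈ e.source)
    {ω : DForm I' M' F k} {η : DForm I M F k}
    (h : ∀ᶠ y in 𝓝 x, ω.pullback (I := I) e y = η y) (hη : η.SmoothAt x) : ω.SmoothAt (e x) := by
  refine DForm.SmoothAt.congr ?_ (he.eventually_eq_pullback_symm hx h)
  refine DForm.SmoothAt.pullback ?_ (he.symm.contMDiffAt (e.map_source hx))
  rwa [e.left_inv hx]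

theorem d_eq_zero (he : IsDiffeo I I' e) {x : M} (hx : x ∈ e.source)
    {ω : DForm I' M' F k} {η : DForm I M F k}
    (h : ∀ᶠ y in 𝓝 x, ω.pullback (I := I) e y = η y) (hη : η.SmoothAt x) (hd : η.d x = 0) :
    ω.d (e x) = 0 := by
  have h1 : e.symm (e x) = x := e.left_inv hx
  rw [DForm.d_congr (he.eventually_eq_pullback_symm hx h),
    DForm.d_pullback (by rwa [h1]) (he.symm.contMDiffAt (e.map_source hx))]
  have h2 : ∀ y : M, y = x → η.d y = 0 := by rintro y rfl; exact hd
  simp only [DForm.pullback, h2 _ h1]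
  rfl

end IsDiffeo

end Diffeo

/-! ### The smooth structure of glued spaces -/

namespace GlueData

variable {d n : ℕ} {X : Type*} [TopologicalSpace X] {Z : Fin n → Type*}
  [∀ i, TopologicalSpace (Z i)] (G : GlueData X Z)

/-- The inclusion of `Q` as an open partial homeomorphism. -/
def inQ (h : Nonempty G.Q) : OpenPartialHomeomorph X G.Glued :=
  (G.Q.openPartialHomeomorphSubtypeCoe h).symm.trans
    (G.isOpenEmbedding_jQ.toOpenPartialHomeomorph G.jQ)

/-- The inclusion of `P i` as an open partial homeomorphism. -/
def inP (i : Fin n) (h : Nonempty (G.P i)) : OpenPartialHomeomorph (Z i) G.Glued :=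
  ((G.P i).openPartialHomeomorphSubtypeCoe h).symm.trans
    ((G.isOpenEmbedding_jP i).toOpenPartialHomeomorph (G.jP i))

theorem inQ_source (h : Nonempty G.Q) : (G.inQ h).source = G.Q := by
  simp [inQ]

theorem inP_source (i : Fin n) (h : Nonempty (G.P i)) : (G.inP i h).source = G.P i := by
  simp [inP]

theorem inQ_apply (h : Nonempty G.Q) (x : G.Q) : G.inQ h x = G.jQ x := by
  have : (G.Q.openPartialHomeomorphSubtypeCoe h).symm (x : X) = x :=
    (G.Q.openPartialHomeomorphSubtypeCoe h).left_inv (mem_univ x)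
  simp [inQ, this]

theorem inP_apply (i : Fin n) (h : Nonempty (G.P i)) (z : G.P i) : G.inP i h z = G.jP i z := by
  have : ((G.P i).openPartialHomeomorphSubtypeCoe h).symm (z : Z i) = z :=
    ((G.P i).openPartialHomeomorphSubtypeCoe h).left_inv (mem_univ z)
  simp [inP, this]

theorem disjoint_range_jP {i j : Fin n} (hij : i ≠ j)
    (h : Disjoint (G.φ i).source (G.φ j).source) :
    Disjoint (range (G.jP i)) (range (G.jP j)) := by
  rw [Set.disjoint_left]
  rintro _ ⟨z, rfl⟩ ⟨w, e⟩
  obtain ⟨x, hx⟩ := G.jP_eq_jP_of_ne hij e.symm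
  exact Set.disjoint_left.1 h (G.jQ_eq_jP.1 hx).1 (G.jQ_eq_jP.1 (hx.trans e.symm)).1

variable [ChartedSpace (Eu d) X] [∀ i, ChartedSpace (Eu d) (Z i)]

/-- `e` is a chart of the glued space that comes, by way of `ψ`, from the chart `e₀`. -/
structure ChartFrom {A : Type*} [TopologicalSpace A] (ψ : OpenPartialHomeomorph A G.Glued)
    (e₀ : OpenPartialHomeomorph A (Eu d)) (e : OpenPartialHomeomorph G.Glued (Eu d)) : Prop where
  source : e.source = ψ '' (ψ.source ∩ e₀.source)
  eq : ∀ x ∈ ψ.source ∩ e₀.source, e (ψ x) = e₀ x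

theorem chartFrom_jQ {e' : OpenPartialHomeomorph G.Q (Eu d)} (he' : e' ∈ atlas (Eu d) G.Q)
    (h : Nonempty G.Q) : ∃ e₀ ∈ atlas (Eu d) X,
      G.ChartFrom (G.inQ h) e₀ (e'.lift_openEmbedding G.isOpenEmbedding_jQ) := by
  obtain ⟨x, rfl⟩ := mem_iUnion.1 he'
  refine ⟨chartAt (Eu d) (x : X), chart_mem_atlas _ _, ?_, ?_⟩
  · rw [OpenPartialHomeomorph.lift_openEmbedding_source, OpenPartialHomeomorph.subtypeRestr_source,
      inQ_source]
    ext q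
    constructor
    · rintro ⟨y, hy, rfl⟩; exact ⟨y, ⟨y.2, hy⟩, G.inQ_apply h y⟩
    · rintro ⟨y, ⟨hy1, hy2⟩, rfl⟩; exact ⟨⟨y, hy1⟩, hy2, (G.inQ_apply h ⟨y, hy1⟩).symm⟩
  · rintro y ⟨hy1, -⟩
    rw [inQ_source] at hy1
    rw [G.inQ_apply h ⟨y, hy1⟩, OpenPartialHomeomorph.lift_openEmbedding_apply]
    rfl

theorem chartFrom_jP (i : Fin n) {e' : OpenPartialHomeomorph (G.P i) (Eu d)}
    (he' : e' ∈ atlas (Eu d) (G.P i)) (h : Nonempty (G.P i)) : ∃ e₀ ∈ atlas (Eu d) (Z i),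
      G.ChartFrom (G.inP i h) e₀ (e'.lift_openEmbedding (G.isOpenEmbedding_jP i)) := by
  obtain ⟨x, rfl⟩ := mem_iUnion.1 he'
  refine ⟨chartAt (Eu d) (x : Z i), chart_mem_atlas _ _, ?_, ?_⟩
  · rw [OpenPartialHomeomorph.lift_openEmbedding_source, OpenPartialHomeomorph.subtypeRestr_source,
      inP_source]
    ext q
    constructor
    · rintro ⟨y, hy, rfl⟩; exact ⟨y, ⟨y.2, hy⟩, G.inP_apply i h y⟩
    · rintro ⟨y, ⟨hy1, hy2⟩, rfl⟩; exact ⟨⟨y, hy1⟩, hy2, (G.inP_apply i h ⟨y, hy1⟩).symm⟩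
  · rintro y ⟨hy1, -⟩
    rw [inP_source] at hy1
    rw [G.inP_apply i h ⟨y, hy1⟩, OpenPartialHomeomorph.lift_openEmbedding_apply]
    rfl

/-- The transition between two charts is smooth if it is so in the pieces they come from. -/
theorem ChartFrom.contDiffOn {A B : Type*} [TopologicalSpace A] [TopologicalSpace B]
    [ChartedSpace (Eu d) A] [ChartedSpace (Eu d) B] [IsManifold (𝓡 d) ∞ A] [IsManifold (𝓡 d) ∞ B]
    {ψ : OpenPartialHomeomorph A G.Glued} {χ : OpenPartialHomeomorph B G.Glued}
    {e₀ : OpenPartialHomeomorph A (Eu d)} {e₁ : OpenPartialHomeomorph B (Eu d)}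
    {e e' : OpenPartialHomeomorph G.Glued (Eu d)}
    (he₀ : e₀ ∈ atlas (Eu d) A) (he₁ : e₁ ∈ atlas (Eu d) B)
    (he : G.ChartFrom ψ e₀ e) (he' : G.ChartFrom χ e₁ e')
    (hT : ∀ x ∈ ψ.source, ∀ z ∈ χ.source, ψ x = χ z → ∃ T : A → B, T x = z ∧
      ContMDiffAt (𝓡 d) (𝓡 d) ∞ T x ∧ ∀ᶠ y in 𝓝 x, T y ∈ χ.source ∧ χ (T y) = ψ y) :
    ContDiffOn ℝ ∞ (e' ∘ e.symm) (e.symm.trans e').source := by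
  intro y hy
  have hy1 : y ∈ e.target := hy.1
  have hy2 : e.symm y ∈ e'.source := hy.2
  have h1 := e.map_target hy1
  rw [he.source] at h1
  rw [he'.source] at hy2
  obtain ⟨x, hx, hxy⟩ := h1
  obtain ⟨z, hz, hzy⟩ := hy2
  -- `T` is the local identification between the pieces that the charts come from: the identity, a
  -- gluing map or its inverse. Near `y` the transition map is `e₁ ∘ T ∘ e₀.symm`.
  obtain ⟨T, hTx, hTs, hTe⟩ := hT x hx.1 z hz.1 (hxy.trans hzy.symm)
  have hyx : e₀ x = y := by rw [← he.eq x hx, hxy, e.right_inv hy1]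
  have hyt : y ∈ e₀.target := hyx ▸ e₀.map_source hx.2
  have hxe : e₀.symm y = x := by rw [← hyx, e₀.left_inv hx.2]
  have hs0 : ContMDiffAt (𝓡 d) (𝓡 d) ∞ e₀.symm y :=
    (contMDiffOn_symm_of_mem_maximalAtlas (IsManifold.subset_maximalAtlas he₀)).contMDiffAt
      (e₀.open_target.mem_nhds hyt)
  have hs1 : ContMDiffAt (𝓡 d) (𝓡 d) ∞ e₁ z :=
    (contMDiffOn_of_mem_maximalAtlas (IsManifold.subset_maximalAtlas he₁)).contMDiffAt
      (e₁.open_source.mem_nhds hz.2)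
  have hT0 : ContMDiffAt (𝓡 d) (𝓡 d) ∞ T (e₀.symm y) := by rw [hxe]; exact hTs
  have hT1 : ContMDiffAt (𝓡 d) (𝓡 d) ∞ (T ∘ e₀.symm) y := hT0.comp y hs0
  have hs2 : ContMDiffAt (𝓡 d) (𝓡 d) ∞ e₁ ((T ∘ e₀.symm) y) := by
    rw [Function.comp, hxe, hTx]; exact hs1
  have hcomp : ContMDiffAt (𝓡 d) (𝓡 d) ∞ (e₁ ∘ T ∘ e₀.symm) y := hs2.comp y hT1
  refine ((contMDiffAt_iff_contDiffAt.1 hcomp).congr_of_eventuallyEq ?_).contDiffWithinAt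
  have hc0 : Filter.Tendsto e₀.symm (𝓝 y) (𝓝 x) := by
    have := hs0.continuousAt
    rwa [ContinuousAt, hxe] at this
  have hT1 : ∀ᶠ a in 𝓝 x, T a ∈ e₁.source := by
    refine hTs.continuousAt.eventually (e₁.open_source.mem_nhds ?_)
    rw [hTx]; exact hz.2
  filter_upwards [hc0.eventually hTe, hc0.eventually hT1, e₀.open_target.mem_nhds hyt,
    hc0.eventually (ψ.open_source.mem_nhds hx.1)] with y' h1 h2 h3 h4
  have h5 : e (ψ (e₀.symm y')) = y' := by
    rw [he.eq _ ⟨h4, e₀.map_target h3⟩, e₀.right_inv h3]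
  have h6 : ψ (e₀.symm y') ∈ e.source := by
    rw [he.source]; exact ⟨_, ⟨h4, e₀.map_target h3⟩, rfl⟩
  have h7 : e.symm y' = ψ (e₀.symm y') := by
    rw [← e.left_inv h6, h5]
  change e' (e.symm y') = _
  rw [h7, ← h1.2, he'.eq _ ⟨h1.1, h2⟩]
  rfl

variable [IsManifold (𝓡 d) ∞ X] [∀ i, IsManifold (𝓡 d) ∞ (Z i)]

/-- Two charts that meet come from one piece, whose own transition is then smooth, or from `Q` and
some `P i`, where the transition is `φ i` or its inverse read in charts. Two different `P i` never
meet, as their images in `Q` are disjoint. -/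
theorem isManifold_glued (hφ : ∀ i, IsDiffeo (𝓡 d) (𝓡 d) (G.φ i))
    (hd : ∀ i j, i ≠ j → Disjoint (G.φ i).source (G.φ j).source) :
    IsManifold (𝓡 d) ∞ G.Glued := by
  refine isManifold_of_contDiffOn _ _ _ fun e e' he he' ↦ ?_
  have main : ContDiffOn ℝ ∞ (e' ∘ e.symm) (e.symm.trans e').source := by
    by_cases hemp : (e.symm.trans e').source = ∅
    · rw [hemp]; exact fun x hx ↦ absurd hx (notMem_empty x)
    obtain ⟨y, hy⟩ := nonempty_iff_ne_empty.2 hemp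
    have hye := e.map_target hy.1
    have hye' : e.symm y ∈ e'.source := hy.2
    rcases he with ⟨f, hf, rfl⟩ | ⟨i, f, hf, rfl⟩ <;>
      rcases he' with ⟨f', hf', rfl⟩ | ⟨j, f', hf', rfl⟩
    · obtain ⟨x, -, -⟩ := hye
      obtain ⟨e₀, he₀, h⟩ := G.chartFrom_jQ hf ⟨x⟩
      obtain ⟨e₁, he₁, h'⟩ := G.chartFrom_jQ hf' ⟨x⟩
      refine h.contDiffOn G he₀ he₁ h' fun x hx z hz hxz ↦ ⟨id, ?_, contMDiffAt_id, ?_⟩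
      · exact (G.inQ _).injOn hx hz hxz
      · filter_upwards [(G.inQ _).open_source.mem_nhds hx] with a ha using ⟨ha, rfl⟩
    · obtain ⟨x, -, -⟩ := hye
      obtain ⟨z, -, -⟩ := hye'
      obtain ⟨e₀, he₀, h⟩ := G.chartFrom_jQ hf ⟨x⟩
      obtain ⟨e₁, he₁, h'⟩ := G.chartFrom_jP j hf' ⟨z⟩
      refine h.contDiffOn G he₀ he₁ h' fun x hx z hz hxz ↦ ?_
      rw [inQ_source] at hx
      rw [inP_source] at hz
      rw [G.inQ_apply _ ⟨x, hx⟩, G.inP_apply _ _ ⟨z, hz⟩, G.jQ_eq_jP] at hxz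
      refine ⟨G.φ j, hxz.2, (hφ j).contMDiffAt hxz.1, ?_⟩
      filter_upwards [(G.φ j).open_source.mem_nhds hxz.1] with a ha
      rw [inP_source]
      have ha' := G.target_sub j ((G.φ j).map_source ha)
      refine ⟨ha', ?_⟩
      rw [G.inQ_apply _ ⟨a, G.source_sub j ha⟩, G.inP_apply _ _ ⟨_, ha'⟩, eq_comm, G.jQ_eq_jP]
      exact ⟨ha, rfl⟩
    · obtain ⟨z, -, -⟩ := hye
      obtain ⟨x, -, -⟩ := hye'
      obtain ⟨e₀, he₀, h⟩ := G.chartFrom_jP i hf ⟨z⟩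
      obtain ⟨e₁, he₁, h'⟩ := G.chartFrom_jQ hf' ⟨x⟩
      refine h.contDiffOn G he₀ he₁ h' fun z hz x hx hxz ↦ ?_
      rw [inQ_source] at hx
      rw [inP_source] at hz
      rw [G.inQ_apply _ ⟨x, hx⟩, G.inP_apply _ _ ⟨z, hz⟩, eq_comm, G.jQ_eq_jP] at hxz
      have hx1 : x ∈ (G.φ i).source := hxz.1
      have hx2 : G.φ i x = z := hxz.2
      have hzt : z ∈ (G.φ i).target := hx2 ▸ (G.φ i).map_source hx1
      refine ⟨(G.φ i).symm, ?_, (hφ i).symm.contMDiffAt hzt, ?_⟩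
      · rw [← hx2, (G.φ i).left_inv hx1]
      filter_upwards [(G.φ i).open_target.mem_nhds hzt] with a ha
      rw [inQ_source]
      have ha' := G.source_sub i ((G.φ i).map_target ha)
      refine ⟨ha', ?_⟩
      rw [G.inQ_apply _ ⟨_, ha'⟩, G.inP_apply _ _ ⟨a, G.target_sub i ha⟩, G.jQ_eq_jP]
      exact ⟨(G.φ i).map_target ha, (G.φ i).right_inv ha⟩
    · obtain ⟨z, -, hz⟩ := hye
      obtain ⟨z', -, hz'⟩ := hye'
      by_cases hij : i = j
      · subst hij
        obtain ⟨e₀, he₀, h⟩ := G.chartFrom_jP i hf ⟨z⟩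
        obtain ⟨e₁, he₁, h'⟩ := G.chartFrom_jP i hf' ⟨z⟩
        refine h.contDiffOn G he₀ he₁ h' fun x hx z hz hxz ↦ ⟨id, ?_, contMDiffAt_id, ?_⟩
        · exact (G.inP i _).injOn hx hz hxz
        · filter_upwards [(G.inP i _).open_source.mem_nhds hx] with a ha using ⟨ha, rfl⟩
      · exact absurd ⟨z', hz'⟩
          (Set.disjoint_left.1 (G.disjoint_range_jP hij (hd i j hij)) ⟨z, hz⟩)
  simpa using main

/-- A piece of the glued space is diffeomorphic to its image. -/
theorem isDiffeo_of_chartFrom [IsManifold (𝓡 d) ∞ G.Glued] {A : Type*} [TopologicalSpace A]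
    [ChartedSpace (Eu d) A] [IsManifold (𝓡 d) ∞ A] {ψ : OpenPartialHomeomorph A G.Glued}
    (h : ∀ x ∈ ψ.source, ∃ e₀ ∈ atlas (Eu d) A, ∃ e ∈ atlas (Eu d) G.Glued,
      G.ChartFrom ψ e₀ e ∧ x ∈ e₀.source) : IsDiffeo (𝓡 d) (𝓡 d) ψ := by
  constructor
  · intro x hx
    obtain ⟨e₀, he₀, e, he, hc, hxe⟩ := h x hx
    have hs0 : ContMDiffAt (𝓡 d) (𝓡 d) ∞ e₀ x :=
      (contMDiffOn_of_mem_maximalAtlas (IsManifold.subset_maximalAtlas he₀)).contMDiffAt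
        (e₀.open_source.mem_nhds hxe)
    have hm : ∀ a ∈ ψ.source ∩ e₀.source, ψ a ∈ e.source := fun a ha ↦ by
      rw [hc.source]; exact ⟨a, ha, rfl⟩
    have hs1 : ContMDiffAt (𝓡 d) (𝓡 d) ∞ e.symm (e₀ x) := by
      refine (contMDiffOn_symm_of_mem_maximalAtlas (IsManifold.subset_maximalAtlas he)).contMDiffAt
        (e.open_target.mem_nhds ?_)
      rw [← hc.eq x ⟨hx, hxe⟩]
      exact e.map_source (hm x ⟨hx, hxe⟩)
    refine ((hs1.comp x hs0).congr_of_eventuallyEq ?_).contMDiffWithinAt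
    filter_upwards [ψ.open_source.mem_nhds hx, e₀.open_source.mem_nhds hxe] with a h1 h2
    change ψ a = e.symm (e₀ a)
    rw [← hc.eq a ⟨h1, h2⟩, e.left_inv (hm a ⟨h1, h2⟩)]
  · intro q hq
    obtain ⟨e₀, he₀, e, he, hc, hxe⟩ := h (ψ.symm q) (ψ.map_target hq)
    have hqe : q ∈ e.source := by
      rw [hc.source]; exact ⟨_, ⟨ψ.map_target hq, hxe⟩, ψ.right_inv hq⟩
    have hs1 : ContMDiffAt (𝓡 d) (𝓡 d) ∞ e q :=
      (contMDiffOn_of_mem_maximalAtlas (IsManifold.subset_maximalAtlas he)).contMDiffAt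
        (e.open_source.mem_nhds hqe)
    have heq : ∀ a ∈ e.source, e a ∈ e₀.target ∧ e₀.symm (e a) = ψ.symm a := by
      intro a ha
      rw [hc.source] at ha
      obtain ⟨b, hb, rfl⟩ := ha
      rw [hc.eq b hb, e₀.left_inv hb.2, ψ.left_inv hb.1]
      exact ⟨e₀.map_source hb.2, rfl⟩
    have hs0 : ContMDiffAt (𝓡 d) (𝓡 d) ∞ e₀.symm (e q) :=
      (contMDiffOn_symm_of_mem_maximalAtlas (IsManifold.subset_maximalAtlas he₀)).contMDiffAt
        (e₀.open_target.mem_nhds (heq q hqe).1)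
    refine ((hs0.comp q hs1).congr_of_eventuallyEq ?_).contMDiffWithinAt
    filter_upwards [e.open_source.mem_nhds hqe] with a ha
    exact (heq a ha).2.symm

theorem isDiffeo_inQ [IsManifold (𝓡 d) ∞ G.Glued] (h : Nonempty G.Q) :
    IsDiffeo (𝓡 d) (𝓡 d) (G.inQ h) := by
  refine G.isDiffeo_of_chartFrom fun x hx ↦ ?_
  rw [inQ_source] at hx
  have hx' : G.jQ ⟨x, hx⟩ = G.inQ h x := (G.inQ_apply h ⟨x, hx⟩).symm
  obtain ⟨e₀, he₀, hc⟩ := G.chartFrom_jQ (chart_mem_atlas (Eu d) (⟨x, hx⟩ : G.Q)) h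
  refine ⟨e₀, he₀, _, .inl ⟨_, chart_mem_atlas (Eu d) (⟨x, hx⟩ : G.Q), rfl⟩, hc, ?_⟩
  have h1 : G.inQ h x ∈ ((chartAt (Eu d) (⟨x, hx⟩ : G.Q)).lift_openEmbedding
      G.isOpenEmbedding_jQ).source := ⟨⟨x, hx⟩, mem_chart_source _ _, hx'⟩
  rw [hc.source] at h1
  obtain ⟨b, hb, e⟩ := h1
  rw [← (G.inQ h).injOn hb.1 (by rwa [inQ_source]) e]
  exact hb.2

theorem isDiffeo_inP [IsManifold (𝓡 d) ∞ G.Glued] (i : Fin n) (h : Nonempty (G.P i)) :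
    IsDiffeo (𝓡 d) (𝓡 d) (G.inP i h) := by
  refine G.isDiffeo_of_chartFrom fun x hx ↦ ?_
  rw [inP_source] at hx
  have hx' : G.jP i ⟨x, hx⟩ = G.inP i h x := (G.inP_apply i h ⟨x, hx⟩).symm
  obtain ⟨e₀, he₀, hc⟩ := G.chartFrom_jP i (chart_mem_atlas (Eu d) (⟨x, hx⟩ : G.P i)) h
  refine ⟨e₀, he₀, _, .inr ⟨i, _, chart_mem_atlas (Eu d) (⟨x, hx⟩ : G.P i), rfl⟩, hc, ?_⟩
  have h1 : G.inP i h x ∈ ((chartAt (Eu d) (⟨x, hx⟩ : G.P i)).lift_openEmbedding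
      (G.isOpenEmbedding_jP i)).source := ⟨⟨x, hx⟩, mem_chart_source _ _, hx'⟩
  rw [hc.source] at h1
  obtain ⟨b, hb, e⟩ := h1
  rw [← (G.inP i h).injOn hb.1 (by rwa [inP_source]) e]
  exact hb.2

end GlueData

/-! ### Hausdorff criterion, and forms on the glued space. -/

namespace GlueData

variable {d n : ℕ} {X : Type*} [TopologicalSpace X] {Z : Fin n → Type*}
  [∀ i, TopologicalSpace (Z i)] (G : GlueData X Z)

theorem inQ_eq_inP (hQ : Nonempty G.Q) (i : Fin n) (hP : Nonempty (G.P i)) {x : X} {z : Z i}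
    (hx : x ∈ G.Q) (hz : z ∈ G.P i) :
    G.inQ hQ x = G.inP i hP z ↔ x ∈ (G.φ i).source ∧ G.φ i x = z := by
  rw [G.inQ_apply hQ ⟨x, hx⟩, G.inP_apply i hP ⟨z, hz⟩, jQ_eq_jP]

/-- Points in a common piece are separated there, and different `P i` are disjoint open sets. The
remaining case is a point of `Q` and a point of `P i` that both lie outside the overlap but possibly
on its boundary; gluing can destroy the Hausdorff property exactly here, and `hs` provides the
separating sets. -/
theorem t2Space [T2Space X] [∀ i, T2Space (Z i)]
    (hd : ∀ i j, i ≠ j → Disjoint (G.φ i).source (G.φ j).source)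
    (hs : ∀ i, ∃ U : Set X, ∃ W : Set (Z i), IsOpen U ∧ IsOpen W ∧
      (∀ x ∈ G.Q, x ∉ (G.φ i).source → x ∈ U) ∧ (∀ z ∈ G.P i, z ∉ (G.φ i).target → z ∈ W) ∧
      ∀ x ∈ (G.φ i).source, x ∈ U → G.φ i x ∉ W) : T2Space G.Glued := by
  have sepQ : ∀ x y : G.Q, x ≠ y → ∃ u v : Set G.Glued, IsOpen u ∧ IsOpen v ∧ G.jQ x ∈ u ∧
      G.jQ y ∈ v ∧ Disjoint u v := by
    intro x y hxy
    obtain ⟨u, v, hu, hv, hxu, hyv, huv⟩ := t2_separation hxy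
    exact ⟨G.jQ '' u, G.jQ '' v, G.isOpenEmbedding_jQ.isOpenMap _ hu,
      G.isOpenEmbedding_jQ.isOpenMap _ hv, mem_image_of_mem _ hxu, mem_image_of_mem _ hyv,
      (Set.disjoint_image_iff G.jQ_injective).2 huv⟩
  have sepP : ∀ i, ∀ x y : G.P i, x ≠ y → ∃ u v : Set G.Glued, IsOpen u ∧ IsOpen v ∧
      G.jP i x ∈ u ∧ G.jP i y ∈ v ∧ Disjoint u v := by
    intro i x y hxy
    obtain ⟨u, v, hu, hv, hxu, hyv, huv⟩ := t2_separation hxy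
    exact ⟨G.jP i '' u, G.jP i '' v, (G.isOpenEmbedding_jP i).isOpenMap _ hu,
      (G.isOpenEmbedding_jP i).isOpenMap _ hv, mem_image_of_mem _ hxu, mem_image_of_mem _ hyv,
      (Set.disjoint_image_iff (G.jP_injective i)).2 huv⟩
  have toQ : ∀ i, ∀ z : G.P i, (z : Z i) ∈ (G.φ i).target → ∃ x : G.Q, G.jQ x = G.jP i z :=
    fun i z hz ↦ ⟨⟨(G.φ i).symm z, G.source_sub i ((G.φ i).map_target hz)⟩,
      G.jQ_eq_jP.2 ⟨(G.φ i).map_target hz, (G.φ i).right_inv hz⟩⟩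
  have sepQP : ∀ x : G.Q, ∀ i, ∀ z : G.P i, G.jQ x ≠ G.jP i z → ∃ u v : Set G.Glued, IsOpen u ∧
      IsOpen v ∧ G.jQ x ∈ u ∧ G.jP i z ∈ v ∧ Disjoint u v := by
    intro x i z hxz
    by_cases hz : (z : Z i) ∈ (G.φ i).target
    · obtain ⟨y, hy⟩ := toQ i z hz
      rw [← hy] at hxz ⊢
      exact sepQ x y fun h ↦ hxz (h ▸ rfl)
    by_cases hx : (x : X) ∈ (G.φ i).source
    · have hw := G.target_sub i ((G.φ i).map_source hx)
      have e : G.jQ x = G.jP i ⟨_, hw⟩ := G.jQ_eq_jP.2 ⟨hx, rfl⟩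
      rw [e] at hxz ⊢
      exact sepP i _ z fun h ↦ hxz (h ▸ rfl)
    · obtain ⟨U, W, hU, hW, h1, h2, h3⟩ := hs i
      refine ⟨G.jQ '' (Subtype.val ⁻¹' U), G.jP i '' (Subtype.val ⁻¹' W),
        G.isOpenEmbedding_jQ.isOpenMap _ (hU.preimage continuous_subtype_val),
        (G.isOpenEmbedding_jP i).isOpenMap _ (hW.preimage continuous_subtype_val),
        mem_image_of_mem _ (h1 x x.2 hx), mem_image_of_mem _ (h2 z z.2 hz), ?_⟩
      rw [Set.disjoint_left]
      rintro _ ⟨x', hx', rfl⟩ ⟨z', hz', e⟩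
      obtain ⟨h4, h5⟩ := G.jQ_eq_jP.1 e.symm
      apply h3 _ h4 hx'
      rw [h5]
      exact hz'
  refine ⟨fun a b hab ↦ ?_⟩
  rcases G.exists_rep a with ⟨x, rfl⟩ | ⟨⟨i, z⟩, rfl⟩ <;>
    rcases G.exists_rep b with ⟨y, rfl⟩ | ⟨⟨j, w⟩, rfl⟩
  · exact sepQ x y fun h ↦ hab (h ▸ rfl)
  · exact sepQP x j w hab
  · obtain ⟨u, v, hu, hv, h1, h2, h3⟩ := sepQP y i z hab.symm
    exact ⟨v, u, hv, hu, h2, h1, h3.symm⟩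
  · by_cases hij : i = j
    · subst hij
      exact sepP i z w fun h ↦ hab (h ▸ rfl)
    · exact ⟨range (G.jP i), range (G.jP j), (G.isOpenEmbedding_jP i).isOpen_range,
        (G.isOpenEmbedding_jP j).isOpen_range, mem_range_self _, mem_range_self _,
        G.disjoint_range_jP hij (hd i j hij)⟩

variable [ChartedSpace (Eu d) X] [∀ i, ChartedSpace (Eu d) (Z i)]
  {F : Type*} [NormedAddCommGroup F] [NormedSpace ℝ F] {k : ℕ}
  (η : DForm (𝓡 d) X F k) (ζ : ∀ i, DForm (𝓡 d) (Z i) F k)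

/-- The preimage chosen in the definition of `form` must be `x`, as `jQ` is injective. The equality
is transported through `key` because the types of the forms depend on the point. -/
theorem form_jQ (x : G.Q) : G.form η ζ (G.jQ x) = pushAt (I := 𝓡 d) (I' := 𝓡 d) G.jQ x
    (η.pullback (I := 𝓡 d) (Subtype.val : G.Q → X) x) := by
  have h : ∃ y, G.jQ y = G.jQ x := ⟨x, rfl⟩
  have hc : h.choose = x := G.jQ_injective h.choose_spec
  have key : ∀ y : G.Q, y = x → (pushAt (I := 𝓡 d) (I' := 𝓡 d) G.jQ y
      (η.pullback (I := 𝓡 d) (Subtype.val : G.Q → X) y) : Eu d [⋀^Fin k]→L[ℝ] F) =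
      (pushAt (I := 𝓡 d) (I' := 𝓡 d) G.jQ x
      (η.pullback (I := 𝓡 d) (Subtype.val : G.Q → X) x) : Eu d [⋀^Fin k]→L[ℝ] F) := by
    rintro y rfl; rfl
  exact (dif_pos h).trans (key _ hc)

/-- Points with a partner in `Q` are excluded, since there `form` takes its value from `Q`. -/
theorem form_jP {i : Fin n} {z : G.P i} (hz : (z : Z i) ∉ (G.φ i).target) :
    G.form η ζ (G.jP i z) = pushAt (I := 𝓡 d) (I' := 𝓡 d) (G.jP i) z
      ((ζ i).pullback (I := 𝓡 d) (Subtype.val : G.P i → Z i) z) := by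
  have h : ¬ ∃ y, G.jQ y = G.jP i z := by
    rintro ⟨y, hy⟩
    obtain ⟨h1, h2⟩ := G.jQ_eq_jP.1 hy
    exact hz (h2 ▸ (G.φ i).map_source h1)
  have hc : ((G.exists_rep (G.jP i z)).resolve_left h).choose = ⟨i, z⟩ := by
    have hs := ((G.exists_rep (G.jP i z)).resolve_left h).choose_spec
    set c := ((G.exists_rep (G.jP i z)).resolve_left h).choose
    obtain ⟨j, w⟩ := c
    by_cases hij : j = i
    · subst hij
      exact congrArg _ (G.jP_injective j hs)
    · obtain ⟨x, hx⟩ := G.jP_eq_jP_of_ne hij hs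
      exact absurd ⟨x, hx.trans hs⟩ h
  have key : ∀ c : (Σ i, G.P i), c = ⟨i, z⟩ → (pushAt (I := 𝓡 d) (I' := 𝓡 d) (G.jP c.1) c.2
      ((ζ c.1).pullback (I := 𝓡 d) (Subtype.val : G.P c.1 → Z c.1) c.2) :
        Eu d [⋀^Fin k]→L[ℝ] F) = (pushAt (I := 𝓡 d) (I' := 𝓡 d) (G.jP i) z
      ((ζ i).pullback (I := 𝓡 d) (Subtype.val : G.P i → Z i) z) : Eu d [⋀^Fin k]→L[ℝ] F) := by
    rintro c rfl; rfl
  exact (dif_neg h).trans (key _ hc)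

variable [IsManifold (𝓡 d) ∞ X] [∀ i, IsManifold (𝓡 d) ∞ (Z i)] [IsManifold (𝓡 d) ∞ G.Glued]

/-- A form that is pushed forward from an open subset under an open embedding pulls back to the
original form. -/
theorem pullback_of_subtype {A : Type*} [TopologicalSpace A] [ChartedSpace (Eu d) A]
    [IsManifold (𝓡 d) ∞ A] {U : TopologicalSpace.Opens A} {j : U → G.Glued}
    (hj : Topology.IsOpenEmbedding j) (hU : Nonempty U)
    (hat : ∀ e₀ ∈ atlas (Eu d) U, e₀.lift_openEmbedding hj ∈ atlas (Eu d) G.Glued)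
    {ψ : OpenPartialHomeomorph A G.Glued} (hψs : ψ.source = U) (hψ : IsDiffeo (𝓡 d) (𝓡 d) ψ)
    (hψj : ∀ x : U, ψ x = j x)
    {ω : DForm (𝓡 d) G.Glued F k} {η : DForm (𝓡 d) A F k} (x : U)
    (h : ω (j x) = pushAt (I := 𝓡 d) (I' := 𝓡 d) j x
      (η.pullback (I := 𝓡 d) (Subtype.val : U → A) x)) :
    ω.pullback (I := 𝓡 d) ψ x = η x := by
  have hJ : IsDiffeo (𝓡 d) (𝓡 d) (hj.toOpenPartialHomeomorph j) := by
    refine G.isDiffeo_of_chartFrom fun y _ ↦ ⟨chartAt (Eu d) y, chart_mem_atlas _ _, _,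
      hat _ (chart_mem_atlas _ y), ⟨?_, ?_⟩, mem_chart_source _ _⟩
    · rw [OpenPartialHomeomorph.lift_openEmbedding_source]
      simp
    · intro a _
      exact OpenPartialHomeomorph.lift_openEmbedding_apply _ _
  have h1 := hJ.pullback_of_eq_pushAt (x := x) (by simp) h
  have h2 : ω.pullback (I := 𝓡 d) ((ψ : A → G.Glued) ∘ (Subtype.val : U → A)) x =
      η.pullback (I := 𝓡 d) (Subtype.val : U → A) x := by
    rw [← h1]
    refine DForm.pullback_congr (Filter.Eventually.of_forall fun y ↦ ?_) ω
    exact hψj y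
  have hx : (x : A) ∈ ψ.source := by rw [hψs]; exact x.2
  have hv : MDifferentiableAt (𝓡 d) (𝓡 d) (Subtype.val : U → A) x :=
    (contMDiff_subtype_val (n := ∞) x).mdifferentiableAt (by simp)
  rw [DForm.pullback_comp ω (hψ.mdifferentiableAt hx) hv] at h2
  -- the derivative of the inclusion is onto
  let s : A → U := (hj.toOpenPartialHomeomorph j).symm ∘ ψ
  have hs : MDifferentiableAt (𝓡 d) (𝓡 d) s x := by
    refine MDifferentiableAt.comp (I' := 𝓡 d) _ (hJ.symm.mdifferentiableAt ?_)
      (hψ.mdifferentiableAt hx)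
    rw [hψj]
    simp
  have hsx : s x = x := by
    change (hj.toOpenPartialHomeomorph j).symm (ψ x) = x
    rw [hψj]
    exact (hj.toOpenPartialHomeomorph j).left_inv (by simp)
  have hvs : (Subtype.val : U → A) ∘ s =ᶠ[𝓝 (x : A)] id := by
    filter_upwards [ψ.open_source.mem_nhds hx] with a ha
    have ha' : a ∈ U := by rw [hψs] at ha; exact ha
    change ((hj.toOpenPartialHomeomorph j).symm (ψ a) : A) = a
    rw [hψj ⟨a, ha'⟩]
    exact congrArg Subtype.val ((hj.toOpenPartialHomeomorph j).left_inv (by simp))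
  have hv' : MDifferentiableAt (𝓡 d) (𝓡 d) (Subtype.val : U → A) (s x) := by rw [hsx]; exact hv
  have h3 : ∀ θ : DForm (𝓡 d) A F k,
      (θ.pullback (I := 𝓡 d) (Subtype.val : U → A)).pullback (I := 𝓡 d) s x = θ x := by
    intro θ
    rw [← DForm.pullback_comp θ hv' hs, DForm.pullback_congr hvs]
    ext w
    change θ x (fun j ↦ (mfderiv (𝓡 d) (𝓡 d) (id : A → A) x : Eu d →L[ℝ] Eu d) (w j)) = θ x w
    have : (mfderiv (𝓡 d) (𝓡 d) (id : A → A) (x : A) : Eu d →L[ℝ] Eu d) =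
      ContinuousLinearMap.id ℝ _ := mfderiv_id
    rw [this]
    rfl
  rw [← h3 η, ← h3 (ω.pullback (I := 𝓡 d) ψ)]
  have h4 : ∀ y : U, y = x → (ω.pullback (I := 𝓡 d) ψ).pullback (I := 𝓡 d)
      (Subtype.val : U → A) y = η.pullback (I := 𝓡 d) (Subtype.val : U → A) y := by
    rintro y rfl; exact h2
  have h5 := h4 _ hsx
  ext w
  exact DFunLike.congr_fun h5 _

theorem form_pullback_inQ (h : Nonempty G.Q) {x : X} (hx : x ∈ G.Q) :
    (G.form η ζ).pullback (I := 𝓡 d) (G.inQ h) x = η x :=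
  G.pullback_of_subtype G.isOpenEmbedding_jQ h (fun e₀ he₀ ↦ .inl ⟨e₀, he₀, rfl⟩)
    (G.inQ_source h) (G.isDiffeo_inQ h) (G.inQ_apply h) ⟨x, hx⟩ (G.form_jQ η ζ ⟨x, hx⟩)

theorem form_pullback_inP (i : Fin n) (h : Nonempty (G.P i)) {z : Z i} (hz : z ∈ G.P i)
    (hz' : z ∉ (G.φ i).target) :
    (G.form η ζ).pullback (I := 𝓡 d) (G.inP i h) z = ζ i z :=
  G.pullback_of_subtype (G.isOpenEmbedding_jP i) h (fun e₀ he₀ ↦ .inr ⟨i, e₀, he₀, rfl⟩)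
    (G.inP_source i h) (G.isDiffeo_inP i h) (G.inP_apply i h) ⟨z, hz⟩ (G.form_jP η ζ hz')

end GlueData

/-! ### Linear algebra of `SU(3)`-structures -/

/-- The standard holomorphic volume form as an alternating map. -/
def volForm : (Fin 3 → ℂ) [⋀^Fin 3]→L[ℝ] ℂ :=
  ContinuousAlternatingMap.restrictScalars ℝ
    { (Matrix.detRowAlternating : (Fin 3 → ℂ) [⋀^Fin 3]→ₗ[ℂ] ℂ) with
      cont := by
        change Continuous fun w : Fin 3 → Fin 3 → ℂ ↦ (Matrix.of w).det
        exact Continuous.matrix_det (continuous_id) }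

theorem stdVol_eq (w : Fin 3 → Fin 3 → ℂ) : stdVol w =
    w 0 0 * w 1 1 * w 2 2 - w 0 0 * w 1 2 * w 2 1 - w 0 1 * w 1 0 * w 2 2 +
      w 0 1 * w 1 2 * w 2 0 + w 0 2 * w 1 0 * w 2 1 - w 0 2 * w 1 1 * w 2 0 := by
  rw [stdVol, Matrix.det_fin_three]; rfl

theorem stdOmega_add_left (u u' v : Fin 3 → ℂ) :
    stdOmega (u + u') v = stdOmega u v + stdOmega u' v := by
  simp [stdOmega, add_mul, Finset.sum_add_distrib]

theorem stdOmega_smul_left (c : ℝ) (u v : Fin 3 → ℂ) :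
    stdOmega (c • u) v = c * stdOmega u v := by
  simp only [stdOmega, Finset.mul_sum]
  refine Finset.sum_congr rfl fun j _ ↦ ?_
  simp; ring

theorem stdOmega_swap (u v : Fin 3 → ℂ) : stdOmega v u = -stdOmega u v := by
  simp only [stdOmega, ← Finset.sum_neg_distrib]
  refine Finset.sum_congr rfl fun j _ ↦ ?_
  simp; ring

theorem stdOmega_add_right (u v v' : Fin 3 → ℂ) :
    stdOmega u (v + v') = stdOmega u v + stdOmega u v' := by
  rw [stdOmega_swap, stdOmega_add_left, stdOmega_swap u v, stdOmega_swap u v']; ring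

theorem stdOmega_smul_right (c : ℝ) (u v : Fin 3 → ℂ) :
    stdOmega u (c • v) = c * stdOmega u v := by
  rw [stdOmega_swap, stdOmega_smul_left, stdOmega_swap u v]; ring

theorem stdOmega_I (u v : Fin 3 → ℂ) :
    stdOmega (Complex.I • u) (Complex.I • v) = stdOmega u v := by
  simp only [stdOmega]
  refine Finset.sum_congr rfl fun j _ ↦ ?_
  simp

theorem continuous_stdOmega : Continuous fun q : (Fin 3 → ℂ) × (Fin 3 → ℂ) ↦ stdOmega q.1 q.2 := by
  unfold stdOmega
  fun_prop

/-- The standard Kähler form as an alternating map. -/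
def kahlerForm : (Fin 3 → ℂ) [⋀^Fin 2]→L[ℝ] ℝ where
  toFun w := stdOmega (w 0) (w 1)
  map_update_add' w i x y := by
    fin_cases i <;> simp [stdOmega_add_left, stdOmega_add_right]
  map_update_smul' w i c x := by
    fin_cases i <;> simp [stdOmega_smul_left, stdOmega_smul_right]
  cont := by
    have h : Continuous fun w : Fin 2 → Fin 3 → ℂ ↦ (w 0, w 1) :=
      (continuous_apply 0).prodMk (continuous_apply 1)
    exact continuous_stdOmega.comp h
  map_eq_zero_of_eq' w i j h hij := by
    have h0 : w 0 = w 1 := by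
      fin_cases i <;> fin_cases j <;> first | exact absurd rfl hij | exact h | exact h.symm
    have := stdOmega_swap (w 0) (w 1)
    rw [← h0] at this ⊢
    linarith

theorem kahlerForm_apply (w : Fin 2 → Fin 3 → ℂ) : kahlerForm w = stdOmega (w 0) (w 1) := rfl

/-- The real part of the volume form. -/
def reVolForm : (Fin 3 → ℂ) [⋀^Fin 3]→L[ℝ] ℝ :=
  Complex.reCLM.compContinuousAlternatingMap volForm

theorem reVolForm_apply (w : Fin 3 → Fin 3 → ℂ) : reVolForm w = (stdVol w).re := rfl

/-- Multiplication by `i`. -/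
def mulI : (Fin 3 → ℂ) →L[ℝ] (Fin 3 → ℂ) :=
  ContinuousLinearMap.restrictScalars ℝ (Complex.I • ContinuousLinearMap.id ℂ (Fin 3 → ℂ))

theorem mulI_apply (v : Fin 3 → ℂ) : mulI v = Complex.I • v := rfl

theorem mulI_mulI (v : Fin 3 → ℂ) : mulI (mulI v) = -v := by
  rw [mulI_apply, mulI_apply, smul_smul, Complex.I_mul_I, neg_one_smul]

/-- A complex-linear form in coordinates. -/
theorem complex_linear_expand {f : (Fin 3 → ℂ) → ℂ} (hadd : ∀ x y, f (x + y) = f x + f y)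
    (hr : ∀ (r : ℝ) x, f (r • x) = r * f x) (hI : ∀ x, f (mulI x) = Complex.I * f x)
    (v : Fin 3 → ℂ) :
    f v = v 0 * f (Pi.single 0 1) + v 1 * f (Pi.single 1 1) + v 2 * f (Pi.single 2 1) := by
  have hc : ∀ (z : ℂ) x, f (z • x) = z * f x := by
    intro z x
    have : z • x = z.re • x + z.im • mulI x := by
      ext j
      simp only [Pi.add_apply, Pi.smul_apply, mulI_apply, smul_eq_mul, Complex.real_smul]
      linear_combination (-(x j)) * Complex.re_add_im z
    rw [this, hadd, hr, hr, hI]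
    linear_combination (f x) * Complex.re_add_im z
  have h : v = v 0 • Pi.single 0 1 + v 1 • Pi.single 1 1 + v 2 • (Pi.single 2 1 : Fin 3 → ℂ) := by
    ext j; fin_cases j <;> simp
  conv_lhs => rw [h]
  rw [hadd, hadd, hc, hc, hc]

/-! ### Real 3-forms on ℂ³ by type. -/

section ThreeForms

variable (θ : (Fin 3 → ℂ) [⋀^Fin 3]→L[ℝ] ℝ)

theorem threeForm_add (a a' b c : Fin 3 → ℂ) :
    θ ![a + a', b, c] = θ ![a, b, c] + θ ![a', b, c] :=
  θ.toMultilinearMap.cons_add ![b, c] a a'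

theorem threeForm_smul (r : ℝ) (a b c : Fin 3 → ℂ) :
    θ ![r • a, b, c] = r * θ ![a, b, c] :=
  θ.toMultilinearMap.cons_smul ![b, c] r a

theorem threeForm_swap12 (a b c : Fin 3 → ℂ) : θ ![b, a, c] = -θ ![a, b, c] := by
  have := θ.toAlternatingMap.map_swap ![a, b, c] (show (0 : Fin 3) ≠ 1 by decide)
  have h : ![a, b, c] ∘ Equiv.swap (0 : Fin 3) 1 = ![b, a, c] := by
    ext i; fin_cases i <;> simp [Equiv.swap_apply_of_ne_of_ne]
  rw [h] at this
  exact this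

theorem threeForm_swap23 (a b c : Fin 3 → ℂ) : θ ![a, c, b] = -θ ![a, b, c] := by
  have := θ.toAlternatingMap.map_swap ![a, b, c] (show (1 : Fin 3) ≠ 2 by decide)
  have h : ![a, b, c] ∘ Equiv.swap (1 : Fin 3) 2 = ![a, c, b] := by
    ext i; fin_cases i <;> simp [Equiv.swap_apply_of_ne_of_ne]
  rw [h] at this
  exact this

theorem threeForm_rot (a b c : Fin 3 → ℂ) : θ ![b, c, a] = θ ![a, b, c] := by
  rw [threeForm_swap23, threeForm_swap12, neg_neg]

theorem threeForm_neg (a b c : Fin 3 → ℂ) : θ ![-a, b, c] = -θ ![a, b, c] := by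
  have := threeForm_smul θ (-1) a b c
  rw [neg_one_smul] at this
  linarith

/-- Twice the `(3,0)`-part of a real 3-form. -/
def part30 (u v w : Fin 3 → ℂ) : ℂ :=
  (1 / 4 : ℂ) * (θ ![u, v, w] - θ ![mulI u, mulI v, w] - θ ![mulI u, v, mulI w]
      - θ ![u, mulI v, mulI w]
    + Complex.I * (θ ![mulI u, mulI v, mulI w] - θ ![mulI u, v, w] - θ ![u, mulI v, w]
      - θ ![u, v, mulI w]))

/-- Twice the component of a real 3-form that is complex linear in the first two arguments and
conjugate linear in the last one. -/
def part21 (u v w : Fin 3 → ℂ) : ℂ :=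
  (1 / 4 : ℂ) * (θ ![u, v, w] - θ ![mulI u, mulI v, w] + θ ![mulI u, v, mulI w]
      + θ ![u, mulI v, mulI w]
    + Complex.I * (-θ ![mulI u, mulI v, mulI w] - θ ![mulI u, v, w] - θ ![u, mulI v, w]
      + θ ![u, v, mulI w]))

/-- The parts of type (0,3) and (1,2) of a real form are the conjugates of those of type (3,0) and
(2,1), so the form is the real part of twice the latter two. The (2,1)-part is the cyclic sum over
the slot that is conjugate linear. -/
theorem threeForm_eq_parts (u v w : Fin 3 → ℂ) : θ ![u, v, w] =
    (part30 θ u v w + part21 θ u v w + part21 θ v w u + part21 θ w u v).re := by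
  have h1 := threeForm_rot θ
  simp only [part30, part21, Complex.add_re, Complex.mul_re, Complex.sub_re, Complex.ofReal_re,
    Complex.I_re, Complex.I_im, Complex.ofReal_im, Complex.sub_im, Complex.add_im, Complex.mul_im,
    Complex.neg_re, Complex.neg_im]
  -- Cyclic invariance is used to bring every value into the order `u`, `v`, `w`; the identity then
  -- holds formally.
  rw [h1 u v w, h1 u (mulI v) w, h1 u v (mulI w), h1 u (mulI v) (mulI w), h1 (mulI u) v w,
    h1 (mulI u) (mulI v) w, h1 (mulI u) v (mulI w), h1 (mulI u) (mulI v) (mulI w),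
    ← h1 w u v, ← h1 w (mulI u) v, ← h1 w u (mulI v), ← h1 w (mulI u) (mulI v), ← h1 (mulI w) u v,
    ← h1 (mulI w) (mulI u) v, ← h1 (mulI w) u (mulI v), ← h1 (mulI w) (mulI u) (mulI v)]
  norm_num
  ring

theorem part30_swap12 (u v w : Fin 3 → ℂ) : part30 θ v u w = -part30 θ u v w := by
  simp only [part30, threeForm_swap12 θ u v, threeForm_swap12 θ (mulI u) v,
    threeForm_swap12 θ u (mulI v), threeForm_swap12 θ (mulI u) (mulI v)]
  push_cast; ring

theorem part30_swap23 (u v w : Fin 3 → ℂ) : part30 θ u w v = -part30 θ u v w := by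
  simp only [part30, threeForm_swap23 θ _ v w, threeForm_swap23 θ _ (mulI v) w,
    threeForm_swap23 θ _ v (mulI w), threeForm_swap23 θ _ (mulI v) (mulI w)]
  push_cast; ring

theorem part21_swap12 (u v w : Fin 3 → ℂ) : part21 θ v u w = -part21 θ u v w := by
  simp only [part21, threeForm_swap12 θ u v, threeForm_swap12 θ (mulI u) v,
    threeForm_swap12 θ u (mulI v), threeForm_swap12 θ (mulI u) (mulI v)]
  push_cast; ring

theorem part30_expand (u v w : Fin 3 → ℂ) : part30 θ u v w =
    u 0 * part30 θ (Pi.single 0 1) v w + u 1 * part30 θ (Pi.single 1 1) v w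
      + u 2 * part30 θ (Pi.single 2 1) v w := by
  refine complex_linear_expand (f := fun u ↦ part30 θ u v w) (fun x y ↦ ?_) (fun r x ↦ ?_)
    (fun x ↦ ?_) u
  · simp only [part30, map_add, threeForm_add]; push_cast; ring
  · simp only [part30, map_smul, threeForm_smul]; push_cast; ring
  · simp only [part30, mulI_mulI, threeForm_neg]; push_cast
    linear_combination (1 / 4 : ℂ) * (θ ![mulI x, v, w] + θ ![x, mulI v, w] + θ ![x, v, mulI w]
      - θ ![mulI x, mulI v, mulI w]) * Complex.I_mul_I

theorem part21_expand (u v w : Fin 3 → ℂ) : part21 θ u v w =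
    u 0 * part21 θ (Pi.single 0 1) v w + u 1 * part21 θ (Pi.single 1 1) v w
      + u 2 * part21 θ (Pi.single 2 1) v w := by
  refine complex_linear_expand (f := fun u ↦ part21 θ u v w) (fun x y ↦ ?_) (fun r x ↦ ?_)
    (fun x ↦ ?_) u
  · simp only [part21, map_add, threeForm_add]; push_cast; ring
  · simp only [part21, map_smul, threeForm_smul]; push_cast; ring
  · simp only [part21, mulI_mulI, threeForm_neg]; push_cast
    linear_combination (1 / 4 : ℂ) * (θ ![mulI x, v, w] + θ ![x, mulI v, w] - θ ![x, v, mulI w]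
      + θ ![mulI x, mulI v, mulI w]) * Complex.I_mul_I

theorem threeForm_add3 (a b c c' : Fin 3 → ℂ) :
    θ ![a, b, c + c'] = θ ![a, b, c] + θ ![a, b, c'] := by
  rw [threeForm_rot θ (c + c') a b, threeForm_add, threeForm_rot θ c a b, threeForm_rot θ c' a b]

theorem threeForm_smul3 (r : ℝ) (a b c : Fin 3 → ℂ) :
    θ ![a, b, r • c] = r * θ ![a, b, c] := by
  rw [threeForm_rot θ (r • c) a b, threeForm_smul, threeForm_rot θ c a b]

theorem part21_add (u v x y : Fin 3 → ℂ) :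
    part21 θ u v (x + y) = part21 θ u v x + part21 θ u v y := by
  simp only [part21, map_add, threeForm_add3]
  push_cast; ring

theorem part21_smul (u v x : Fin 3 → ℂ) (r : ℝ) :
    part21 θ u v (r • x) = r * part21 θ u v x := by
  simp only [part21, map_smul, threeForm_smul3]
  push_cast; ring

theorem part21_self (u w : Fin 3 → ℂ) : part21 θ u u w = 0 := by
  have := part21_swap12 θ u u w
  linear_combination (1 / 2 : ℂ) * this

/-- Complex bilinear and alternating in the first two arguments, hence a linear function of their
cross product, with coefficients that depend on `w`. -/
theorem part21_eq (u v w : Fin 3 → ℂ) : part21 θ u v w =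
    (u 1 * v 2 - u 2 * v 1) * part21 θ (Pi.single 1 1) (Pi.single 2 1) w
    + (u 2 * v 0 - u 0 * v 2) * part21 θ (Pi.single 2 1) (Pi.single 0 1) w
    + (u 0 * v 1 - u 1 * v 0) * part21 θ (Pi.single 0 1) (Pi.single 1 1) w := by
  have h : ∀ x, part21 θ x v w = v 0 * part21 θ x (Pi.single 0 1) w
      + v 1 * part21 θ x (Pi.single 1 1) w + v 2 * part21 θ x (Pi.single 2 1) w := fun x ↦ by
    rw [part21_swap12, part21_expand θ v x w, part21_swap12 θ x (Pi.single 0 1),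
      part21_swap12 θ x (Pi.single 1 1), part21_swap12 θ x (Pi.single 2 1)]
    ring
  rw [part21_expand θ u v w, h, h, h, part21_self, part21_self, part21_self,
    part21_swap12 θ (Pi.single 0 1) (Pi.single 1 1), part21_swap12 θ (Pi.single 1 1) (Pi.single 2 1),
    part21_swap12 θ (Pi.single 2 1) (Pi.single 0 1)]
  ring

theorem part30_self (u w : Fin 3 → ℂ) : part30 θ u u w = 0 := by
  have := part30_swap12 θ u u w
  linear_combination (1 / 2 : ℂ) * this

theorem part30_self' (u w : Fin 3 → ℂ) : part30 θ w u u = 0 := by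
  have := part30_swap23 θ w u u
  linear_combination (1 / 2 : ℂ) * this

/-- Complex trilinear alternating forms on ℂ³ are multiples of the determinant. -/
theorem part30_eq (u v w : Fin 3 → ℂ) : part30 θ u v w =
    stdVol ![u, v, w] * part30 θ (Pi.single 0 1) (Pi.single 1 1) (Pi.single 2 1) := by
  have h2 : ∀ x y, part30 θ x v y = v 0 * part30 θ x (Pi.single 0 1) y
      + v 1 * part30 θ x (Pi.single 1 1) y + v 2 * part30 θ x (Pi.single 2 1) y := fun x y ↦ by
    rw [part30_swap12, part30_expand θ v x y, part30_swap12 θ x (Pi.single 0 1),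
      part30_swap12 θ x (Pi.single 1 1), part30_swap12 θ x (Pi.single 2 1)]
    ring
  have h3 : ∀ x y, part30 θ x y w = w 0 * part30 θ x y (Pi.single 0 1)
      + w 1 * part30 θ x y (Pi.single 1 1) + w 2 * part30 θ x y (Pi.single 2 1) := fun x y ↦ by
    rw [part30_swap23, part30_swap12, neg_neg, part30_expand θ w x y]
    simp only [fun i ↦ part30_swap12 θ x (Pi.single i 1) y,
      fun i ↦ part30_swap23 θ x y (Pi.single i 1)]
    ring
  have e102 := part30_swap12 θ (Pi.single 0 1) (Pi.single 1 1) (Pi.single 2 1)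
  have e021 := part30_swap23 θ (Pi.single 0 1) (Pi.single 1 1) (Pi.single 2 1)
  have e201 := part30_swap12 θ (Pi.single 0 1) (Pi.single 2 1) (Pi.single 1 1)
  have e120 := part30_swap23 θ (Pi.single 1 1) (Pi.single 0 1) (Pi.single 2 1)
  have e210 := part30_swap12 θ (Pi.single 1 1) (Pi.single 2 1) (Pi.single 0 1)
  have z : ∀ i j : Fin 3, part30 θ (Pi.single i 1) (Pi.single j 1) (Pi.single i 1) = 0 := by
    intro i j
    rw [part30_swap12, part30_self', neg_zero]
  rw [part30_expand θ u v w]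
  simp only [h2, h3, part30_self, part30_self', z]
  rw [e210, e201, e120, e102, e021, stdVol_eq]
  simp
  ring

/-- The infinitesimal action of `GL(6, ℝ)` on `Re (dz₁ ∧ dz₂ ∧ dz₃)` reaches every 3-form. -/
theorem exists_fderiv_reVolForm : ∃ X : (Fin 3 → ℂ) →L[ℝ] (Fin 3 → ℂ),
    reVolForm.fderivCompContinuousLinearMap (ContinuousLinearMap.id ℝ _) X = θ := by
  set a := part30 θ (Pi.single 0 1) (Pi.single 1 1) (Pi.single 2 1) with ha
  -- The derivative of det along X is the sum of the determinants with one argument replaced by its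
  -- image. Multiplication by a/3 contributes a · det, since three slots are replaced, and this is
  -- the (3,0)-part. The vector with components `part21 (e_{j+1}) (e_{j+2}) w`, paired with the
  -- cross product of `u` and `v`, contributes `part21 u v w`.
  let X₀ : (Fin 3 → ℂ) →ₗ[ℝ] (Fin 3 → ℂ) :=
    { toFun := fun w ↦ ![(a / 3) * w 0 + part21 θ (Pi.single 1 1) (Pi.single 2 1) w,
        (a / 3) * w 1 + part21 θ (Pi.single 2 1) (Pi.single 0 1) w,
        (a / 3) * w 2 + part21 θ (Pi.single 0 1) (Pi.single 1 1) w]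
      map_add' := fun x y ↦ by
        ext j; fin_cases j <;> simp [part21_add] <;> ring
      map_smul' := fun r x ↦ by
        ext j; fin_cases j <;> simp [part21_smul] <;> ring }
  refine ⟨LinearMap.toContinuousLinearMap X₀, ?_⟩
  ext w
  rw [ContinuousAlternatingMap.fderivCompContinuousLinearMap_apply]
  have hw : w = ![w 0, w 1, w 2] := by ext i; fin_cases i <;> rfl
  conv_rhs => rw [hw]
  rw [threeForm_eq_parts, part30_eq, part21_eq θ (w 0), part21_eq θ (w 1), part21_eq θ (w 2), ← ha]
  rw [Fin.sum_univ_three, reVolForm_apply, reVolForm_apply, reVolForm_apply, ← Complex.add_re,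
    ← Complex.add_re]
  congr 1
  simp only [stdVol_eq]
  simp [X₀]
  ring

end ThreeForms

/-! ### Perturbation of `SU(3)`-structures -/

section TwoForms

variable (τ : (Fin 3 → ℂ) [⋀^Fin 2]→L[ℝ] ℝ)

theorem twoForm_add_left (a a' b : Fin 3 → ℂ) : τ ![a + a', b] = τ ![a, b] + τ ![a', b] :=
  τ.toMultilinearMap.cons_add ![b] a a'

theorem twoForm_smul_left (r : ℝ) (a b : Fin 3 → ℂ) : τ ![r • a, b] = r * τ ![a, b] :=
  τ.toMultilinearMap.cons_smul ![b] r a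

theorem twoForm_swap (a b : Fin 3 → ℂ) : τ ![b, a] = -τ ![a, b] := by
  have := τ.toAlternatingMap.map_swap ![a, b] (show (0 : Fin 2) ≠ 1 by decide)
  have h : ![a, b] ∘ Equiv.swap (0 : Fin 2) 1 = ![b, a] := by
    ext i; fin_cases i <;> simp
  rw [h] at this
  exact this

theorem twoForm_add_right (a b b' : Fin 3 → ℂ) : τ ![a, b + b'] = τ ![a, b] + τ ![a, b'] := by
  rw [twoForm_swap, twoForm_add_left, twoForm_swap τ a b, twoForm_swap τ a b']; ring

theorem twoForm_smul_right (r : ℝ) (a b : Fin 3 → ℂ) : τ ![a, r • b] = r * τ ![a, b] := by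
  rw [twoForm_swap, twoForm_smul_left, twoForm_swap τ a b]; ring

theorem twoForm_neg_right (a b : Fin 3 → ℂ) : τ ![a, -b] = -τ ![a, b] := by
  have := twoForm_smul_right τ (-1) a b
  rw [neg_one_smul] at this
  linarith

theorem twoForm_neg_left (a b : Fin 3 → ℂ) : τ ![-a, b] = -τ ![a, b] := by
  have := twoForm_smul_left τ (-1) a b
  rw [neg_one_smul] at this
  linarith

theorem twoForm_self (a : Fin 3 → ℂ) : τ ![a, a] = 0 := by
  have := twoForm_swap τ a a
  linarith

/-- The Hermitian form, linear in the second argument, whose imaginary part is a given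
`(1,1)`-form. -/
def hermForm (u v : Fin 3 → ℂ) : ℂ := (τ ![u, mulI v] : ℝ) + Complex.I * (τ ![u, v] : ℝ)

theorem hermForm_add_right (u x y : Fin 3 → ℂ) :
    hermForm τ u (x + y) = hermForm τ u x + hermForm τ u y := by
  simp only [hermForm, map_add, twoForm_add_right]; push_cast; ring

theorem hermForm_smul_right (u x : Fin 3 → ℂ) (r : ℝ) :
    hermForm τ u (r • x) = r * hermForm τ u x := by
  simp only [hermForm, map_smul, twoForm_smul_right]; push_cast; ring

theorem hermForm_I_right (u x : Fin 3 → ℂ) :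
    hermForm τ u (mulI x) = Complex.I * hermForm τ u x := by
  simp only [hermForm, mulI_mulI, twoForm_neg_right]; push_cast
  linear_combination (-(τ ![u, x] : ℂ)) * Complex.I_mul_I

theorem hermForm_right (u v : Fin 3 → ℂ) : hermForm τ u v = v 0 * hermForm τ u (Pi.single 0 1)
    + v 1 * hermForm τ u (Pi.single 1 1) + v 2 * hermForm τ u (Pi.single 2 1) :=
  complex_linear_expand (hermForm_add_right τ u) (fun r x ↦ hermForm_smul_right τ u x r)
    (hermForm_I_right τ u) v

variable {τ}

/-- Conjugate linearity in the first argument is where invariance under i, that is type (1,1),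
enters. -/
theorem hermForm_left (hτ : ∀ u v, τ ![mulI u, mulI v] = τ ![u, v]) (u v : Fin 3 → ℂ) :
    hermForm τ u v = starRingEnd ℂ (u 0) * hermForm τ (Pi.single 0 1) v
      + starRingEnd ℂ (u 1) * hermForm τ (Pi.single 1 1) v
      + starRingEnd ℂ (u 2) * hermForm τ (Pi.single 2 1) v := by
  have h := complex_linear_expand (f := fun u ↦ starRingEnd ℂ (hermForm τ u v))
    (fun x y ↦ by simp only [hermForm, twoForm_add_left, ← map_add]; congr 1; push_cast; ring)
    (fun r x ↦ by
      simp only [hermForm, twoForm_smul_left, map_add, map_mul, Complex.conj_ofReal]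
      push_cast; ring)
    (fun x ↦ by
      have : τ ![mulI x, v] = -τ ![x, mulI v] := by
        rw [← hτ x (mulI v), mulI_mulI, twoForm_neg_right, neg_neg]
      simp only [hermForm, hτ, this, map_add, map_mul, Complex.conj_ofReal, Complex.conj_I]
      push_cast
      linear_combination (τ ![x, v] : ℂ) * Complex.I_mul_I) u
  have h' := congrArg (starRingEnd ℂ) h
  simpa using h'

/-- Every real (1,1)-form is obtained from the standard Kähler form by an infinitesimal
transformation that fixes `Re (dz₁ ∧ dz₂ ∧ dz₃)` and a rescaling. -/
theorem exists_fderiv_kahlerForm (hτ : ∀ u v, τ ![mulI u, mulI v] = τ ![u, v]) :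
    ∃ X : (Fin 3 → ℂ) →L[ℝ] (Fin 3 → ℂ), ∃ c : ℝ,
      reVolForm.fderivCompContinuousLinearMap (ContinuousLinearMap.id ℝ _) X = 0 ∧
      kahlerForm.fderivCompContinuousLinearMap (ContinuousLinearMap.id ℝ _) X
        + c • kahlerForm = τ := by
  set e : Fin 3 → Fin 3 → ℂ := fun j ↦ Pi.single j 1 with he
  set s : ℝ := τ ![e 0, mulI (e 0)] + τ ![e 1, mulI (e 1)] + τ ![e 2, mulI (e 2)] with hs
  have htr : hermForm τ (e 0) (e 0) + hermForm τ (e 1) (e 1) + hermForm τ (e 2) (e 2) = s := by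
    simp only [hermForm, twoForm_self, hs]; push_cast; ring
  -- Half of the Hermitian matrix of τ, acting infinitesimally on the Kähler form, produces τ.
  -- Subtracting s/6, a third of its trace s/2, puts it in 𝔰𝔩(3, ℂ), so that it fixes the
  -- holomorphic volume form. This costs (s/3) times the Kähler form, which is returned by the
  -- rescaling `s / 3`.
  let X₀ : (Fin 3 → ℂ) →ₗ[ℝ] (Fin 3 → ℂ) :=
    { toFun := fun w j ↦ (1 / 2 : ℂ) * hermForm τ (e j) w - (s / 6 : ℂ) * w j
      map_add' := fun x y ↦ by
        ext j; simp only [hermForm_add_right, Pi.add_apply]; ring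
      map_smul' := fun r x ↦ by
        ext j; simp only [hermForm_smul_right, Pi.smul_apply, Complex.real_smul, RingHom.id_apply]
        ring }
  have hX : ∀ w j, X₀ w j = (1 / 2 : ℂ) * (w 0 * hermForm τ (e j) (e 0)
      + w 1 * hermForm τ (e j) (e 1) + w 2 * hermForm τ (e j) (e 2)) - (s / 6 : ℂ) * w j := by
    intro w j
    rw [← hermForm_right]
    rfl
  refine ⟨LinearMap.toContinuousLinearMap X₀, s / 3, ?_, ?_⟩
  · ext w
    rw [ContinuousAlternatingMap.fderivCompContinuousLinearMap_apply, Fin.sum_univ_three,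
      reVolForm_apply, reVolForm_apply, reVolForm_apply, ← Complex.add_re, ← Complex.add_re]
    simp only [stdVol_eq]
    change _ = (0 : ℂ).re
    congr 1
    simp only [Function.update_self, LinearMap.coe_toContinuousLinearMap', hX,
      ContinuousLinearMap.id_apply, Function.update_of_ne, ne_eq, Fin.reduceEq, not_false_eq_true]
    linear_combination (1 / 2 : ℂ) * (w 0 0 * w 1 1 * w 2 2 - w 0 0 * w 1 2 * w 2 1
      - w 0 1 * w 1 0 * w 2 2 + w 0 1 * w 1 2 * w 2 0 + w 0 2 * w 1 0 * w 2 1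
      - w 0 2 * w 1 1 * w 2 0) * htr
  · have key : ∀ u v, stdOmega u (X₀ v) = 1 / 2 * τ ![u, v] - s / 6 * stdOmega u v := by
      intro u v
      have h1 : (hermForm τ u v).im = τ ![u, v] := by simp [hermForm]
      rw [← h1, hermForm_left hτ u v]
      simp only [stdOmega, Fin.sum_univ_three]
      have h2 : ∀ j, X₀ v j = (1 / 2 : ℂ) * hermForm τ (e j) v - (s / 6 : ℂ) * v j := fun j ↦ rfl
      simp only [h2, he]
      have h3 : (s / 6 : ℂ) = ((s / 6 : ℝ) : ℂ) := by push_cast; ring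
      have h4 : (1 / 2 : ℂ) = ((1 / 2 : ℝ) : ℂ) := by push_cast; ring
      rw [h3, h4]
      simp only [Complex.mul_im, Complex.sub_im, Complex.add_im, Complex.mul_re, Complex.sub_re,
        Complex.ofReal_re, Complex.ofReal_im]
      ring
    ext w
    have hw : w = ![w 0, w 1] := by ext i; fin_cases i <;> rfl
    rw [ContinuousAlternatingMap.add_apply,
      ContinuousAlternatingMap.fderivCompContinuousLinearMap_apply, Fin.sum_univ_two,
      ContinuousAlternatingMap.smul_apply, kahlerForm_apply, kahlerForm_apply, kahlerForm_apply]
    simp only [Function.update_self, LinearMap.coe_toContinuousLinearMap',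
      ContinuousLinearMap.id_apply, Function.update_of_ne, ne_eq, Fin.reduceEq, not_false_eq_true,
      smul_eq_mul]
    conv_rhs => rw [hw]
    rw [stdOmega_swap (w 1) (X₀ (w 0)), key, key, twoForm_swap τ (w 0) (w 1),
      stdOmega_swap (w 0) (w 1)]
    ring

end TwoForms

/-- A `2`-form minus its image under `i`. -/
def antiPart : ((Fin 3 → ℂ) [⋀^Fin 2]→L[ℝ] ℝ) →L[ℝ] ((Fin 3 → ℂ) [⋀^Fin 2]→L[ℝ] ℝ) :=
  ContinuousLinearMap.id ℝ _ - ContinuousAlternatingMap.compContinuousLinearMapCLM mulI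

theorem antiPart_apply (β : (Fin 3 → ℂ) [⋀^Fin 2]→L[ℝ] ℝ) (u v : Fin 3 → ℂ) :
    antiPart β ![u, v] = β ![u, v] - β ![mulI u, mulI v] := by
  change β ![u, v] - β (fun j ↦ mulI (![u, v] j)) = _
  congr 2
  ext j; fin_cases j <;> rfl

/-- The parametrization of pairs of a 3-form and a 2-form near the standard ones. -/
def deform (q : ((Fin 3 → ℂ) →L[ℝ] (Fin 3 → ℂ)) × ℝ × ((Fin 3 → ℂ) [⋀^Fin 2]→L[ℝ] ℝ)) :
    ((Fin 3 → ℂ) [⋀^Fin 3]→L[ℝ] ℝ) × ((Fin 3 → ℂ) [⋀^Fin 2]→L[ℝ] ℝ) :=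
  (reVolForm.compContinuousLinearMap q.1,
    (q.2.1 • kahlerForm + antiPart q.2.2).compContinuousLinearMap q.1)

/-- A strictly differentiable map with surjective derivative is open at the point. The derivative is
onto because some X₁ reaches any 3-form, and the 2-form that then remains splits into an
anti-invariant part, reached through `antiPart`, and a (1,1)-part, reached by an X₂ that leaves the
3-form alone together with a rescaling. -/
theorem map_deform_nhds : Filter.map deform (𝓝 (ContinuousLinearMap.id ℝ _, 1, 0)) =
    𝓝 (reVolForm, kahlerForm) := by
  set b : ((Fin 3 → ℂ) →L[ℝ] (Fin 3 → ℂ)) × ℝ × ((Fin 3 → ℂ) [⋀^Fin 2]→L[ℝ] ℝ) :=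
    (ContinuousLinearMap.id ℝ _, 1, 0) with hb
  have hb' : deform b = (reVolForm, kahlerForm) := by
    simp only [deform, hb, one_smul, map_zero, add_zero]
    rfl
  have h1 : HasStrictFDerivAt (fun q : ((Fin 3 → ℂ) →L[ℝ] (Fin 3 → ℂ)) × ℝ ×
      ((Fin 3 → ℂ) [⋀^Fin 2]→L[ℝ] ℝ) ↦ reVolForm.compContinuousLinearMap q.1) _ b :=
    (hasStrictFDerivAt_const reVolForm b).continuousAlternatingMapCompContinuousLinearMap
      hasStrictFDerivAt_fst
  let P : (((Fin 3 → ℂ) →L[ℝ] (Fin 3 → ℂ)) × ℝ × ((Fin 3 → ℂ) [⋀^Fin 2]→L[ℝ] ℝ)) →L[ℝ]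
      ((Fin 3 → ℂ) [⋀^Fin 2]→L[ℝ] ℝ) :=
    ((ContinuousLinearMap.fst ℝ ℝ ((Fin 3 → ℂ) [⋀^Fin 2]→L[ℝ] ℝ)).comp
      (ContinuousLinearMap.snd ℝ ((Fin 3 → ℂ) →L[ℝ] (Fin 3 → ℂ)) _)).smulRight kahlerForm
      + antiPart.comp ((ContinuousLinearMap.snd ℝ ℝ ((Fin 3 → ℂ) [⋀^Fin 2]→L[ℝ] ℝ)).comp
        (ContinuousLinearMap.snd ℝ ((Fin 3 → ℂ) →L[ℝ] (Fin 3 → ℂ)) _))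
  have h2 : HasStrictFDerivAt (fun q : ((Fin 3 → ℂ) →L[ℝ] (Fin 3 → ℂ)) × ℝ ×
      ((Fin 3 → ℂ) [⋀^Fin 2]→L[ℝ] ℝ) ↦ q.2.1 • kahlerForm + antiPart q.2.2) P b :=
    P.hasStrictFDerivAt
  have h3 := h2.continuousAlternatingMapCompContinuousLinearMap
    (hasStrictFDerivAt_fst (p := b) (𝕜 := ℝ))
  have h4 := (h1.prodMk h3).map_nhds_eq_of_surj ?_
  · exact h4.trans (by rw [← hb']; rfl)
  rw [LinearMap.range_eq_top]
  rintro ⟨θ, τ⟩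
  obtain ⟨X₁, hX₁⟩ := exists_fderiv_reVolForm θ
  set τ' := τ - kahlerForm.fderivCompContinuousLinearMap (ContinuousLinearMap.id ℝ _) X₁ with hτ'
  -- `antiPart` doubles forms that change sign under i and kills invariant ones. With the factor 1/2
  -- it is the projection to the anti-invariant part, and `inv` is the (1,1)-part of `τ'`.
  set inv : (Fin 3 → ℂ) [⋀^Fin 2]→L[ℝ] ℝ := τ' - antiPart ((1 / 2 : ℝ) • τ') with hinv
  have hinv' : ∀ u v, inv ![mulI u, mulI v] = inv ![u, v] := by
    intro u v
    have h (x y) : inv ![x, y] = 1 / 2 * τ' ![x, y] + 1 / 2 * τ' ![mulI x, mulI y] := by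
      change τ' ![x, y] - antiPart ((1 / 2 : ℝ) • τ') ![x, y] = _
      rw [antiPart_apply]
      change _ - (1 / 2 * τ' _ - 1 / 2 * τ' _) = _
      ring
    rw [h, h, mulI_mulI, mulI_mulI, twoForm_neg_left, twoForm_neg_right]
    ring
  obtain ⟨X₂, c, hX₂, hc⟩ := exists_fderiv_kahlerForm hinv'
  refine ⟨(X₁ + X₂, c, (1 / 2 : ℝ) • τ'), ?_⟩
  have hb2 : (b.2.1 • kahlerForm + antiPart b.2.2) = kahlerForm := by
    simp only [hb, one_smul, map_zero, add_zero]
  have hid : ContinuousAlternatingMap.compContinuousLinearMapCLM (F := ℝ) (ι := Fin 2)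
      (ContinuousLinearMap.id ℝ (Fin 3 → ℂ)) = ContinuousLinearMap.id ℝ _ := by
    ext; rfl
  refine Prod.ext ?_ ?_
  · change ContinuousAlternatingMap.compContinuousLinearMapCLM _ 0 +
      reVolForm.fderivCompContinuousLinearMap (ContinuousLinearMap.id ℝ _) (X₁ + X₂) = θ
    rw [map_zero, zero_add, map_add, hX₁, hX₂, add_zero]
  · change ContinuousAlternatingMap.compContinuousLinearMapCLM (ContinuousLinearMap.id ℝ _)
      (c • kahlerForm + antiPart ((1 / 2 : ℝ) • τ')) +
      (b.2.1 • kahlerForm + antiPart b.2.2).fderivCompContinuousLinearMap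
        (ContinuousLinearMap.id ℝ _) (X₁ + X₂) = τ
    rw [hid, hb2, (kahlerForm.fderivCompContinuousLinearMap
      (ContinuousLinearMap.id ℝ (Fin 3 → ℂ))).map_add X₁ X₂]
    change (c • kahlerForm + antiPart ((1 / 2 : ℝ) • τ')) + _ = τ
    have e1 : antiPart ((1 / 2 : ℝ) • τ') = τ' - inv := by rw [hinv, sub_sub_cancel]
    have e2 : kahlerForm.fderivCompContinuousLinearMap (ContinuousLinearMap.id ℝ _) X₁ = τ - τ' := by
      rw [hτ', sub_sub_cancel]
    rw [e1, e2, ← hc]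
    abel

/-! ### The identity `ω³ = (3/2) Re Ω ∧ Im Ω` on `ℂ³` -/

/-- The vectors of `stdBasis`, enumerated by `Fin 6`. -/
def basisIndex : Fin 6 → Fin 3 × Fin 2 := ![(0, 0), (0, 1), (1, 0), (1, 1), (2, 0), (2, 1)]

theorem bijective_basisIndex : Function.Bijective basisIndex := by decide

/-- The entries of the vectors of `stdBasis`, as Gaussian integers. -/
def basisEntry (i : Fin 6) (k : Fin 3) : ℤ × ℤ :=
  if i.val / 2 = k.val then (if i.val % 2 = 0 then (1, 0) else (0, 1)) else (0, 0)

/-- Multiplication of Gaussian integers. -/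
def gaussMul (a b : ℤ × ℤ) : ℤ × ℤ := (a.1 * b.1 - a.2 * b.2, a.1 * b.2 + a.2 * b.1)

/-- The values of `stdOmega` on `stdBasis`. -/
def omegaEntry (i j : Fin 6) : ℤ := if i.val / 2 = j.val / 2 then (j.val : ℤ) - i.val else 0

/-- The values of `stdVol` on `stdBasis`. -/
def volEntry (i j k : Fin 6) : ℤ × ℤ :=
  gaussMul (gaussMul (basisEntry i 0) (basisEntry j 1)) (basisEntry k 2)
  - gaussMul (gaussMul (basisEntry i 0) (basisEntry j 2)) (basisEntry k 1)
  - gaussMul (gaussMul (basisEntry i 1) (basisEntry j 0)) (basisEntry k 2)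
  + gaussMul (gaussMul (basisEntry i 1) (basisEntry j 2)) (basisEntry k 0)
  + gaussMul (gaussMul (basisEntry i 2) (basisEntry j 0)) (basisEntry k 1)
  - gaussMul (gaussMul (basisEntry i 2) (basisEntry j 1)) (basisEntry k 0)

/-- The summand of `ω³ - (3/2) Re Ω ∧ Im Ω`, up to a factor 24. -/
def cubeEntry (σ : Equiv.Perm (Fin 6)) : ℤ :=
  3 * (omegaEntry (σ 0) (σ 1) * omegaEntry (σ 2) (σ 3) * omegaEntry (σ 4) (σ 5))
    - (volEntry (σ 0) (σ 1) (σ 2)).1 * (volEntry (σ 3) (σ 4) (σ 5)).2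

-- A finite computation in integers over the 720 permutations. The test for zero comes before the
-- sign, so that signs are evaluated only for the permutations that contribute.
set_option maxRecDepth 100000 in
theorem sum_cubeEntry : ∑ σ : Equiv.Perm (Fin 6),
    (if cubeEntry σ = 0 then 0 else (Equiv.Perm.sign σ : ℤ) * cubeEntry σ) = 0 := by
  decide +kernel

/-- The complex number of a Gaussian integer. -/
def gaussC (a : ℤ × ℤ) : ℂ := a.1 + a.2 * Complex.I

theorem gaussC_mul (a b : ℤ × ℤ) : gaussC (gaussMul a b) = gaussC a * gaussC b := by
  simp only [gaussC, gaussMul]; push_cast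
  linear_combination (-(a.2 * b.2 : ℂ)) * Complex.I_mul_I

theorem gaussC_add (a b : ℤ × ℤ) : gaussC (a + b) = gaussC a + gaussC b := by
  simp only [gaussC, Prod.fst_add, Prod.snd_add]; push_cast; ring

theorem gaussC_sub (a b : ℤ × ℤ) : gaussC (a - b) = gaussC a - gaussC b := by
  simp only [gaussC, Prod.fst_sub, Prod.snd_sub]; push_cast; ring

theorem gaussC_re (a : ℤ × ℤ) : (gaussC a).re = a.1 := by simp [gaussC]

theorem gaussC_im (a : ℤ × ℤ) : (gaussC a).im = a.2 := by simp [gaussC]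

theorem stdBasis_basisIndex (i : Fin 6) (k : Fin 3) :
    stdBasis (basisIndex i) k = gaussC (basisEntry i k) := by
  fin_cases i <;> fin_cases k <;>
    simp [stdBasis, basisIndex, basisEntry, gaussC]

theorem stdVol_basis (i j k : Fin 6) : stdVol ![stdBasis (basisIndex i), stdBasis (basisIndex j),
    stdBasis (basisIndex k)] = gaussC (volEntry i j k) := by
  rw [stdVol_eq]
  simp only [volEntry, gaussC_add, gaussC_sub, gaussC_mul, ← stdBasis_basisIndex]
  rfl

theorem stdOmega_basis (i j : Fin 6) :
    stdOmega (stdBasis (basisIndex i)) (stdBasis (basisIndex j)) = omegaEntry i j := by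
  simp only [stdOmega, stdBasis_basisIndex, Fin.sum_univ_three]
  fin_cases i <;> fin_cases j <;> simp [basisEntry, gaussC, omegaEntry]

/-- `ω³ - (3/2) Re Ω ∧ Im Ω` on `ℂ³`. -/
def cubeDefect (w : Fin 6 → Fin 3 → ℂ) : ℝ :=
  wedgeCube kahlerForm w - (3 / 2) * wedge33 (fun z ↦ (stdVol z).re) (fun z ↦ (stdVol z).im) w

theorem cubeDefect_perm (w : Fin 6 → Fin 3 → ℂ) (τ : Equiv.Perm (Fin 6)) :
    cubeDefect (w ∘ τ) = ((Equiv.Perm.sign τ : ℤ) : ℝ) * cubeDefect w := by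
  have key (f : (Fin 6 → Fin 3 → ℂ) → ℝ) :
      ∑ σ : Equiv.Perm (Fin 6), ((Equiv.Perm.sign σ : ℤ) : ℝ) * f (fun i ↦ w (τ (σ i))) =
      ((Equiv.Perm.sign τ : ℤ) : ℝ) *
        ∑ σ : Equiv.Perm (Fin 6), ((Equiv.Perm.sign σ : ℤ) : ℝ) * f (fun i ↦ w (σ i)) := by
    rw [← Equiv.sum_comp (Equiv.mulLeft τ)
      (fun σ : Equiv.Perm (Fin 6) ↦ ((Equiv.Perm.sign σ : ℤ) : ℝ) * f (fun i ↦ w (σ i))),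
      Finset.mul_sum]
    refine Finset.sum_congr rfl fun σ _ ↦ ?_
    have h1 : (((Equiv.Perm.sign τ : ℤ) : ℝ)) * ((Equiv.Perm.sign τ : ℤ) : ℝ) = 1 := by
      exact_mod_cast Int.units_coe_mul_self (Equiv.Perm.sign τ)
    simp only [Equiv.coe_mulLeft, Equiv.Perm.sign_mul, Units.val_mul, Int.cast_mul,
      Equiv.Perm.mul_apply]
    linear_combination (-((Equiv.Perm.sign σ : ℤ) : ℝ) * f (fun i ↦ w (τ (σ i)))) * h1
  have e1 := key (fun w ↦ kahlerForm ![w 0, w 1] * kahlerForm ![w 2, w 3] * kahlerForm ![w 4, w 5])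
  have e2 := key (fun w ↦ (stdVol ![w 0, w 1, w 2]).re * (stdVol ![w 3, w 4, w 5]).im)
  simp only [cubeDefect, wedgeCube, wedge33, Function.comp_apply]
  rw [e1, e2]
  ring

theorem cubeDefect_basis_self : cubeDefect (fun i ↦ stdBasis (basisIndex i)) = 0 := by
  have h : cubeDefect (fun i ↦ stdBasis (basisIndex i)) =
      (1 / 24) * ((∑ σ : Equiv.Perm (Fin 6),
        (if cubeEntry σ = 0 then 0 else (Equiv.Perm.sign σ : ℤ) * cubeEntry σ) : ℤ) : ℝ) := by
    simp only [cubeDefect, wedgeCube, wedge33, kahlerForm_apply, Matrix.cons_val_zero,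
      Matrix.cons_val_one, stdVol_basis, stdOmega_basis, gaussC_re, gaussC_im]
    rw [← mul_assoc, Finset.mul_sum, Finset.mul_sum, ← Finset.sum_sub_distrib, Int.cast_sum,
      Finset.mul_sum]
    refine Finset.sum_congr rfl fun σ _ ↦ ?_
    have : (if cubeEntry σ = 0 then 0 else (Equiv.Perm.sign σ : ℤ) * cubeEntry σ) =
        (Equiv.Perm.sign σ : ℤ) * cubeEntry σ := by
      split_ifs with h
      · rw [h, mul_zero]
      · rfl
    rw [this, cubeEntry]
    push_cast
    ring
  rw [h, sum_cubeEntry]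
  simp

/-- By antisymmetry: a repeated vector gives 0, and six different ones are a permutation of the
enumerated basis, where the defect was computed. -/
theorem cubeDefect_basis (s : Fin 6 → Fin 3 × Fin 2) : cubeDefect (fun i ↦ stdBasis (s i)) = 0 := by
  by_cases hs : Function.Injective s
  · have hb : Function.Bijective s :=
      (Fintype.bijective_iff_injective_and_card s).2 ⟨hs, by simp⟩
    let e : Fin 6 ≃ Fin 3 × Fin 2 := Equiv.ofBijective _ bijective_basisIndex
    have := cubeDefect_perm (fun i ↦ stdBasis (basisIndex i)) ((Equiv.ofBijective s hb).trans e.symm)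
    rw [cubeDefect_basis_self, mul_zero] at this
    rw [← this]
    congr 1
    ext1 i
    change _ = stdBasis (e (e.symm (s i)))
    rw [e.apply_symm_apply]
  · rw [Function.not_injective_iff] at hs
    obtain ⟨i, j, hij, hne⟩ := hs
    have := cubeDefect_perm (fun i ↦ stdBasis (s i)) (Equiv.swap i j)
    rw [Equiv.Perm.sign_swap hne] at this
    have h2 : (fun i ↦ stdBasis (s i)) ∘ Equiv.swap i j = fun i ↦ stdBasis (s i) := by
      ext1 k
      simp only [Function.comp_apply]
      rcases eq_or_ne k i with rfl | hki
      · rw [Equiv.swap_apply_left, hij]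
      · rcases eq_or_ne k j with rfl | hkj
        · rw [Equiv.swap_apply_right, hij]
        · rw [Equiv.swap_apply_of_ne_of_ne hki hkj]
    rw [h2] at this
    push_cast at this
    linarith

/-! ### Nearly Calabi-Yau structures close to a Calabi-Yau structure, at a point -/

/-- The pointwise condition in the definition of a nearly Calabi-Yau structure. -/
def IsNearlyAt {T : Type*} [AddCommGroup T] [Module ℝ T] [TopologicalSpace T] (ε : ℝ)
    (ω : (Fin 2 → T) → ℝ) (Ω : (Fin 3 → T) → ℂ) : Prop :=
  ∃ A : T ≃L[ℝ] (Fin 3 → ℂ),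
    ∃ J' : T → T, ∃ θ₂' : (Fin 3 → T) → ℝ, ∃ f : ℝ, 0 < f ∧
      (∀ v, A (J' v) = Complex.I • A v) ∧
      (∀ w, (Ω w).re = (stdVol (fun j ↦ A (w j))).re) ∧
      (∀ w, θ₂' w = (stdVol (fun j ↦ A (w j))).im) ∧
      (∀ u v, (1 / 2) * (ω ![u, v] + ω ![J' u, J' v]) =
        f ^ (1 / 3 : ℝ) * stdOmega (A u) (A v)) ∧
      formNorm A (fun w : Fin 3 → T ↦ (Ω w).im - θ₂' w) < ε ∧
      formNorm A (fun w : Fin 2 → T ↦ (1 / 4 : ℂ) *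
        (((ω ![w 0, w 1] - ω ![J' (w 0), J' (w 1)] : ℝ) : ℂ)
          - Complex.I * ((ω ![J' (w 0), w 1] + ω ![w 0, J' (w 1)] : ℝ) : ℂ))) < ε ∧
      formNorm A (fun w : Fin 6 → T ↦ wedgeCube ω w -
        (3 / 2) * wedge33 (fun z ↦ (Ω z).re) (fun z ↦ (Ω z).im) w) < ε

/-- The norm of a tensor on `ℂ³` in terms of its values on the standard basis. -/
def basisNorm {G : Type*} [NormedAddCommGroup G] {k : ℕ} (θ : (Fin k → Fin 3 × Fin 2) → G) : ℝ :=
  √((∑ s, ‖θ s‖ ^ 2) / k.factorial)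

theorem basisNorm_lt {X G : Type*} [TopologicalSpace X] [NormedAddCommGroup G] {k : ℕ}
    {θ : X → (Fin k → Fin 3 × Fin 2) → G} {x : X} (hθ : ∀ s, ContinuousAt (fun y ↦ θ y s) x)
    (h0 : ∀ s, θ x s = 0) {ε : ℝ} (hε : 0 < ε) : ∀ᶠ y in 𝓝 x, basisNorm (θ y) < ε := by
  have hc : ContinuousAt (fun y ↦ basisNorm (θ y)) x := by
    refine ContinuousAt.sqrt (ContinuousAt.div_const ?_ _)
    exact tendsto_finsetSum _ fun s _ ↦ (hθ s).norm.pow 2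
  have hx : basisNorm (θ x) = 0 := by simp [basisNorm, h0]
  exact hc.eventually_lt continuousAt_const (by rw [hx]; exact hε)

/-- Pairs of an endomorphism of `ℂ³` and a complex 3-form. -/
abbrev EndForm := ((Fin 3 → ℂ) →L[ℝ] (Fin 3 → ℂ)) × ((Fin 3 → ℂ) [⋀^Fin 3]→L[ℝ] ℂ)

theorem continuous_endForm_apply (w : Fin 3 → Fin 3 → ℂ) :
    Continuous fun q : EndForm ↦ q.2 fun j ↦ q.1 (w j) := by
  have h : Continuous fun q : ((Fin 3 → ℂ) [⋀^Fin 3]→L[ℝ] ℂ) × ((Fin 3 → ℂ) →L[ℝ] (Fin 3 → ℂ)) ↦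
      q.1.compContinuousLinearMap q.2 := continuous_iff_continuousAt.2 fun q ↦
    (ContinuousAlternatingMap.hasStrictFDerivAt_compContinuousLinearMap q).continuousAt
  exact (ContinuousEvalConst.continuous_eval_const w).comp (h.comp continuous_swap)

theorem continuous_end_omega (u v : Fin 3 → ℂ) :
    Continuous fun q : EndForm ↦ stdOmega (q.1 u) (q.1 v) := by
  have h1 : Continuous fun q : EndForm ↦ q.1 u := continuous_fst.clm_apply continuous_const
  have h2 : Continuous fun q : EndForm ↦ q.1 v := continuous_fst.clm_apply continuous_const
  exact continuous_stdOmega.comp (h1.prodMk h2)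

/-- The three errors in the definition of a nearly Calabi-Yau structure are small near the standard
structure. -/
theorem eventually_errors_lt {ε : ℝ} (hε : 0 < ε) :
    ∀ᶠ q : EndForm in 𝓝 (ContinuousLinearMap.id ℝ _, volForm),
      basisNorm (fun s : Fin 3 → Fin 3 × Fin 2 ↦ (q.2 fun j ↦ q.1 (stdBasis (s j))).im
        - (stdVol fun j ↦ stdBasis (s j)).im) < ε ∧
      basisNorm (fun s : Fin 2 → Fin 3 × Fin 2 ↦ (1 / 4 : ℂ) *
        (((stdOmega (q.1 (stdBasis (s 0))) (q.1 (stdBasis (s 1)))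
          - stdOmega (q.1 (mulI (stdBasis (s 0)))) (q.1 (mulI (stdBasis (s 1)))) : ℝ) : ℂ)
        - Complex.I * ((stdOmega (q.1 (mulI (stdBasis (s 0)))) (q.1 (stdBasis (s 1)))
          + stdOmega (q.1 (stdBasis (s 0))) (q.1 (mulI (stdBasis (s 1)))) : ℝ) : ℂ))) < ε ∧
      basisNorm (fun s : Fin 6 → Fin 3 × Fin 2 ↦
        wedgeCube (fun w : Fin 2 → Fin 3 → ℂ ↦ stdOmega (q.1 (w 0)) (q.1 (w 1)))
          (fun j ↦ stdBasis (s j))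
        - (3 / 2) * wedge33 (fun z : Fin 3 → Fin 3 → ℂ ↦ (q.2 fun j ↦ q.1 (z j)).re)
          (fun z ↦ (q.2 fun j ↦ q.1 (z j)).im) (fun j ↦ stdBasis (s j))) < ε := by
  refine (basisNorm_lt (fun s ↦ ?_) (fun s ↦ ?_) hε).and
    ((basisNorm_lt (fun s ↦ ?_) (fun s ↦ ?_) hε).and (basisNorm_lt (fun s ↦ ?_) (fun s ↦ ?_) hε))
  · exact ((Complex.continuous_im.comp (continuous_endForm_apply _)).sub
      continuous_const).continuousAt
  · exact sub_self _
  · refine Continuous.continuousAt (continuous_const.mul (.sub ?_ (continuous_const.mul ?_)))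
    · exact Complex.continuous_ofReal.comp
        ((continuous_end_omega _ _).sub (continuous_end_omega _ _))
    · exact Complex.continuous_ofReal.comp
        ((continuous_end_omega _ _).add (continuous_end_omega _ _))
  · have h (u v : Fin 3 → ℂ) : stdOmega (mulI u) v + stdOmega u (mulI v) = 0 := by
      have h1 := stdOmega_I u (mulI v)
      have h2 := stdOmega_smul_right (-1) (Complex.I • u) v
      rw [← mulI_apply, ← mulI_apply, mulI_mulI] at h1
      rw [neg_one_smul, ← mulI_apply] at h2
      linarith
    simp only [ContinuousLinearMap.id_apply, h]
    simp only [mulI_apply, stdOmega_I]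
    simp
  · refine Continuous.continuousAt (.sub (continuous_const.mul ?_)
      (continuous_const.mul (continuous_const.mul ?_)))
    · refine continuous_finsetSum _ fun σ _ ↦ continuous_const.mul ?_
      exact ((continuous_end_omega _ _).mul (continuous_end_omega _ _)).mul
        (continuous_end_omega _ _)
    · refine continuous_finsetSum _ fun σ _ ↦ continuous_const.mul ?_
      exact (Complex.continuous_re.comp (continuous_endForm_apply _)).mul
        (Complex.continuous_im.comp (continuous_endForm_apply _))
  · exact cubeDefect_basis s

/-- Since `deform` is open at the base point, (Re Ω, `kahlerForm`) comes from some (A, c, β) with A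
invertible, A⁻¹ close to the identity and c > 0. This A is the required frame, with J' = A⁻¹ i A.
The β-term is anti-invariant, so the (1,1)-part of the Kähler form is c times the pulled back one,
and f = c³. On A⁻¹ of the standard basis the three errors are continuous functions of (A⁻¹, Ω) that
vanish for the standard structure. -/
theorem eventually_isNearlyAt {ε : ℝ} (hε : 0 < ε) :
    ∀ᶠ Ω : (Fin 3 → ℂ) [⋀^Fin 3]→L[ℝ] ℂ in 𝓝 volForm, IsNearlyAt ε kahlerForm Ω := by
  have h1 := eventually_errors_lt hε
  rw [nhds_prod_eq] at h1
  obtain ⟨P, hP, Q, hQ, hPQ⟩ := Filter.eventually_prod_iff.1 h1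
  have hinv : Filter.Tendsto (ContinuousLinearMap.inverse (R := ℝ) (M := Fin 3 → ℂ)
      (M₂ := Fin 3 → ℂ)) (𝓝 (ContinuousLinearMap.id ℝ _)) (𝓝 (ContinuousLinearMap.id ℝ _)) := by
    have := (contDiffAt_map_inverse (𝕜 := ℝ) (n := 0)
      (ContinuousLinearEquiv.refl ℝ (Fin 3 → ℂ))).continuousAt
    have h2 := this.tendsto
    rw [ContinuousLinearMap.inverse_equiv] at h2
    exact h2
  have hA : ∀ᶠ A : (Fin 3 → ℂ) →L[ℝ] (Fin 3 → ℂ) in 𝓝 (ContinuousLinearMap.id ℝ _),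
      A ∈ range ((↑) : ((Fin 3 → ℂ) ≃L[ℝ] (Fin 3 → ℂ)) → _) :=
    ContinuousLinearEquiv.nhds (ContinuousLinearEquiv.refl ℝ (Fin 3 → ℂ))
  have t1 : Filter.Tendsto (fun q : ((Fin 3 → ℂ) →L[ℝ] (Fin 3 → ℂ)) × ℝ ×
      ((Fin 3 → ℂ) [⋀^Fin 2]→L[ℝ] ℝ) ↦ q.1) (𝓝 (ContinuousLinearMap.id ℝ _, 1, 0))
      (𝓝 (ContinuousLinearMap.id ℝ _)) := continuous_fst.tendsto _
  have t2 : Filter.Tendsto (fun q : ((Fin 3 → ℂ) →L[ℝ] (Fin 3 → ℂ)) × ℝ ×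
      ((Fin 3 → ℂ) [⋀^Fin 2]→L[ℝ] ℝ) ↦ q.2.1) (𝓝 (ContinuousLinearMap.id ℝ _, 1, 0))
      (𝓝 1) := (continuous_fst.comp continuous_snd).tendsto _
  have hq : ∀ᶠ q : ((Fin 3 → ℂ) →L[ℝ] (Fin 3 → ℂ)) × ℝ × ((Fin 3 → ℂ) [⋀^Fin 2]→L[ℝ] ℝ) in
      𝓝 (ContinuousLinearMap.id ℝ _, 1, 0),
      (q.1 ∈ range ((↑) : ((Fin 3 → ℂ) ≃L[ℝ] (Fin 3 → ℂ)) → _) ∧ P q.1.inverse) ∧ 0 < q.2.1 :=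
    (t1.eventually (hA.and (hinv.eventually hP))).and (t2.eventually (lt_mem_nhds zero_lt_one))
  have hG : ∀ᶠ z in 𝓝 (reVolForm, kahlerForm), ∃ q, deform q = z ∧
      (q.1 ∈ range ((↑) : ((Fin 3 → ℂ) ≃L[ℝ] (Fin 3 → ℂ)) → _) ∧ P q.1.inverse) ∧ 0 < q.2.1 := by
    rw [← map_deform_nhds, Filter.eventually_map]
    exact hq.mono fun q hq ↦ ⟨q, rfl, hq⟩
  have hΩ : Filter.Tendsto (fun Ω : (Fin 3 → ℂ) [⋀^Fin 3]→L[ℝ] ℂ ↦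
      (Complex.reCLM.compContinuousAlternatingMap Ω, kahlerForm)) (𝓝 volForm)
      (𝓝 (reVolForm, kahlerForm)) :=
    ((ContinuousLinearMap.compContinuousAlternatingMapCLM ℝ _ _ _ _
      Complex.reCLM).continuous.continuousAt.prodMk continuousAt_const)
  filter_upwards [hQ, hΩ.eventually hG] with Ω hΩQ ⟨q, hq, ⟨⟨A, hA⟩, hPA⟩, hc⟩
  obtain ⟨A', c, β⟩ := q
  obtain rfl : (A : (Fin 3 → ℂ) →L[ℝ] (Fin 3 → ℂ)) = A' := hA
  rw [ContinuousLinearMap.inverse_equiv] at hPA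
  obtain ⟨e1, e2, e3⟩ := hPQ hPA hΩQ
  have hre : ∀ w, (Ω w).re = (stdVol fun j ↦ A (w j)).re := fun w ↦
    (DFunLike.congr_fun (congrArg Prod.fst hq) w).symm
  have hom : ∀ u v, stdOmega u v = c * stdOmega (A u) (A v) + (β ![A u, A v]
      - β ![mulI (A u), mulI (A v)]) := fun u v ↦ by
    have := DFunLike.congr_fun (congrArg Prod.snd hq) ![u, v]
    rw [← antiPart_apply]
    refine this.symm.trans ?_
    change (c • kahlerForm + antiPart β) (fun j ↦ A (![u, v] j)) = _
    have h : (fun j ↦ A (![u, v] j)) = ![A u, A v] := by ext j; fin_cases j <;> rfl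
    rw [h]
    rfl
  refine ⟨A, fun v ↦ A.symm (mulI (A v)), fun w ↦ (stdVol fun j ↦ A (w j)).im, c ^ 3,
    by positivity, fun v ↦ by rw [A.apply_symm_apply, mulI_apply], hre, fun w ↦ rfl, ?_, ?_, ?_, ?_⟩
  · intro u v
    have : (c ^ 3) ^ (1 / 3 : ℝ) = c := by
      rw [← Real.rpow_natCast, ← Real.rpow_mul hc.le]; norm_num
    rw [this]
    simp only [kahlerForm_apply, Matrix.cons_val_zero, Matrix.cons_val_one]
    rw [hom, hom (A.symm (mulI (A u)))]
    simp only [A.apply_symm_apply, mulI_mulI, twoForm_neg_left, twoForm_neg_right]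
    rw [mulI_apply, mulI_apply, stdOmega_I]
    ring
  · refine lt_of_eq_of_lt ?_ e1
    simp only [formNorm, basisNorm, A.apply_symm_apply]
    rfl
  · refine lt_of_eq_of_lt ?_ e2
    simp only [formNorm, basisNorm, A.apply_symm_apply]
    rfl
  · refine lt_of_eq_of_lt ?_ e3
    have hv (a b c : Fin 3 → ℂ) : ![A.symm a, A.symm b, A.symm c] = fun j ↦ A.symm (![a, b, c] j) := by
      ext1 j; fin_cases j <;> rfl
    simp only [formNorm, basisNorm, wedgeCube, wedge33, hv]
    rfl

/-- A pair `(ω, Ω)` is nearly Calabi-Yau if `ω` comes from the standard Kähler form and `Ω` is close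
to the corresponding volume form. -/
theorem exists_isNearlyAt {ε : ℝ} (hε : 0 < ε) : ∃ δ > 0, ∀ {T : Type*} [AddCommGroup T]
    [Module ℝ T] [TopologicalSpace T] (A₀ : T ≃L[ℝ] (Fin 3 → ℂ)) (ω : T [⋀^Fin 2]→L[ℝ] ℝ)
    (Ω : T [⋀^Fin 3]→L[ℝ] ℂ), (∀ u v, ω ![u, v] = stdOmega (A₀ u) (A₀ v)) →
    (∀ w, ‖Ω w - stdVol fun j ↦ A₀ (w j)‖ ≤ δ * ∏ j, ‖A₀ (w j)‖) → IsNearlyAt ε ω Ω := by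
  obtain ⟨δ, hδ, h⟩ := Metric.eventually_nhds_iff.1 (eventually_isNearlyAt hε)
  refine ⟨δ / 2, half_pos hδ, fun {T} _ _ _ A₀ ω Ω hω hΩ ↦ ?_⟩
  set Ω₀ : (Fin 3 → ℂ) [⋀^Fin 3]→L[ℝ] ℂ :=
    Ω.compContinuousLinearMap (A₀.symm : (Fin 3 → ℂ) →L[ℝ] T) with hΩ₀
  have hd : dist Ω₀ volForm < δ := by
    rw [dist_eq_norm]
    refine (ContinuousAlternatingMap.opNorm_le_bound _ (half_pos hδ).le fun w ↦ ?_).trans_lt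
      (half_lt_self hδ)
    have := hΩ fun j ↦ A₀.symm (w j)
    simp only [A₀.apply_symm_apply] at this
    exact this
  obtain ⟨A, J', θ, f, hf, hJ, hre, hθ, hom, e1, e2, e3⟩ := h hd
  have hk : ∀ u v, ω ![A₀.symm u, A₀.symm v] = kahlerForm ![u, v] := fun u v ↦ by
    rw [hω, A₀.apply_symm_apply, A₀.apply_symm_apply]; rfl
  have hk' : ∀ u v, ω ![u, v] = kahlerForm ![A₀ u, A₀ v] := fun u v ↦ hω u v
  have hO : ∀ w, Ω w = Ω₀ fun j ↦ A₀ (w j) := fun w ↦ by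
    change _ = Ω fun j ↦ A₀.symm (A₀ (w j))
    simp only [A₀.symm_apply_apply]
  refine ⟨A₀.trans A, fun v ↦ A₀.symm (J' (A₀ v)), fun w ↦ θ fun j ↦ A₀ (w j), f, hf,
    fun v ↦ ?_, fun w ↦ ?_, fun w ↦ ?_, fun u v ↦ ?_, ?_, ?_, ?_⟩
  · simp [hJ]
  · rw [hO, hre]; rfl
  · exact hθ _
  · rw [hk', hk', A₀.apply_symm_apply, A₀.apply_symm_apply, hom]; rfl
  · refine lt_of_eq_of_lt ?_ e1
    simp only [formNorm, hO]
    simp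
  · refine lt_of_eq_of_lt ?_ e2
    simp only [formNorm, hk']
    simp
  · refine lt_of_eq_of_lt ?_ e3
    have hv (a b c : T) : (fun j ↦ A₀ (![a, b, c] j)) = ![A₀ a, A₀ b, A₀ c] := by
      ext1 j; fin_cases j <;> rfl
    simp only [formNorm, hO, hk', wedgeCube, wedge33, hv]
    simp

/-! ### Dilations of cones and the interpolating 3-form -/

section Shrink

variable {d : ℕ} {Γ : Type*} [TopologicalSpace Γ] [ChartedSpace (Eu d) Γ]

theorem hasMFDerivAt_shrink (t : ℝ) (p : Γ × ℝ) :
    HasMFDerivAt (coneModel d) (coneModel d) (shrink t) p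
      ((ContinuousLinearMap.id ℝ (Eu d)).prodMap (t⁻¹ • ContinuousLinearMap.id ℝ ℝ) :
        Eu d × ℝ →L[ℝ] Eu d × ℝ) := by
  have h1 : HasMFDerivAt (𝓡 d) (𝓡 d) (id : Γ → Γ) p.1 (ContinuousLinearMap.id ℝ _) :=
    hasMFDerivAt_id p.1
  have h2 : HasMFDerivAt 𝓘(ℝ, ℝ) 𝓘(ℝ, ℝ) (fun r : ℝ ↦ t⁻¹ * r) p.2
      (t⁻¹ • ContinuousLinearMap.id ℝ ℝ) := by
    refine HasFDerivAt.hasMFDerivAt ?_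
    exact (hasFDerivAt_id p.2).const_mul t⁻¹
  have h := h1.prodMap h2
  rw [h1.mfderiv, h2.mfderiv] at h
  exact h

theorem mfderiv_shrink (t : ℝ) (p : Γ × ℝ) (v : Eu d × ℝ) :
    (mfderiv (coneModel d) (coneModel d) (shrink t) p : Eu d × ℝ →L[ℝ] Eu d × ℝ) v =
      (v.1, t⁻¹ * v.2) := by
  have h := (hasMFDerivAt_shrink (d := d) t p).mfderiv
  exact DFunLike.congr_fun (F := Eu d × ℝ →L[ℝ] Eu d × ℝ) h v

theorem contMDiff_shrink (t : ℝ) :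
    ContMDiff (coneModel d) (coneModel d) ∞ (shrink t : Γ × ℝ → Γ × ℝ) := by
  refine contMDiff_fst.prodMk ?_
  have : ContMDiff 𝓘(ℝ, ℝ) 𝓘(ℝ, ℝ) ∞ (fun r : ℝ ↦ t⁻¹ * r) :=
    (contDiff_const.mul contDiff_id).contMDiff
  exact this.comp contMDiff_snd

theorem mfderiv_radial {f : ℝ → ℝ} {p : Γ × ℝ} (hf : DifferentiableAt ℝ f p.2) (v : Eu d × ℝ) :
    dFun (coneModel d) (fun q : Γ × ℝ ↦ f q.2) p v = deriv f p.2 * v.2 := by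
  have h1 : HasMFDerivAt 𝓘(ℝ, ℝ) 𝓘(ℝ, ℝ) f p.2 (fderiv ℝ f p.2) := hf.hasFDerivAt.hasMFDerivAt
  have h2 := (h1.comp p (hasMFDerivAt_snd (I := 𝓡 d) (I' := 𝓘(ℝ, ℝ)) p)).mfderiv
  have h3 := DFunLike.congr_fun (F := Eu d × ℝ →L[ℝ] ℝ) h2 v
  refine h3.trans ?_
  change fderiv ℝ f p.2 v.2 = _
  rw [fderiv_eq_smul_deriv, smul_eq_mul, mul_comm]

end Shrink

section Cone

variable {Γ : Type*} [TopologicalSpace Γ] [ChartedSpace (Eu 5) Γ]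
  {V : Triple (coneModel 5) (Γ × ℝ)}

namespace IsCalabiYauCone

/-- Homogeneity of the cone: both r² and r dr scale by the square of the dilation factor. -/
theorem omega_shrink (hV : IsCalabiYauCone V) {t : ℝ} (ht : 0 < t) {p : Γ × ℝ} (hp : 0 < p.2) :
    V.ω.pullback (I := coneModel 5) (shrink t) p = (t⁻¹) ^ 2 • V.ω p := by
  obtain ⟨α, hα⟩ := hV.omega_eq
  obtain ⟨γ, r⟩ := p
  ext w
  have e1 := hα γ r hp (fun j ↦ (w j : Eu 5 × ℝ).1) (fun j ↦ (w j : Eu 5 × ℝ).2)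
  have e2 := hα γ (t⁻¹ * r) (by have : 0 < r := hp; positivity) (fun j ↦ (w j : Eu 5 × ℝ).1)
    (fun j ↦ t⁻¹ * (w j : Eu 5 × ℝ).2)
  have h2 : V.ω.pullback (I := coneModel 5) (shrink t) (γ, r) w =
      V.ω (γ, t⁻¹ * r) (fun j ↦ (((w j : Eu 5 × ℝ).1, t⁻¹ * (w j : Eu 5 × ℝ).2) : Eu 5 × ℝ)) := by
    change V.ω (γ, t⁻¹ * r) (fun j ↦ (mfderiv (coneModel 5) (coneModel 5) (shrink t) (γ, r) :
      Eu 5 × ℝ →L[ℝ] Eu 5 × ℝ) (w j)) = _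
    congr 1
    ext1 j
    exact mfderiv_shrink t (γ, r) (w j)
  change _ = (t⁻¹) ^ 2 * V.ω (γ, r) (fun j ↦ (((w j : Eu 5 × ℝ).1, (w j : Eu 5 × ℝ).2) : Eu 5 × ℝ))
  rw [h2, e2, e1]
  ring

theorem Omega_shrink (hV : IsCalabiYauCone V) {t : ℝ} (ht : 0 < t) {p : Γ × ℝ} (hp : 0 < p.2) :
    V.Ω.pullback (I := coneModel 5) (shrink t) p = (t⁻¹) ^ 3 • V.Ω p := by
  obtain ⟨β, hβ⟩ := hV.Omega_eq
  obtain ⟨γ, r⟩ := p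
  ext w
  have e1 := hβ γ r hp (fun j ↦ (w j : Eu 5 × ℝ).1) (fun j ↦ (w j : Eu 5 × ℝ).2)
  have e2 := hβ γ (t⁻¹ * r) (by have : 0 < r := hp; positivity) (fun j ↦ (w j : Eu 5 × ℝ).1)
    (fun j ↦ t⁻¹ * (w j : Eu 5 × ℝ).2)
  have h2 : V.Ω.pullback (I := coneModel 5) (shrink t) (γ, r) w =
      V.Ω (γ, t⁻¹ * r) (fun j ↦ (((w j : Eu 5 × ℝ).1, t⁻¹ * (w j : Eu 5 × ℝ).2) : Eu 5 × ℝ)) := by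
    change V.Ω (γ, t⁻¹ * r) (fun j ↦ (mfderiv (coneModel 5) (coneModel 5) (shrink t) (γ, r) :
      Eu 5 × ℝ →L[ℝ] Eu 5 × ℝ) (w j)) = _
    congr 1
    ext1 j
    exact mfderiv_shrink t (γ, r) (w j)
  change _ = ((t⁻¹) ^ 3 : ℝ) • V.Ω (γ, r)
    (fun j ↦ (((w j : Eu 5 × ℝ).1, (w j : Eu 5 × ℝ).2) : Eu 5 × ℝ))
  rw [h2, e2, e1, Complex.real_smul]
  push_cast
  ring

theorem metric_nonneg (hV : IsCalabiYauCone V) {p : Γ × ℝ} (hp : 0 < p.2)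
    (v : TangentSpace (coneModel 5) p) : 0 ≤ V.metric p v v := by
  obtain ⟨-, -, -, -, -, h⟩ := hV.cy
  obtain ⟨A, hJ, hω, -⟩ := h p hp
  rw [Triple.metric, hω, hJ]
  refine Finset.sum_nonneg fun j _ ↦ ?_
  have : (starRingEnd ℂ (A v j) * (Complex.I • A v) j).im = Complex.normSq (A v j) := by
    simp [Complex.normSq_apply]
  rw [this]
  exact Complex.normSq_nonneg _

theorem metric_shrink (hV : IsCalabiYauCone V) {t : ℝ} (ht : 0 < t) {p : Γ × ℝ} (hp : 0 < p.2)
    (v : Eu 5 × ℝ) : V.metric (shrink t p) ((v.1, t⁻¹ * v.2) : Eu 5 × ℝ)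
      ((v.1, t⁻¹ * v.2) : Eu 5 × ℝ) = (t⁻¹) ^ 2 * V.metric p v v := by
  obtain ⟨γ, r⟩ := p
  have e1 := hV.metric_eq γ r hp v.1 v.1 v.2 v.2
  have e2 := hV.metric_eq γ (t⁻¹ * r) (by have : 0 < r := hp; positivity) v.1 v.1
    (t⁻¹ * v.2) (t⁻¹ * v.2)
  have e1' : V.metric (γ, r) v v = _ := e1
  have e2' : V.metric (shrink t (γ, r)) ((v.1, t⁻¹ * v.2) : Eu 5 × ℝ)
      ((v.1, t⁻¹ * v.2) : Eu 5 × ℝ) = _ := e2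
  rw [e1', e2']
  ring

/-- The cone metric is the sum of dr² and a nonnegative tangential part, so dr has norm at most 1.
This is what bounds derivatives of the cut-off, which depends on r alone. -/
theorem abs_radial_le (hV : IsCalabiYauCone V) {p : Γ × ℝ} (hp : 0 < p.2) (v : Eu 5 × ℝ) :
    |v.2| ≤ √(V.metric p v v) := by
  obtain ⟨γ, r⟩ := p
  have e1 : V.metric (γ, r) v v = _ := hV.metric_eq γ r hp v.1 v.1 v.2 v.2
  rw [e1]
  refine Real.abs_le_sqrt ?_
  have := hV.metric_nonneg (p := (γ, 1)) zero_lt_one ((v.1, 0) : Eu 5 × ℝ)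
  nlinarith [sq_nonneg r]

end IsCalabiYauCone

variable [IsManifold (𝓡 5) ∞ Γ]

/-- At order zero no covariant derivative is left, and in the chart at `p` the frame at `p` is the
identity. -/
theorem CovNormLE.norm_le {d m : ℕ} {X F : Type*} [TopologicalSpace X] [ChartedSpace (Eu d) X]
    [IsManifold (𝓡 d) ∞ X] [NormedAddCommGroup F] [NormedSpace ℝ F]
    {g : ∀ p : X × ℝ, TangentSpace (coneModel d) p → TangentSpace (coneModel d) p → ℝ}
    {T : ∀ p : X × ℝ, (Fin m → TangentSpace (coneModel d) p) → F} {p : X × ℝ} {C : ℝ}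
    (h : CovNormLE (coneModel d) g T 0 p C) (w : Fin m → Eu d × ℝ) :
    ‖T p w‖ ≤ C * ∏ j, √(g p (w j) (w j)) := by
  have h1 := h w
  have : IsManifold (coneModel d) 1 (X × ℝ) := .of_le (n := ∞) (by simp)
  -- The point φ⁻¹(φ p) occurs in the types. It is replaced by a variable, together with the
  -- differential at it, so that both can be substituted at once.
  have key : ∀ q : X × ℝ, q = p → ∀ D : Eu d × ℝ →L[ℝ] Eu d × ℝ, D = ContinuousLinearMap.id ℝ _ →
      ‖T q (fun j ↦ D (w j))‖ ≤ C * ∏ j, √(g q (D (w j)) (D (w j))) →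
      ‖T p w‖ ≤ C * ∏ j, √(g p (w j) (w j)) := by
    rintro q rfl D rfl h
    exact h
  exact key _ (extChartAt_to_inv p) _ (mfderiv_extChartAt_symm_self (I := coneModel d) p) h1

/-- The 3-form `Ω_V + d[F(cr) A + t³ (1 - F(cr)) B(γ, t⁻¹ r)]`. -/
def interpForm (V : Triple (coneModel 5) (Γ × ℝ)) (F : ℝ → ℝ) (c t : ℝ)
    (A B : DForm (coneModel 5) (Γ × ℝ) ℂ 2) : DForm (coneModel 5) (Γ × ℝ) ℂ 3 := fun p ↦
  V.Ω p + DForm.d (I := coneModel 5) (M := Γ × ℝ) (F := ℂ) (k := 2) (fun q ↦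
    F (c * q.2) • A q + (t ^ 3 * (1 - F (c * q.2))) • B.pullback (I := coneModel 5) (shrink t) q) p

variable {F : ℝ → ℝ} {c t : ℝ} {A B : DForm (coneModel 5) (Γ × ℝ) ℂ 2} {p : Γ × ℝ}

theorem contMDiff_radial {f : ℝ → ℝ} (hf : ContDiff ℝ ∞ f) :
    ContMDiff (coneModel 5) 𝓘(ℝ, ℝ) ∞ (fun q : Γ × ℝ ↦ f q.2) :=
  hf.contMDiff.comp contMDiff_snd

theorem smoothAt_interp (hF : ContDiff ℝ ∞ F) (hA : A.SmoothAt p) (hB : B.SmoothAt (shrink t p)) :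
    DForm.SmoothAt (I := coneModel 5) (M := Γ × ℝ) (F := ℂ) (k := 2) (fun q ↦
      F (c * q.2) • A q + (t ^ 3 * (1 - F (c * q.2))) •
        B.pullback (I := coneModel 5) (shrink t) q) p := by
  refine DForm.SmoothAt.add ?_ ?_
  · exact DForm.SmoothAt.smul (contMDiff_radial (f := fun r ↦ F (c * r))
      (hF.comp (contDiff_const.mul contDiff_id))).contMDiffAt hA
  · exact DForm.SmoothAt.smul (contMDiff_radial (f := fun r ↦ t ^ 3 * (1 - F (c * r)))
      (contDiff_const.mul (contDiff_const.sub (hF.comp (contDiff_const.mul contDiff_id))))).contMDiffAt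
      (hB.pullback (contMDiff_shrink t).contMDiffAt)

theorem interpForm_apply (hF : ContDiff ℝ ∞ F) (hA : A.SmoothAt p) (hB : B.SmoothAt (shrink t p))
    (w : Fin 3 → Eu 5 × ℝ) : interpForm V F c t A B p w = V.Ω p w +
      ((F (c * p.2) • A.d p w + ∑ i : Fin 3, (-1 : ℝ) ^ (i : ℕ) •
        (deriv F (c * p.2) * c * (w i).2) • A p (i.removeNth w)) +
      ((t ^ 3 * (1 - F (c * p.2))) • B.d.pullback (I := coneModel 5) (shrink t) p w +
        ∑ i : Fin 3, (-1 : ℝ) ^ (i : ℕ) • (-(t ^ 3 * (deriv F (c * p.2) * c)) * (w i).2) •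
          B.pullback (I := coneModel 5) (shrink t) p (i.removeNth w))) := by
  have hF1 : ContDiff ℝ ∞ (fun r ↦ F (c * r)) := hF.comp (contDiff_const.mul contDiff_id)
  have hF2 : ContDiff ℝ ∞ (fun r ↦ t ^ 3 * (1 - F (c * r))) :=
    contDiff_const.mul (contDiff_const.sub hF1)
  have hB' := hB.pullback (I := coneModel 5) (contMDiff_shrink t (Γ := Γ) (d := 5)).contMDiffAt
  have d1 : deriv (fun r ↦ F (c * r)) p.2 = deriv F (c * p.2) * c := by
    have h := ((hF.differentiable (by simp)) (c * p.2)).hasDerivAt.comp p.2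
      ((hasDerivAt_id p.2).const_mul c)
    have h' := h.deriv
    rw [mul_one] at h'
    exact h'
  have d2 : deriv (fun r ↦ t ^ 3 * (1 - F (c * r))) p.2 = -(t ^ 3 * (deriv F (c * p.2) * c)) := by
    have h : DifferentiableAt ℝ (fun r ↦ F (c * r)) p.2 := hF1.differentiable (by simp) p.2
    rw [deriv_const_mul _ (h.const_sub 1), deriv_const_sub, d1]; ring
  have s1 := (contMDiff_radial (Γ := Γ) hF1).contMDiffAt (x := p)
  have s2 := (contMDiff_radial (Γ := Γ) hF2).contMDiffAt (x := p)
  have e1 := DForm.d_smul_apply s1 hA w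
  have e2 := DForm.d_smul_apply s2 hB' w
  have e3 := DForm.d_add (hA.smul s1) (hB'.smul s2)
  have r1 := fun v ↦ mfderiv_radial (d := 5) (Γ := Γ) (p := p) (hF1.differentiable (by simp) p.2) v
  have r2 := fun v ↦ mfderiv_radial (d := 5) (Γ := Γ) (p := p) (hF2.differentiable (by simp) p.2) v
  rw [d1] at r1
  rw [d2] at r2
  simp only [r1] at e1
  simp only [r2] at e2
  have e4 := DForm.d_pullback hB (contMDiff_shrink t (Γ := Γ) (d := 5)).contMDiffAt
  rw [e4] at e2
  change V.Ω p w + _ = _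
  refine congrArg (V.Ω p w + ·) ?_
  refine (DFunLike.congr_fun e3 w).trans ?_
  exact congrArg₂ (· + ·) e1 e2

/-- Closedness is automatic: the cone form is closed and what is added is exact. This is why the
primitives `A` and `B` are interpolated and not the 3-forms themselves. -/
theorem smoothAt_interpForm (hV : IsCalabiYauCone V) (hF : ContDiff ℝ ∞ F) (hp : 0 < p.2)
    (hA : ∀ᶠ q in 𝓝 p, A.SmoothAt q) (hB : ∀ᶠ q in 𝓝 p, B.SmoothAt (shrink t q)) :
    (interpForm V F c t A B).SmoothAt p ∧ (interpForm V F c t A B).d p = 0 := by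
  have h1 : ∀ᶠ q in 𝓝 p, DForm.SmoothAt (I := coneModel 5) (M := Γ × ℝ) (F := ℂ) (k := 2) (fun q ↦
      F (c * q.2) • A q + (t ^ 3 * (1 - F (c * q.2))) •
        B.pullback (I := coneModel 5) (shrink t) q) q := by
    filter_upwards [hA, hB] with q h1 h2 using smoothAt_interp hF h1 h2
  have h2 : V.Ω.SmoothAt p := hV.cy.2.2.1 p hp
  have h3 := DForm.smoothAt_d h1
  refine ⟨h2.add h3, ?_⟩
  refine (DForm.d_add h2 h3).trans ?_
  rw [hV.cy.2.2.2.2.1 p hp, DForm.d_d h1, add_zero]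

end Cone

/-! ### Estimates on the neck -/

section Cutoff

variable {F : ℝ → ℝ}

theorem cutoff_nonneg (hmono : Monotone F) (h0 : ∀ s ≤ 1, F s = 0) (s : ℝ) : 0 ≤ F s := by
  rw [← h0 (min s 1) (min_le_right _ _)]
  exact hmono (min_le_left _ _)

theorem cutoff_le_one (hmono : Monotone F) (h1 : ∀ s, 2 ≤ s → F s = 1) (s : ℝ) : F s ≤ 1 := by
  rw [← h1 (max s 2) (le_max_right _ _)]
  exact hmono (le_max_left _ _)

/-- The value 0 is the minimum of `F`, so the derivative also vanishes at the end point s = 1, where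
`F` is constant on one side only. -/
theorem deriv_cutoff_of_le (hmono : Monotone F) (h0 : ∀ s ≤ 1, F s = 0) {s : ℝ} (hs : s ≤ 1) : deriv F s = 0 := by
  refine IsLocalMin.deriv_eq_zero (Filter.Eventually.of_forall fun y ↦ ?_)
  rw [h0 s hs]
  exact cutoff_nonneg hmono h0 y

theorem deriv_cutoff_of_ge (hmono : Monotone F) (h1 : ∀ s, 2 ≤ s → F s = 1) {s : ℝ} (hs : 2 ≤ s) : deriv F s = 0 := by
  refine IsLocalMax.deriv_eq_zero (Filter.Eventually.of_forall fun y ↦ ?_)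
  rw [h1 s hs]
  exact cutoff_le_one hmono h1 y

theorem exists_deriv_cutoff_le (hF : ContDiff ℝ ∞ F) (hmono : Monotone F)
    (h0 : ∀ s ≤ 1, F s = 0) (h1 : ∀ s, 2 ≤ s → F s = 1) : ∃ K ≥ 0, ∀ s, |deriv F s| ≤ K := by
  obtain ⟨K, hK⟩ := (isCompact_Icc (a := (1 : ℝ)) (b := 2)).exists_bound_of_continuousOn
    (hF.continuous_deriv (by simp)).continuousOn
  refine ⟨max K 0, le_max_right _ _, fun s ↦ ?_⟩
  by_cases hs : s ∈ Icc (1 : ℝ) 2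
  · exact (hK s hs).trans (le_max_left _ _)
  · have : deriv F s = 0 := by
      rw [mem_Icc, not_and_or, not_le, not_le] at hs
      rcases hs with h | h
      · exact deriv_cutoff_of_le hmono h0 h.le
      · exact deriv_cutoff_of_ge hmono h1 h.le
    rw [this, abs_zero]
    exact le_max_right _ _

end Cutoff

/-! ### Distance of the interpolating 3-form from the cone form. -/

section Interp

variable {Γ : Type*} [TopologicalSpace Γ] [ChartedSpace (Eu 5) Γ] [IsManifold (𝓡 5) ∞ Γ]
  {V : Triple (coneModel 5) (Γ × ℝ)} {F : ℝ → ℝ} {c t : ℝ}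
  {A B : DForm (coneModel 5) (Γ × ℝ) ℂ 2} {p : Γ × ℝ}

/-- A bound for the summands with a derivative of the cut-off function. -/
theorem norm_sum_removeNth_le (hV : IsCalabiYauCone V) (hp : 0 < p.2) {k a : ℝ}
    {η : (Fin 2 → Eu 5 × ℝ) → ℂ} (ha : ∀ u, ‖η u‖ ≤ a * ∏ j, √(V.metric p (u j) (u j)))
    (w : Fin 3 → Eu 5 × ℝ) :
    ‖∑ i : Fin 3, (-1 : ℝ) ^ (i : ℕ) • (k * (w i).2) • η (i.removeNth w)‖ ≤
      3 * |k| * a * ∏ j, √(V.metric p (w j) (w j)) := by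
  have h : ∀ i : Fin 3, ‖(-1 : ℝ) ^ (i : ℕ) • (k * (w i).2) • η (i.removeNth w)‖ ≤
      |k| * a * ∏ j, √(V.metric p (w j) (w j)) := by
    intro i
    rw [norm_smul, norm_smul, norm_pow, norm_neg, norm_one, one_pow, one_mul, Real.norm_eq_abs,
      abs_mul, Fin.prod_univ_succAbove _ i]
    have h1 := hV.abs_radial_le hp (w i)
    have h2 := ha (i.removeNth w)
    calc |k| * |(w i).2| * ‖η (i.removeNth w)‖
        ≤ |k| * √(V.metric p (w i) (w i)) *
          (a * ∏ j, √(V.metric p (i.removeNth w j) (i.removeNth w j))) := by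
          gcongr
      _ = _ := by
          simp only [Fin.removeNth]
          ring
  refine (norm_sum_le _ _).trans ((Finset.sum_le_sum fun i _ ↦ h i).trans ?_)
  rw [Finset.sum_const, Finset.card_univ, Fintype.card_fin, nsmul_eq_mul]
  apply le_of_eq
  push_cast
  ring

/-- The dilation multiplies lengths by t⁻¹, hence each of the k slots contributes a factor t⁻¹. -/
theorem norm_pullback_shrink_le (hV : IsCalabiYauCone V) (ht : 0 < t) (hp : 0 < p.2) {k : ℕ} {b : ℝ}
    {η : DForm (coneModel 5) (Γ × ℝ) ℂ k}
    (hb : ∀ w, ‖η (shrink t p) w‖ ≤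
      b * ∏ j, √(V.metric (shrink t p) (w j) (w j))) (w : Fin k → Eu 5 × ℝ) :
    ‖η.pullback (I := coneModel 5) (shrink t) p w‖ ≤
      b * (t⁻¹) ^ k * ∏ j, √(V.metric p (w j) (w j)) := by
  have h2 : η.pullback (I := coneModel 5) (shrink t) p w =
      η (shrink t p) (fun j ↦ (((w j).1, t⁻¹ * (w j).2) : Eu 5 × ℝ)) := by
    change η (shrink t p) (fun j ↦ (mfderiv (coneModel 5) (coneModel 5) (shrink t) p :
      Eu 5 × ℝ →L[ℝ] Eu 5 × ℝ) (w j)) = _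
    congr 1
    ext1 j
    exact mfderiv_shrink t p (w j)
  rw [h2]
  refine (hb _).trans (le_of_eq ?_)
  rw [mul_assoc]
  congr 1
  have : ∀ j, √(V.metric (shrink t p) (((w j).1, t⁻¹ * (w j).2) : Eu 5 × ℝ)
      (((w j).1, t⁻¹ * (w j).2) : Eu 5 × ℝ)) = t⁻¹ * √(V.metric p (w j) (w j)) := fun j ↦ by
    rw [hV.metric_shrink ht hp, Real.sqrt_mul (by positivity), Real.sqrt_sq (by positivity)]
  rw [Finset.prod_congr rfl fun j _ ↦ this j, Finset.prod_mul_distrib, Finset.prod_const,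
    Finset.card_univ, Fintype.card_fin]

/-- The difference is F dA + dF ∧ A + t³(1-F) δ^*dB - t³ dF ∧ δ^*B, with δ the dilation by t⁻¹ and
|dF| ≤ K|c|. The factor t³ cancels the t⁻³ from the pullback of the 3-form dB, and leaves one t next
to the t⁻² from the 2-form B. The number 3 counts the slots in a wedge product with dF. -/
theorem norm_interpForm_sub_le (hV : IsCalabiYauCone V) (hF : ContDiff ℝ ∞ F)
    (hF0 : ∀ s, 0 ≤ F s) (hF1 : ∀ s, F s ≤ 1) {K : ℝ} (hK : ∀ s, |deriv F s| ≤ K)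
    (ht : 0 < t) (hp : 0 < p.2) (hA : A.SmoothAt p)
    (hB : B.SmoothAt (shrink t p)) {a a' b b' : ℝ} (ha0 : 0 ≤ a) (hb0 : 0 ≤ b)
    (ha : ∀ w, ‖A p w‖ ≤ a * ∏ j, √(V.metric p (w j) (w j)))
    (ha' : ∀ w, ‖A.d p w‖ ≤ a' * ∏ j, √(V.metric p (w j) (w j)))
    (hb : ∀ w, ‖B (shrink t p) w‖ ≤ b * ∏ j, √(V.metric (shrink t p) (w j) (w j)))
    (hb' : ∀ w, ‖B.d (shrink t p) w‖ ≤ b' * ∏ j, √(V.metric (shrink t p) (w j) (w j)))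
    (w : Fin 3 → Eu 5 × ℝ) :
    ‖interpForm V F c t A B p w - V.Ω p w‖ ≤
      (a' + 3 * (K * |c|) * a + (b' + 3 * (K * |c|) * (t * b))) *
        ∏ j, √(V.metric p (w j) (w j)) := by
  set G := ∏ j, √(V.metric p (w j) (w j)) with hG
  have hG0 : 0 ≤ G := Finset.prod_nonneg fun j _ ↦ Real.sqrt_nonneg _
  rw [interpForm_apply hF hA hB, add_sub_cancel_left]
  have hk : |deriv F (c * p.2) * c| ≤ K * |c| := by
    rw [abs_mul]; exact mul_le_mul_of_nonneg_right (hK _) (abs_nonneg _)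
  have n1 : ‖F (c * p.2) • A.d p w‖ ≤ a' * G := by
    rw [norm_smul, Real.norm_eq_abs, abs_of_nonneg (hF0 _)]
    calc F (c * p.2) * ‖A.d p w‖ ≤ 1 * (a' * G) := by
          gcongr
          · exact hF1 _
          · exact ha' w
      _ = _ := one_mul _
  have n2 := norm_sum_removeNth_le hV hp (k := deriv F (c * p.2) * c) ha w
  have n3 : ‖(t ^ 3 * (1 - F (c * p.2))) • B.d.pullback (I := coneModel 5) (shrink t) p w‖ ≤
      b' * G := by
    rw [norm_smul, Real.norm_eq_abs, abs_of_nonneg (mul_nonneg (by positivity)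
      (sub_nonneg.2 (hF1 _)))]
    have h := norm_pullback_shrink_le hV ht hp hb' w
    calc t ^ 3 * (1 - F (c * p.2)) * ‖B.d.pullback (I := coneModel 5) (shrink t) p w‖
        ≤ t ^ 3 * 1 * (b' * (t⁻¹) ^ 3 * G) := by
          gcongr
          linarith [hF0 (c * p.2)]
      _ = b' * G := by field_simp
  have n4 := norm_sum_removeNth_le hV hp (k := -(t ^ 3 * (deriv F (c * p.2) * c)))
    (fun u ↦ norm_pullback_shrink_le hV ht hp hb u) w
  have n2' : 3 * |deriv F (c * p.2) * c| * a * G ≤ 3 * (K * |c|) * a * G := by gcongr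
  have n4' : 3 * |(-(t ^ 3 * (deriv F (c * p.2) * c)))| * (b * (t⁻¹) ^ 2) * G ≤
      3 * (K * |c|) * (t * b) * G := by
    rw [abs_neg, abs_mul, abs_of_pos (by positivity : 0 < t ^ 3)]
    calc 3 * (t ^ 3 * |deriv F (c * p.2) * c|) * (b * (t⁻¹) ^ 2) * G
        ≤ 3 * (t ^ 3 * (K * |c|)) * (b * (t⁻¹) ^ 2) * G := by gcongr
      _ = _ := by field_simp
  refine (norm_add_le _ _).trans ((add_le_add ((norm_add_le _ _).trans (add_le_add n1 n2))
    ((norm_add_le _ _).trans (add_le_add n3 n4))).trans ?_)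
  linarith

end Interp

/-! ### The two scales of the neck. -/

section Scales

theorem tendsto_rpow_zero {α : ℝ} (hα : 0 < α) :
    Filter.Tendsto (fun t : ℝ ↦ t ^ α) (𝓝[>] 0) (𝓝 0) := by
  have h := (Real.continuousAt_rpow_const 0 α (.inr hα.le)).tendsto
  rw [Real.zero_rpow hα.ne'] at h
  exact h.mono_left nhdsWithin_le_nhds

theorem tendsto_rpow_div {α : ℝ} (hα : α < 1) :
    Filter.Tendsto (fun t : ℝ ↦ t ^ α / t) (𝓝[>] 0) Filter.atTop := by
  have h1 : Filter.Tendsto (fun t : ℝ ↦ (t⁻¹) ^ (1 - α)) (𝓝[>] 0) Filter.atTop :=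
    (tendsto_rpow_atTop (sub_pos.2 hα)).comp tendsto_inv_nhdsGT_zero
  refine h1.congr' ?_
  filter_upwards [self_mem_nhdsWithin] with t ht
  have ht : 0 < t := ht
  rw [Real.inv_rpow ht.le, ← Real.rpow_neg ht.le, neg_sub, Real.rpow_sub ht, Real.rpow_one]

end Scales

/-! ### The interpolating form of the construction -/

theorem ConicalCY.mem_source {n : ℕ} {M₀ : Type*} [TopologicalSpace M₀] {x : Fin n → M₀}
    [ChartedSpace (Eu 6) (Reg x)] {Γ : Fin n → Type*} [∀ i, TopologicalSpace (Γ i)]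
    [∀ i, ChartedSpace (Eu 5) (Γ i)] {V : ∀ i, Triple (coneModel 5) (Γ i × ℝ)}
    (X : ConicalCY x V) {i : Fin n} {p : Γ i × ℝ} (h0 : 0 < p.2) (h1 : p.2 < X.ε) :
    p ∈ (X.Φ i).source := by
  rw [X.Φ_source i]; exact ⟨h0, h1⟩

theorem ACCY.shrink_mem_source {G : Type*} [TopologicalSpace G] [ChartedSpace (Eu 5) G]
    {W : Triple (coneModel 5) (G × ℝ)} {N : Type*} [TopologicalSpace N] [ChartedSpace (Eu 6) N]
    {R : ℝ} (S : ACCY W N R) {t : ℝ} (ht : 0 < t) {p : G × ℝ} (hp : t * R < p.2) :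
    shrink t p ∈ S.Υ.source := by
  rw [S.Υ_source]
  change R < t⁻¹ * p.2
  rwa [lt_inv_mul_iff₀ ht]

section Geometry

variable {n : ℕ} {M₀ : Type*} [TopologicalSpace M₀] {x : Fin n → M₀} [ChartedSpace (Eu 6) (Reg x)]
  [IsManifold (𝓡 6) ∞ (Reg x)]
  {Γ : Fin n → Type*} [∀ i, TopologicalSpace (Γ i)] [∀ i, ChartedSpace (Eu 5) (Γ i)]
  [∀ i, IsManifold (𝓡 5) ∞ (Γ i)]
  {Y : Fin n → Type*} [∀ i, TopologicalSpace (Y i)] [∀ i, ChartedSpace (Eu 6) (Y i)]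
  [∀ i, IsManifold (𝓡 6) ∞ (Y i)]
  {V : ∀ i, Triple (coneModel 5) (Γ i × ℝ)} {X : ConicalCY x V} {R : ℝ}
  {Z : ∀ i, ACCY (V i) (Y i) R} (C : Choices X Z)

theorem ConicalCY.isDiffeo (X : ConicalCY x V) (i : Fin n) :
    IsDiffeo (coneModel 5) (𝓡 6) (X.Φ i) := ⟨X.Φ_smooth i, X.Φ_symm_smooth i⟩

section Single

variable {G : Type*} [TopologicalSpace G] [ChartedSpace (Eu 5) G] [IsManifold (𝓡 5) ∞ G]
  {W : Triple (coneModel 5) (G × ℝ)} {N : Type*} [TopologicalSpace N] [ChartedSpace (Eu 6) N]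
  [IsManifold (𝓡 6) ∞ N] (S : ACCY W N R)

theorem ACCY.isDiffeo : IsDiffeo (coneModel 5) (𝓡 6) S.Υ := ⟨S.Υ_smooth, S.Υ_symm_smooth⟩

theorem ACCY.pullback_Υt {k : ℕ} {F : Type*} [NormedAddCommGroup F] [NormedSpace ℝ F]
    (η : DForm (𝓡 6) N F k) {t : ℝ} (ht : 0 < t) {p : G × ℝ}
    (hp : t * R < p.2) : η.pullback (I := coneModel 5) (S.Υt t) p =
      (η.pullback (I := coneModel 5) S.Υ).pullback (I := coneModel 5) (shrink t) p :=
  DForm.pullback_comp (f := shrink t) η (S.isDiffeo.mdifferentiableAt (S.shrink_mem_source ht hp))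
    ((contMDiff_shrink t).contMDiffAt.mdifferentiableAt (by simp))

theorem DForm.pullback_congr_form {E H M E' H' M' F : Type*}
    [NormedAddCommGroup E] [NormedSpace ℝ E] [TopologicalSpace H] {I : ModelWithCorners ℝ E H}
    [TopologicalSpace M] [ChartedSpace H M]
    [NormedAddCommGroup E'] [NormedSpace ℝ E'] [TopologicalSpace H']
    {I' : ModelWithCorners ℝ E' H'} [TopologicalSpace M'] [ChartedSpace H' M']
    [NormedAddCommGroup F] [NormedSpace ℝ F] {k : ℕ} {η ζ : DForm I' M' F k} {f : M → M'} {x : M}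
    (h : η (f x) = ζ (f x)) : η.pullback (I := I) f x = ζ.pullback (I := I) f x := by
  simp only [DForm.pullback, h]

theorem ACCY.sq_smul_pullback_omega (hW : IsCalabiYauCone W) {t : ℝ} (ht : 0 < t) {p : G × ℝ}
    (hp : t * R < p.2) :
    t ^ 2 • S.S.ω.pullback (I := coneModel 5) (S.Υt t) p = W.ω p := by
  have h0 : 0 < p.2 := (mul_pos ht S.R_pos).trans hp
  rw [S.pullback_Υt _ ht hp, DForm.pullback_congr_form
    (S.symplectic _ (S.shrink_mem_source ht hp)), hW.omega_shrink ht h0, smul_smul, ← mul_pow,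
    mul_inv_cancel₀ ht.ne', one_pow, one_smul]

end Single

variable {C} {t : ℝ} {i : Fin n} {p : Γ i × ℝ}

theorem scaled_le_one (ht : 0 < t) {α r : ℝ} (h : r ≤ t ^ α) : t ^ (-α) * r ≤ 1 := by
  rw [Real.rpow_neg ht.le, inv_mul_le_iff₀ (Real.rpow_pos_of_pos ht α), mul_one]
  exact h

theorem two_le_scaled (ht : 0 < t) {α r : ℝ} (h : 2 * t ^ α ≤ r) : 2 ≤ t ^ (-α) * r := by
  rw [Real.rpow_neg ht.le, le_inv_mul_iff₀ (Real.rpow_pos_of_pos ht α)]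
  linarith

theorem Choices.A_smoothAt (C : Choices X Z) (h0 : 0 < p.2) (h1 : p.2 < X.ε) :
    (C.A i).SmoothAt p := C.A_smooth i p ⟨h0, h1⟩

theorem Choices.B_smoothAt (C : Choices X Z) (ht : 0 < t) (hp : t * R < p.2) :
    (C.B i).SmoothAt (shrink t p) := C.B_smooth i _ (by
  change R < t⁻¹ * p.2
  rwa [lt_inv_mul_iff₀ ht])

/-- For r ≤ t^α the cut-off and its derivative vanish. What remains is Ω_V + t³ δ^*dB, and Ω_V = t³
δ^*Ω_V by homogeneity. So `annulusForm` describes the glued 3-form on the inner side of the annulus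
as well, and there is no seam at r = t^α. -/
theorem Choices.annulusForm_inner (hV : IsCalabiYauCone (V i)) (ht : 0 < t)
    (hp : t * R < p.2) (hp' : p.2 ≤ t ^ C.α) (hε : p.2 < X.ε) :
    C.annulusForm t i p = t ^ 3 • (Z i).S.Ω.pullback (I := coneModel 5) ((Z i).Υt t) p := by
  have h0 : 0 < p.2 := (mul_pos ht (Z i).R_pos).trans hp
  have hs := scaled_le_one ht hp'
  have hR : R < (shrink t p).2 := by
    change R < t⁻¹ * p.2
    rwa [lt_inv_mul_iff₀ ht]
  ext w
  refine (interpForm_apply C.F_smooth (C.A_smoothAt h0 hε) (C.B_smoothAt ht hp) w).trans ?_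
  rw [C.F_zero _ hs, deriv_cutoff_of_le C.F_mono C.F_zero hs, (Z i).pullback_Υt _ ht hp,
    DForm.pullback_congr_form (ζ := fun q ↦ (V i).Ω q + (C.B i).d q) (C.dB i _ hR)]
  have h1 := hV.Omega_shrink ht h0
  have h2 : DForm.pullback (I := coneModel 5) (I' := coneModel 5) (shrink t)
      (fun q ↦ (V i).Ω q + (C.B i).d q) p = (V i).Ω.pullback (I := coneModel 5) (shrink t) p +
        (C.B i).d.pullback (I := coneModel 5) (shrink t) p := rfl
  rw [h2, h1, smul_add, smul_smul, ← mul_pow, mul_inv_cancel₀ ht.ne', one_pow, one_smul]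
  simp

/-- At the other end the cut-off is 1 with zero derivative, and Ω_V + dA is left; there is no seam
at r = 2t^α either. -/
theorem Choices.annulusForm_outer (ht : 0 < t)
    (hp : t * R < p.2) (hp' : 2 * t ^ C.α ≤ p.2) (hε : p.2 < X.ε) :
    C.annulusForm t i p = X.S.Ω.pullback (I := coneModel 5) (X.Φ i) p := by
  have h0 : 0 < p.2 := (mul_pos ht (Z i).R_pos).trans hp
  have hs := two_le_scaled ht hp'
  ext w
  refine (interpForm_apply C.F_smooth (C.A_smoothAt h0 hε) (C.B_smoothAt ht hp) w).trans ?_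
  rw [C.F_one _ hs, deriv_cutoff_of_ge C.F_mono C.F_one hs, C.dA i p h0 hε]
  simp

theorem Choices.annulusForm_smooth (hV : IsCalabiYauCone (V i)) (ht : 0 < t)
    (hp : t * R < p.2) (hε : p.2 < X.ε) :
    (C.annulusForm t i).SmoothAt p ∧ (C.annulusForm t i).d p = 0 := by
  have h0 : 0 < p.2 := (mul_pos ht (Z i).R_pos).trans hp
  have c2 : ContinuousAt (fun q : Γ i × ℝ ↦ q.2) p := continuous_snd.continuousAt
  refine smoothAt_interpForm hV C.F_smooth h0 ?_ ?_
  · filter_upwards [c2.eventually (lt_mem_nhds h0), c2.eventually (gt_mem_nhds hε)] with q h1 h2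
    exact C.A_smoothAt h1 h2
  · filter_upwards [c2.eventually (lt_mem_nhds hp)] with q h1
    exact C.B_smoothAt ht h1

variable (i) in
/-- On the annulus, the interpolating form is close to the volume form of the cone. -/
theorem Choices.eventually_annulusForm_close (C : Choices X Z) (hV : IsCalabiYauCone (V i)) {δ : ℝ}
    (hδ : 0 < δ) : ∀ᶠ t in 𝓝[>] (0 : ℝ), ∀ p : Γ i × ℝ, t ^ C.α ≤ p.2 → p.2 ≤ 2 * t ^ C.α →
      ∀ w, ‖C.annulusForm t i p w - (V i).Ω p w‖ ≤
        δ * ∏ j, √((V i).metric p (w j) (w j)) := by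
  obtain ⟨K, hK0, hK⟩ := exists_deriv_cutoff_le C.F_smooth C.F_mono C.F_zero C.F_one
  obtain ⟨cA, δA, hδA, hA⟩ := C.A_decay i 0
  obtain ⟨cΩ, δΩ, hδΩ, hΩ⟩ := X.Omega_decay i 0
  obtain ⟨cB, ρB, hB⟩ := C.B_decay i 0
  obtain ⟨cY, ρY, hY⟩ := (Z i).Omega_decay 0
  have hν := X.ν_pos
  have hlam := (Z i).rate_lt
  set lam := (Z i).rate with hlam'
  have T0 := tendsto_rpow_zero C.α_pos
  have T1 := tendsto_rpow_div C.α_lt_one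
  have T2 : Filter.Tendsto (fun t : ℝ ↦ 2 * t ^ C.α) (𝓝[>] 0) (𝓝 0) := by
    simpa using T0.const_mul 2
  have T3 : Filter.Tendsto (fun t : ℝ ↦ (2 * t ^ C.α) ^ X.ν) (𝓝[>] 0) (𝓝 0) := by
    have h := (Real.continuousAt_rpow_const 0 X.ν (.inr hν.le)).tendsto.comp T2
    rwa [Real.zero_rpow hν.ne'] at h
  have T4 : Filter.Tendsto (fun t : ℝ ↦ (t ^ C.α / t) ^ lam) (𝓝[>] 0) (𝓝 0) := by
    have h := (tendsto_rpow_neg_atTop (y := -lam) (by linarith)).comp T1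
    simp only [neg_neg] at h
    exact h
  -- The total error: dA and t^{-α}|A| are O((2t^α)^ν), where the extra 2 comes from t^{-α} r ≤ 2,
  -- and dB and t^{-α} t|B| are O((t^{α-1})^λ), where λ < 0.
  have T5 : Filter.Tendsto (fun t : ℝ ↦ (|cΩ| + 3 * K * (2 * |cA|)) * (2 * t ^ C.α) ^ X.ν +
      (|cY| + 3 * K * |cB|) * (t ^ C.α / t) ^ lam) (𝓝[>] 0) (𝓝 0) := by
    simpa using (T3.const_mul (|cΩ| + 3 * K * (2 * |cA|))).add
      (T4.const_mul (|cY| + 3 * K * |cB|))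
  filter_upwards [self_mem_nhdsWithin, T2.eventually (gt_mem_nhds hδA),
    T2.eventually (gt_mem_nhds hδΩ), T2.eventually (gt_mem_nhds X.ε_pos),
    T1.eventually (Filter.eventually_gt_atTop ρB), T1.eventually (Filter.eventually_gt_atTop ρY),
    T1.eventually (Filter.eventually_gt_atTop R), T5.eventually (gt_mem_nhds hδ)]
    with t ht h1 h2 h3 h4 h5 h6 h7 p hp1 hp2 w
  have ht : 0 < t := ht
  have hs : 0 < t ^ C.α := Real.rpow_pos_of_pos ht _
  have hp0 : 0 < p.2 := hs.trans_le hp1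
  have hpR : t * R < p.2 := by
    have := (lt_div_iff₀ ht).1 h6
    linarith
  have hpε : p.2 < X.ε := hp2.trans_lt h3
  have hsh : (shrink t p).2 = p.2 / t := by
    change t⁻¹ * p.2 = _
    rw [div_eq_inv_mul]
  have hsh0 : 0 < (shrink t p).2 := by rw [hsh]; positivity
  have hshge : t ^ C.α / t ≤ (shrink t p).2 := by rw [hsh]; gcongr
  have hshR : R < (shrink t p).2 := h6.trans_le hshge
  have bA := fun w ↦ (hA p hp0 (hp2.trans_lt h1)).norm_le w
  have bΩ := fun w ↦ (hΩ p hp0 (hp2.trans_lt h2)).norm_le w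
  have bB := fun w ↦ (hB (shrink t p) hsh0 (h4.trans_le hshge)).norm_le w
  have bY := fun w ↦ (hY (shrink t p) hsh0 (h5.trans_le hshge)).norm_le w
  -- As dA is the difference of the 3-form and the cone form, its bound is the zeroth order decay of
  -- that difference; the same holds for dB below.
  have dA : ∀ w, ‖(C.A i).d p w‖ ≤ |cΩ| * p.2 ^ X.ν * ∏ j, √((V i).metric p (w j) (w j)) := by
    intro w
    have := bΩ w
    rw [C.dA i p hp0 hpε] at this
    simp only [ContinuousAlternatingMap.add_apply, add_sub_cancel_left] at this
    refine this.trans ?_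
    rw [Nat.cast_zero, sub_zero]
    have hpr : 0 ≤ ∏ j, √((V i).metric p (w j) (w j)) :=
      Finset.prod_nonneg fun j _ ↦ Real.sqrt_nonneg _
    gcongr
    exact le_abs_self _
  have dB : ∀ w, ‖(C.B i).d (shrink t p) w‖ ≤ |cY| * (shrink t p).2 ^ lam *
      ∏ j, √((V i).metric (shrink t p) (w j) (w j)) := by
    intro w
    have := bY w
    rw [C.dB i _ hshR] at this
    simp only [ContinuousAlternatingMap.add_apply, add_sub_cancel_left] at this
    refine this.trans ?_
    rw [Nat.cast_zero, sub_zero]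
    have hpr : 0 ≤ ∏ j, √((V i).metric (shrink t p) (w j) (w j)) :=
      Finset.prod_nonneg fun j _ ↦ Real.sqrt_nonneg _
    gcongr
    exact le_abs_self _
  have aA : ∀ w, ‖C.A i p w‖ ≤ |cA| * p.2 ^ (X.ν + 1) * ∏ j, √((V i).metric p (w j) (w j)) := by
    intro w
    refine (bA w).trans ?_
    rw [Nat.cast_zero, sub_zero]
    have hpr : 0 ≤ ∏ j, √((V i).metric p (w j) (w j)) :=
      Finset.prod_nonneg fun j _ ↦ Real.sqrt_nonneg _
    gcongr
    exact le_abs_self _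
  have aB : ∀ w, ‖C.B i (shrink t p) w‖ ≤ |cB| * (shrink t p).2 ^ (lam + 1) *
      ∏ j, √((V i).metric (shrink t p) (w j) (w j)) := by
    intro w
    refine (bB w).trans ?_
    rw [Nat.cast_zero, sub_zero]
    have hpr : 0 ≤ ∏ j, √((V i).metric (shrink t p) (w j) (w j)) :=
      Finset.prod_nonneg fun j _ ↦ Real.sqrt_nonneg _
    gcongr
    exact le_abs_self _
  have main := norm_interpForm_sub_le (c := t ^ (-C.α)) hV C.F_smooth
    (cutoff_nonneg C.F_mono C.F_zero) (cutoff_le_one C.F_mono C.F_one) hK ht hp0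
    (C.A_smoothAt hp0 hpε) (C.B_smoothAt ht hpR) (by positivity) (by positivity) aA dA aB dB w
  refine main.trans ?_
  have hpr : 0 ≤ ∏ j, √((V i).metric p (w j) (w j)) :=
    Finset.prod_nonneg fun j _ ↦ Real.sqrt_nonneg _
  refine mul_le_mul_of_nonneg_right (le_trans ?_ h7.le) hpr
  have hc : |t ^ (-C.α)| = (t ^ C.α)⁻¹ := by
    rw [Real.rpow_neg ht.le, abs_of_pos (inv_pos.2 hs)]
  rw [hc]
  have i1 : p.2 ^ X.ν ≤ (2 * t ^ C.α) ^ X.ν := Real.rpow_le_rpow hp0.le hp2 hν.le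
  have i2 : (t ^ C.α)⁻¹ * p.2 ^ (X.ν + 1) ≤ 2 * (2 * t ^ C.α) ^ X.ν := by
    rw [Real.rpow_add hp0, Real.rpow_one, inv_mul_le_iff₀ hs]
    calc p.2 ^ X.ν * p.2 ≤ (2 * t ^ C.α) ^ X.ν * (2 * t ^ C.α) := by gcongr
      _ = _ := by ring
  have hq : 0 < t ^ C.α / t := by positivity
  have i3 : (shrink t p).2 ^ lam ≤ (t ^ C.α / t) ^ lam :=
    Real.rpow_le_rpow_of_nonpos hq hshge (by linarith)
  -- With q the radius measured in `Y i`, the factor t^{-α} t is the inverse of t^α / t, and it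
  -- absorbs one power of q ≥ t^α / t in q^{λ+1}.
  have i4 : (t ^ C.α)⁻¹ * (t * (shrink t p).2 ^ (lam + 1)) ≤ (t ^ C.α / t) ^ lam := by
    have : (shrink t p).2 ^ (lam + 1) ≤ (t ^ C.α / t) ^ (lam + 1) :=
      Real.rpow_le_rpow_of_nonpos hq hshge (by linarith)
    rw [Real.rpow_add hq, Real.rpow_one] at this
    calc (t ^ C.α)⁻¹ * (t * (shrink t p).2 ^ (lam + 1))
        ≤ (t ^ C.α)⁻¹ * (t * ((t ^ C.α / t) ^ lam * (t ^ C.α / t))) := by gcongr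
      _ = _ := by field_simp
  have j2 : 3 * (K * (t ^ C.α)⁻¹) * (|cA| * p.2 ^ (X.ν + 1)) ≤
      3 * K * |cA| * (2 * (2 * t ^ C.α) ^ X.ν) := by
    calc _ = 3 * K * |cA| * ((t ^ C.α)⁻¹ * p.2 ^ (X.ν + 1)) := by ring
      _ ≤ _ := by gcongr
  have j4 : 3 * (K * (t ^ C.α)⁻¹) * (t * (|cB| * (shrink t p).2 ^ (lam + 1))) ≤
      3 * K * |cB| * (t ^ C.α / t) ^ lam := by
    calc _ = 3 * K * |cB| * ((t ^ C.α)⁻¹ * (t * (shrink t p).2 ^ (lam + 1))) := by ring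
      _ ≤ _ := by gcongr
  have j1 : |cΩ| * p.2 ^ X.ν ≤ |cΩ| * (2 * t ^ C.α) ^ X.ν := by gcongr
  have j3 : |cY| * (shrink t p).2 ^ lam ≤ |cY| * (t ^ C.α / t) ^ lam := by gcongr
  linarith

end Geometry

/-! ### The topology of the glued 6-fold -/

theorem isDiffeo_shrinkHomeo {d : ℕ} {A : Type*} [TopologicalSpace A] [ChartedSpace (Eu d) A] {t : ℝ}
    (ht : 0 < t) : IsDiffeo (coneModel d) (coneModel d)
      (shrinkHomeo A ht).toOpenPartialHomeomorph := by
  refine ⟨(contMDiff_shrink t).contMDiffOn, ?_⟩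
  have h : ∀ p, (shrinkHomeo A ht).symm p = shrink t⁻¹ p := fun p ↦ by
    change (p.1, (t⁻¹)⁻¹ * p.2) = _
    rfl
  exact ((contMDiff_shrink t⁻¹).congr h).contMDiffOn

section Geometry

variable {n : ℕ} {M₀ : Type*} [TopologicalSpace M₀] {x : Fin n → M₀} [ChartedSpace (Eu 6) (Reg x)]
  {Γ : Fin n → Type*} [∀ i, TopologicalSpace (Γ i)] [∀ i, ChartedSpace (Eu 5) (Γ i)]
  {Y : Fin n → Type*} [∀ i, TopologicalSpace (Y i)] [∀ i, ChartedSpace (Eu 6) (Y i)]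
  {V : ∀ i, Triple (coneModel 5) (Γ i × ℝ)} {X : ConicalCY x V} {R : ℝ}
  {Z : ∀ i, ACCY (V i) (Y i) R}

theorem ConicalCY.Φ_inj (X : ConicalCY x V) {i j : Fin n} {p : Γ i × ℝ} {q : Γ j × ℝ}
    (hp : p ∈ (X.Φ i).source) (hq : q ∈ (X.Φ j).source) (h : X.Φ i p = X.Φ j q) :
    (⟨i, p⟩ : Σ i, Γ i × ℝ) = ⟨j, q⟩ := by
  by_cases hij : i = j
  · subst hij
    rw [(X.Φ i).injOn hp hq h]
  · exact absurd (h ▸ (X.Φ j).map_source hq)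
      (Set.disjoint_left.1 (X.Φ_disjoint i j hij) ((X.Φ i).map_source hp))

section Single

variable {G : Type*} [TopologicalSpace G] [ChartedSpace (Eu 5) G]
  {W : Triple (coneModel 5) (G × ℝ)} {N : Type*} [TopologicalSpace N] [ChartedSpace (Eu 6) N]
  (S : ACCY W N R)

theorem ACCY.Υt_mem_target {t : ℝ} (ht : 0 < t) {p : G × ℝ} (hp : t * R < p.2) :
    S.Υt t p ∈ S.Υ.target := S.Υ.map_source (S.shrink_mem_source ht hp)

theorem ACCY.Υt_inj {t : ℝ} (ht : 0 < t) {p q : G × ℝ} (hp : t * R < p.2) (hq : t * R < q.2)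
    (h : S.Υt t p = S.Υt t q) : p = q := by
  have h1 := S.Υ.injOn (S.shrink_mem_source ht hp) (S.shrink_mem_source ht hq) h
  exact (shrinkHomeo G ht).injective h1

theorem ACCY.exists_Υt {t : ℝ} (ht : 0 < t) {y : N} (hy : y ∈ S.Υ.target) :
    ∃ p : G × ℝ, t * R < p.2 ∧ S.Υt t p = y := by
  refine ⟨(shrinkHomeo G ht).symm (S.Υ.symm y), ?_, ?_⟩
  · have h := S.Υ.map_target hy
    rw [S.Υ_source] at h
    have h' : R < (S.Υ.symm y).2 := h
    have h2 : ((shrinkHomeo G ht).symm (S.Υ.symm y)).2 = t * (S.Υ.symm y).2 := by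
      change (t⁻¹)⁻¹ * (S.Υ.symm y).2 = _
      rw [inv_inv]
    rw [h2]
    exact mul_lt_mul_of_pos_left h' ht
  · change S.Υ ((shrinkHomeo G ht) ((shrinkHomeo G ht).symm (S.Υ.symm y))) = y
    rw [Homeomorph.apply_symm_apply, S.Υ.right_inv hy]

theorem ACCY.isCompact_compl (hs : R ≤ s) : IsCompact (S.Υ '' {p | s < p.2})ᶜ := by
  obtain ⟨K, hK, hKs⟩ := Filter.mem_cocompact.1 (S.end_basis.mem_of_mem hs)
  refine hK.of_isClosed_subset (IsOpen.isClosed_compl ?_) (Set.compl_subset_comm.1 hKs)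
  refine S.Υ.isOpen_image_of_subset_source (isOpen_lt continuous_const continuous_snd) ?_
  intro p hp
  rw [S.Υ_source]
  exact hs.trans_lt hp

end Single

theorem ConicalCY.isOpen_insert [T1Space M₀] (X : ConicalCY x V) (i : Fin n) {c : ℝ} (hc : 0 < c)
    (hcε : c ≤ X.ε) :
    IsOpen (insert (x i) ((fun p ↦ (X.Φ i p : M₀)) '' {p | 0 < p.2 ∧ p.2 < c})) := by
  have hreg : IsOpen {p : M₀ | ∀ i, p ≠ x i} := by
    rw [Set.ofPred_forall]
    exact isOpen_iInter_of_finite fun i ↦ isOpen_ne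
  have hemb : Topology.IsOpenEmbedding (Subtype.val : Reg x → M₀) := hreg.isOpenEmbedding_subtypeVal
  have h1 : IsOpen ((fun p ↦ (X.Φ i p : M₀)) '' {p | 0 < p.2 ∧ p.2 < c}) := by
    have h2 : IsOpen (X.Φ i '' {p | 0 < p.2 ∧ p.2 < c}) := by
      refine (X.Φ i).isOpen_image_of_subset_source
        ((isOpen_lt continuous_const continuous_snd).inter
          (isOpen_lt continuous_snd continuous_const)) ?_
      exact fun p hp ↦ X.mem_source hp.1 (hp.2.trans_le hcε)
    have := hemb.isOpenMap _ h2
    rwa [image_image] at this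
  rw [isOpen_iff_mem_nhds]
  rintro q (rfl | hq)
  · exact (X.Φ_basis i).mem_of_mem ⟨hc, hcε⟩
  · exact Filter.mem_of_superset (h1.mem_nhds hq) (subset_insert _ _)

/-- Seen in `M₀` this set is closed, being the complement of open neighbourhoods of all the `x i`,
and `M₀` is compact. -/
theorem ConicalCY.isCompact_outside [T1Space M₀] [CompactSpace M₀] (X : ConicalCY x V) {c : ℝ}
    (hc : 0 < c) (hcε : c ≤ X.ε) :
    IsCompact {q : Reg x | ∀ i, q ∉ X.Φ i '' {p | 0 < p.2 ∧ p.2 < c}} := by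
  rw [Subtype.isCompact_iff]
  have h : IsClosed (⋃ i, insert (x i) ((fun p ↦ (X.Φ i p : M₀)) '' {p | 0 < p.2 ∧ p.2 < c}))ᶜ :=
    (isOpen_iUnion fun i ↦ X.isOpen_insert i hc hcε).isClosed_compl
  convert! h.isCompact using 1
  ext q
  constructor
  · rintro ⟨q, hq, rfl⟩ h
    obtain ⟨i, hi | ⟨p, hp, e⟩⟩ := mem_iUnion.1 h
    · exact q.2 i hi
    · exact hq i ⟨p, hp, Subtype.ext e⟩
  · intro h
    have h' := fun i hi ↦ h (mem_iUnion.2 ⟨i, hi⟩)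
    exact ⟨⟨q, fun i e ↦ h' i (.inl e)⟩, fun i ⟨p, hp, e⟩ ↦ h' i (.inr ⟨p, hp, congrArg Subtype.val e⟩), rfl⟩

variable [T2Space M₀] [∀ i, CompactSpace (Γ i)] [∀ i, T2Space (Y i)] {α t : ℝ}
  (ht : Admissible R X.ε α t)

namespace Admissible

theorem scale_pos (ht : Admissible R X.ε α t) : 0 < t ^ α := Real.rpow_pos_of_pos ht.pos α

variable {ht} {i : Fin n} {p : Γ i × ℝ}

/-- This and the following lemmas translate membership in the pieces of the gluing, and in their
overlap, into inequalities for the radius. -/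
theorem Φ_mem_Q_iff (h0 : 0 < p.2) (h1 : p.2 < X.ε) :
    X.Φ i p ∈ (glueData X Z ht).Q ↔ t ^ α < p.2 := by
  constructor
  · intro h
    by_contra hc
    exact h i ⟨p, ⟨h0, not_lt.1 hc⟩, rfl⟩
  · rintro h j ⟨q, ⟨hq0, hq1⟩, e⟩
    have hq : q.2 < X.ε := by linarith [ht.right, ht.scale_pos]
    have := X.Φ_inj (X.mem_source hq0 hq) (X.mem_source h0 h1) e
    cases this
    linarith

theorem Υt_mem_P_iff (hp : t * R < p.2) :
    (Z i).Υt t p ∈ (glueData X Z ht).P i ↔ p.2 < 2 * t ^ α := by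
  constructor
  · rintro (h | ⟨q, ⟨hq0, hq1⟩, e⟩)
    · exact absurd ((Z i).Υt_mem_target ht.pos hp) h
    · rwa [← (Z i).Υt_inj ht.pos hq0 hp e]
  · exact fun h ↦ .inr ⟨p, ⟨hp, h⟩, rfl⟩

theorem mem_source_iff {q : Reg x} : q ∈ ((glueData X Z ht).φ i).source ↔
    ∃ p ∈ annulus (Γ i) α t, X.Φ i p = q := by
  change q ∈ (annulusMap X Z α ht.pos i).source ↔ _
  simp only [annulusMap, OpenPartialHomeomorph.trans_source]
  constructor
  · rintro ⟨⟨⟨hq1, hq2⟩, -⟩, -⟩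
    exact ⟨(X.Φ i).symm q, hq2, (X.Φ i).right_inv hq1⟩
  · rintro ⟨p, hp, rfl⟩
    have h0 : 0 < p.2 := ht.scale_pos.trans hp.1
    have hs := X.mem_source (i := i) h0 (hp.2.trans ht.right)
    have hinv := (X.Φ i).left_inv hs
    refine ⟨⟨⟨(X.Φ i).map_source hs, ?_⟩, trivial⟩, ?_⟩
    · change (X.Φ i).symm (X.Φ i p) ∈ annulus (Γ i) α t
      rw [hinv]; exact hp
    · change shrink t ((X.Φ i).symm (X.Φ i p)) ∈ (Z i).Υ.source
      rw [hinv]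
      exact (Z i).shrink_mem_source ht.pos (ht.left.trans hp.1)

theorem φ_apply (hp : p ∈ annulus (Γ i) α t) :
    (glueData X Z ht).φ i (X.Φ i p) = (Z i).Υt t p := by
  have h0 : 0 < p.2 := ht.scale_pos.trans hp.1
  have hs := X.mem_source (i := i) h0 (hp.2.trans ht.right)
  change (Z i).Υ (shrink t ((X.Φ i).symm (X.Φ i p))) = _
  rw [(X.Φ i).left_inv hs]
  rfl

theorem mem_target_iff {y : Y i} : y ∈ ((glueData X Z ht).φ i).target ↔
    ∃ p ∈ annulus (Γ i) α t, (Z i).Υt t p = y := by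
  constructor
  · intro hy
    obtain ⟨p, hp, e⟩ := mem_source_iff.1 (((glueData X Z ht).φ i).map_target hy)
    exact ⟨p, hp, by rw [← φ_apply (ht := ht) hp, e, ((glueData X Z ht).φ i).right_inv hy]⟩
  · rintro ⟨p, hp, rfl⟩
    rw [← φ_apply (ht := ht) hp]
    exact ((glueData X Z ht).φ i).map_source (mem_source_iff.2 ⟨p, hp, rfl⟩)

theorem Υt_mem_target_iff (hp : t * R < p.2) : (Z i).Υt t p ∈ ((glueData X Z ht).φ i).target ↔
    p ∈ annulus (Γ i) α t := by
  rw [mem_target_iff]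
  constructor
  · rintro ⟨q, hq, e⟩
    rwa [← (Z i).Υt_inj ht.pos (ht.left.trans hq.1) hp e]
  · exact fun h ↦ ⟨p, h, rfl⟩

theorem disjoint_source (i j : Fin n) (hij : i ≠ j) :
    Disjoint ((glueData X Z ht).φ i).source ((glueData X Z ht).φ j).source := by
  refine (X.Φ_disjoint i j hij).mono ?_ ?_
  all_goals
    intro q hq
    obtain ⟨p, hp, rfl⟩ := mem_source_iff.1 hq
    exact (X.Φ _).map_source (X.mem_source (ht.scale_pos.trans hp.1) (hp.2.trans ht.right))

theorem inQ_eq_inP (hQ : Nonempty (glueData X Z ht).Q) (hP : Nonempty ((glueData X Z ht).P i))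
    (hp : p ∈ annulus (Γ i) α t) :
    (glueData X Z ht).inQ hQ (X.Φ i p) = (glueData X Z ht).inP i hP ((Z i).Υt t p) := by
  have h0 : 0 < p.2 := ht.scale_pos.trans hp.1
  exact ((glueData X Z ht).inQ_eq_inP hQ i hP
    ((Φ_mem_Q_iff h0 (hp.2.trans ht.right)).2 hp.1)
    ((Υt_mem_P_iff (ht.left.trans hp.1)).2 hp.2)).2 ⟨mem_source_iff.2 ⟨p, hp, rfl⟩, φ_apply hp⟩

theorem jQ_eq_jP {q : (glueData X Z ht).Q} {y : (glueData X Z ht).P i}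
    (hp : p ∈ annulus (Γ i) α t) (hq : X.Φ i p = q) (hy : (Z i).Υt t p = y) :
    (glueData X Z ht).jQ q = (glueData X Z ht).jP i y := by
  rw [GlueData.jQ_eq_jP, ← hq, ← hy]
  exact ⟨mem_source_iff.2 ⟨p, hp, rfl⟩, φ_apply hp⟩

-- The level r = (3/2) t^α inside the annulus separates the sides. A point of `Q` outside the
-- overlap is not in the region r ≤ (3/2) t^α, and a point of `P i` outside it is not in the region
-- r ≥ (3/2) t^α; both regions are closed.
variable (ht) in
theorem t2Space_Mt : T2Space (Mt X Z ht) := by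
  have hs := ht.scale_pos
  refine (glueData X Z ht).t2Space disjoint_source fun i ↦ ?_
  have h1 : 3 / 2 * t ^ α < X.ε := by linarith [ht.right]
  have h2 : R < 3 / 2 * t ^ α / t := by
    rw [lt_div_iff₀ ht.pos]; linarith [ht.left]
  refine ⟨(X.Φ i '' {p | 0 < p.2 ∧ p.2 ≤ 3 / 2 * t ^ α})ᶜ, ((Z i).Υ '' {p | 3 / 2 * t ^ α / t ≤ p.2})ᶜ,
    (X.isClosed_image i h1).isOpen_compl, ((Z i).isClosed_image h2).isOpen_compl, ?_, ?_, ?_⟩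
  · rintro q hq hqs ⟨p, ⟨hp0, hp1⟩, rfl⟩
    refine hqs (mem_source_iff.2 ⟨p, ⟨?_, by linarith⟩, rfl⟩)
    exact (Φ_mem_Q_iff hp0 (hp1.trans_lt h1)).1 hq
  · rintro y hy hyt ⟨p, hp, rfl⟩
    have hp : 3 / 2 * t ^ α / t ≤ p.2 := hp
    obtain ⟨q, hq, e⟩ := (Z i).exists_Υt ht.pos ((Z i).Υ.map_source
      (by rw [(Z i).Υ_source]; exact h2.trans_le hp))
    rw [← e] at hy hyt
    have h3 := (Υt_mem_P_iff hq).1 hy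
    refine hyt ((Υt_mem_target_iff hq).2 ⟨?_, h3⟩)
    have h4 : shrink t q = p := (Z i).Υ.injOn ((Z i).shrink_mem_source ht.pos hq)
      (by rw [(Z i).Υ_source]; exact h2.trans_le hp) e
    have h5 : p.2 = t⁻¹ * q.2 := by rw [← h4]; rfl
    rw [h5, div_eq_inv_mul] at hp
    have := le_of_mul_le_mul_left hp (inv_pos.2 ht.pos)
    linarith
  · intro q hq hqU
    obtain ⟨p, hp, rfl⟩ := mem_source_iff.1 hq
    rw [φ_apply hp]
    intro hW
    refine hW ⟨shrink t p, ?_, rfl⟩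
    change 3 / 2 * t ^ α / t ≤ t⁻¹ * p.2
    rw [div_eq_inv_mul]
    refine mul_le_mul_of_nonneg_left ?_ (inv_pos.2 ht.pos).le
    by_contra hc
    exact hqU ⟨p, ⟨hs.trans hp.1, (not_le.1 hc).le⟩, rfl⟩

-- The part of `M₀` outside r < (3/2) t^α and the parts of the `Y i` outside r > (7/4) t^α are
-- compact and lie in `Q` and `P i`. They cover because 3/2 ≤ 7/4: what one of them omits lies, by
-- way of the annulus, in the other.
variable (ht) in
theorem compactSpace_Mt [CompactSpace M₀] : CompactSpace (Mt X Z ht) := by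
  have hs := ht.scale_pos
  have h1 : 3 / 2 * t ^ α < X.ε := by linarith [ht.right]
  have h2 : R ≤ 7 / 4 * t ^ α / t := by
    rw [le_div_iff₀ ht.pos]; linarith [ht.left]
  have c1 := X.isCompact_outside (c := 3 / 2 * t ^ α) (by positivity) h1.le
  have c2 := fun i ↦ (Z i).isCompact_compl h2
  have c1' : IsCompact ((glueData X Z ht).jQ ''
      (Subtype.val ⁻¹' {q : Reg x | ∀ i, q ∉ X.Φ i '' {p | 0 < p.2 ∧ p.2 < 3 / 2 * t ^ α}})) := by
    refine IsCompact.image ?_ (glueData X Z ht).isOpenEmbedding_jQ.continuous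
    rw [Subtype.isCompact_iff, image_preimage_eq_inter_range, inter_eq_left.2]
    · exact c1
    · intro q hq
      rw [Subtype.range_coe]
      rintro i ⟨p, ⟨hp0, hp1⟩, e⟩
      exact hq i ⟨p, ⟨hp0, by linarith⟩, e⟩
  have c2' : ∀ i, IsCompact ((glueData X Z ht).jP i ''
      (Subtype.val ⁻¹' ((Z i).Υ '' {p | 7 / 4 * t ^ α / t < p.2})ᶜ)) := by
    intro i
    refine IsCompact.image ?_ ((glueData X Z ht).isOpenEmbedding_jP i).continuous
    rw [Subtype.isCompact_iff, image_preimage_eq_inter_range, inter_eq_left.2]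
    · exact c2 i
    · intro y hy
      rw [Subtype.range_coe]
      by_cases hyt : y ∈ (Z i).Υ.target
      · obtain ⟨p, hp, rfl⟩ := (Z i).exists_Υt ht.pos hyt
        refine (Υt_mem_P_iff hp).2 ?_
        by_contra hc
        refine hy ⟨shrink t p, ?_, rfl⟩
        change 7 / 4 * t ^ α / t < t⁻¹ * p.2
        rw [div_eq_inv_mul]
        exact mul_lt_mul_of_pos_left (by linarith) (inv_pos.2 ht.pos)
      · exact .inl hyt
  have key : (univ : Set (Mt X Z ht)) = (glueData X Z ht).jQ ''
      (Subtype.val ⁻¹' {q : Reg x | ∀ i, q ∉ X.Φ i '' {p | 0 < p.2 ∧ p.2 < 3 / 2 * t ^ α}}) ∪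
      ⋃ i, (glueData X Z ht).jP i ''
      (Subtype.val ⁻¹' ((Z i).Υ '' {p | 7 / 4 * t ^ α / t < p.2})ᶜ) := by
    refine (eq_univ_of_forall fun a ↦ ?_).symm
    have hout : ∀ (i : Fin n) (p : Γ i × ℝ), t * R < p.2 → p.2 ≤ 7 / 4 * t ^ α →
        (Z i).Υt t p ∉ (Z i).Υ '' {p | 7 / 4 * t ^ α / t < p.2} := by
      rintro i p hp hp' ⟨q, hq, e⟩
      have hq : 7 / 4 * t ^ α / t < q.2 := hq
      have h4 : q = shrink t p := (Z i).Υ.injOn (by rw [(Z i).Υ_source]; exact h2.trans_lt hq)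
        ((Z i).shrink_mem_source ht.pos hp) e
      rw [h4] at hq
      change _ < t⁻¹ * p.2 at hq
      rw [div_eq_inv_mul] at hq
      have := lt_of_mul_lt_mul_left hq (inv_pos.2 ht.pos).le
      linarith
    rcases (glueData X Z ht).exists_rep a with ⟨q, rfl⟩ | ⟨⟨i, y⟩, rfl⟩
    · by_cases hq : ∀ i, (q : Reg x) ∉ X.Φ i '' {p | 0 < p.2 ∧ p.2 < 3 / 2 * t ^ α}
      · exact .inl ⟨q, hq, rfl⟩
      · push Not at hq
        obtain ⟨i, p, ⟨hp0, hp1⟩, e⟩ := hq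
        have hp2 : t ^ α < p.2 := (Φ_mem_Q_iff (ht := ht) (Z := Z) hp0 (hp1.trans h1)).1 (e ▸ q.2)
        have hpR := ht.left.trans hp2
        have hpa : p ∈ annulus (Γ i) α t := ⟨hp2, by linarith⟩
        right
        rw [mem_iUnion]
        refine ⟨i, ⟨(Z i).Υt t p, (Υt_mem_P_iff hpR).2 hpa.2⟩, hout i p hpR (by linarith), ?_⟩
        exact (jQ_eq_jP hpa e rfl).symm
    · by_cases hy : (y : Y i) ∈ (Z i).Υ '' {p | 7 / 4 * t ^ α / t < p.2}
      · have hyt : (y : Y i) ∈ (Z i).Υ.target := by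
          obtain ⟨p, hp, e⟩ := hy
          rw [← e]
          exact (Z i).Υ.map_source (by rw [(Z i).Υ_source]; exact h2.trans_lt hp)
        obtain ⟨p, hp, e⟩ := (Z i).exists_Υt ht.pos hyt
        have hp2 : p.2 < 2 * t ^ α := (Υt_mem_P_iff (ht := ht) hp).1 (e ▸ y.2)
        have hp1 : 7 / 4 * t ^ α < p.2 := by
          by_contra hc
          exact hout i p hp (not_lt.1 hc) (e ▸ hy)
        have hpa : p ∈ annulus (Γ i) α t := ⟨by linarith, hp2⟩
        have hp0 := hs.trans hpa.1
        left
        refine ⟨⟨X.Φ i p, (Φ_mem_Q_iff hp0 (hp2.trans ht.right)).2 hpa.1⟩, ?_,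
          jQ_eq_jP hpa rfl e⟩
        rintro j ⟨p', ⟨hp0', hp1'⟩, e'⟩
        have := X.Φ_inj (X.mem_source hp0' (hp1'.trans h1))
          (X.mem_source hp0 (hp2.trans ht.right)) e'
        cases this
        linarith
      · right
        rw [mem_iUnion]
        exact ⟨i, y, hy, rfl⟩
  constructor
  rw [key]
  exact c1'.union (isCompact_iUnion c2')

end Admissible

end Geometry

/-! ### The nearly Calabi-Yau structure on the glued 6-fold -/

section Geometry

variable {n : ℕ} {M₀ : Type*} [TopologicalSpace M₀] {x : Fin n → M₀} [ChartedSpace (Eu 6) (Reg x)]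
  [IsManifold (𝓡 6) ∞ (Reg x)]
  {Γ : Fin n → Type*} [∀ i, TopologicalSpace (Γ i)] [∀ i, ChartedSpace (Eu 5) (Γ i)]
  [∀ i, IsManifold (𝓡 5) ∞ (Γ i)]
  {Y : Fin n → Type*} [∀ i, TopologicalSpace (Y i)] [∀ i, ChartedSpace (Eu 6) (Y i)]
  [∀ i, IsManifold (𝓡 6) ∞ (Y i)]
  {V : ∀ i, Triple (coneModel 5) (Γ i × ℝ)} {X : ConicalCY x V} {R : ℝ}
  {Z : ∀ i, ACCY (V i) (Y i) R} (C : Choices X Z)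
  [T2Space M₀] [∀ i, CompactSpace (Γ i)] [∀ i, T2Space (Y i)] {t : ℝ}

instance Admissible.isManifold_Mt {α : ℝ} (ht : Admissible R X.ε α t) :
    IsManifold (𝓡 6) ∞ (Mt X Z ht) := by
  refine (glueData X Z ht).isManifold_glued (fun i ↦ ?_) Admissible.disjoint_source
  exact (((X.isDiffeo i).symm.trans (.ofSet _)).trans
    (isDiffeo_shrinkHomeo ht.pos)).trans (Z i).isDiffeo

theorem Choices.OmegaQ_of_mem {C : Choices X Z} (ht : Admissible R X.ε C.α t) {i : Fin n}
    {p : Γ i × ℝ} (hp : p ∈ annulus (Γ i) C.α t) :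
    (C.OmegaQ t).pullback (I := coneModel 5) (X.Φ i) p = C.annulusForm t i p := by
  have h : ∃ z : (Σ i, Γ i × ℝ), z.2 ∈ annulus (Γ z.1) C.α t ∧ X.Φ z.1 z.2 = X.Φ i p :=
    ⟨⟨i, p⟩, hp, rfl⟩
  have hs : ∀ {j : Fin n} {q : Γ j × ℝ}, q ∈ annulus (Γ j) C.α t → q ∈ (X.Φ j).source :=
    fun hq ↦ X.mem_source (ht.scale_pos.trans hq.1) (hq.2.trans ht.right)
  have hc : h.choose = ⟨i, p⟩ := X.Φ_inj (hs h.choose_spec.1) (hs hp) h.choose_spec.2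
  have key : ∀ z : (Σ i, Γ i × ℝ), z = ⟨i, p⟩ →
      (pushAt (I := coneModel 5) (I' := 𝓡 6) (X.Φ z.1) z.2 (C.annulusForm t z.1 z.2) :
        Eu 6 [⋀^Fin 3]→L[ℝ] ℂ) =
      pushAt (I := coneModel 5) (I' := 𝓡 6) (X.Φ i) p (C.annulusForm t i p) := by
    rintro z rfl; rfl
  refine (X.isDiffeo i).pullback_of_eq_pushAt (hs hp) ?_
  exact (dif_pos h).trans (key _ hc)

theorem Choices.OmegaQ_of_notMem {C : Choices X Z} {q : Reg x}
    (hq : ∀ i, q ∉ X.Φ i '' annulus (Γ i) C.α t) : C.OmegaQ t q = X.S.Ω q := by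
  refine dif_neg ?_
  rintro ⟨⟨i, p⟩, hp, e⟩
  exact hq i ⟨p, hp, e⟩

/-- The case distinction in `OmegaQ` is invisible on the neck, since the interpolating form equals
the pullback of Ω₀ beyond the annulus. -/
theorem Choices.OmegaQ_pullback {C : Choices X Z} (ht : Admissible R X.ε C.α t) {i : Fin n}
    {p : Γ i × ℝ} (hp : t ^ C.α < p.2) (hε : p.2 < X.ε) :
    (C.OmegaQ t).pullback (I := coneModel 5) (X.Φ i) p = C.annulusForm t i p := by
  by_cases h2 : p.2 < 2 * t ^ C.α
  · exact Choices.OmegaQ_of_mem ht ⟨hp, h2⟩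
  · rw [Choices.annulusForm_outer ht.pos (ht.left.trans hp) (not_lt.1 h2) hε]
    refine DForm.pullback_congr_form (Choices.OmegaQ_of_notMem fun j hj ↦ ?_)
    obtain ⟨q, hq, e⟩ := hj
    have := X.Φ_inj (X.mem_source (ht.scale_pos.trans hq.1) (hq.2.trans ht.right))
      (X.mem_source (ht.scale_pos.trans hp) hε) e
    cases this
    exact h2 hq.2

variable {C} (ht : Admissible R X.ε C.α t)

theorem Admissible.pullback_inQ_Φ {F : Type*} [NormedAddCommGroup F] [NormedSpace ℝ F] {k : ℕ}
    (η : DForm (𝓡 6) (Mt X Z ht) F k) (hQ : Nonempty (glueData X Z ht).Q) {i : Fin n}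
    {p : Γ i × ℝ} (hp : t ^ C.α < p.2) (hε : p.2 < X.ε) :
    η.pullback (I := coneModel 5) ((X.Φ i).trans ((glueData X Z ht).inQ hQ)) p =
      (η.pullback (I := 𝓡 6) ((glueData X Z ht).inQ hQ)).pullback (I := coneModel 5) (X.Φ i) p := by
  have h0 := ht.scale_pos.trans hp
  refine DForm.pullback_comp (f := X.Φ i) (g := (glueData X Z ht).inQ hQ) η ?_
    ((X.isDiffeo i).mdifferentiableAt (X.mem_source h0 hε))
  refine ((glueData X Z ht).isDiffeo_inQ hQ).mdifferentiableAt ?_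
  rw [GlueData.inQ_source]
  exact (Admissible.Φ_mem_Q_iff h0 hε).2 hp

/-- The chart of the neck given by `Υ_t`. -/
def Admissible.neckP (i : Fin n) (hP : Nonempty ((glueData X Z ht).P i)) :
    OpenPartialHomeomorph (Γ i × ℝ) (Mt X Z ht) :=
  ((shrinkHomeo (Γ i) ht.pos).toOpenPartialHomeomorph.trans (Z i).Υ).trans
    ((glueData X Z ht).inP i hP)

/-- The chart of the neck given by `Φ`. -/
def Admissible.neckQ (i : Fin n) (hQ : Nonempty (glueData X Z ht).Q) :
    OpenPartialHomeomorph (Γ i × ℝ) (Mt X Z ht) :=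
  (X.Φ i).trans ((glueData X Z ht).inQ hQ)

theorem Admissible.isDiffeo_neckP (i : Fin n) (hP : Nonempty ((glueData X Z ht).P i)) :
    IsDiffeo (coneModel 5) (𝓡 6) (ht.neckP i hP) :=
  ((isDiffeo_shrinkHomeo ht.pos).trans (Z i).isDiffeo).trans ((glueData X Z ht).isDiffeo_inP i hP)

theorem Admissible.isDiffeo_neckQ (i : Fin n) (hQ : Nonempty (glueData X Z ht).Q) :
    IsDiffeo (coneModel 5) (𝓡 6) (ht.neckQ i hQ) :=
  (X.isDiffeo i).trans ((glueData X Z ht).isDiffeo_inQ hQ)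

theorem Admissible.mem_neckP {i : Fin n} {hP : Nonempty ((glueData X Z ht).P i)} {p : Γ i × ℝ}
    (hp : t * R < p.2) (hp' : p.2 < 2 * t ^ C.α) : p ∈ (ht.neckP i hP).source := by
  refine ⟨⟨trivial, (Z i).shrink_mem_source ht.pos hp⟩, ?_⟩
  rw [GlueData.inP_source]
  exact (Admissible.Υt_mem_P_iff hp).2 hp'

theorem Admissible.mem_neckQ {i : Fin n} {hQ : Nonempty (glueData X Z ht).Q} {p : Γ i × ℝ}
    (hp : t ^ C.α < p.2) (hp' : p.2 < X.ε) : p ∈ (ht.neckQ i hQ).source := by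
  have h0 := ht.scale_pos.trans hp
  refine ⟨X.mem_source h0 hp', ?_⟩
  rw [GlueData.inQ_source]
  exact (Admissible.Φ_mem_Q_iff h0 hp').2 hp

theorem Admissible.neckP_eq_neckQ {i : Fin n} {hP : Nonempty ((glueData X Z ht).P i)}
    {hQ : Nonempty (glueData X Z ht).Q} {p : Γ i × ℝ} (hp : p ∈ annulus (Γ i) C.α t) :
    ht.neckP i hP p = ht.neckQ i hQ p := (Admissible.inQ_eq_inP hQ hP hp).symm

theorem Admissible.pullback_neckP {F : Type*} [NormedAddCommGroup F] [NormedSpace ℝ F] {k : ℕ}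
    (η : DForm (𝓡 6) (Mt X Z ht) F k) {i : Fin n} (hP : Nonempty ((glueData X Z ht).P i))
    {p : Γ i × ℝ} (hp : t * R < p.2) (hp' : p.2 < 2 * t ^ C.α) :
    η.pullback (I := coneModel 5) (ht.neckP i hP) p =
      (η.pullback (I := 𝓡 6) ((glueData X Z ht).inP i hP)).pullback (I := coneModel 5)
        ((Z i).Υt t) p := by
  refine DForm.pullback_comp (f := (Z i).Υt t) (g := (glueData X Z ht).inP i hP) η ?_ ?_
  · refine ((glueData X Z ht).isDiffeo_inP i hP).mdifferentiableAt ?_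
    rw [GlueData.inP_source]
    exact (Admissible.Υt_mem_P_iff hp).2 hp'
  · exact ((isDiffeo_shrinkHomeo (A := Γ i) (d := 5) ht.pos).trans (Z i).isDiffeo).mdifferentiableAt
      (x := p) ⟨trivial, (Z i).shrink_mem_source ht.pos hp⟩

/-- A form on the glued space that is given on the neck by a single form. -/
theorem Admissible.form_pullback_neckP {F : Type*} [NormedAddCommGroup F] [NormedSpace ℝ F] {k : ℕ}
    {η : DForm (𝓡 6) (Reg x) F k} {ζ : ∀ i, DForm (𝓡 6) (Y i) F k} {i : Fin n}
    {θ : DForm (coneModel 5) (Γ i × ℝ) F k}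
    (hη : ∀ p : Γ i × ℝ, t ^ C.α < p.2 → p.2 < X.ε →
      η.pullback (I := coneModel 5) (X.Φ i) p = θ p)
    (hζ : ∀ p : Γ i × ℝ, t * R < p.2 → p.2 ≤ t ^ C.α →
      (ζ i).pullback (I := coneModel 5) ((Z i).Υt t) p = θ p)
    (hP : Nonempty ((glueData X Z ht).P i))
    {p : Γ i × ℝ} (hp : t * R < p.2) (hp' : p.2 < 2 * t ^ C.α) :
    ((glueData X Z ht).form η ζ).pullback (I := coneModel 5) (ht.neckP i hP) p = θ p := by
  by_cases h1 : p.2 ≤ t ^ C.α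
  · rw [ht.pullback_neckP _ hP hp hp', ← hζ p hp h1]
    refine DForm.pullback_congr_form (GlueData.form_pullback_inP _ _ _ i hP
      ((Admissible.Υt_mem_P_iff hp).2 hp') ?_)
    rw [Admissible.Υt_mem_target_iff hp]
    exact fun h ↦ absurd h.1 (not_lt.2 h1)
  · have h1 := not_le.1 h1
    have h0 := ht.scale_pos.trans h1
    have hε := hp'.trans ht.right
    have hQ : Nonempty (glueData X Z ht).Q := ⟨⟨_, (Admissible.Φ_mem_Q_iff (i := i) h0 hε).2 h1⟩⟩
    -- For r > t^α the two charts of the neck have the same germ, and the form is read off from the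
    -- `Q` side.
    have hev : ht.neckP i hP =ᶠ[𝓝 p] ht.neckQ i hQ := by
      filter_upwards [(isOpen_annulus (Γ i) C.α t).mem_nhds ⟨h1, hp'⟩] with q hq
      exact ht.neckP_eq_neckQ hq
    rw [DForm.pullback_congr hev]
    refine (ht.pullback_inQ_Φ _ hQ h1 hε).trans ?_
    rw [← hη p h1 hε]
    exact DForm.pullback_congr_form (GlueData.form_pullback_inQ _ _ _ hQ
      ((Admissible.Φ_mem_Q_iff h0 hε).2 h1))

theorem Admissible.form_pullback_neckQ {F : Type*} [NormedAddCommGroup F] [NormedSpace ℝ F] {k : ℕ}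
    {η : DForm (𝓡 6) (Reg x) F k} {ζ : ∀ i, DForm (𝓡 6) (Y i) F k} {i : Fin n}
    {θ : DForm (coneModel 5) (Γ i × ℝ) F k}
    (hη : ∀ p : Γ i × ℝ, t ^ C.α < p.2 → p.2 < X.ε →
      η.pullback (I := coneModel 5) (X.Φ i) p = θ p)
    (hQ : Nonempty (glueData X Z ht).Q)
    {p : Γ i × ℝ} (h1 : t ^ C.α < p.2) (hε : p.2 < X.ε) :
    ((glueData X Z ht).form η ζ).pullback (I := coneModel 5) (ht.neckQ i hQ) p = θ p := by
  refine (ht.pullback_inQ_Φ _ hQ h1 hε).trans ?_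
  rw [← hη p h1 hε]
  exact DForm.pullback_congr_form (GlueData.form_pullback_inQ _ _ _ hQ
    ((Admissible.Φ_mem_Q_iff (ht.scale_pos.trans h1) hε).2 h1))

/-- A form on the glued space is smooth and closed if the forms that it is made of are. -/
theorem Admissible.form_smooth_closed {F : Type*} [NormedAddCommGroup F] [NormedSpace ℝ F] {k : ℕ}
    {η η' : DForm (𝓡 6) (Reg x) F k} {ζ : ∀ i, DForm (𝓡 6) (Y i) F k}
    {θ : ∀ i, DForm (coneModel 5) (Γ i × ℝ) F k}
    (hη : ∀ i, ∀ p : Γ i × ℝ, t ^ C.α < p.2 → p.2 < X.ε →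
      η.pullback (I := coneModel 5) (X.Φ i) p = θ i p)
    (hζ : ∀ i, ∀ p : Γ i × ℝ, t * R < p.2 → p.2 ≤ t ^ C.α →
      (ζ i).pullback (I := coneModel 5) ((Z i).Υt t) p = θ i p)
    (hη' : ∀ q, (∀ i, q ∉ X.Φ i '' annulus (Γ i) C.α t) → η q = η' q)
    (sη : ∀ q, η'.SmoothAt q ∧ η'.d q = 0) (sζ : ∀ i y, (ζ i).SmoothAt y ∧ (ζ i).d y = 0)
    (sθ : ∀ i, ∀ p : Γ i × ℝ, t * R < p.2 → p.2 < X.ε → (θ i).SmoothAt p ∧ (θ i).d p = 0)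
    (a : Mt X Z ht) :
    ((glueData X Z ht).form η ζ).SmoothAt a ∧ ((glueData X Z ht).form η ζ).d a = 0 := by
  rcases (glueData X Z ht).exists_rep a with ⟨q, rfl⟩ | ⟨⟨i, y⟩, rfl⟩
  · have hQ : Nonempty (glueData X Z ht).Q := ⟨q⟩
    obtain ⟨q, hq⟩ := q
    rw [← GlueData.inQ_apply _ hQ]
    -- On the neck the form pulls back to the single form `θ i`, which is smooth across both ends of
    -- the annulus. Away from the neck it coincides near the point with `η'` or with `ζ i`; a whole
    -- neighbourhood is available because the bounded parts of the neck have closed images.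
    by_cases h : ∃ i, ∃ p ∈ (X.Φ i).source, X.Φ i p = q
    · obtain ⟨i, p, hp, rfl⟩ := h
      rw [X.Φ_source i] at hp
      have h1 := (Admissible.Φ_mem_Q_iff hp.1 hp.2).1 hq
      have hev : ∀ᶠ y in 𝓝 p, ((glueData X Z ht).form η ζ).pullback (I := coneModel 5)
          (ht.neckQ i hQ) y = θ i y := by
        filter_upwards [(isOpen_lt continuous_const continuous_snd).mem_nhds h1,
          (isOpen_lt continuous_snd continuous_const).mem_nhds hp.2] with y hy1 hy2
        exact ht.form_pullback_neckQ (hη i) hQ hy1 hy2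
      have hm := ht.mem_neckQ (hQ := hQ) h1 hp.2
      obtain ⟨s1, s2⟩ := sθ i p (ht.left.trans h1) hp.2
      exact ⟨(ht.isDiffeo_neckQ i hQ).smoothAt hm hev s1,
        (ht.isDiffeo_neckQ i hQ).d_eq_zero hm hev s1 s2⟩
    · push Not at h
      have hev : ∀ᶠ y in 𝓝 q, ((glueData X Z ht).form η ζ).pullback (I := 𝓡 6)
          ((glueData X Z ht).inQ hQ) y = η' y := by
        have hcl : ∀ i, ∀ᶠ y in 𝓝 q, y ∉ X.Φ i '' {p | 0 < p.2 ∧ p.2 ≤ 2 * t ^ C.α} := by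
          intro i
          refine (X.isClosed_image i ht.right).isOpen_compl.mem_nhds ?_
          rintro ⟨p, ⟨hp0, hp1⟩, e⟩
          exact h i p (X.mem_source hp0 (hp1.trans_lt ht.right)) e
        filter_upwards [Filter.eventually_all.2 hcl,
          (glueData X Z ht).Q.isOpen.mem_nhds hq] with y hy1 hy2
        rw [GlueData.form_pullback_inQ _ _ _ hQ hy2]
        refine hη' y fun i ⟨p, hp, e⟩ ↦ hy1 i ⟨p, ⟨ht.scale_pos.trans hp.1, hp.2.le⟩, e⟩
      have hm : q ∈ ((glueData X Z ht).inQ hQ).source := by rwa [GlueData.inQ_source]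
      obtain ⟨s1, s2⟩ := sη q
      exact ⟨((glueData X Z ht).isDiffeo_inQ hQ).smoothAt hm hev s1,
        ((glueData X Z ht).isDiffeo_inQ hQ).d_eq_zero hm hev s1 s2⟩
  · have hP : Nonempty ((glueData X Z ht).P i) := ⟨y⟩
    obtain ⟨y, hy⟩ := y
    simp only
    rw [← GlueData.inP_apply _ i hP]
    by_cases h : y ∈ (Z i).Υ.target
    · obtain ⟨p, hp, rfl⟩ := (Z i).exists_Υt ht.pos h
      have h1 := (Admissible.Υt_mem_P_iff hp).1 hy
      have hev : ∀ᶠ y in 𝓝 p, ((glueData X Z ht).form η ζ).pullback (I := coneModel 5)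
          (ht.neckP i hP) y = θ i y := by
        filter_upwards [(isOpen_lt continuous_const continuous_snd).mem_nhds hp,
          (isOpen_lt continuous_snd continuous_const).mem_nhds h1] with y hy1 hy2
        exact ht.form_pullback_neckP (hη i) (hζ i) hP hy1 hy2
      have hm := ht.mem_neckP (hP := hP) hp h1
      obtain ⟨s1, s2⟩ := sθ i p hp (h1.trans ht.right)
      exact ⟨(ht.isDiffeo_neckP i hP).smoothAt hm hev s1,
        (ht.isDiffeo_neckP i hP).d_eq_zero hm hev s1 s2⟩
    · have hR : R < t ^ C.α / t := by rw [lt_div_iff₀ ht.pos]; linarith [ht.left]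
      have hev : ∀ᶠ z in 𝓝 y, ((glueData X Z ht).form η ζ).pullback (I := 𝓡 6)
          ((glueData X Z ht).inP i hP) z = ζ i z := by
        have hy2 : y ∉ (Z i).Υ '' {p | t ^ C.α / t ≤ p.2} := by
          rintro ⟨p, hp, rfl⟩
          exact h ((Z i).Υ.map_source (by rw [(Z i).Υ_source]; exact hR.trans_le hp))
        filter_upwards [((Z i).isClosed_image hR).isOpen_compl.mem_nhds hy2,
          ((glueData X Z ht).P i).isOpen.mem_nhds hy] with z hz1 hz2
        refine GlueData.form_pullback_inP _ _ _ i hP hz2 fun hz ↦ ?_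
        obtain ⟨p, hp, rfl⟩ := Admissible.mem_target_iff.1 hz
        refine hz1 ⟨shrink t p, ?_, rfl⟩
        change t ^ C.α / t ≤ t⁻¹ * p.2
        rw [div_eq_inv_mul]
        exact mul_le_mul_of_nonneg_left hp.1.le (inv_pos.2 ht.pos).le
      have hm : y ∈ ((glueData X Z ht).inP i hP).source := by rwa [GlueData.inP_source]
      obtain ⟨s1, s2⟩ := sζ i y
      exact ⟨((glueData X Z ht).isDiffeo_inP i hP).smoothAt hm hev s1,
        ((glueData X Z ht).isDiffeo_inP i hP).d_eq_zero hm hev s1 s2⟩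

end Geometry

/-! ### The nearly Calabi-Yau condition at each point of the glued 6-fold. -/

section Pointwise

variable {E H M E' H' M' : Type*}
  [NormedAddCommGroup E] [NormedSpace ℝ E] [TopologicalSpace H] {I : ModelWithCorners ℝ E H}
  [TopologicalSpace M] [ChartedSpace H M]
  [NormedAddCommGroup E'] [NormedSpace ℝ E'] [TopologicalSpace H'] {I' : ModelWithCorners ℝ E' H'}
  [TopologicalSpace M'] [ChartedSpace H' M']

/-- Transport of structure: the differential at `x` carries the frame `A₀` to the tangent space at
`e x`, so both hypotheses may be verified after pulling back. -/
theorem IsDiffeo.isNearlyAt {e : OpenPartialHomeomorph M M'} (he : IsDiffeo I I' e) {x : M}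
    (hx : x ∈ e.source) {ε δ : ℝ}
    (hδ : ∀ (A₀ : E' ≃L[ℝ] (Fin 3 → ℂ)) (ω : E' [⋀^Fin 2]→L[ℝ] ℝ) (Ω : E' [⋀^Fin 3]→L[ℝ] ℂ),
      (∀ u v, ω ![u, v] = stdOmega (A₀ u) (A₀ v)) →
      (∀ w, ‖Ω w - stdVol fun j ↦ A₀ (w j)‖ ≤ δ * ∏ j, ‖A₀ (w j)‖) → IsNearlyAt ε ω Ω)
    (ω : DForm I' M' ℝ 2) (Ω : DForm I' M' ℂ 3) (A₀ : E ≃L[ℝ] (Fin 3 → ℂ))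
    {ω₀ : E [⋀^Fin 2]→L[ℝ] ℝ} {Ω₀ : E [⋀^Fin 3]→L[ℝ] ℂ}
    (hω₀ : ω.pullback (I := I) e x = ω₀) (hΩ₀ : Ω.pullback (I := I) e x = Ω₀)
    (hω : ∀ u v, ω₀ ![u, v] = stdOmega (A₀ u) (A₀ v))
    (hΩ : ∀ w, ‖Ω₀ w - stdVol fun j ↦ A₀ (w j)‖ ≤ δ * ∏ j, ‖A₀ (w j)‖) :
    IsNearlyAt (T := E') ε (ω (e x)) (Ω (e x)) := by
  refine hδ ((he.equiv hx).symm.trans A₀) (ω (e x)) (Ω (e x)) (fun u v ↦ ?_) fun w ↦ ?_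
  · refine Eq.trans ?_ (hω ((he.equiv hx).symm u) ((he.equiv hx).symm v))
    rw [← hω₀]
    change ω (e x) ![u, v] = ω (e x) (fun j ↦ he.equiv hx (![_, _] j))
    congr 1
    ext j
    fin_cases j <;> simp <;> rfl
  · refine le_trans (le_of_eq ?_) (hΩ fun j ↦ (he.equiv hx).symm (w j))
    rw [← hΩ₀]
    congr 2
    change _ = Ω (e x) (fun j ↦ he.equiv hx ((he.equiv hx).symm (w j)))
    simp
    rfl

end Pointwise

theorem stdOmega_self_mulI (z : Fin 3 → ℂ) :
    stdOmega z (Complex.I • z) = ∑ j, Complex.normSq (z j) := by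
  simp only [stdOmega, Pi.smul_apply, smul_eq_mul]
  refine Finset.sum_congr rfl fun j _ ↦ ?_
  simp [Complex.normSq_apply]

/-- The norm on `Fin 3 → ℂ` is the sup norm, so comparing it with the Euclidean one costs √3 ≤ 2.
For 3-forms this is the factor 8 = 2³ below. -/
theorem sqrt_sum_normSq_le (z : Fin 3 → ℂ) : √(∑ j, Complex.normSq (z j)) ≤ 2 * ‖z‖ := by
  refine Real.sqrt_le_iff.2 ⟨by positivity, ?_⟩
  have h : ∀ j, Complex.normSq (z j) ≤ ‖z‖ ^ 2 := fun j ↦ by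
    rw [Complex.normSq_eq_norm_sq]
    exact pow_le_pow_left₀ (norm_nonneg _) (norm_le_pi_norm z j) 2
  calc ∑ j, Complex.normSq (z j) ≤ ∑ _j : Fin 3, ‖z‖ ^ 2 := Finset.sum_le_sum fun j _ ↦ h j
    _ = 3 * ‖z‖ ^ 2 := by simp
    _ ≤ (2 * ‖z‖) ^ 2 := by nlinarith [sq_nonneg ‖z‖]

theorem stdOmega_smul_smul (t : ℝ) (u v : Fin 3 → ℂ) :
    stdOmega (t • u) (t • v) = t ^ 2 * stdOmega u v := by
  simp only [stdOmega, Finset.mul_sum]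
  refine Finset.sum_congr rfl fun j _ ↦ ?_
  simp
  ring

theorem stdVol_smul (t : ℝ) (w : Fin 3 → Fin 3 → ℂ) :
    stdVol (fun j ↦ t • w j) = t ^ 3 • stdVol w := by
  have : Matrix.of (fun j ↦ t • w j) = (t : ℂ) • Matrix.of w := by
    ext
    simp
  rw [stdVol, this, Matrix.det_smul, stdVol]
  simp

section Geometry

variable {n : ℕ} {M₀ : Type*} [TopologicalSpace M₀] {x : Fin n → M₀} [ChartedSpace (Eu 6) (Reg x)]
  [IsManifold (𝓡 6) ∞ (Reg x)]
  {Γ : Fin n → Type*} [∀ i, TopologicalSpace (Γ i)] [∀ i, ChartedSpace (Eu 5) (Γ i)]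
  [∀ i, IsManifold (𝓡 5) ∞ (Γ i)]
  {Y : Fin n → Type*} [∀ i, TopologicalSpace (Y i)] [∀ i, ChartedSpace (Eu 6) (Y i)]
  [∀ i, IsManifold (𝓡 6) ∞ (Y i)]
  {V : ∀ i, Triple (coneModel 5) (Γ i × ℝ)} {X : ConicalCY x V} {R : ℝ}
  {Z : ∀ i, ACCY (V i) (Y i) R} {C : Choices X Z}
  [T2Space M₀] [∀ i, CompactSpace (Γ i)] [∀ i, T2Space (Y i)] {t : ℝ}

theorem omegaT_pullback_neckP (hV : ∀ i, IsCalabiYauCone (V i)) (ht : Admissible R X.ε C.α t)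
    {i : Fin n} (hP : Nonempty ((glueData X Z ht).P i)) {p : Γ i × ℝ} (hp : t * R < p.2)
    (hp' : p.2 < 2 * t ^ C.α) :
    (omegaT X Z ht).pullback (I := coneModel 5) (ht.neckP i hP) p = (V i).ω p :=
  ht.form_pullback_neckP (θ := (V i).ω) (ζ := fun i y ↦ t ^ 2 • (Z i).S.ω y)
    (fun q h1 h2 ↦ X.symplectic i q (X.mem_source (ht.scale_pos.trans h1) h2))
    (fun _ h1 _ ↦ (Z i).sq_smul_pullback_omega (hV i) ht.pos h1) hP hp hp'

theorem omegaT_pullback_neckQ (ht : Admissible R X.ε C.α t)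
    {i : Fin n} (hQ : Nonempty (glueData X Z ht).Q) {p : Γ i × ℝ} (hp : t ^ C.α < p.2)
    (hp' : p.2 < X.ε) :
    (omegaT X Z ht).pullback (I := coneModel 5) (ht.neckQ i hQ) p = (V i).ω p :=
  ht.form_pullback_neckQ (θ := (V i).ω)
    (fun q h1 h2 ↦ X.symplectic i q (X.mem_source (ht.scale_pos.trans h1) h2)) hQ hp hp'

theorem omegaT_smooth_closed (hV : ∀ i, IsCalabiYauCone (V i)) (ht : Admissible R X.ε C.α t)
    (a : Mt X Z ht) : (omegaT X Z ht).SmoothAt a ∧ (omegaT X Z ht).d a = 0 := by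
  refine ht.form_smooth_closed (C := C) (η := X.S.ω) (η' := X.S.ω)
    (ζ := fun i y ↦ t ^ 2 • (Z i).S.ω y) (θ := fun i ↦ (V i).ω)
    (fun i q h1 h2 ↦ X.symplectic i q (X.mem_source (ht.scale_pos.trans h1) h2))
    (fun i q h1 _ ↦ (Z i).sq_smul_pullback_omega (hV i) ht.pos h1) (fun _ _ ↦ rfl)
    (fun q ↦ ⟨X.cy.2.1 q trivial, X.cy.2.2.2.1 q trivial⟩) (fun i y ↦ ?_) (fun i p h _ ↦ ?_) a
  · have h1 : (Z i).S.ω.SmoothAt y := (Z i).cy.2.1 y trivial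
    refine ⟨h1.const_smul (t ^ 2), (DForm.d_const_smul (Z i).S.ω y (t ^ 2)).trans ?_⟩
    exact (congrArg (t ^ 2 • ·) ((Z i).cy.2.2.2.1 y trivial)).trans (smul_zero _)
  · have h0 : 0 < p.2 := (mul_pos ht.pos (Z i).R_pos).trans h
    exact ⟨(hV i).cy.2.1 p h0, (hV i).cy.2.2.2.1 p h0⟩

theorem OmegaT_smooth_closed (hV : ∀ i, IsCalabiYauCone (V i)) (ht : Admissible R X.ε C.α t)
    (a : Mt X Z ht) : (C.OmegaT ht).SmoothAt a ∧ (C.OmegaT ht).d a = 0 := by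
  refine ht.form_smooth_closed (C := C) (η := C.OmegaQ t) (η' := X.S.Ω)
    (ζ := fun i y ↦ t ^ 3 • (Z i).S.Ω y)
    (θ := fun i ↦ C.annulusForm t i)
    (fun i q h1 h2 ↦ Choices.OmegaQ_pullback ht h1 h2)
    (fun i q h1 h2 ↦ (Choices.annulusForm_inner (hV i) ht.pos h1 h2 ?_).symm)
    (fun _ h ↦ Choices.OmegaQ_of_notMem h)
    (fun q ↦ ⟨X.cy.2.2.1 q trivial, X.cy.2.2.2.2.1 q trivial⟩) (fun i y ↦ ?_)
    (fun i p h h' ↦ Choices.annulusForm_smooth (hV i) ht.pos h h') a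
  · have := ht.right; have := ht.scale_pos; linarith
  · have h1 : (Z i).S.Ω.SmoothAt y := (Z i).cy.2.2.1 y trivial
    refine ⟨h1.const_smul (t ^ 3), (DForm.d_const_smul (Z i).S.Ω y (t ^ 3)).trans ?_⟩
    exact (congrArg (t ^ 3 • ·) ((Z i).cy.2.2.2.2.1 y trivial)).trans (smul_zero _)

/-- Off the annuli the structure is an honest Calabi-Yau structure. On the `P i` side it is (t²ω,
t³Ω), for which the frame is multiplied by t. On the annuli the frame of the cone is used: ω is
exactly the cone form there, and Ω is within the tolerance by `hclose`. -/
theorem isNearlyAt_of_close (hV : ∀ i, IsCalabiYauCone (V i)) (ht : Admissible R X.ε C.α t)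
    {ε δ : ℝ} (hδ0 : 0 < δ)
    (hδ : ∀ (A₀ : Eu 6 ≃L[ℝ] (Fin 3 → ℂ)) (ω : Eu 6 [⋀^Fin 2]→L[ℝ] ℝ) (Ω : Eu 6 [⋀^Fin 3]→L[ℝ] ℂ),
      (∀ u v, ω ![u, v] = stdOmega (A₀ u) (A₀ v)) →
      (∀ w, ‖Ω w - stdVol fun j ↦ A₀ (w j)‖ ≤ δ * ∏ j, ‖A₀ (w j)‖) → IsNearlyAt ε ω Ω)
    (hclose : ∀ i, ∀ p : Γ i × ℝ, t ^ C.α ≤ p.2 → p.2 ≤ 2 * t ^ C.α →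
      ∀ w, ‖C.annulusForm t i p w - (V i).Ω p w‖ ≤
        δ / 8 * ∏ j, √((V i).metric p (w j) (w j)))
    (a : Mt X Z ht) : IsNearlyAt (T := Eu 6) ε (omegaT X Z ht a) (C.OmegaT ht a) := by
  have hpos : ∀ {A : Type} {B : A → Fin 3 → ℂ} (w : Fin 3 → A), 0 ≤ δ * ∏ j, ‖B (w j)‖ :=
    fun w ↦ mul_nonneg hδ0.le (Finset.prod_nonneg fun j _ ↦ norm_nonneg _)
  have key : ∀ q, IsNearlyAt (T := Eu 6) ε (omegaT X Z ht ((glueData X Z ht).jQ q))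
      (C.OmegaT ht ((glueData X Z ht).jQ q)) := by
    intro q
    have hQ : Nonempty (glueData X Z ht).Q := ⟨q⟩
    obtain ⟨q, hq⟩ := q
    rw [← GlueData.inQ_apply _ hQ]
    by_cases h : ∃ i, q ∈ X.Φ i '' annulus (Γ i) C.α t
    · obtain ⟨i, p, hp, rfl⟩ := h
      have hε := hp.2.trans ht.right
      have h0 := ht.scale_pos.trans hp.1
      obtain ⟨A₀, hJ, hω, hΩ⟩ := (hV i).cy.2.2.2.2.2 p h0
      refine (ht.isDiffeo_neckQ i hQ).isNearlyAt (ht.mem_neckQ hp.1 hε) hδ _ _ A₀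
        (omegaT_pullback_neckQ ht hQ hp.1 hε)
        (ht.form_pullback_neckQ (fun _ ↦ Choices.OmegaQ_pullback ht) hQ hp.1 hε) hω fun w ↦ ?_
      refine (le_of_eq (congrArg (fun z ↦ ‖C.annulusForm t i p w - z‖) (hΩ w).symm)).trans ?_
      refine (hclose i p hp.1.le hp.2.le w).trans ?_
      have hm : ∀ v : Eu 5 × ℝ, √((V i).metric p v v) ≤ 2 * ‖A₀ v‖ := fun v ↦ by
        refine le_trans (le_of_eq ?_) (sqrt_sum_normSq_le (A₀ v))
        congr 1
        rw [← stdOmega_self_mulI]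
        exact (hω _ _).trans (congrArg (stdOmega (A₀ v)) (hJ v))
      calc δ / 8 * ∏ j, √((V i).metric p (w j) (w j)) ≤ δ / 8 * ∏ j, (2 * ‖A₀ (w j)‖) := by
            refine mul_le_mul_of_nonneg_left ?_ (by positivity)
            exact Finset.prod_le_prod (fun j _ ↦ Real.sqrt_nonneg _) fun j _ ↦ hm _
        _ = δ * ∏ j, ‖A₀ (w j)‖ := by
            rw [Finset.prod_mul_distrib]
            simp
            ring
    · push Not at h
      obtain ⟨A₀, hJ, hω, hΩ⟩ := X.cy.2.2.2.2.2 q trivial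
      refine ((glueData X Z ht).isDiffeo_inQ hQ).isNearlyAt (by rwa [GlueData.inQ_source]) hδ _ _ A₀
        (GlueData.form_pullback_inQ _ _ _ hQ hq)
        ((GlueData.form_pullback_inQ _ _ _ hQ hq).trans (Choices.OmegaQ_of_notMem h)) hω fun w ↦ ?_
      refine le_trans (le_of_eq ?_) (hpos w)
      exact norm_eq_zero.2 (sub_eq_zero.2 (hΩ w))
  by_cases h : ∃ q, (glueData X Z ht).jQ q = a
  · obtain ⟨q, rfl⟩ := h
    exact key q
  obtain ⟨⟨i, y⟩, rfl⟩ := ((glueData X Z ht).exists_rep a).resolve_left h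
  have hP : Nonempty ((glueData X Z ht).P i) := ⟨y⟩
  obtain ⟨y, hy⟩ := y
  have hy' : y ∉ ((glueData X Z ht).φ i).target := fun hy' ↦
    h ⟨⟨_, (glueData X Z ht).source_sub i (((glueData X Z ht).φ i).map_target hy')⟩,
      (glueData X Z ht).jQ_eq_jP.2 ⟨((glueData X Z ht).φ i).map_target hy',
        ((glueData X Z ht).φ i).right_inv hy'⟩⟩
  simp only
  rw [← GlueData.inP_apply _ i hP]
  obtain ⟨A₀, hJ, hω, hΩ⟩ := (Z i).cy.2.2.2.2.2 y trivial
  refine ((glueData X Z ht).isDiffeo_inP i hP).isNearlyAt (by rwa [GlueData.inP_source]) hδ _ _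
    (A₀.trans (ContinuousLinearEquiv.smulLeft (Units.mk0 t ht.pos.ne')))
    (GlueData.form_pullback_inP _ _ _ i hP hy hy')
    (GlueData.form_pullback_inP _ _ _ i hP hy hy') (fun u v ↦ ?_) fun w ↦ ?_
  · refine (congrArg (t ^ 2 * ·) (hω u v)).trans ?_
    exact (stdOmega_smul_smul t _ _).symm
  · refine le_trans (le_of_eq ?_) (hpos w)
    rw [norm_eq_zero, sub_eq_zero]
    refine (congrArg (t ^ 3 • ·) (hΩ w)).trans ?_
    exact (stdVol_smul t _).symm

theorem eventually_isNearlyCalabiYau (hV : ∀ i, IsCalabiYauCone (V i)) (C : Choices X Z) {ε₀ : ℝ}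
    (hε₀ : 0 < ε₀) : ∀ᶠ t in 𝓝[>] (0 : ℝ), ∀ ht : Admissible R X.ε C.α t,
      IsNearlyCalabiYau ε₀ (omegaT X Z ht) (C.OmegaT ht) := by
  obtain ⟨δ, hδ, h⟩ := exists_isNearlyAt hε₀
  filter_upwards [Filter.eventually_all.2 fun i ↦
    Choices.eventually_annulusForm_close i C (hV i) (δ := δ / 8) (by positivity)] with t hclose ht
  exact ⟨fun a _ ↦ (omegaT_smooth_closed hV ht a).1, fun a _ ↦ (OmegaT_smooth_closed hV ht a).1,
    fun a ↦ (omegaT_smooth_closed hV ht a).2, fun a ↦ (OmegaT_smooth_closed hV ht a).2,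
    ε₀, hε₀, le_rfl, isNearlyAt_of_close hV ht hδ (fun A₀ ω Ω ↦ h A₀ ω Ω) hclose⟩

end Geometry

/-! ### Submanifolds and diffeomorphisms -/

section Curves

variable {E H M E' H' M' : Type*}
  [NormedAddCommGroup E] [NormedSpace ℝ E] [TopologicalSpace H] {I : ModelWithCorners ℝ E H}
  [TopologicalSpace M] [ChartedSpace H M]
  [NormedAddCommGroup E'] [NormedSpace ℝ E'] [TopologicalSpace H'] {I' : ModelWithCorners ℝ E' H'}
  [TopologicalSpace M'] [ChartedSpace H' M']

/-- Curves can be lifted along a diffeomorphism. -/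
theorem IsDiffeo.exists_lift {e : OpenPartialHomeomorph M M'} (he : IsDiffeo I I' e) {p : M}
    (hp : p ∈ e.source) {c : ℝ → M'} (hc0 : c 0 = e p) (hc : ContMDiffAt 𝓘(ℝ, ℝ) I' ∞ c 0) :
    ∃ b : ℝ → M, b 0 = p ∧ ContMDiffAt 𝓘(ℝ, ℝ) I ∞ b 0 ∧
      (∀ᶠ s in 𝓝 0, b s ∈ e.source ∧ e (b s) = c s) ∧
      (mfderiv 𝓘(ℝ, ℝ) I' c 0 (1 : ℝ) : E') =
        (mfderiv I I' e p : E →L[ℝ] E') (mfderiv 𝓘(ℝ, ℝ) I b 0 (1 : ℝ) : E) := by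
  have h0 : e.symm (c 0) = p := by rw [hc0, e.left_inv hp]
  have hct : c 0 ∈ e.target := hc0 ▸ e.map_source hp
  have hb : ContMDiffAt 𝓘(ℝ, ℝ) I ∞ (e.symm ∘ c) 0 := (he.symm.contMDiffAt hct).comp 0 hc
  have hev : ∀ᶠ s in 𝓝 (0 : ℝ), c s ∈ e.target :=
    hc.continuousAt.eventually (e.open_target.mem_nhds hct)
  refine ⟨e.symm ∘ c, h0, hb, hev.mono fun s hs ↦ ⟨e.map_target hs, e.right_inv hs⟩, ?_⟩
  have h1 : c =ᶠ[𝓝 0] e ∘ (e.symm ∘ c) := hev.mono fun s hs ↦ (e.right_inv hs).symm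
  have hd : MDifferentiableAt I I' e ((e.symm ∘ c) 0) := he.mdifferentiableAt (by
    change e.symm (c 0) ∈ _; rwa [h0])
  have h2 : (mfderiv 𝓘(ℝ, ℝ) I' c 0 : ℝ →L[ℝ] E') =
      mfderiv 𝓘(ℝ, ℝ) I' (e ∘ (e.symm ∘ c)) 0 := h1.mfderiv_eq
  have h3 := mfderiv_comp 0 hd (hb.mdifferentiableAt (by simp))
  have h4 : (mfderiv I I' e ((e.symm ∘ c) 0) : E →L[ℝ] E') = mfderiv I I' e p := by
    change (mfderiv I I' e (e.symm (c 0)) : E →L[ℝ] E') = _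
    rw [h0]
  change (mfderiv 𝓘(ℝ, ℝ) I' c 0 : ℝ →L[ℝ] E') 1 = _
  rw [h2, ← h4]
  exact DFunLike.congr_fun h3 (1 : ℝ)

end Curves

section Sub

variable {M : Type*} [TopologicalSpace M] [ChartedSpace (Eu 6) M] [IsManifold (𝓡 6) ∞ M]
  {M' : Type*} [TopologicalSpace M'] [ChartedSpace (Eu 6) M'] [IsManifold (𝓡 6) ∞ M']
  {N : Set M} {N' : Set M'} {p : M}

theorem IsDiffeo.mem_maximalAtlas {c : OpenPartialHomeomorph M (Eu 6)}
    (hc : IsDiffeo (𝓡 6) (𝓡 6) c) : c ∈ IsManifold.maximalAtlas (𝓡 6) ∞ M := by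
  rw [IsManifold.maximalAtlas, mem_maximalAtlas_iff]
  intro e' he'
  have h' : IsDiffeo (𝓡 6) (𝓡 6) e' :=
    ⟨contMDiffOn_of_mem_maximalAtlas (IsManifold.subset_maximalAtlas he'),
      contMDiffOn_symm_of_mem_maximalAtlas (IsManifold.subset_maximalAtlas he')⟩
  have key : ∀ f : OpenPartialHomeomorph (Eu 6) (Eu 6), IsDiffeo (𝓡 6) (𝓡 6) f →
      f ∈ contDiffGroupoid ∞ (𝓡 6) := by
    intro f hf
    rw [contDiffGroupoid, mem_groupoid_of_pregroupoid]
    refine ⟨?_, ?_⟩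
    · have := hf.smooth.contDiffOn
      simpa [contDiffPregroupoid] using this
    · have := hf.symm_smooth.contDiffOn
      simpa [contDiffPregroupoid] using this
  exact ⟨key _ (hc.symm.trans h'), key _ (h'.symm.trans hc)⟩

/-- `N` is a 3-dimensional submanifold near `p`. -/
def SubmanifoldAt (N : Set M) (p : M) : Prop :=
  ∃ e ∈ IsManifold.maximalAtlas (𝓡 6) ∞ M, p ∈ e.source ∧
    e '' (e.source ∩ N) = {y ∈ e.target | ∀ j : Fin 6, 3 ≤ j.val → y j = 0}

theorem submanifoldAt_of_isDiffeo {c : OpenPartialHomeomorph M (Eu 6)}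
    (hc : IsDiffeo (𝓡 6) (𝓡 6) c) (hp : p ∈ c.source)
    (h : ∀ᶠ z in 𝓝 p, z ∈ N ↔ ∀ j : Fin 6, 3 ≤ j.val → c z j = 0) : SubmanifoldAt N p := by
  obtain ⟨U, hU, hUo, hpU⟩ := eventually_nhds_iff.1 h
  refine ⟨(OpenPartialHomeomorph.ofSet U hUo).trans c,
    ((IsDiffeo.ofSet hUo).trans hc).mem_maximalAtlas, ⟨hpU, hp⟩, ?_⟩
  ext y
  constructor
  · rintro ⟨z, ⟨hz, hzN⟩, rfl⟩
    exact ⟨OpenPartialHomeomorph.map_source _ hz, (hU z hz.1).1 hzN⟩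
  · rintro ⟨hy, hy0⟩
    have hs := OpenPartialHomeomorph.map_target _ hy
    refine ⟨_, ⟨hs, (hU _ hs.1).2 ?_⟩, OpenPartialHomeomorph.right_inv _ hy⟩
    have h1 := OpenPartialHomeomorph.right_inv _ hy
    have h2 : c (((OpenPartialHomeomorph.ofSet U hUo).trans c).symm y) = y := h1
    rwa [h2]

/-- Being a submanifold is a local property and is invariant under diffeomorphisms, so it is enough
that the two sets correspond near the point. -/
theorem SubmanifoldAt.transfer {e : OpenPartialHomeomorph M M'} (he : IsDiffeo (𝓡 6) (𝓡 6) e)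
    (hp : p ∈ e.source) (hN : SubmanifoldAt N p) (h : ∀ᶠ z in 𝓝 p, e z ∈ N' ↔ z ∈ N) :
    SubmanifoldAt N' (e p) := by
  obtain ⟨c, hc, hpc, hcN⟩ := hN
  have hcd : IsDiffeo (𝓡 6) (𝓡 6) c := ⟨contMDiffOn_of_mem_maximalAtlas hc,
    contMDiffOn_symm_of_mem_maximalAtlas hc⟩
  have hev : ∀ᶠ z in 𝓝 p, e z ∈ N' ↔ ∀ j : Fin 6, 3 ≤ j.val → c z j = 0 := by
    filter_upwards [h, c.open_source.mem_nhds hpc] with z hz hzc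
    rw [hz]
    constructor
    · intro hzN
      exact (hcN.subset ⟨z, ⟨hzc, hzN⟩, rfl⟩).2
    · intro hz0
      obtain ⟨z', ⟨h1, h2⟩, h3⟩ := hcN.superset ⟨c.map_source hzc, hz0⟩
      exact c.injOn h1 hzc h3 ▸ h2
  refine submanifoldAt_of_isDiffeo (he.symm.trans hcd) ⟨e.map_source hp, ?_⟩ ?_
  · change e.symm (e p) ∈ c.source
    rwa [e.left_inv hp]
  · have hc2 : Filter.Tendsto e.symm (𝓝 (e p)) (𝓝 p) := by
      have := e.symm.continuousAt (e.map_source hp)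
      rwa [ContinuousAt, e.left_inv hp] at this
    filter_upwards [hc2.eventually hev, e.open_target.mem_nhds (e.map_source hp)] with z hz hzt
    rw [e.right_inv hzt] at hz
    exact hz

/-- Tangent vectors are velocities of curves, and a curve in `N'` lifts through the diffeomorphism
to a curve in `N`. -/
theorem IsDiffeo.eq_zero_of_tangentVectors {e : OpenPartialHomeomorph M M'}
    (he : IsDiffeo (𝓡 6) (𝓡 6) e) (hp : p ∈ e.source) (h : ∀ᶠ z in 𝓝 p, e z ∈ N' → z ∈ N)
    {ω : DForm (𝓡 6) M' ℝ 2}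
    (hω : ∀ u ∈ tangentVectors N p, ∀ v ∈ tangentVectors N p,
      (ω.pullback (I := 𝓡 6) e p : Eu 6 [⋀^Fin 2]→L[ℝ] ℝ) ![u, v] = 0) :
    ∀ u ∈ tangentVectors N' (e p), ∀ v ∈ tangentVectors N' (e p),
      (ω (e p) : Eu 6 [⋀^Fin 2]→L[ℝ] ℝ) ![u, v] = 0 := by
  have key : ∀ u ∈ tangentVectors N' (e p), ∃ u' ∈ tangentVectors N p,
      (u : Eu 6) = (mfderiv (𝓡 6) (𝓡 6) e p : Eu 6 →L[ℝ] Eu 6) u' := by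
    rintro u ⟨c, hc0, hc, hcN, hu⟩
    obtain ⟨b, hb0, hb, hbc, hd⟩ := he.exists_lift hp hc0 hc
    refine ⟨_, ⟨b, hb0, hb, ?_, rfl⟩, hu.trans hd⟩
    have hbt : Filter.Tendsto b (𝓝 0) (𝓝 p) := hb0 ▸ hb.continuousAt
    filter_upwards [hbc, hcN, hbt.eventually h] with s h1 h2 h3
    exact h3 (h1.2 ▸ h2)
  intro u hu v hv
  obtain ⟨u', hu', rfl⟩ := key u hu
  obtain ⟨v', hv', rfl⟩ := key v hv
  refine Eq.trans ?_ (hω u' hu' v' hv')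
  change (ω (e p) : Eu 6 [⋀^Fin 2]→L[ℝ] ℝ) _ = (ω (e p) : Eu 6 [⋀^Fin 2]→L[ℝ] ℝ)
    (fun j ↦ (mfderiv (𝓡 6) (𝓡 6) e p : Eu 6 →L[ℝ] Eu 6) (![u', v'] j))
  congr 1
  ext j : 1
  fin_cases j <;> rfl

end Sub

/-! ### The cotangent bundle -/

section Cotangent

variable {E H : Type*} [NormedAddCommGroup E] [NormedSpace ℝ E] [TopologicalSpace H]
  {I : ModelWithCorners ℝ E H} {X : Type*} [TopologicalSpace X] [ChartedSpace H X]

/-- The section `du` of the cotangent bundle. -/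
def secD (I : ModelWithCorners ℝ E H) (u : X → ℝ) (x : X) : Cot I X := ⟨x, mfderiv I 𝓘(ℝ, ℝ) u x⟩

variable [IsManifold I ∞ X] [I.Boundaryless]

/-- The cotangent bundle is the bundle of homomorphisms from the tangent bundle to the trivial line
bundle. Its fibre coordinate is therefore composition with the differential of the inverse chart,
and the section du becomes the derivative of the coordinate expression of u. -/
theorem Cot.inCoordinates_eq {x₀ x : X} (hx : x ∈ (chartAt H x₀).source)
    (ξ : TangentSpace I x →L[ℝ] ℝ) :
    ContinuousLinearMap.inCoordinates E (TangentSpace I) ℝ (Bundle.Trivial X ℝ) x₀ x x₀ x ξ =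
      (ξ : E →L[ℝ] ℝ).comp
        (mfderiv 𝓘(ℝ, E) I (extChartAt I x₀).symm (extChartAt I x₀ x) : E →L[ℝ] E) := by
  rw [ContinuousLinearMap.inCoordinates, TangentBundle.symmL_trivializationAt hx, I.range_eq_univ,
    mfderivWithin_univ]
  ext v
  exact DFunLike.congr_fun (Bundle.Trivial.continuousLinearMapAt_trivialization ℝ X ℝ x) _

theorem Cot.trivializationAt_apply (x₀ : X) (q : Cot I X) (hq : q.proj ∈ (chartAt H x₀).source) :
    (trivializationAt (E →L[ℝ] ℝ) (fun x : X ↦ TangentSpace I x →L[ℝ] ℝ) x₀) q =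
      (q.proj, (q.2 : E →L[ℝ] ℝ).comp (mfderiv 𝓘(ℝ, E) I (extChartAt I x₀).symm
        (extChartAt I x₀ q.proj) : E →L[ℝ] E)) := by
  refine (hom_trivializationAt_apply (RingHom.id ℝ) (F₁ := E) (E₁ := TangentSpace I) (F₂ := ℝ)
    (E₂ := Bundle.Trivial X ℝ) x₀ q).trans ?_
  exact congrArg (Prod.mk q.proj) (Cot.inCoordinates_eq hq _)

theorem Cot.extChartAt_apply (p q : Cot I X) (hq : q.proj ∈ (chartAt H p.proj).source) :
    extChartAt (I.prod 𝓘(ℝ, E →L[ℝ] ℝ)) p q = (extChartAt I p.proj q.proj,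
      (q.2 : E →L[ℝ] ℝ).comp (mfderiv 𝓘(ℝ, E) I (extChartAt I p.proj).symm
        (extChartAt I p.proj q.proj) : E →L[ℝ] E)) := by
  rw [FiberBundle.extChartAt]
  change ((extChartAt I p.proj) ((trivializationAt (E →L[ℝ] ℝ)
    (fun x : X ↦ TangentSpace I x →L[ℝ] ℝ) p.proj) q).1, ((trivializationAt (E →L[ℝ] ℝ)
    (fun x : X ↦ TangentSpace I x →L[ℝ] ℝ) p.proj) q).2) = _
  rw [Cot.trivializationAt_apply _ _ hq]
  rfl

/-- The differential of a function in a chart. -/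
theorem mfderiv_comp_mfderiv_extChartAt_symm {u : X → ℝ} {x y : X} (hyc : y ∈ (chartAt H x).source)
    (hy : MDifferentiableAt I 𝓘(ℝ, ℝ) u y) :
    (mfderiv I 𝓘(ℝ, ℝ) u y : E →L[ℝ] ℝ).comp
      (mfderiv 𝓘(ℝ, E) I (extChartAt I x).symm (extChartAt I x y) : E →L[ℝ] E) =
      fderiv ℝ (u ∘ (extChartAt I x).symm) (extChartAt I x y) := by
  have hyc' : y ∈ (extChartAt I x).source := by rwa [extChartAt_source]
  have h1 : (extChartAt I x).symm (extChartAt I x y) = y := (extChartAt I x).left_inv hyc'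
  have hd : MDifferentiableAt 𝓘(ℝ, E) I (extChartAt I x).symm (extChartAt I x y) :=
    ((contMDiffOn_extChartAt_symm (n := 1) x).contMDiffAt
      ((isOpen_extChartAt_target x).mem_nhds ((extChartAt I x).map_source hyc'))).mdifferentiableAt
      (by simp)
  have h2 := mfderiv_comp (extChartAt I x y) (g := u) (I'' := 𝓘(ℝ, ℝ))
    (by rw [h1]; exact hy) hd
  rw [← mfderiv_eq_fderiv]
  refine Eq.trans ?_ h2.symm
  rw [h1]

theorem contMDiffAt_secD {u : X → ℝ} {x : X} (hu : ContMDiffAt I 𝓘(ℝ, ℝ) ∞ u x) :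
    ContMDiffAt I (I.prod 𝓘(ℝ, E →L[ℝ] ℝ)) ∞ (secD I u) x := by
  have h := contMDiffAt_hom_bundle (n := ∞) (IM := I) (IB := I) (F₁ := E) (E₁ := TangentSpace I)
    (F₂ := ℝ) (E₂ := Bundle.Trivial X ℝ) (f := secD I u) (x₀ := x)
  refine h.2 ⟨contMDiffAt_id, ?_⟩
  have hs : ContDiffAt ℝ ∞ (u ∘ (extChartAt I x).symm) (extChartAt I x x) :=
    contDiffAt_comp_extChartAt_symm hu
  have hf : ContDiffAt ℝ ∞ (fderiv ℝ (u ∘ (extChartAt I x).symm)) (extChartAt I x x) :=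
    hs.fderiv_right (m := ∞) (by simp)
  refine (hf.contMDiffAt.comp x (contMDiffAt_extChartAt (n := ∞))).congr_of_eventuallyEq ?_
  have hev : ∀ᶠ y in 𝓝 x, ContMDiffAt I 𝓘(ℝ, ℝ) 1 u y :=
    (contMDiffAt_iff_contMDiffAt_nhds (by simp)).1 (hu.of_le (m := 1) (by simp))
  filter_upwards [hev, (chartAt H x).open_source.mem_nhds (mem_chart_source H x)] with y hy hyc
  refine (Cot.inCoordinates_eq hyc _).trans ?_
  exact mfderiv_comp_mfderiv_extChartAt_symm hyc (hy.mdifferentiableAt (by simp))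

theorem Cot.mfderiv_proj_secD {u : X → ℝ} {x : X} (hu : ContMDiffAt I 𝓘(ℝ, ℝ) ∞ u x) (v : E) :
    (mfderiv (I.prod 𝓘(ℝ, E →L[ℝ] ℝ)) I (TotalSpace.proj : Cot I X → X) (secD I u x) :
      (E × (E →L[ℝ] ℝ)) →L[ℝ] E)
      ((mfderiv I (I.prod 𝓘(ℝ, E →L[ℝ] ℝ)) (secD I u) x : E →L[ℝ] (E × (E →L[ℝ] ℝ))) v) = v := by
  have h1 := mfderiv_comp x (g := (TotalSpace.proj : Cot I X → X)) (I'' := I)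
    ((Bundle.contMDiff_proj (fun x : X ↦ TangentSpace I x →L[ℝ] ℝ) (n := ∞) _).mdifferentiableAt
      (by simp)) ((contMDiffAt_secD hu).mdifferentiableAt (by simp))
  have h2 : (mfderiv I I ((TotalSpace.proj : Cot I X → X) ∘ secD I u) x : E →L[ℝ] E) =
    ContinuousLinearMap.id ℝ E := mfderiv_id
  have h3 := DFunLike.congr_fun (h1.symm.trans h2) v
  exact h3

variable (E) in
/-- Linear forms as alternating 1-forms. -/
def oneFormCLM : (E →L[ℝ] ℝ) →L[ℝ] E [⋀^Fin 1]→L[ℝ] ℝ :=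
  LinearMap.mkContinuous
    { toFun := fun f ↦ ContinuousAlternatingMap.ofSubsingleton ℝ E ℝ (0 : Fin 1) f
      map_add' := fun _ _ ↦ rfl
      map_smul' := fun _ _ ↦ rfl } 1 fun f ↦ by
    refine ContinuousAlternatingMap.opNorm_le_bound _ (by positivity) fun w ↦ ?_
    change ‖f (w 0)‖ ≤ _
    simpa using f.le_opNorm (w 0)

variable (E) in
theorem contDiff_oneFormCLM : ContDiff ℝ ∞ (oneFormCLM E) :=
  ContinuousLinearMap.contDiff (E := E →L[ℝ] ℝ) (F := E [⋀^Fin 1]→L[ℝ] ℝ) (oneFormCLM E)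

/-- The differential of a function, as a 1-form. -/
def DForm.ofFun (I : ModelWithCorners ℝ E H) (u : X → ℝ) : DForm I X ℝ 0 := fun x ↦
  ContinuousAlternatingMap.constOfIsEmpty ℝ E (Fin 0) (u x)

theorem DForm.ofFun_smoothAt {u : X → ℝ} {x : X} (hu : ContMDiffAt I 𝓘(ℝ, ℝ) ∞ u x) :
    (DForm.ofFun I u).SmoothAt x := by
  have h : (DForm.ofFun I u).inChart x = fun y ↦
      ContinuousAlternatingMap.constOfIsEmptyLIE ℝ E ℝ (Fin 0) ((u ∘ (extChartAt I x).symm) y) := by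
    ext y w
    rfl
  rw [DForm.SmoothAt, h]
  exact (ContinuousAlternatingMap.constOfIsEmptyLIE ℝ E ℝ
    (Fin 0)).toContinuousLinearEquiv.contDiff.contDiffAt.comp _ (contDiffAt_comp_extChartAt_symm hu)

theorem DForm.d_ofFun {u : X → ℝ} {x : X} (hu : MDifferentiableAt I 𝓘(ℝ, ℝ) u x) :
    (DForm.ofFun I u).d x = oneFormCLM E (dFun I u x) := by
  have h : (DForm.ofFun I u).inChart x = fun y ↦
      ContinuousAlternatingMap.constOfIsEmpty ℝ E (Fin 0) ((u ∘ (extChartAt I x).symm) y) := by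
    ext y w
    rfl
  rw [DForm.d_eq, h, extDeriv_constOfIsEmpty, dFun_eq_fderiv hu]
  rfl

/-- The defining property of λ: since the projection composed with du is the identity, λ evaluated
along the section is the covector du itself. -/
theorem tautForm_pullback_secD {u : X → ℝ} {x : X} (hu : ContMDiffAt I 𝓘(ℝ, ℝ) ∞ u x) :
    (tautForm (I := I) (X := X)).pullback (I := I) (secD I u) x = (DForm.ofFun I u).d x := by
  rw [DForm.d_ofFun (hu.mdifferentiableAt (by simp))]
  ext w
  exact congrArg (mfderiv I 𝓘(ℝ, ℝ) u x : E →L[ℝ] ℝ) (Cot.mfderiv_proj_secD hu (w 0))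

theorem Cot.proj_extChartAt_symm_mem (p : Cot I X) {y : E × (E →L[ℝ] ℝ)}
    (hy : y ∈ (extChartAt (I.prod 𝓘(ℝ, E →L[ℝ] ℝ)) p).target) :
    ((extChartAt (I.prod 𝓘(ℝ, E →L[ℝ] ℝ)) p).symm y).proj ∈ (chartAt H p.proj).source := by
  have hq := (extChartAt (I.prod 𝓘(ℝ, E →L[ℝ] ℝ)) p).map_target hy
  have h1 : (trivializationAt (E →L[ℝ] ℝ) (fun x : X ↦ TangentSpace I x →L[ℝ] ℝ) p.proj
      ((extChartAt (I.prod 𝓘(ℝ, E →L[ℝ] ℝ)) p).symm y)).1 ∈ (extChartAt I p.proj).source := by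
    have h := FiberBundle.extChartAt (IB := I) p
    have h2 : ∀ q, q ∈ (extChartAt (I.prod 𝓘(ℝ, E →L[ℝ] ℝ)) p).source →
        (trivializationAt (E →L[ℝ] ℝ) (fun x : X ↦ TangentSpace I x →L[ℝ] ℝ) p.proj q).1 ∈
          (extChartAt I p.proj).source := by
      intro q hq
      rw [h] at hq
      exact hq.2.1
    exact h2 _ hq
  rw [extChartAt_source] at h1
  exact h1

theorem Cot.proj_extChartAt_symm (p : Cot I X) {y : E × (E →L[ℝ] ℝ)}
    (hy : y ∈ (extChartAt (I.prod 𝓘(ℝ, E →L[ℝ] ℝ)) p).target) :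
    ((extChartAt (I.prod 𝓘(ℝ, E →L[ℝ] ℝ)) p).symm y).proj = (extChartAt I p.proj).symm y.1 := by
  have h := Cot.proj_extChartAt_symm_mem p hy
  have h2 := Cot.extChartAt_apply p _ h
  rw [(extChartAt (I.prod 𝓘(ℝ, E →L[ℝ] ℝ)) p).right_inv hy] at h2
  have h3 := congrArg Prod.fst h2
  simp only at h3
  rw [h3, (extChartAt I p.proj).left_inv (by rwa [extChartAt_source])]

/-- In bundle coordinates (y, ξ) the form is ξ dy, which depends linearly on the coordinates. The
projection, read in these charts, is the first coordinate. -/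
theorem tautForm_smoothAt (p : Cot I X) : (tautForm (I := I) (X := X)).SmoothAt p := by
  have hc : ContDiff ℝ ∞ fun y : E × (E →L[ℝ] ℝ) ↦
      oneFormCLM (E × (E →L[ℝ] ℝ)) (y.2.comp (ContinuousLinearMap.fst ℝ E (E →L[ℝ] ℝ))) := by
    exact (contDiff_oneFormCLM (E × (E →L[ℝ] ℝ))).comp (contDiff_snd.clm_comp contDiff_const)
  refine ContDiffAt.congr_of_eventuallyEq hc.contDiffAt ?_
  filter_upwards [extChartAt_target_mem_nhds (I := I.prod 𝓘(ℝ, E →L[ℝ] ℝ)) p] with y hy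
  set c := extChartAt (I.prod 𝓘(ℝ, E →L[ℝ] ℝ)) p with hcdef
  have hqs := Cot.proj_extChartAt_symm_mem p hy
  have hy2 := c.right_inv hy
  have hy3 : c (c.symm y) = _ := Cot.extChartAt_apply p (c.symm y) hqs
  rw [hy2] at hy3
  set q := c.symm y with hqdef
  have hy1 : y.1 = extChartAt I p.proj q.proj := congrArg Prod.fst hy3
  have hyA : y.2 = (q.2 : E →L[ℝ] ℝ).comp (mfderiv 𝓘(ℝ, E) I (extChartAt I p.proj).symm
        (extChartAt I p.proj q.proj) : E →L[ℝ] E) := congrArg Prod.snd hy3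
  have hd : MDifferentiableAt 𝓘(ℝ, E × (E →L[ℝ] ℝ)) (I.prod 𝓘(ℝ, E →L[ℝ] ℝ)) c.symm y :=
    ((contMDiffOn_extChartAt_symm (n := 1) p).contMDiffAt
      ((isOpen_extChartAt_target p).mem_nhds hy)).mdifferentiableAt (by simp)
  have hπ : MDifferentiableAt (I.prod 𝓘(ℝ, E →L[ℝ] ℝ)) I (TotalSpace.proj : Cot I X → X) q :=
    (Bundle.contMDiff_proj (fun x : X ↦ TangentSpace I x →L[ℝ] ℝ) (n := ∞) _).mdifferentiableAt
      (by simp)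
  have h1 := mfderiv_comp y (g := (TotalSpace.proj : Cot I X → X)) (I'' := I) hπ hd
  have hy1t : y.1 ∈ (extChartAt I p.proj).target := by
    rw [hy1]
    exact (extChartAt I p.proj).map_source (by rwa [extChartAt_source])
  have hd' : MDifferentiableAt 𝓘(ℝ, E) I (extChartAt I p.proj).symm y.1 :=
    ((contMDiffOn_extChartAt_symm (n := 1) p.proj).contMDiffAt
      ((isOpen_extChartAt_target p.proj).mem_nhds hy1t)).mdifferentiableAt (by simp)
  have h2 : (TotalSpace.proj : Cot I X → X) ∘ c.symm =ᶠ[𝓝 y]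
      (extChartAt I p.proj).symm ∘ Prod.fst := by
    filter_upwards [(isOpen_extChartAt_target p).mem_nhds hy] with z hz
    exact Cot.proj_extChartAt_symm p hz
  have h3 := mfderiv_comp y (g := (extChartAt I p.proj).symm) (f := Prod.fst)
    (I := 𝓘(ℝ, E × (E →L[ℝ] ℝ))) (I' := 𝓘(ℝ, E)) (I'' := I) hd' 
    ((contDiff_fst (n := 1)).contMDiff.mdifferentiableAt (by simp))
  have h4 : (mfderiv 𝓘(ℝ, E × (E →L[ℝ] ℝ)) I ((TotalSpace.proj : Cot I X → X) ∘ c.symm) y :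
      E × (E →L[ℝ] ℝ) →L[ℝ] E) = mfderiv 𝓘(ℝ, E × (E →L[ℝ] ℝ)) I
        ((extChartAt I p.proj).symm ∘ Prod.fst) y := h2.mfderiv_eq
  have h5 : (mfderiv 𝓘(ℝ, E × (E →L[ℝ] ℝ)) 𝓘(ℝ, E) Prod.fst y : E × (E →L[ℝ] ℝ) →L[ℝ] E) =
      ContinuousLinearMap.fst ℝ E (E →L[ℝ] ℝ) :=
    mfderiv_eq_fderiv.trans (ContinuousLinearMap.fst ℝ E (E →L[ℝ] ℝ)).fderiv
  ext w
  have h6 : (mfderiv (I.prod 𝓘(ℝ, E →L[ℝ] ℝ)) I (TotalSpace.proj : Cot I X → X) q :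
      (E × (E →L[ℝ] ℝ)) →L[ℝ] E) ((mfderiv 𝓘(ℝ, E × (E →L[ℝ] ℝ)) (I.prod 𝓘(ℝ, E →L[ℝ] ℝ)) c.symm y :
        (E × (E →L[ℝ] ℝ)) →L[ℝ] (E × (E →L[ℝ] ℝ))) (w 0)) =
      (mfderiv 𝓘(ℝ, E) I (extChartAt I p.proj).symm y.1 : E →L[ℝ] E) (w 0).1 := by
    refine (DFunLike.congr_fun (h1.symm.trans (h4.trans h3)) (w 0)).trans ?_
    exact congrArg (mfderiv 𝓘(ℝ, E) I (extChartAt I p.proj).symm y.1 : E →L[ℝ] E)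
      (DFunLike.congr_fun h5 (w 0))
  have h7 : y.2 (w 0).1 = (q.2 : E →L[ℝ] ℝ)
      ((mfderiv 𝓘(ℝ, E) I (extChartAt I p.proj).symm y.1 : E →L[ℝ] E) (w 0).1) := by
    rw [hyA, hy1]
    rfl
  exact (congrArg (q.2 : E →L[ℝ] ℝ) h6).trans h7.symm

/-- By naturality the pullback of dλ is the exterior derivative of du, and `d ∘ d = 0`. -/
theorem canForm_pullback_secD {u : X → ℝ} {x : X} (hu : ∀ᶠ y in 𝓝 x, ContMDiffAt I 𝓘(ℝ, ℝ) ∞ u y) :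
    (canForm (I := I) (X := X)).pullback (I := I) (secD I u) x = 0 := by
  have h0 := hu.self_of_nhds
  have h1 := DForm.d_pullback (tautForm_smoothAt (secD I u x)) (contMDiffAt_secD h0)
  have h2 : ∀ᶠ y in 𝓝 x, (tautForm (I := I) (X := X)).pullback (I := I) (secD I u) y =
    (DForm.ofFun I u).d y := hu.mono fun y hy ↦ tautForm_pullback_secD hy
  rw [DForm.d_congr h2, DForm.d_d (hu.mono fun y hy ↦ DForm.ofFun_smoothAt hy)] at h1
  ext w
  exact (congrArg (fun z : E [⋀^Fin 2]→L[ℝ] ℝ ↦ -(z w)) h1.symm).trans neg_zero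

end Cotangent

/-! ### Graphs of exact 1-forms as submanifolds -/

/-- `ℝ³ × ℝ³ ≃ ℝ⁶`. -/
def appendEquiv : (Eu 3 × Eu 3) ≃ₗ[ℝ] Eu 6 where
  toFun v := WithLp.toLp 2 (Fin.append (m := 3) (n := 3) v.1 v.2)
  invFun y := (WithLp.toLp 2 fun j ↦ y (Fin.castAdd 3 j), WithLp.toLp 2 fun j ↦ y (Fin.natAdd 3 j))
  map_add' v w := by
    ext j
    refine Fin.addCases (m := 3) (n := 3) (fun j ↦ ?_) (fun j ↦ ?_) j <;> simp [-Fin.natAdd_eq_addNat]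
  map_smul' c v := by
    ext j
    refine Fin.addCases (m := 3) (n := 3) (fun j ↦ ?_) (fun j ↦ ?_) j <;> simp [-Fin.natAdd_eq_addNat]
  left_inv v := by
    refine Prod.ext ?_ ?_ <;> ext j <;> simp [-Fin.natAdd_eq_addNat]
  right_inv y := by
    ext j
    refine Fin.addCases (m := 3) (n := 3) (fun j ↦ ?_) (fun j ↦ ?_) j <;> simp [-Fin.natAdd_eq_addNat]

theorem appendEquiv_vanish (v : Eu 3 × Eu 3) :
    (∀ j : Fin 6, 3 ≤ j.val → appendEquiv v j = 0) ↔ v.2 = 0 := by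
  constructor
  · intro h
    ext j
    have := h (Fin.natAdd 3 j) (by simp)
    simpa [appendEquiv, -Fin.natAdd_eq_addNat] using this
  · intro h j
    refine Fin.addCases (m := 3) (n := 3) (fun j hj ↦ ?_) (fun j _ ↦ ?_) j
    · simp only [Fin.val_castAdd] at hj
      omega
    · simp [appendEquiv, h, -Fin.natAdd_eq_addNat]

theorem exists_split {E F : Type*} [NormedAddCommGroup E] [NormedSpace ℝ E]
    [NormedAddCommGroup F] [NormedSpace ℝ F] (hE : Module.finrank ℝ E = 3)
    (hF : Module.finrank ℝ F = 3) : ∃ T : (E × F) ≃L[ℝ] Eu 6, ∀ v : E × F,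
      (∀ j : Fin 6, 3 ≤ j.val → T v j = 0) ↔ v.2 = 0 := by
  have : FiniteDimensional ℝ E := Module.finite_of_finrank_pos (by omega)
  have : FiniteDimensional ℝ F := Module.finite_of_finrank_pos (by omega)
  have e1 : E ≃L[ℝ] Eu 3 := ContinuousLinearEquiv.ofFinrankEq (by simpa using hE)
  have e2 : F ≃L[ℝ] Eu 3 := ContinuousLinearEquiv.ofFinrankEq (by simpa using hF)
  refine ⟨(e1.prodCongr e2).trans appendEquiv.toContinuousLinearEquiv, fun v ↦ ?_⟩
  refine (appendEquiv_vanish (e1 v.1, e2 v.2)).trans ?_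
  simp

/-- The shear `(y, A) ↦ (y, A - g y)`. -/
def shear {E F : Type*} [TopologicalSpace E] [NormedAddCommGroup F] {W : Set E} (hW : IsOpen W)
    {g : E → F} (hg : ContinuousOn g W) : OpenPartialHomeomorph (E × F) (E × F) where
  toFun v := (v.1, v.2 - g v.1)
  invFun v := (v.1, v.2 + g v.1)
  source := W ×ˢ univ
  target := W ×ˢ univ
  map_source' _ h := h
  map_target' _ h := h
  left_inv' v _ := by simp
  right_inv' v _ := by simp
  open_source := hW.prod isOpen_univ
  open_target := hW.prod isOpen_univ
  continuousOn_toFun := continuousOn_fst.prodMk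
    (continuousOn_snd.sub (hg.comp continuousOn_fst fun _ h ↦ h.1))
  continuousOn_invFun := continuousOn_fst.prodMk
    (continuousOn_snd.add (hg.comp continuousOn_fst fun _ h ↦ h.1))

theorem isDiffeo_shear {E F : Type*} [NormedAddCommGroup E] [NormedSpace ℝ E]
    [NormedAddCommGroup F] [NormedSpace ℝ F] {W : Set E} (hW : IsOpen W)
    {g : E → F} (hg : ContDiffOn ℝ ∞ g W) :
    IsDiffeo 𝓘(ℝ, E × F) 𝓘(ℝ, E × F) (shear hW hg.continuousOn) := by
  constructor
  · exact (contDiffOn_fst.prodMk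
      (contDiffOn_snd.sub (hg.comp contDiffOn_fst fun _ h ↦ h.1))).contMDiffOn
  · exact (contDiffOn_fst.prodMk
      (contDiffOn_snd.add (hg.comp contDiffOn_fst fun _ h ↦ h.1))).contMDiffOn

section Chart

variable {E H M : Type*} [NormedAddCommGroup E] [NormedSpace ℝ E] [TopologicalSpace H]
  (I : ModelWithCorners ℝ E H) [I.Boundaryless] [TopologicalSpace M] [ChartedSpace H M]

/-- The extended chart of a manifold without boundary. -/
def chartHomeo (p : M) : OpenPartialHomeomorph M E where
  toPartialEquiv := extChartAt I p
  open_source := isOpen_extChartAt_source p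
  open_target := isOpen_extChartAt_target p
  continuousOn_toFun := continuousOn_extChartAt p
  continuousOn_invFun := continuousOn_extChartAt_symm p

theorem isDiffeo_chartHomeo [IsManifold I ∞ M] (p : M) : IsDiffeo I 𝓘(ℝ, E) (chartHomeo I p) :=
  ⟨by
    have := contMDiffOn_extChartAt (I := I) (x := p) (n := ∞)
    rwa [← extChartAt_source I] at this, contMDiffOn_extChartAt_symm p⟩

end Chart

theorem isDiffeo_equiv {E F : Type*} [NormedAddCommGroup E] [NormedSpace ℝ E]
    [NormedAddCommGroup F] [NormedSpace ℝ F] (T : E ≃L[ℝ] F) :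
    IsDiffeo 𝓘(ℝ, E) 𝓘(ℝ, F) T.toHomeomorph.toOpenPartialHomeomorph :=
  ⟨T.contDiff.contMDiff.contMDiffOn, T.symm.contDiff.contMDiff.contMDiffOn⟩

section Graph

variable {E H : Type*} [NormedAddCommGroup E] [NormedSpace ℝ E] [TopologicalSpace H]
  {I : ModelWithCorners ℝ E H} [I.Boundaryless] {X : Type*} [TopologicalSpace X] [ChartedSpace H X]
  [IsManifold I ∞ X]
  {M : Type*} [TopologicalSpace M] [ChartedSpace (Eu 6) M] [IsManifold (𝓡 6) ∞ M]

/-- In a bundle chart the section is the graph of the ordinary derivative `g` of a function on the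
three-dimensional model space. The shear (y, ξ) ↦ (y, ξ - g y) flattens it to ξ = 0, and a linear
isomorphism onto ℝ⁶ puts this in the standard position. -/
theorem submanifoldAt_graph (hE : Module.finrank ℝ E = 3) {e : OpenPartialHomeomorph (Cot I X) M}
    (he : IsDiffeo (I.prod 𝓘(ℝ, E →L[ℝ] ℝ)) (𝓡 6) e) {u : X → ℝ} {x : X}
    (hu : ∀ᶠ y in 𝓝 x, ContMDiffAt I 𝓘(ℝ, ℝ) ∞ u y) (hx : secD I u x ∈ e.source) {N : Set M}
    (hN : ∀ᶠ q in 𝓝 (secD I u x), e q ∈ N ↔ q = secD I u q.proj) :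
    SubmanifoldAt N (e (secD I u x)) := by
  have : FiniteDimensional ℝ E := Module.finite_of_finrank_pos (by omega)
  have hE' : Module.finrank ℝ (E →L[ℝ] ℝ) = 3 := by
    rw [← hE, ← LinearMap.toContinuousLinearMap.finrank_eq (R := ℝ)]
    exact Subspace.dual_finrank_eq
  obtain ⟨T, hT⟩ := exists_split hE hE'
  set p := secD I u x with hp
  set ψ := extChartAt I x with hψ
  set g : E → E →L[ℝ] ℝ := fderiv ℝ (u ∘ ψ.symm) with hg
  have hsm : ∀ᶠ y in 𝓝 (ψ x), ContDiffAt ℝ ∞ g y := by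
    have h1 : ∀ᶠ y in 𝓝 (ψ x), ContMDiffAt I 𝓘(ℝ, ℝ) ∞ u (ψ.symm y) := eventually_extChartAt_symm hu
    filter_upwards [h1, extChartAt_target_mem_nhds (I := I) x] with y hy hyt
    have h2 : ContMDiffAt 𝓘(ℝ, E) 𝓘(ℝ, ℝ) ∞ (u ∘ ψ.symm) y :=
      hy.comp y ((contMDiffOn_extChartAt_symm x).contMDiffAt
        ((isOpen_extChartAt_target x).mem_nhds hyt))
    exact h2.contDiffAt.fderiv_right (m := ∞) (by simp)
  obtain ⟨W, hW, hWo, hxW⟩ := eventually_nhds_iff.1 hsm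
  have hgW : ContDiffOn ℝ ∞ g W := fun y hy ↦ (hW y hy).contDiffWithinAt
  have hc := isDiffeo_chartHomeo (I.prod 𝓘(ℝ, E →L[ℝ] ℝ)) p
  have hpc : p ∈ (chartHomeo (I.prod 𝓘(ℝ, E →L[ℝ] ℝ)) p).source := mem_extChartAt_source p
  have hcp : chartHomeo (I.prod 𝓘(ℝ, E →L[ℝ] ℝ)) p p ∈ (shear hWo hgW.continuousOn).source := by
    refine ⟨?_, trivial⟩
    have := Cot.extChartAt_apply p p (mem_chart_source _ _)
    change (extChartAt (I.prod 𝓘(ℝ, E →L[ℝ] ℝ)) p p).1 ∈ W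
    rw [this]
    exact hxW
  have hd := he.symm.trans ((hc.trans (isDiffeo_shear hWo hgW)).trans (isDiffeo_equiv T))
  refine submanifoldAt_of_isDiffeo hd ⟨e.map_source hx, ?_⟩ ?_
  · change e.symm (e p) ∈ (((chartHomeo (I.prod 𝓘(ℝ, E →L[ℝ] ℝ)) p).trans
      (shear hWo hgW.continuousOn)).trans T.toHomeomorph.toOpenPartialHomeomorph).source
    rw [e.left_inv hx]
    exact ⟨⟨hpc, hcp⟩, trivial⟩
  · have hev : ∀ᶠ q in 𝓝 p, e q ∈ N ↔ ∀ j : Fin 6, 3 ≤ j.val →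
        T (shear hWo hgW.continuousOn (chartHomeo (I.prod 𝓘(ℝ, E →L[ℝ] ℝ)) p q)) j = 0 := by
      have hcont : ContinuousAt (TotalSpace.proj : Cot I X → X) p :=
        (Bundle.contMDiff_proj (fun x : X ↦ TangentSpace I x →L[ℝ] ℝ)
          (n := ∞) (IB := I)).continuous.continuousAt
      have hsec : ContinuousAt (secD I u) x := (contMDiffAt_secD hu.self_of_nhds).continuousAt
      have h2 : ∀ᶠ y in 𝓝 x, y ∈ (chartAt H x).source :=
        (chartAt H x).open_source.mem_nhds (mem_chart_source H x)
      have h3 : ∀ᶠ y in 𝓝 x, secD I u y ∈ (chartHomeo (I.prod 𝓘(ℝ, E →L[ℝ] ℝ)) p).source :=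
        hsec.eventually ((chartHomeo (I.prod 𝓘(ℝ, E →L[ℝ] ℝ)) p).open_source.mem_nhds hpc)
      filter_upwards [hN, hcont.eventually hu, hcont.eventually h2, hcont.eventually h3,
        (chartHomeo (I.prod 𝓘(ℝ, E →L[ℝ] ℝ)) p).open_source.mem_nhds hpc] with q hq hqu hqc hqs hqp
      have hA : chartHomeo (I.prod 𝓘(ℝ, E →L[ℝ] ℝ)) p q = _ := Cot.extChartAt_apply p q hqc
      have hB : chartHomeo (I.prod 𝓘(ℝ, E →L[ℝ] ℝ)) p (secD I u q.proj) = _ :=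
        Cot.extChartAt_apply p (secD I u q.proj) hqc
      have hB2 : chartHomeo (I.prod 𝓘(ℝ, E →L[ℝ] ℝ)) p (secD I u q.proj) =
          (ψ q.proj, g (ψ q.proj)) := by
        rw [hB]
        exact congrArg (Prod.mk _) (mfderiv_comp_mfderiv_extChartAt_symm hqc
          (hqu.mdifferentiableAt (by simp)))
      rw [hq, hT, ← (chartHomeo (I.prod 𝓘(ℝ, E →L[ℝ] ℝ)) p).injOn.eq_iff hqp hqs, hB2, hA]
      change _ ↔ _ - g (ψ q.proj) = 0
      rw [sub_eq_zero]
      exact ⟨fun h ↦ congrArg Prod.snd h, fun h ↦ Prod.ext rfl h⟩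
    have hc2 : Filter.Tendsto e.symm (𝓝 (e p)) (𝓝 p) := by
      have := e.symm.continuousAt (e.map_source hx)
      rwa [ContinuousAt, e.left_inv hx] at this
    filter_upwards [hc2.eventually hev, e.open_target.mem_nhds (e.map_source hx)] with z hz hzt
    rw [e.right_inv hzt] at hz
    exact hz

/-- The pullback of the canonical symplectic form to the graph of `du` vanishes. -/
theorem eq_zero_of_tangentVectors_graph {e : OpenPartialHomeomorph (Cot I X) M}
    (he : IsDiffeo (I.prod 𝓘(ℝ, E →L[ℝ] ℝ)) (𝓡 6) e) {u : X → ℝ} {x : X}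
    (hu : ∀ᶠ y in 𝓝 x, ContMDiffAt I 𝓘(ℝ, ℝ) ∞ u y) (hx : secD I u x ∈ e.source) {N : Set M}
    (hN : ∀ᶠ q in 𝓝 (secD I u x), e q ∈ N → q = secD I u q.proj) {ω : DForm (𝓡 6) M ℝ 2}
    (hω : ω.pullback (I := I.prod 𝓘(ℝ, E →L[ℝ] ℝ)) e (secD I u x) = canForm (secD I u x)) :
    ∀ v ∈ tangentVectors N (e (secD I u x)), ∀ w ∈ tangentVectors N (e (secD I u x)),
      (ω (e (secD I u x)) : Eu 6 [⋀^Fin 2]→L[ℝ] ℝ) ![v, w] = 0 := by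
  -- A curve in `N` lifts to a curve in the graph and is recovered from its projection to the base
  -- by composing with the section. So every tangent vector of `N` is in the image of the
  -- differential of `secD I u`.
  have key : ∀ v ∈ tangentVectors N (e (secD I u x)), ∃ v' : E, (v : Eu 6) =
      (mfderiv (I.prod 𝓘(ℝ, E →L[ℝ] ℝ)) (𝓡 6) e (secD I u x) : E × (E →L[ℝ] ℝ) →L[ℝ] Eu 6)
        ((mfderiv I (I.prod 𝓘(ℝ, E →L[ℝ] ℝ)) (secD I u) x : E →L[ℝ] E × (E →L[ℝ] ℝ)) v') := by
    rintro v ⟨c, hc0, hc, hcN, hv⟩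
    obtain ⟨b, hb0, hb, hbc, hd⟩ := he.exists_lift hx hc0 hc
    have hπ : ContMDiffAt (I.prod 𝓘(ℝ, E →L[ℝ] ℝ)) I ∞ (TotalSpace.proj : Cot I X → X) (b 0) :=
      Bundle.contMDiff_proj (fun x : X ↦ TangentSpace I x →L[ℝ] ℝ) (n := ∞) _
    have ha : ContMDiffAt 𝓘(ℝ, ℝ) I ∞ ((TotalSpace.proj : Cot I X → X) ∘ b) 0 := hπ.comp 0 hb
    have ha0 : ((TotalSpace.proj : Cot I X → X) ∘ b) 0 = x := by
      change (b 0).proj = x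
      rw [hb0]
      rfl
    have hbt : Filter.Tendsto b (𝓝 0) (𝓝 (secD I u x)) := hb0 ▸ hb.continuousAt
    have hbe : b =ᶠ[𝓝 0] secD I u ∘ ((TotalSpace.proj : Cot I X → X) ∘ b) := by
      filter_upwards [hbc, hcN, hbt.eventually hN] with s h1 h2 h3
      exact h3 (h1.2 ▸ h2)
    have hs : MDifferentiableAt I (I.prod 𝓘(ℝ, E →L[ℝ] ℝ)) (secD I u)
        (((TotalSpace.proj : Cot I X → X) ∘ b) 0) := by
      rw [ha0]
      exact (contMDiffAt_secD hu.self_of_nhds).mdifferentiableAt (by simp)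
    have h1 := mfderiv_comp 0 hs (ha.mdifferentiableAt (by simp))
    have h2 : (mfderiv 𝓘(ℝ, ℝ) (I.prod 𝓘(ℝ, E →L[ℝ] ℝ)) b 0 : ℝ →L[ℝ] E × (E →L[ℝ] ℝ)) =
      mfderiv 𝓘(ℝ, ℝ) (I.prod 𝓘(ℝ, E →L[ℝ] ℝ))
        (secD I u ∘ ((TotalSpace.proj : Cot I X → X) ∘ b)) 0 := hbe.mfderiv_eq
    have h3 : (mfderiv I (I.prod 𝓘(ℝ, E →L[ℝ] ℝ)) (secD I u)
        (((TotalSpace.proj : Cot I X → X) ∘ b) 0) : E →L[ℝ] E × (E →L[ℝ] ℝ)) =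
      mfderiv I (I.prod 𝓘(ℝ, E →L[ℝ] ℝ)) (secD I u) x := by rw [ha0]
    refine ⟨(mfderiv 𝓘(ℝ, ℝ) I ((TotalSpace.proj : Cot I X → X) ∘ b) 0 : ℝ →L[ℝ] E) 1,
      (hv.trans hd).trans ?_⟩
    refine congrArg (mfderiv (I.prod 𝓘(ℝ, E →L[ℝ] ℝ)) (𝓡 6) e (secD I u x) :
      E × (E →L[ℝ] ℝ) →L[ℝ] Eu 6) ?_
    refine (DFunLike.congr_fun (h2.trans h1) (1 : ℝ)).trans ?_
    exact DFunLike.congr_fun h3 _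
  intro v hv w hw
  obtain ⟨v', hv'⟩ := key v hv
  obtain ⟨w', hw'⟩ := key w hw
  have h0 := canForm_pullback_secD hu
  have h1 := DFunLike.congr_fun hω
    (fun j ↦ (mfderiv I (I.prod 𝓘(ℝ, E →L[ℝ] ℝ)) (secD I u) x : E →L[ℝ] E × (E →L[ℝ] ℝ))
      (![v', w'] j))
  have h2 := DFunLike.congr_fun h0 ![v', w']
  refine Eq.trans ?_ (h1.trans h2)
  change (ω (e (secD I u x)) : Eu 6 [⋀^Fin 2]→L[ℝ] ℝ) _ = (ω (e (secD I u x)) :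
    Eu 6 [⋀^Fin 2]→L[ℝ] ℝ) (fun j ↦ (mfderiv (I.prod 𝓘(ℝ, E →L[ℝ] ℝ)) (𝓡 6) e (secD I u x) :
      E × (E →L[ℝ] ℝ) →L[ℝ] Eu 6) ((mfderiv I (I.prod 𝓘(ℝ, E →L[ℝ] ℝ)) (secD I u) x :
        E →L[ℝ] E × (E →L[ℝ] ℝ)) (![v', w'] j)))
  congr 1
  ext j : 1
  fin_cases j
  · exact hv'
  · exact hw'

end Graph

/-! ### Uniform size of Lagrangian neighbourhoods -/

section Cot

variable {E H : Type*} [NormedAddCommGroup E] [NormedSpace ℝ E] [TopologicalSpace H]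
  {I : ModelWithCorners ℝ E H} [I.Boundaryless] {X : Type*} [TopologicalSpace X] [ChartedSpace H X]
  [IsManifold I ∞ X]

variable (I) in
/-- The differential of the preferred chart at `x₀`. -/
def chartD (x₀ x : X) : E →L[ℝ] E := mfderiv I 𝓘(ℝ, E) (extChartAt I x₀) x

variable (I) in
/-- The differential of the inverse of the preferred chart at `x₀`. -/
def chartSymmD (x₀ x : X) : E →L[ℝ] E :=
  mfderiv 𝓘(ℝ, E) I (extChartAt I x₀).symm (extChartAt I x₀ x)

/-- Neighbourhoods of the zero section contain all small covectors, measured in a chart. -/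
theorem Cot.exists_ball_subset {O : Set (Cot I X)} (hO : IsOpen O) {x₀ : X}
    (h0 : (⟨x₀, 0⟩ : Cot I X) ∈ O) :
    ∃ c > 0, ∀ᶠ x in 𝓝 x₀, ∀ ξ : E →L[ℝ] ℝ,
      ‖ξ.comp (chartSymmD I x₀ x)‖ < c →
        (⟨x, ξ⟩ : Cot I X) ∈ O := by
  set p : Cot I X := ⟨x₀, 0⟩
  set c := chartHomeo (I.prod 𝓘(ℝ, E →L[ℝ] ℝ)) p
  have hpc : p ∈ c.source := mem_extChartAt_source p
  have hcp : c p = (extChartAt I x₀ x₀, 0) :=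
    (Cot.extChartAt_apply p p (mem_chart_source _ _)).trans
      (Prod.ext rfl (ContinuousLinearMap.zero_comp _))
  have h1 : ∀ᶠ y in 𝓝 (c p), c.symm y ∈ O := by
    have := c.symm.continuousAt (c.map_source hpc)
    rw [ContinuousAt, c.left_inv hpc] at this
    exact this.eventually (hO.mem_nhds h0)
  rw [hcp, nhds_prod_eq, Filter.eventually_prod_iff] at h1
  obtain ⟨P, hP, Q, hQ, h⟩ := h1
  obtain ⟨r, hr, hrQ⟩ := Metric.eventually_nhds_iff.1 hQ
  refine ⟨r, hr, ?_⟩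
  filter_upwards [(continuousAt_extChartAt x₀).eventually hP,
    (chartAt H x₀).open_source.mem_nhds (mem_chart_source H x₀)] with x hx hxc ξ hξ
  have h2 := h hx (hrQ (y := ξ.comp (chartSymmD I x₀ x)) (by rwa [dist_zero_right]))
  have h3 : c (⟨x, ξ⟩ : Cot I X) = _ := Cot.extChartAt_apply p ⟨x, ξ⟩ hxc
  have h4 : (⟨x, ξ⟩ : Cot I X) ∈ c.source := by
    change _ ∈ (extChartAt (I.prod 𝓘(ℝ, E →L[ℝ] ℝ)) p).source
    rw [FiberBundle.extChartAt]
    have hb : (⟨x, ξ⟩ : Cot I X) ∈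
        (trivializationAt (E →L[ℝ] ℝ) (fun x : X ↦ TangentSpace I x →L[ℝ] ℝ) x₀).source :=
      (Trivialization.mem_source _).2 ⟨by simpa using hxc, mem_univ _⟩
    refine ⟨hb, ?_, mem_univ _⟩
    change ((trivializationAt (E →L[ℝ] ℝ) (fun x : X ↦ TangentSpace I x →L[ℝ] ℝ) x₀)
      (⟨x, ξ⟩ : Cot I X)).1 ∈ _
    rw [Trivialization.coe_fst _ hb, extChartAt_source]
    exact hxc
  rw [← c.left_inv h4, h3]
  exact h2

end Cot

/-! ### Local bounds in charts for metrics and differentials. -/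

section Metric

variable {E H M : Type*} [NormedAddCommGroup E] [NormedSpace ℝ E] [TopologicalSpace H]
  {I : ModelWithCorners ℝ E H} [I.Boundaryless] [TopologicalSpace M] [ChartedSpace H M]
  [IsManifold I ∞ M]

/-- A Calabi-Yau metric is locally bounded in charts. -/
theorem Triple.IsCalabiYauOn.eventually_metric_le {S : Triple I M} {U : Set M}
    (hS : S.IsCalabiYauOn U) {p₀ : M} (hp₀ : p₀ ∈ U) :
    ∃ K > 0, ∀ᶠ p in 𝓝 p₀, ∀ v : E,
      S.metric p v v ≤ K * ‖chartD I p₀ p v‖ ^ 2 := by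
  have hJ := (hS.1 p₀ hp₀).continuousAt.norm
  have hω := (hS.2.1 p₀ hp₀).continuousAt.norm
  refine ⟨(‖S.ω.inChart p₀ (extChartAt I p₀ p₀)‖ + 1) * (‖S.JInChart p₀ (extChartAt I p₀ p₀)‖ + 1),
    by positivity, ?_⟩
  have hc := continuousAt_extChartAt (I := I) p₀
  filter_upwards [hc.eventually (hJ.eventually (gt_mem_nhds (lt_add_one _))),
    hc.eventually (hω.eventually (gt_mem_nhds (lt_add_one _))),
    extChartAt_source_mem_nhds (I := I) p₀] with p h1 h2 hp v
  set D : E →L[ℝ] E := chartD I p₀ p with hD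
  set y := extChartAt I p₀ p with hy
  have hinv : (extChartAt I p₀).symm y = p := (extChartAt I p₀).left_inv hp
  have hDD : ∀ v, (mfderiv 𝓘(ℝ, E) I (extChartAt I p₀).symm y : E →L[ℝ] E) (D v) = v := fun v ↦
    DFunLike.congr_fun ((isDiffeo_chartHomeo I p₀).mfderiv_symm_comp hp) v
  have key : ∀ q : M, q = p → ∀ D' : E →L[ℝ] E, (∀ v, D' (D v) = v) →
      (S.ω q : E [⋀^Fin 2]→L[ℝ] ℝ) ![D' (D v), D' ((mfderiv I 𝓘(ℝ, E) (extChartAt I p₀) q :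
        E →L[ℝ] E) ((S.J q : E →L[ℝ] E) (D' (D v))))] = S.metric p v v := by
    rintro q rfl D' h
    rw [h]
    change _ = (S.ω q : E [⋀^Fin 2]→L[ℝ] ℝ) ![v, (S.J q : E →L[ℝ] E) v]
    exact congrArg (fun z ↦ (S.ω q : E [⋀^Fin 2]→L[ℝ] ℝ) ![v, z]) (h _)
  have h3 : S.metric p v v = S.ω.inChart p₀ y ![D v, S.JInChart p₀ y (D v)] := by
    rw [← key _ hinv _ hDD]
    change (S.ω ((extChartAt I p₀).symm y) : E [⋀^Fin 2]→L[ℝ] ℝ) _ =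
      (S.ω ((extChartAt I p₀).symm y) : E [⋀^Fin 2]→L[ℝ] ℝ)
        (fun j ↦ (mfderiv 𝓘(ℝ, E) I (extChartAt I p₀).symm y : E →L[ℝ] E) (![_, _] j))
    congr 1
    ext j : 1
    fin_cases j <;> rfl
  rw [h3]
  calc S.ω.inChart p₀ y ![D v, S.JInChart p₀ y (D v)]
      ≤ ‖S.ω.inChart p₀ y‖ * ∏ j, ‖(![D v, S.JInChart p₀ y (D v)] : Fin 2 → E) j‖ :=
        (le_abs_self _).trans ((S.ω.inChart p₀ y).le_opNorm _)
    _ = ‖S.ω.inChart p₀ y‖ * (‖D v‖ * ‖S.JInChart p₀ y (D v)‖) := by simp [Fin.prod_univ_two]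
    _ ≤ ‖S.ω.inChart p₀ y‖ * (‖D v‖ * (‖S.JInChart p₀ y‖ * ‖D v‖)) := by
        gcongr
        exact (S.JInChart p₀ y).le_opNorm _
    _ = ‖S.ω.inChart p₀ y‖ * ‖S.JInChart p₀ y‖ * ‖D v‖ ^ 2 := by ring
    _ ≤ _ := by gcongr

/-- Read in fixed charts, the differential of a smooth map is a continuous function of the point,
hence locally bounded. -/
theorem eventually_norm_mfderiv_le {E' H' M' : Type*} [NormedAddCommGroup E'] [NormedSpace ℝ E']
    [TopologicalSpace H'] {I' : ModelWithCorners ℝ E' H'} [I'.Boundaryless] [TopologicalSpace M']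
    [ChartedSpace H' M'] [IsManifold I' ∞ M'] {f : M → M'} {x₀ : M} (hf : ContMDiffAt I I' ∞ f x₀) :
    ∃ K > 0, ∀ᶠ x in 𝓝 x₀, ∀ v : E,
      ‖chartD I' (f x₀) (f x) ((mfderiv I I' f x : E →L[ℝ] E') (chartSymmD I x₀ x v))‖ ≤ K * ‖v‖ := by
  have : IsManifold I 1 M := .of_le (n := ∞) (by simp)
  have : IsManifold I' 1 M' := .of_le (n := ∞) (by simp)
  have h := (hf.mfderiv_const (m := 0) (by simp)).continuousAt.norm
  refine ⟨‖inTangentCoordinates I I' id f (fun x ↦ (mfderiv I I' f x : E →L[ℝ] E')) x₀ x₀‖ + 1,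
    by positivity, ?_⟩
  filter_upwards [h.eventually (gt_mem_nhds (lt_add_one _)),
    (chartAt H x₀).open_source.mem_nhds (mem_chart_source H x₀),
    hf.continuousAt.eventually ((chartAt H' (f x₀)).open_source.mem_nhds
      (mem_chart_source H' (f x₀)))] with x hx hxc hxc' v
  have h1 : inTangentCoordinates I I' id f (fun x ↦ (mfderiv I I' f x : E →L[ℝ] E')) x₀ x v =
      chartD I' (f x₀) (f x) ((mfderiv I I' f x : E →L[ℝ] E') (chartSymmD I x₀ x v)) := by
    have a1 := TangentBundle.continuousLinearMapAt_trivializationAt (I := I') hxc'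
    have a2 := TangentBundle.symmL_trivializationAt (I := I) hxc
    rw [I.range_eq_univ, mfderivWithin_univ] at a2
    refine (DFunLike.congr_fun a1 _).trans ?_
    refine congrArg (fun z ↦ chartD I' (f x₀) (f x) ((mfderiv I I' f x : E →L[ℝ] E') z)) ?_
    exact DFunLike.congr_fun a2 v
  rw [← h1]
  exact ((inTangentCoordinates I I' id f _ x₀ x).le_opNorm v).trans (by gcongr)

end Metric

section Cone

variable {G : Type*} [TopologicalSpace G] [ChartedSpace (Eu 5) G] [IsManifold (𝓡 5) ∞ G]
  {V : Triple (coneModel 5) (G × ℝ)}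
  {S : Type*} [TopologicalSpace S] [ChartedSpace (Eu 2) S] [IsManifold (𝓡 2) ∞ S] {ι : S → G}

theorem IsSLCone.contMDiff_coneMap (hι : IsSLCone V ι) :
    ContMDiff (coneModel 2) (coneModel 5) ∞ (coneMap ι) :=
  (hι.embedding.contMDiff.comp contMDiff_fst).prodMk contMDiff_snd

theorem IsSLCone.mfderiv_coneMap (hι : IsSLCone V ι) (p : S × ℝ) (v : Eu 2 × ℝ) :
    (mfderiv (coneModel 2) (coneModel 5) (coneMap ι) p : Eu 2 × ℝ →L[ℝ] Eu 5 × ℝ) v =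
      ((mfderiv (𝓡 2) (𝓡 5) ι p.1 : Eu 2 →L[ℝ] Eu 5) v.1, v.2) := by
  have h1 : HasMFDerivAt (𝓡 2) (𝓡 5) ι p.1 (mfderiv (𝓡 2) (𝓡 5) ι p.1) :=
    (hι.embedding.contMDiff.contMDiffAt.mdifferentiableAt (by simp)).hasMFDerivAt
  have h2 : HasMFDerivAt 𝓘(ℝ, ℝ) 𝓘(ℝ, ℝ) (id : ℝ → ℝ) p.2 (ContinuousLinearMap.id ℝ ℝ) :=
    hasMFDerivAt_id p.2
  have h := h1.prodMap h2
  rw [h2.mfderiv] at h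
  exact DFunLike.congr_fun (F := Eu 2 × ℝ →L[ℝ] Eu 5 × ℝ) h.mfderiv v

theorem abs_snd_le_slConeMetric (hV : IsCalabiYauCone V) (hι : IsSLCone V ι) {p : S × ℝ}
    (hp : 0 < p.2) (v : Eu 2 × ℝ) : |v.2| ≤ √(slConeMetric V ι p v v) := by
  have h := hV.abs_radial_le (p := coneMap ι p) hp
    ((mfderiv (coneModel 2) (coneModel 5) (coneMap ι) p : Eu 2 × ℝ →L[ℝ] Eu 5 × ℝ) v)
  have h2 : ((mfderiv (coneModel 2) (coneModel 5) (coneMap ι) p :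
    Eu 2 × ℝ →L[ℝ] Eu 5 × ℝ) v).2 = v.2 := by rw [hι.mfderiv_coneMap]
  rw [h2] at h
  exact h

theorem slConeMetric_shrink (hV : IsCalabiYauCone V) (hι : IsSLCone V ι) {t : ℝ} (ht : 0 < t)
    {p : S × ℝ} (hp : 0 < p.2) (v : Eu 2 × ℝ) :
    slConeMetric V ι (shrink t p) ((v.1, t⁻¹ * v.2) : Eu 2 × ℝ) ((v.1, t⁻¹ * v.2) : Eu 2 × ℝ) =
      (t⁻¹) ^ 2 * slConeMetric V ι p v v := by
  have h := hV.metric_shrink ht (p := coneMap ι p) hp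
    ((mfderiv (coneModel 2) (coneModel 5) (coneMap ι) p : Eu 2 × ℝ →L[ℝ] Eu 5 × ℝ) v)
  have h2 : (mfderiv (coneModel 2) (coneModel 5) (coneMap ι) (shrink t p) :
      Eu 2 × ℝ →L[ℝ] Eu 5 × ℝ) (v.1, t⁻¹ * v.2) =
      (((mfderiv (coneModel 2) (coneModel 5) (coneMap ι) p : Eu 2 × ℝ →L[ℝ] Eu 5 × ℝ) v).1,
        t⁻¹ * ((mfderiv (coneModel 2) (coneModel 5) (coneMap ι) p :
          Eu 2 × ℝ →L[ℝ] Eu 5 × ℝ) v).2) := by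
    rw [hι.mfderiv_coneMap, hι.mfderiv_coneMap]
    rfl
  refine Eq.trans ?_ h
  change V.metric (coneMap ι (shrink t p)) ((mfderiv (coneModel 2) (coneModel 5) (coneMap ι)
    (shrink t p) : Eu 2 × ℝ →L[ℝ] Eu 5 × ℝ) (v.1, t⁻¹ * v.2)) ((mfderiv (coneModel 2) (coneModel 5)
      (coneMap ι) (shrink t p) : Eu 2 × ℝ →L[ℝ] Eu 5 × ℝ) (v.1, t⁻¹ * v.2)) = _
  rw [h2]
  rfl

/-- Acting by s on a covector η + c dr gives s²η + s c dr, which is s² times the pullback under the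
dilation by s⁻¹. In this form the action matches the behaviour of differentials of rescaled
functions. -/
theorem LagNbhd.dilate (L : LagNbhd V ι) {p : Cot (coneModel 2) (S × ℝ)} (hp : p ∈ L.Ψ.source)
    {s : ℝ} (hs : 0 < s) {x : S × ℝ} (hx : shrink s x = p.proj) {ξ : (Eu 2 × ℝ) →L[ℝ] ℝ}
    (hξ : ∀ v : Eu 2 × ℝ, ξ v = s ^ 2 * (p.2 : (Eu 2 × ℝ) →L[ℝ] ℝ) (v.1, s⁻¹ * v.2)) :
    (⟨x, ξ⟩ : Cot (coneModel 2) (S × ℝ)) ∈ L.Ψ.source ∧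
      L.Ψ (⟨x, ξ⟩ : Cot (coneModel 2) (S × ℝ)) = ((L.Ψ p).1, s * (L.Ψ p).2) := by
  refine L.equivariant p hp ⟨x, ξ⟩ s hs ?_ fun η a ↦ ?_
  · rw [← hx]
    change x = (x.1, s * (s⁻¹ * x.2))
    rw [mul_inv_cancel_left₀ hs.ne']
  · change ξ (η, a) = _
    rw [hξ]
    have key : ∀ q : (Eu 2 × ℝ) →L[ℝ] ℝ,
        s ^ 2 * q (η, s⁻¹ * a) = s ^ 2 * q (η, 0) + s * q (0, a) := fun q ↦ by
      have h1 : ((η, s⁻¹ * a) : Eu 2 × ℝ) = (η, 0) + s⁻¹ • ((0, a) : Eu 2 × ℝ) := by simp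
      rw [h1, map_add, map_smul, smul_eq_mul]
      field_simp
    exact key p.2

/-- Covectors that are small compared to the distance from the vertex lie in the Lagrangian
neighbourhood, and their images are at comparable distance from the vertex. -/
theorem LagNbhd.exists_small [CompactSpace S] (hV : IsCalabiYauCone V) (hι : IsSLCone V ι)
    (L : LagNbhd V ι) : ∃ δ > 0, ∀ (p : S × ℝ) (ξ : (Eu 2 × ℝ) →L[ℝ] ℝ), 0 < p.2 →
      (∀ v : Eu 2 × ℝ, |ξ v| ≤ δ * p.2 * √(slConeMetric V ι p v v)) →
      (⟨p, ξ⟩ : Cot (coneModel 2) (S × ℝ)) ∈ L.Ψ.source ∧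
        p.2 / 2 < (L.Ψ (⟨p, ξ⟩ : Cot (coneModel 2) (S × ℝ))).2 ∧
        (L.Ψ (⟨p, ξ⟩ : Cot (coneModel 2) (S × ℝ))).2 < 2 * p.2 := by
  set O : Set (Cot (coneModel 2) (S × ℝ)) := L.Ψ.source ∩ L.Ψ ⁻¹' {q | 1 / 2 < q.2 ∧ q.2 < 2}
    with hOdef
  have hO : IsOpen O := L.Ψ.isOpen_inter_preimage ((isOpen_lt continuous_const continuous_snd).inter
    (isOpen_lt continuous_snd continuous_const))
  have h0 : ∀ σ : S, (⟨(σ, 1), 0⟩ : Cot (coneModel 2) (S × ℝ)) ∈ O := fun σ ↦ by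
    refine ⟨L.zero_mem (σ, 1) zero_lt_one, ?_⟩
    have := L.zero_eq (σ, 1) zero_lt_one
    change _ < (L.Ψ _).2 ∧ (L.Ψ _).2 < 2
    rw [this]
    change (1 / 2 : ℝ) < 1 ∧ (1 : ℝ) < 2
    norm_num
  -- On the slice r = 1 a uniform δ exists by compactness of the link, once it exists near each
  -- point.
  have hone : ∃ δ > 0, ∀ σ ∈ (univ : Set S), ∀ ξ : (Eu 2 × ℝ) →L[ℝ] ℝ,
      (∀ v : Eu 2 × ℝ, |ξ v| ≤ δ * √(slConeMetric V ι (σ, 1) v v)) →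
      (⟨(σ, 1), ξ⟩ : Cot (coneModel 2) (S × ℝ)) ∈ O := by
    refine isCompact_univ.induction_on (p := fun U ↦ ∃ δ > 0, ∀ σ ∈ U, ∀ ξ : (Eu 2 × ℝ) →L[ℝ] ℝ,
      (∀ v : Eu 2 × ℝ, |ξ v| ≤ δ * √(slConeMetric V ι (σ, 1) v v)) →
      (⟨(σ, 1), ξ⟩ : Cot (coneModel 2) (S × ℝ)) ∈ O) ⟨1, one_pos, by simp⟩ ?_ ?_ ?_
    · rintro U W hUW ⟨δ, hδ, h⟩
      exact ⟨δ, hδ, fun σ hσ ↦ h σ (hUW hσ)⟩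
    · rintro U W ⟨δ, hδ, h⟩ ⟨δ', hδ', h'⟩
      refine ⟨min δ δ', lt_min hδ hδ', ?_⟩
      rintro σ (hσ | hσ) ξ hξ
      · exact h σ hσ ξ fun v ↦ (hξ v).trans (by gcongr; exact min_le_left _ _)
      · exact h' σ hσ ξ fun v ↦ (hξ v).trans (by gcongr; exact min_le_right _ _)
    · intro σ₀ _
      obtain ⟨c, hc, h1⟩ := Cot.exists_ball_subset hO (h0 σ₀)
      obtain ⟨K, hK, h2⟩ := hV.cy.eventually_metric_le (p₀ := coneMap ι (σ₀, 1))
        (show (0 : ℝ) < 1 from zero_lt_one)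
      obtain ⟨K', hK', h3⟩ := eventually_norm_mfderiv_le (x₀ := (σ₀, (1 : ℝ)))
        hι.contMDiff_coneMap.contMDiffAt
      have h2' := (hι.contMDiff_coneMap.continuous.continuousAt (x := (σ₀, (1 : ℝ)))).eventually h2
      have hcont : ContinuousAt (fun σ : S ↦ (σ, (1 : ℝ))) σ₀ := by fun_prop
      -- Near σ₀ a vector with coordinates v has cone length at most √K K' ‖v‖. With this δ the
      -- coordinates of the covector have norm at most c/2, strictly less than the radius c of the
      -- available ball.
      refine ⟨_, mem_nhdsWithin_of_mem_nhds (hcont.eventually (h1.and (h2'.and h3))),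
        c / (2 * (√K * K')), by positivity, ?_⟩
      rintro σ ⟨g1, g2, g3⟩ ξ hξ
      refine g1 ξ (lt_of_le_of_lt (ContinuousLinearMap.opNorm_le_bound _ (half_pos hc).le
        fun v ↦ ?_) (half_lt_self hc))
      set w := chartSymmD (coneModel 2) (σ₀, (1 : ℝ)) (σ, 1) v
      have h4 : slConeMetric V ι (σ, 1) w w ≤ K * (K' * ‖v‖) ^ 2 := by
        refine (g2 ((mfderiv (coneModel 2) (coneModel 5) (coneMap ι) (σ, (1 : ℝ)) :
          Eu 2 × ℝ →L[ℝ] Eu 5 × ℝ) w)).trans ?_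
        gcongr
        exact g3 v
      have h5 : √(slConeMetric V ι (σ, 1) w w) ≤ √K * (K' * ‖v‖) := by
        refine (Real.sqrt_le_sqrt h4).trans_eq ?_
        rw [Real.sqrt_mul hK.le, Real.sqrt_sq (by positivity)]
      calc ‖ξ w‖ ≤ c / (2 * (√K * K')) * √(slConeMetric V ι (σ, 1) w w) := hξ w
        _ ≤ c / (2 * (√K * K')) * (√K * (K' * ‖v‖)) := by gcongr
        _ = c / 2 * ‖v‖ := by
          have := Real.sqrt_pos.2 hK
          field_simp
  obtain ⟨δ, hδ, h⟩ := hone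
  refine ⟨δ, hδ, fun p ξ hp hξ ↦ ?_⟩
  set r := p.2 with hr
  -- The covector is moved to the slice r = 1 by the inverse dilation. There its length is the
  -- original one divided by r, which is why the bound is proportional to r; equivariance carries
  -- the conclusion back.
  set ξ' : (Eu 2 × ℝ) →L[ℝ] ℝ := (r⁻¹ ^ 2) • ξ.comp
    ((ContinuousLinearMap.id ℝ (Eu 2)).prodMap (r • ContinuousLinearMap.id ℝ ℝ)) with hξ'
  have e1 : ∀ v : Eu 2 × ℝ, ξ' v = r⁻¹ ^ 2 * ξ (v.1, r * v.2) := fun v ↦ rfl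
  have hsh : shrink r p = (p.1, 1) := by
    change (p.1, r⁻¹ * p.2) = _
    rw [← hr, inv_mul_cancel₀ hp.ne']
  have h1 : (⟨(p.1, 1), ξ'⟩ : Cot (coneModel 2) (S × ℝ)) ∈ O := by
    refine h p.1 (mem_univ _) ξ' fun v ↦ ?_
    have h2 := slConeMetric_shrink hV hι hp (p := p) hp (v.1, r * v.2)
    rw [hsh] at h2
    simp only [inv_mul_cancel_left₀ hp.ne'] at h2
    have h3 := hξ (v.1, r * v.2)
    rw [e1, abs_mul, abs_of_pos (by positivity), ← mul_le_mul_iff_right₀ (show 0 < r ^ 2 by positivity)]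
    have h4 : √(slConeMetric V ι (p.1, 1) v v) =
        r⁻¹ * √(slConeMetric V ι p (v.1, r * v.2) (v.1, r * v.2)) := by
      refine (congrArg Real.sqrt h2).trans ?_
      rw [Real.sqrt_mul (by positivity), Real.sqrt_sq (by positivity)]
    rw [h4]
    refine le_trans (le_of_eq ?_) (h3.trans (le_of_eq ?_))
    · field_simp
    · field_simp
  have h2 := L.dilate h1.1 hp (x := p) (ξ := ξ) hsh fun v ↦ by
    change ξ v = r ^ 2 * ξ' (v.1, r⁻¹ * v.2)
    rw [e1]
    simp only [mul_inv_cancel_left₀ hp.ne']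
    field_simp
  refine ⟨h2.1, ?_⟩
  rw [h2.2]
  have h3 : 1 / 2 < (L.Ψ (⟨(p.1, 1), ξ'⟩ : Cot (coneModel 2) (S × ℝ))).2 ∧
    (L.Ψ (⟨(p.1, 1), ξ'⟩ : Cot (coneModel 2) (S × ℝ))).2 < 2 := h1.2
  constructor
  · have := mul_lt_mul_of_pos_left h3.1 hp
    change r / 2 < r * _
    linarith
  · have := mul_lt_mul_of_pos_left h3.2 hp
    change r * _ < 2 * r
    linarith

end Cone

/-! ### Interpolation of functions on a special Lagrangian cone -/

section Interp

variable {S : Type*} [TopologicalSpace S] [ChartedSpace (Eu 2) S] [IsManifold (𝓡 2) ∞ S]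

/-- A tensor without slots has no Christoffel terms, so its first covariant derivative is the
differential. -/
theorem CovNormLE.abs_dFun_le {g : ∀ p : S × ℝ, TangentSpace (coneModel 2) p →
      TangentSpace (coneModel 2) p → ℝ} {u : S × ℝ → ℝ} {p : S × ℝ} {c : ℝ}
    (h : CovNormLE (coneModel 2) g (asTensor u) 1 p c)
    (hu : MDifferentiableAt (coneModel 2) 𝓘(ℝ, ℝ) u p) (v : Eu 2 × ℝ) :
    |dFun (coneModel 2) u p v| ≤ c * √(g p v v) := by
  have h1 := h fun _ ↦ v
  have : IsManifold (coneModel 2) 1 (S × ℝ) := .of_le (n := ∞) (by simp)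
  rw [Fin.prod_univ_one] at h1
  have h2 : iterCovDeriv (metricInChart (coneModel 2) g p)
      (tensorInChart (coneModel 2) (asTensor u) p) 1 (extChartAt (coneModel 2) p p) (fun _ ↦ v) =
      dFun (coneModel 2) u p v := by
    rw [dFun_eq_fderiv hu]
    change fderiv ℝ (u ∘ (extChartAt (coneModel 2) p).symm) (extChartAt (coneModel 2) p p) v -
      ∑ j : Fin 0, _ = _
    simp
  rw [h2] at h1
  refine h1.trans (le_of_eq ?_)
  have key : ∀ q : S × ℝ, q = p → ∀ D : Eu 2 × ℝ →L[ℝ] Eu 2 × ℝ, D = ContinuousLinearMap.id ℝ _ →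
      c * √(g q (D v) (D v)) = c * √(g p v v) := by
    rintro q rfl D rfl
    rfl
  exact key _ (extChartAt_to_inv p) _ (mfderiv_extChartAt_symm_self (I := coneModel 2) p)

theorem CovNormLE.abs_le {g : ∀ p : S × ℝ, TangentSpace (coneModel 2) p →
      TangentSpace (coneModel 2) p → ℝ} {u : S × ℝ → ℝ} {p : S × ℝ} {c : ℝ}
    (h : CovNormLE (coneModel 2) g (asTensor u) 0 p c) : |u p| ≤ c := by
  have := h.norm_le Fin.elim0
  simpa [asTensor] using this

/-- The function `F(cr) a + t² (1 - F(cr)) b(σ, t⁻¹ r)`. -/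
def interpFun (F : ℝ → ℝ) (c t : ℝ) (a b : S × ℝ → ℝ) (p : S × ℝ) : ℝ :=
  F (c * p.2) * a p + t ^ 2 * (1 - F (c * p.2)) * b (shrink t p)

variable {F : ℝ → ℝ} {c t : ℝ} {a b : S × ℝ → ℝ} {p : S × ℝ}

theorem dFun_comp_shrink (hb : MDifferentiableAt (coneModel 2) 𝓘(ℝ, ℝ) b (shrink t p))
    (v : Eu 2 × ℝ) : dFun (coneModel 2) (fun q ↦ b (shrink t q)) p v =
      dFun (coneModel 2) b (shrink t p) (v.1, t⁻¹ * v.2) := by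
  have h := (hb.hasMFDerivAt.comp p (hasMFDerivAt_shrink (d := 2) t p)).mfderiv
  exact DFunLike.congr_fun (F := Eu 2 × ℝ →L[ℝ] ℝ) h v

theorem dFun_interpFun (hF : ContDiff ℝ ∞ F) (ha : MDifferentiableAt (coneModel 2) 𝓘(ℝ, ℝ) a p)
    (hb : MDifferentiableAt (coneModel 2) 𝓘(ℝ, ℝ) b (shrink t p)) (v : Eu 2 × ℝ) :
    dFun (coneModel 2) (interpFun F c t a b) p v =
      deriv F (c * p.2) * c * v.2 * (a p - t ^ 2 * b (shrink t p)) +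
        F (c * p.2) * dFun (coneModel 2) a p v +
        t ^ 2 * (1 - F (c * p.2)) * dFun (coneModel 2) b (shrink t p) (v.1, t⁻¹ * v.2) := by
  have hFd : Differentiable ℝ F := hF.differentiable (by simp)
  have d1 : HasDerivAt (fun r ↦ F (c * r)) (deriv F (c * p.2) * c) p.2 := by
    have h1 : HasDerivAt (fun r : ℝ ↦ c * r) c p.2 := by
      simpa using (hasDerivAt_id p.2).const_mul c
    exact (hFd (c * p.2)).hasDerivAt.comp p.2 h1
  have d2 : HasDerivAt (fun r ↦ t ^ 2 * (1 - F (c * r))) (t ^ 2 * -(deriv F (c * p.2) * c)) p.2 :=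
    (d1.const_sub 1).const_mul (t ^ 2)
  have m : ∀ {f : ℝ → ℝ}, DifferentiableAt ℝ f p.2 →
      MDifferentiableAt (coneModel 2) 𝓘(ℝ, ℝ) (fun q : S × ℝ ↦ f q.2) p := fun {f} hf ↦
    (hf.mdifferentiableAt (f := f)).comp p (mdifferentiableAt_snd (I := 𝓡 2) (I' := 𝓘(ℝ, ℝ)))
  have hb' : MDifferentiableAt (coneModel 2) 𝓘(ℝ, ℝ) (fun q ↦ b (shrink t q)) p :=
    hb.comp p ((contMDiff_shrink (d := 2) t).mdifferentiableAt (by simp))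
  have h := (((m d1.differentiableAt).hasMFDerivAt.mul ha.hasMFDerivAt).add
    ((m d2.differentiableAt).hasMFDerivAt.mul hb'.hasMFDerivAt)).mfderiv
  have h2 := DFunLike.congr_fun (F := Eu 2 × ℝ →L[ℝ] ℝ) h v
  have e1 := mfderiv_radial (p := p) d1.differentiableAt v
  have e2 := mfderiv_radial (p := p) d2.differentiableAt v
  have e3 := dFun_comp_shrink hb v
  rw [d1.deriv] at e1
  rw [d2.deriv] at e2
  refine h2.trans ?_
  change F (c * p.2) * dFun (coneModel 2) a p v +
    a p * dFun (coneModel 2) (fun q : S × ℝ ↦ F (c * q.2)) p v +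
    (t ^ 2 * (1 - F (c * p.2)) * dFun (coneModel 2) (fun q ↦ b (shrink t q)) p v +
    b (shrink t p) * dFun (coneModel 2) (fun q : S × ℝ ↦ t ^ 2 * (1 - F (c * q.2))) p v) = _
  rw [e1, e2, e3]
  ring

theorem contMDiffAt_interpFun (hF : ContDiff ℝ ∞ F) (ha : ContMDiffAt (coneModel 2) 𝓘(ℝ, ℝ) ∞ a p)
    (hb : ContMDiffAt (coneModel 2) 𝓘(ℝ, ℝ) ∞ b (shrink t p)) :
    ContMDiffAt (coneModel 2) 𝓘(ℝ, ℝ) ∞ (interpFun F c t a b) p := by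
  have m : ∀ {f : ℝ → ℝ}, ContDiff ℝ ∞ f →
      ContMDiffAt (coneModel 2) 𝓘(ℝ, ℝ) ∞ (fun q : S × ℝ ↦ f q.2) p := fun {f} hf ↦
    (hf.contMDiff.comp contMDiff_snd).contMDiffAt
  have h1 : ContDiff ℝ ∞ fun r ↦ F (c * r) := hF.comp (contDiff_const.mul contDiff_id)
  have hb' : ContMDiffAt (coneModel 2) 𝓘(ℝ, ℝ) ∞ (fun q ↦ b (shrink t q)) p :=
    hb.comp p (contMDiff_shrink (d := 2) t).contMDiffAt
  exact ((m h1).mul ha).add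
    ((m (f := fun r ↦ t ^ 2 * (1 - F (c * r))) (contDiff_const.mul (contDiff_const.sub h1))).mul hb')

end Interp

/-! ### Smallness of the differentials of a, b and u relative to the radius. -/

section Cone

variable {G : Type*} [TopologicalSpace G] [ChartedSpace (Eu 5) G] [IsManifold (𝓡 5) ∞ G]
  {V : Triple (coneModel 5) (G × ℝ)}
  {S : Type*} [TopologicalSpace S] [ChartedSpace (Eu 2) S] [IsManifold (𝓡 2) ∞ S] {ι : S → G}
  {a b : S × ℝ → ℝ} {μ κ : ℝ}

/-- The differential of `a` is O(r^μ) = r · O(r^{μ-1}), and μ > 1. The comparison with r is the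
scale-invariant smallness that `LagNbhd.exists_small` asks for. -/
theorem exists_dFun_small_at_zero (hda : DecaysAtZero (𝓡 2) (slConeMetric V ι) (asTensor a) (μ + 1))
    (hμ : 1 < μ) {e : ℝ} (he : 0 < e)
    (ha : ContMDiffOn (coneModel 2) 𝓘(ℝ, ℝ) ∞ a {p | 0 < p.2 ∧ p.2 < e}) {δ : ℝ} (hδ : 0 < δ) :
    ∃ r₀ > 0, ∀ p : S × ℝ, 0 < p.2 → p.2 < r₀ → ∀ v,
      |dFun (coneModel 2) a p v| ≤ δ * p.2 * √(slConeMetric V ι p v v) := by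
  obtain ⟨c, d, hd, h⟩ := hda 1
  have T : Filter.Tendsto (fun r : ℝ ↦ |c| * r ^ (μ - 1)) (𝓝[>] 0) (𝓝 0) := by
    simpa using (tendsto_rpow_zero (sub_pos.2 hμ)).const_mul |c|
  obtain ⟨r₁, hr₁, h1⟩ := mem_nhdsGT_iff_exists_Ioo_subset.1 (T.eventually (gt_mem_nhds hδ))
  refine ⟨min (min d r₁) e, lt_min (lt_min hd hr₁) he, fun p hp hp' v ↦ ?_⟩
  have hpd : p.2 < d := hp'.trans_le ((min_le_left _ _).trans (min_le_left _ _))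
  have hpr : p.2 < r₁ := hp'.trans_le ((min_le_left _ _).trans (min_le_right _ _))
  have hpe : p.2 < e := hp'.trans_le (min_le_right _ _)
  have hO : IsOpen {p : S × ℝ | 0 < p.2 ∧ p.2 < e} :=
    (isOpen_lt continuous_const continuous_snd).inter (isOpen_lt continuous_snd continuous_const)
  have h2 := (h p hp hpd).abs_dFun_le ((ha.contMDiffAt (hO.mem_nhds ⟨hp, hpe⟩)).mdifferentiableAt
    (by simp)) v
  refine h2.trans (mul_le_mul_of_nonneg_right ?_ (Real.sqrt_nonneg _))
  have h3 : |c| * p.2 ^ (μ - 1) < δ := h1 ⟨hp, hpr⟩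
  have e1 : p.2 ^ (μ + 1 - (1 : ℕ)) = p.2 ^ (μ - 1) * p.2 := by
    rw [← Real.rpow_add_one hp.ne']
    congr 1
    push_cast
    ring
  rw [e1]
  calc c * (p.2 ^ (μ - 1) * p.2) ≤ |c| * (p.2 ^ (μ - 1) * p.2) := by
        gcongr
        exact le_abs_self c
    _ = |c| * p.2 ^ (μ - 1) * p.2 := by ring
    _ ≤ δ * p.2 := by gcongr

/-- Here the differential is O(r^κ) = r · O(r^{κ-1}) with a negative exponent. -/
theorem exists_dFun_small_at_infinity
    (hdb : DecaysAtInfinity (𝓡 2) (slConeMetric V ι) (asTensor b) (κ + 1)) (hκ : κ < -1) {R' : ℝ}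
    (hb : ContMDiffOn (coneModel 2) 𝓘(ℝ, ℝ) ∞ b {p | R' < p.2}) {δ : ℝ} (hδ : 0 < δ) :
    ∃ ρ > R', ∀ p : S × ℝ, 0 < p.2 → ρ < p.2 → ∀ v,
      |dFun (coneModel 2) b p v| ≤ δ * p.2 * √(slConeMetric V ι p v v) := by
  obtain ⟨c, d, h⟩ := hdb 1
  have T : Filter.Tendsto (fun r : ℝ ↦ |c| * r ^ (κ - 1)) Filter.atTop (𝓝 0) := by
    have := (tendsto_rpow_neg_atTop (y := 1 - κ) (by linarith)).const_mul |c|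
    simpa using this
  obtain ⟨r₁, h1⟩ := Filter.eventually_atTop.1 (T.eventually (gt_mem_nhds hδ))
  refine ⟨max (max d r₁) (R' + 1), (lt_add_one R').trans_le (le_max_right _ _),
    fun p hp hp' v ↦ ?_⟩
  have hpd : d < p.2 := ((le_max_left _ _).trans (le_max_left _ _)).trans_lt hp'
  have hpr : r₁ < p.2 := ((le_max_right _ _).trans (le_max_left _ _)).trans_lt hp'
  have hpe : R' < p.2 := ((lt_add_one R').trans_le (le_max_right _ _)).trans hp'
  have hO : IsOpen {p : S × ℝ | R' < p.2} := isOpen_lt continuous_const continuous_snd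
  have h2 := (h p hp hpd).abs_dFun_le ((hb.contMDiffAt (hO.mem_nhds hpe)).mdifferentiableAt
    (by simp)) v
  refine h2.trans (mul_le_mul_of_nonneg_right ?_ (Real.sqrt_nonneg _))
  have h3 : |c| * p.2 ^ (κ - 1) < δ := h1 _ hpr.le
  have e1 : p.2 ^ (κ + 1 - (1 : ℕ)) = p.2 ^ (κ - 1) * p.2 := by
    rw [← Real.rpow_add_one hp.ne']
    congr 1
    push_cast
    ring
  rw [e1]
  calc c * (p.2 ^ (κ - 1) * p.2) ≤ |c| * (p.2 ^ (κ - 1) * p.2) := by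
        gcongr
        exact le_abs_self c
    _ = |c| * p.2 ^ (κ - 1) * p.2 := by ring
    _ ≤ δ * p.2 := by gcongr

/-- On the annulus, the differential of the interpolating function is small. -/
theorem eventually_dFun_interpFun_small (hV : IsCalabiYauCone V) (hι : IsSLCone V ι) {F : ℝ → ℝ}
    (hF : ContDiff ℝ ∞ F) (hmono : Monotone F) (hF0 : ∀ s ≤ 1, F s = 0) (hF1 : ∀ s, 2 ≤ s → F s = 1)
    {α : ℝ} (hα : 0 < α) (hα1 : α < 1)
    (hda : DecaysAtZero (𝓡 2) (slConeMetric V ι) (asTensor a) (μ + 1)) (hμ : 1 < μ)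
    {e : ℝ} (he : 0 < e) (ha : ContMDiffOn (coneModel 2) 𝓘(ℝ, ℝ) ∞ a {p | 0 < p.2 ∧ p.2 < e})
    (hdb : DecaysAtInfinity (𝓡 2) (slConeMetric V ι) (asTensor b) (κ + 1)) (hκ : κ < -1) {R' : ℝ}
    (hb : ContMDiffOn (coneModel 2) 𝓘(ℝ, ℝ) ∞ b {p | R' < p.2}) {δ : ℝ} (hδ : 0 < δ) :
    ∀ᶠ t in 𝓝[>] (0 : ℝ), ∀ p : S × ℝ, t ^ α ≤ p.2 → p.2 ≤ 2 * t ^ α → ∀ v,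
      |dFun (coneModel 2) (interpFun F (t ^ (-α)) t a b) p v| ≤
        δ * p.2 * √(slConeMetric V ι p v v) := by
  obtain ⟨K, hK0, hK⟩ := exists_deriv_cutoff_le hF hmono hF0 hF1
  obtain ⟨cA, dA, hdA, hA⟩ := hda 0
  obtain ⟨cA', dA', hdA', hA'⟩ := hda 1
  obtain ⟨cB, ρB, hB⟩ := hdb 0
  obtain ⟨cB', ρB', hB'⟩ := hdb 1
  have T0 := tendsto_rpow_zero hα
  have T1 := tendsto_rpow_div hα1
  have T2 : Filter.Tendsto (fun t : ℝ ↦ 2 * t ^ α) (𝓝[>] 0) (𝓝 0) := by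
    simpa using T0.const_mul 2
  have T3 : Filter.Tendsto (fun t : ℝ ↦ (2 * t ^ α) ^ (μ - 1)) (𝓝[>] 0) (𝓝 0) := by
    have h := (Real.continuousAt_rpow_const 0 (μ - 1) (.inr (sub_pos.2 hμ).le)).tendsto.comp T2
    rwa [Real.zero_rpow (sub_pos.2 hμ).ne'] at h
  have T4 : Filter.Tendsto (fun t : ℝ ↦ (t ^ α / t) ^ (κ - 1)) (𝓝[>] 0) (𝓝 0) := by
    have h := (tendsto_rpow_neg_atTop (y := 1 - κ) (by linarith)).comp T1
    simp only [neg_sub] at h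
    exact h
  -- The total error relative to r: with q = r/t one has t² |b(q)| ≤ |cB| r² q^{κ-1}, so the
  -- `b`-terms carry the power κ - 1 of t^α / t and the `a`-terms the power μ - 1 of 2t^α. The
  -- factor 2K belongs to the term with F'.
  have T5 : Filter.Tendsto (fun t : ℝ ↦ (2 * K * |cA| + |cA'|) * (2 * t ^ α) ^ (μ - 1) +
      (2 * K * |cB| + |cB'|) * (t ^ α / t) ^ (κ - 1)) (𝓝[>] 0) (𝓝 0) := by
    simpa using (T3.const_mul (2 * K * |cA| + |cA'|)).add (T4.const_mul (2 * K * |cB| + |cB'|))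
  filter_upwards [self_mem_nhdsWithin, T2.eventually (gt_mem_nhds hdA),
    T2.eventually (gt_mem_nhds hdA'), T2.eventually (gt_mem_nhds he),
    T1.eventually (Filter.eventually_gt_atTop ρB), T1.eventually (Filter.eventually_gt_atTop ρB'),
    T1.eventually (Filter.eventually_gt_atTop R'), T5.eventually (gt_mem_nhds hδ)]
    with t ht h1 h2 h3 h4 h5 h6 h7 p hp1 hp2 v
  have ht : 0 < t := ht
  have hs : 0 < t ^ α := Real.rpow_pos_of_pos ht _
  have hp0 : 0 < p.2 := hs.trans_le hp1
  have hpe : p.2 < e := hp2.trans_lt h3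
  have hsh : (shrink t p).2 = p.2 / t := by
    change t⁻¹ * p.2 = _
    rw [div_eq_inv_mul]
  set q := shrink t p with hq
  have hq0 : 0 < q.2 := by rw [hsh]; positivity
  have hqge : t ^ α / t ≤ q.2 := by rw [hsh]; gcongr
  have hqR : R' < q.2 := h6.trans_le hqge
  have hpq : p.2 = t * q.2 := by rw [hsh]; field_simp
  have hO : IsOpen {p : S × ℝ | 0 < p.2 ∧ p.2 < e} :=
    (isOpen_lt continuous_const continuous_snd).inter (isOpen_lt continuous_snd continuous_const)
  have hO' : IsOpen {p : S × ℝ | R' < p.2} := isOpen_lt continuous_const continuous_snd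
  have ma := (ha.contMDiffAt (hO.mem_nhds ⟨hp0, hpe⟩)).mdifferentiableAt (by simp)
  have mb := (hb.contMDiffAt (hO'.mem_nhds hqR)).mdifferentiableAt (by simp)
  set g := √(slConeMetric V ι p v v) with hg
  have hg0 : 0 ≤ g := Real.sqrt_nonneg _
  have hx0 : 0 ≤ p.2 ^ (μ - 1) := by positivity
  have hy0 : 0 ≤ q.2 ^ (κ - 1) := by positivity
  have bA : |a p| ≤ |cA| * (p.2 ^ (μ - 1) * p.2 ^ 2) := by
    refine (hA p hp0 (hp2.trans_lt h1)).abs_le.trans ?_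
    have : p.2 ^ (μ + 1 - (0 : ℕ)) = p.2 ^ (μ - 1) * p.2 ^ 2 := by
      rw [← Real.rpow_add_natCast hp0.ne']
      congr 1
      push_cast
      ring
    rw [this]
    gcongr
    exact le_abs_self _
  have bA' : |dFun (coneModel 2) a p v| ≤ |cA'| * (p.2 ^ (μ - 1) * p.2) * g := by
    refine ((hA' p hp0 (hp2.trans_lt h2)).abs_dFun_le ma v).trans ?_
    have : p.2 ^ (μ + 1 - (1 : ℕ)) = p.2 ^ (μ - 1) * p.2 := by
      rw [← Real.rpow_add_one hp0.ne']
      congr 1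
      push_cast
      ring
    rw [this]
    gcongr
    exact le_abs_self _
  have bB : |b q| ≤ |cB| * (q.2 ^ (κ - 1) * q.2 ^ 2) := by
    refine (hB q hq0 (h4.trans_le hqge)).abs_le.trans ?_
    have : q.2 ^ (κ + 1 - (0 : ℕ)) = q.2 ^ (κ - 1) * q.2 ^ 2 := by
      rw [← Real.rpow_add_natCast hq0.ne']
      congr 1
      push_cast
      ring
    rw [this]
    gcongr
    exact le_abs_self _
  have bB' : |dFun (coneModel 2) b q (v.1, t⁻¹ * v.2)| ≤
      |cB'| * (q.2 ^ (κ - 1) * q.2) * (t⁻¹ * g) := by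
    refine ((hB' q hq0 (h5.trans_le hqge)).abs_dFun_le mb (v.1, t⁻¹ * v.2)).trans ?_
    have h8 : √(slConeMetric V ι q (v.1, t⁻¹ * v.2) (v.1, t⁻¹ * v.2)) = t⁻¹ * g := by
      refine (congrArg Real.sqrt (slConeMetric_shrink hV hι ht hp0 v)).trans ?_
      rw [Real.sqrt_mul (by positivity), Real.sqrt_sq (by positivity)]
    refine (congrArg (_ * ·) h8).trans_le ?_
    have : q.2 ^ (κ + 1 - (1 : ℕ)) = q.2 ^ (κ - 1) * q.2 := by
      rw [← Real.rpow_add_one hq0.ne']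
      congr 1
      push_cast
      ring
    rw [this]
    gcongr
    exact le_abs_self _
  have hc : t ^ (-α) = (t ^ α)⁻¹ := Real.rpow_neg ht.le _
  have hcr : t ^ (-α) * p.2 ≤ 2 := by
    rw [hc, inv_mul_le_iff₀ hs]
    linarith
  have hc0 : 0 < t ^ (-α) := Real.rpow_pos_of_pos ht _
  have i1 : p.2 ^ (μ - 1) ≤ (2 * t ^ α) ^ (μ - 1) :=
    Real.rpow_le_rpow hp0.le hp2 (sub_pos.2 hμ).le
  have i2 : q.2 ^ (κ - 1) ≤ (t ^ α / t) ^ (κ - 1) :=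
    Real.rpow_le_rpow_of_nonpos (by positivity) hqge (by linarith)
  have hv := abs_snd_le_slConeMetric hV hι hp0 v
  rw [dFun_interpFun hF ma mb]
  -- The derivative of the cut-off costs t^{-α}, while a - t²b is smaller than its expected
  -- derivative by one further power of r; on the annulus t^{-α} r ≤ 2.
  have n1 : |deriv F (t ^ (-α) * p.2) * t ^ (-α) * v.2 * (a p - t ^ 2 * b q)| ≤
      2 * K * (|cA| * p.2 ^ (μ - 1) + |cB| * q.2 ^ (κ - 1)) * p.2 * g := by
    have m1 : |a p - t ^ 2 * b q| ≤
        (|cA| * p.2 ^ (μ - 1) + |cB| * q.2 ^ (κ - 1)) * p.2 ^ 2 := by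
      refine (abs_sub _ _).trans ?_
      rw [abs_mul, abs_of_pos (by positivity : 0 < t ^ 2)]
      have : t ^ 2 * |b q| ≤ t ^ 2 * (|cB| * (q.2 ^ (κ - 1) * q.2 ^ 2)) := by gcongr
      have e : t ^ 2 * (|cB| * (q.2 ^ (κ - 1) * q.2 ^ 2)) = |cB| * q.2 ^ (κ - 1) * p.2 ^ 2 := by
        rw [hpq]
        ring
      linarith
    rw [abs_mul, abs_mul, abs_mul, abs_of_pos hc0]
    calc |deriv F (t ^ (-α) * p.2)| * t ^ (-α) * |v.2| * |a p - t ^ 2 * b q|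
        ≤ K * t ^ (-α) * g * ((|cA| * p.2 ^ (μ - 1) + |cB| * q.2 ^ (κ - 1)) * p.2 ^ 2) := by
          gcongr
          exact hK _
      _ = (t ^ (-α) * p.2) * (K * (|cA| * p.2 ^ (μ - 1) + |cB| * q.2 ^ (κ - 1)) * p.2 * g) := by
          ring
      _ ≤ 2 * (K * (|cA| * p.2 ^ (μ - 1) + |cB| * q.2 ^ (κ - 1)) * p.2 * g) := by gcongr
      _ = _ := by ring
  have hFn := cutoff_nonneg hmono hF0 (t ^ (-α) * p.2)
  have hFl := cutoff_le_one hmono hF1 (t ^ (-α) * p.2)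
  have n2 : |F (t ^ (-α) * p.2) * dFun (coneModel 2) a p v| ≤
      |cA'| * p.2 ^ (μ - 1) * p.2 * g := by
    rw [abs_mul, abs_of_nonneg hFn]
    calc F (t ^ (-α) * p.2) * |dFun (coneModel 2) a p v|
        ≤ 1 * (|cA'| * (p.2 ^ (μ - 1) * p.2) * g) := by gcongr
      _ = _ := by ring
  have n3 : |t ^ 2 * (1 - F (t ^ (-α) * p.2)) * dFun (coneModel 2) b q (v.1, t⁻¹ * v.2)| ≤
      |cB'| * q.2 ^ (κ - 1) * p.2 * g := by
    rw [abs_mul, abs_mul, abs_of_pos (by positivity : 0 < t ^ 2), abs_of_nonneg (sub_nonneg.2 hFl)]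
    calc t ^ 2 * (1 - F (t ^ (-α) * p.2)) * |dFun (coneModel 2) b q (v.1, t⁻¹ * v.2)|
        ≤ t ^ 2 * 1 * (|cB'| * (q.2 ^ (κ - 1) * q.2) * (t⁻¹ * g)) := by
          gcongr
          linarith
      _ = _ := by
          rw [hpq]
          field_simp
  calc _ ≤ 2 * K * (|cA| * p.2 ^ (μ - 1) + |cB| * q.2 ^ (κ - 1)) * p.2 * g +
        |cA'| * p.2 ^ (μ - 1) * p.2 * g + |cB'| * q.2 ^ (κ - 1) * p.2 * g :=
        (abs_add_le _ _).trans (add_le_add ((abs_add_le _ _).trans (add_le_add n1 n2)) n3)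
    _ = ((2 * K * |cA| + |cA'|) * p.2 ^ (μ - 1) + (2 * K * |cB| + |cB'|) * q.2 ^ (κ - 1)) *
        (p.2 * g) := by ring
    _ ≤ ((2 * K * |cA| + |cA'|) * (2 * t ^ α) ^ (μ - 1) +
        (2 * K * |cB| + |cB'|) * (t ^ α / t) ^ (κ - 1)) * (p.2 * g) := by gcongr
    _ ≤ δ * (p.2 * g) := by gcongr
    _ = _ := by ring

end Cone

/-! ### The ends of the special Lagrangian 3-folds -/

theorem secD_injective {E H X : Type*} [NormedAddCommGroup E] [NormedSpace ℝ E]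
    [TopologicalSpace H] {I : ModelWithCorners ℝ E H} [TopologicalSpace X] [ChartedSpace H X]
    (u : X → ℝ) : Function.Injective (secD I u) := fun _ _ h ↦ congrArg TotalSpace.proj h

section End

variable {G : Type*} [TopologicalSpace G] [ChartedSpace (Eu 5) G]
  {W : Triple (coneModel 5) (G × ℝ)} {N : Type*} [TopologicalSpace N] [ChartedSpace (Eu 6) N]
  {R R' : ℝ} {S : ACCY W N R}
  {T : Type*} [TopologicalSpace T] [ChartedSpace (Eu 2) T] [IsManifold (𝓡 2) ∞ T] {ι : T → G}
  {L : LagNbhd W ι} (A : ACSL S L R')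

namespace ACSL

theorem mem_source {q : T × ℝ} (hq : R' < q.2) : secD (coneModel 2) A.b q ∈ L.Ψ.source :=
  A.graph_sub ⟨q, hq, rfl⟩

theorem mem_Υ_source {q : T × ℝ} (hq : R' < q.2) :
    L.Ψ (secD (coneModel 2) A.b q) ∈ S.Υ.source :=
  A.graph_sub' ⟨_, ⟨q, hq, rfl⟩, rfl⟩

theorem R_lt_snd {q : T × ℝ} (hq : R' < q.2) : R < (L.Ψ (secD (coneModel 2) A.b q)).2 := by
  have := A.mem_Υ_source hq
  rw [S.Υ_source] at this
  exact this

theorem mem_carrier {q : T × ℝ} (hq : R' < q.2) :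
    S.Υ (L.Ψ (secD (coneModel 2) A.b q)) ∈ A.carrier := by
  have : S.Υ (L.Ψ (secD (coneModel 2) A.b q)) ∈ A.carrier \ A.H := by
    rw [A.outside]
    exact ⟨_, ⟨_, ⟨q, hq, rfl⟩, rfl⟩, rfl⟩
  exact this.1

theorem exists_of_notMem_H {y : N} (hy : y ∈ A.carrier) (hH : y ∉ A.H) :
    ∃ q : T × ℝ, R' < q.2 ∧ S.Υ (L.Ψ (secD (coneModel 2) A.b q)) = y := by
  have : y ∈ A.carrier \ A.H := ⟨hy, hH⟩
  rw [A.outside] at this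
  obtain ⟨_, ⟨_, ⟨q, hq, rfl⟩, rfl⟩, rfl⟩ := this
  exact ⟨q, hq, rfl⟩

theorem eq_of_Υ_eq {q q' : T × ℝ} (hq : R' < q.2) (hq' : R' < q'.2)
    (h : S.Υ (L.Ψ (secD (coneModel 2) A.b q)) = S.Υ (L.Ψ (secD (coneModel 2) A.b q'))) : q = q' :=
  secD_injective _ (L.Ψ.injOn (A.mem_source hq) (A.mem_source hq')
    (S.Υ.injOn (A.mem_Υ_source hq) (A.mem_Υ_source hq') h))

theorem isCompact_H : IsCompact A.H := by
  have h := A.compact R' le_rfl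
  rw [← A.outside, sdiff_sdiff_right_self] at h
  convert h using 1
  exact (inf_eq_right.2 A.H_sub).symm

theorem exists_notMem_H : ∃ s ≥ R, ∀ p : G × ℝ, s < p.2 → S.Υ p ∉ A.H := by
  obtain ⟨s, hs, h⟩ := S.end_basis.mem_iff.1 A.isCompact_H.compl_mem_cocompact
  exact ⟨s, hs, fun p hp ↦ h ⟨p, hp, rfl⟩⟩

/-- The part of the 3-fold that is not the graph beyond ρ is compact, so it misses a neighbourhood
of infinity in `Y`. This bounds the radius where the differential of b is not known to be small. -/
theorem exists_le (ρ : ℝ) (hρ : R' ≤ ρ) : ∃ s, ∀ q : T × ℝ, R' < q.2 → q.2 ≤ ρ →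
    (L.Ψ (secD (coneModel 2) A.b q)).2 ≤ s := by
  obtain ⟨s, hs, h⟩ := S.end_basis.mem_iff.1 (A.compact ρ hρ).compl_mem_cocompact
  refine ⟨s, fun q hq hqρ ↦ ?_⟩
  by_contra hc
  refine h ⟨_, not_le.1 hc, rfl⟩ ⟨A.mem_carrier hq, ?_⟩
  rintro ⟨_, ⟨_, ⟨q', hq', rfl⟩, rfl⟩, e⟩
  have hq' : ρ < q'.2 := hq'
  rw [A.eq_of_Υ_eq (hρ.trans_lt hq') hq e] at hq'
  exact absurd hqρ (not_le.2 hq')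

end ACSL

end End

section Geometry

variable {n : ℕ} {M₀ : Type*} [TopologicalSpace M₀] {x : Fin n → M₀} [ChartedSpace (Eu 6) (Reg x)]
  {Γ : Fin n → Type*} [∀ i, TopologicalSpace (Γ i)] [∀ i, ChartedSpace (Eu 5) (Γ i)]
  {Sg : Fin n → Type*} [∀ i, TopologicalSpace (Sg i)] [∀ i, ChartedSpace (Eu 2) (Sg i)]
  [∀ i, IsManifold (𝓡 2) ∞ (Sg i)]
  {V : ∀ i, Triple (coneModel 5) (Γ i × ℝ)} {ι : ∀ i, Sg i → Γ i}
  {X : ConicalCY x V} {L : ∀ i, LagNbhd (V i) (ι i)} {ε' : ℝ} (N₀ : ConicalSL X L ε') {i : Fin n}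

namespace ConicalSL

theorem mem_source {p : Sg i × ℝ} (h0 : 0 < p.2) (h1 : p.2 < ε') :
    secD (coneModel 2) (N₀.a i) p ∈ (L i).Ψ.source := N₀.graph_sub i ⟨p, ⟨h0, h1⟩, rfl⟩

theorem mem_Φ_source {p : Sg i × ℝ} (h0 : 0 < p.2) (h1 : p.2 < ε') :
    (L i).Ψ (secD (coneModel 2) (N₀.a i) p) ∈ (X.Φ i).source :=
  N₀.graph_sub' i ⟨_, ⟨p, ⟨h0, h1⟩, rfl⟩, rfl⟩

theorem snd_pos_lt {p : Sg i × ℝ} (h0 : 0 < p.2) (h1 : p.2 < ε') :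
    0 < ((L i).Ψ (secD (coneModel 2) (N₀.a i) p)).2 ∧
      ((L i).Ψ (secD (coneModel 2) (N₀.a i) p)).2 < X.ε := by
  have := N₀.mem_Φ_source h0 h1
  rw [X.Φ_source] at this
  exact this

theorem mem_T_iff {q : Reg x} : (q : M₀) ∈ N₀.T i ↔
    ∃ p : Sg i × ℝ, 0 < p.2 ∧ p.2 < ε' ∧ X.Φ i ((L i).Ψ (secD (coneModel 2) (N₀.a i) p)) = q := by
  constructor
  · rintro (h | ⟨_, ⟨_, ⟨p, hp, rfl⟩, rfl⟩, e⟩)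
    · exact absurd h (q.2 i)
    · exact ⟨p, hp.1, hp.2, Subtype.ext e⟩
  · rintro ⟨p, h0, h1, rfl⟩
    exact .inr ⟨_, ⟨_, ⟨p, ⟨h0, h1⟩, rfl⟩, rfl⟩, rfl⟩

theorem mem_of_mem_T {q : Reg x} (h : (q : M₀) ∈ N₀.T i) : (q : M₀) ∈ N₀.N := by
  obtain ⟨W, -, hW⟩ := N₀.nhd i ε' N₀.ε'_pos le_rfl
  have : (q : M₀) ∈ W ∩ N₀.N := by
    rw [hW]
    exact h
  exact this.2

variable (i) in
/-- Near `x i`, the special Lagrangian 3-fold is the graph of `da`. -/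
theorem exists_graph_of_mem {δ : ℝ} (hδ : 0 < δ) (hδ' : δ ≤ ε') : ∃ η > 0, ∀ p : Γ i × ℝ, 0 < p.2 →
    p.2 < η → (X.Φ i p : M₀) ∈ N₀.N → ∃ p' : Sg i × ℝ, 0 < p'.2 ∧ p'.2 < δ ∧
      X.Φ i ((L i).Ψ (secD (coneModel 2) (N₀.a i) p')) = X.Φ i p := by
  obtain ⟨W, hWo, hW⟩ := N₀.nhd i δ hδ hδ'
  have hx : x i ∈ W := by
    have : x i ∈ W ∩ N₀.N := by
      rw [hW]
      exact .inl rfl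
    exact this.1
  obtain ⟨η, ⟨hη, -⟩, h⟩ := (X.Φ_basis i).mem_iff.1 (hWo.mem_nhds hx)
  refine ⟨η, hη, fun p h0 h1 hN ↦ ?_⟩
  have : (X.Φ i p : M₀) ∈ W ∩ N₀.N := ⟨h (.inr ⟨p, ⟨h0, h1⟩, rfl⟩), hN⟩
  rw [hW] at this
  obtain h | ⟨_, ⟨_, ⟨p', hp', rfl⟩, rfl⟩, e⟩ := this
  · exact absurd h ((X.Φ i p).2 i)
  · exact ⟨p', hp'.1, hp'.2, Subtype.ext e⟩

-- Since `T i` is open in N₀, near `x i` all of N₀ belongs to it: no other part of N₀ returns to the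
-- neck.
variable (i) in
theorem exists_mem_T : ∃ η > 0, ∀ p : Γ i × ℝ, 0 < p.2 → p.2 < η → (X.Φ i p : M₀) ∈ N₀.N →
    (X.Φ i p : M₀) ∈ N₀.T i := by
  obtain ⟨η, hη, h⟩ := N₀.exists_graph_of_mem i N₀.ε'_pos le_rfl
  refine ⟨η, hη, fun p h0 h1 hN ↦ N₀.mem_T_iff.2 ?_⟩
  exact h p h0 h1 hN

-- Near `x i` every point of N₀ is on the graph over r < δ. The map from base points to N₀ is
-- injective, so a base point with r ≥ δ cannot be sent close to `x i`.
variable (i) in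
theorem exists_le_snd {δ : ℝ} (hδ : 0 < δ) (hδ' : δ ≤ ε') : ∃ η > 0, ∀ p : Sg i × ℝ, δ ≤ p.2 →
    p.2 < ε' → η ≤ ((L i).Ψ (secD (coneModel 2) (N₀.a i) p)).2 := by
  obtain ⟨η, hη, h⟩ := N₀.exists_graph_of_mem i hδ hδ'
  refine ⟨η, hη, fun p h0 h1 ↦ ?_⟩
  by_contra hc
  have hp := hδ.trans_le h0
  obtain ⟨p', h0', h1', e⟩ := h _ (N₀.snd_pos_lt hp h1).1 (not_le.1 hc)
    (N₀.mem_of_mem_T (N₀.mem_T_iff.2 ⟨p, hp, h1, rfl⟩))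
  have e2 : p' = p := secD_injective _ ((L i).Ψ.injOn (N₀.mem_source h0' (h1'.trans_le hδ'))
    (N₀.mem_source hp h1) ((X.Φ i).injOn (N₀.mem_Φ_source h0' (h1'.trans_le hδ'))
      (N₀.mem_Φ_source hp h1) e))
  rw [e2] at h1'
  exact absurd h0 (not_le.2 h1')

end ConicalSL

end Geometry

/-! ### The graph on the neck -/

section Geometry

variable {n : ℕ} {M₀ : Type*} [TopologicalSpace M₀] {x : Fin n → M₀} [ChartedSpace (Eu 6) (Reg x)]
  {Γ : Fin n → Type*} [∀ i, TopologicalSpace (Γ i)] [∀ i, ChartedSpace (Eu 5) (Γ i)]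
  {Y : Fin n → Type*} [∀ i, TopologicalSpace (Y i)] [∀ i, ChartedSpace (Eu 6) (Y i)]
  {Sg : Fin n → Type*} [∀ i, TopologicalSpace (Sg i)] [∀ i, ChartedSpace (Eu 2) (Sg i)]
  [∀ i, IsManifold (𝓡 2) ∞ (Sg i)]
  {V : ∀ i, Triple (coneModel 5) (Γ i × ℝ)} {ι : ∀ i, Sg i → Γ i} {R : ℝ}
  {X : ConicalCY x V} {Z : ∀ i, ACCY (V i) (Y i) R} {L : ∀ i, LagNbhd (V i) (ι i)}
  {ε' R' : ℝ} (C : Choices X Z) (N₀ : ConicalSL X L ε') (A : ∀ i, ACSL (Z i) (L i) R')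

/-- The point of the cone `V i` given by the value of `du_{t,i}` at `p`. -/
def neckPt (t : ℝ) (i : Fin n) (p : Sg i × ℝ) : Γ i × ℝ :=
  (L i).Ψ (secD (coneModel 2) (uT C N₀ A t i) p)

/-- Bounds that say where the pieces of the glued 3-fold lie. -/
structure NeckBounds (t : ℝ) (i : Fin n) : Prop where
  pos : 0 < t
  R_lt : 16 * (t * R) < t ^ C.α
  R'_lt : 16 * (t * R') < t ^ C.α
  lt_ε' : 16 * t ^ C.α < ε'
  mem_source : ∀ p : Sg i × ℝ, t * R' < p.2 → p.2 < ε' →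
    secD (coneModel 2) (uT C N₀ A t i) p ∈ (L i).Ψ.source
  low : ∀ p : Sg i × ℝ, t * R' < p.2 → p.2 ≤ t ^ C.α / 8 → (neckPt C N₀ A t i p).2 ≤ t ^ C.α / 4
  mid : ∀ p : Sg i × ℝ, t ^ C.α / 8 ≤ p.2 → p.2 ≤ 16 * t ^ C.α →
    p.2 / 2 < (neckPt C N₀ A t i p).2 ∧ (neckPt C N₀ A t i p).2 < 2 * p.2
  high : ∀ p : Sg i × ℝ, 16 * t ^ C.α ≤ p.2 → p.2 < ε' → 8 * t ^ C.α ≤ (neckPt C N₀ A t i p).2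
  range : ∀ p : Sg i × ℝ, t * R' < p.2 → p.2 < ε' →
    t * R < (neckPt C N₀ A t i p).2 ∧ (neckPt C N₀ A t i p).2 < X.ε
  inner : ∀ p : Sg i × ℝ, t * R' < p.2 → p.2 ≤ t ^ C.α → shrink t (neckPt C N₀ A t i p) =
    (L i).Ψ (secD (coneModel 2) (A i).b (shrink t p))
  outer : ∀ p : Sg i × ℝ, 2 * t ^ C.α ≤ p.2 → p.2 < ε' → neckPt C N₀ A t i p =
    (L i).Ψ (secD (coneModel 2) (N₀.a i) p)
  a_lt : ∀ p : Sg i × ℝ, 0 < p.2 → p.2 ≤ 2 * t ^ C.α →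
    ((L i).Ψ (secD (coneModel 2) (N₀.a i) p)).2 < 4 * t ^ C.α
  lt_b : ∀ q : Sg i × ℝ, t ^ C.α ≤ t * q.2 →
    t ^ C.α / 2 < t * ((L i).Ψ (secD (coneModel 2) (A i).b q)).2
  mem_T : ∀ p : Γ i × ℝ, 0 < p.2 → p.2 ≤ 16 * t ^ C.α → (X.Φ i p : M₀) ∈ N₀.N →
    (X.Φ i p : M₀) ∈ N₀.T i
  notMem_H : ∀ p : Γ i × ℝ, t ^ C.α / 8 ≤ p.2 → (Z i).Υt t p ∉ (A i).H

variable {C N₀ A} [∀ i, IsManifold (𝓡 5) ∞ (Γ i)]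

theorem lt_shrink {t : ℝ} (ht : 0 < t) {T : Type*} {p : T × ℝ} {c : ℝ} (hp : t * c < p.2) :
    c < (shrink t p).2 := by
  change c < t⁻¹ * p.2
  rwa [lt_inv_mul_iff₀ ht]

theorem uT_contMDiffAt {t : ℝ} (ht : 0 < t) {i : Fin n} {p : Sg i × ℝ} (h0 : 0 < p.2)
    (h1 : t * R' < p.2) (h2 : p.2 < ε') :
    ContMDiffAt (coneModel 2) 𝓘(ℝ, ℝ) ∞ (uT C N₀ A t i) p := by
  have hO : IsOpen {p : Sg i × ℝ | 0 < p.2 ∧ p.2 < ε'} :=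
    (isOpen_lt continuous_const continuous_snd).inter (isOpen_lt continuous_snd continuous_const)
  have hO' : IsOpen {p : Sg i × ℝ | R' < p.2} := isOpen_lt continuous_const continuous_snd
  exact contMDiffAt_interpFun C.F_smooth ((N₀.a_smooth i).contMDiffAt (hO.mem_nhds ⟨h0, h2⟩))
    ((A i).b_smooth.contMDiffAt (hO'.mem_nhds (lt_shrink ht h1)))

theorem dFun_uT {t : ℝ} (ht : 0 < t) {i : Fin n} {p : Sg i × ℝ} (h0 : 0 < p.2)
    (h1 : t * R' < p.2) (h2 : p.2 < ε') (v : Eu 2 × ℝ) :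
    dFun (coneModel 2) (uT C N₀ A t i) p v =
      deriv C.F (t ^ (-C.α) * p.2) * t ^ (-C.α) * v.2 *
        (N₀.a i p - t ^ 2 * (A i).b (shrink t p)) +
        C.F (t ^ (-C.α) * p.2) * dFun (coneModel 2) (N₀.a i) p v +
        t ^ 2 * (1 - C.F (t ^ (-C.α) * p.2)) *
          dFun (coneModel 2) (A i).b (shrink t p) (v.1, t⁻¹ * v.2) := by
  have hO : IsOpen {p : Sg i × ℝ | 0 < p.2 ∧ p.2 < ε'} :=
    (isOpen_lt continuous_const continuous_snd).inter (isOpen_lt continuous_snd continuous_const)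
  have hO' : IsOpen {p : Sg i × ℝ | R' < p.2} := isOpen_lt continuous_const continuous_snd
  exact dFun_interpFun C.F_smooth
    (((N₀.a_smooth i).contMDiffAt (hO.mem_nhds ⟨h0, h2⟩)).mdifferentiableAt (by simp))
    (((A i).b_smooth.contMDiffAt (hO'.mem_nhds (lt_shrink ht h1))).mdifferentiableAt (by simp)) v

theorem secD_uT_outer {t : ℝ} (ht : 0 < t) {i : Fin n} {p : Sg i × ℝ} (h0 : 0 < p.2)
    (h1 : t * R' < p.2) (h2 : p.2 < ε') (hp : 2 * t ^ C.α ≤ p.2) :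
    secD (coneModel 2) (uT C N₀ A t i) p = secD (coneModel 2) (N₀.a i) p := by
  have h : dFun (coneModel 2) (uT C N₀ A t i) p = dFun (coneModel 2) (N₀.a i) p := by
    refine ContinuousLinearMap.ext fun v ↦ ?_
    have hs := two_le_scaled ht hp
    rw [dFun_uT ht h0 h1 h2, C.F_one _ hs, deriv_cutoff_of_ge C.F_mono C.F_one hs]
    ring
  exact congrArg (fun ξ ↦ (⟨p, ξ⟩ : Cot (coneModel 2) (Sg i × ℝ))) h

theorem dFun_uT_inner {t : ℝ} (ht : 0 < t) {i : Fin n} {p : Sg i × ℝ} (h0 : 0 < p.2)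
    (h1 : t * R' < p.2) (h2 : p.2 < ε') (hp : p.2 ≤ t ^ C.α) (v : Eu 2 × ℝ) :
    dFun (coneModel 2) (uT C N₀ A t i) p v =
      t ^ 2 * dFun (coneModel 2) (A i).b (shrink t p) (v.1, t⁻¹ * v.2) := by
  have hs := scaled_le_one ht hp
  rw [dFun_uT ht h0 h1 h2, C.F_zero _ hs, deriv_cutoff_of_le C.F_mono C.F_zero hs]
  ring

/-- For r ≤ t^α the differential of u is t² times the pullback of db under the dilation by t⁻¹. This
is the image of db under the action of t, so `Ψ` sends it to the dilation by t of the graph of db.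
-/
theorem secD_uT_inner {t : ℝ} (ht : 0 < t) {i : Fin n} {p : Sg i × ℝ} (h0 : 0 < p.2)
    (h1 : t * R' < p.2) (h2 : p.2 < ε') (hp : p.2 ≤ t ^ C.α) :
    secD (coneModel 2) (uT C N₀ A t i) p ∈ (L i).Ψ.source ∧ neckPt C N₀ A t i p =
      (((L i).Ψ (secD (coneModel 2) (A i).b (shrink t p))).1,
        t * ((L i).Ψ (secD (coneModel 2) (A i).b (shrink t p))).2) :=
  (L i).dilate ((A i).mem_source (lt_shrink ht h1)) ht (x := p)
    (ξ := dFun (coneModel 2) (uT C N₀ A t i) p) rfl (dFun_uT_inner ht h0 h1 h2 hp)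

-- Wherever the differential is small relative to r, `Ψ` changes the radius by a factor less than 2.
-- This covers tρ < r up to a fixed radius `ra`: through db on the inside, da on the outside, and
-- the interpolation estimate on the annulus. Below tρ the image is t times a bounded set, so its
-- radius is at most tτ. Beyond `ra` the image stays at a fixed distance η from the vertex. As tρ
-- and tτ are much smaller than t^α, and t^α is much smaller than all fixed radii, what remains is a
-- finite list of inequalities valid for small t; the factors 16 and 32 leave room for the
-- doublings.
variable (C N₀ A) in
theorem eventually_neckBounds (hV : ∀ i, IsCalabiYauCone (V i))
    (hι : ∀ i, IsSLCone (V i) (ι i)) [∀ i, CompactSpace (Sg i)] (i : Fin n) :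
    ∀ᶠ t in 𝓝[>] (0 : ℝ), NeckBounds C N₀ A t i := by
  obtain ⟨δ, hδ, hsmall⟩ := (L i).exists_small (hV i) (hι i)
  obtain ⟨ra, hra, hda⟩ := exists_dFun_small_at_zero (N₀.a_decay i) N₀.one_lt_μ N₀.ε'_pos
    (N₀.a_smooth i) hδ
  obtain ⟨ρ, hρ, hdb⟩ := exists_dFun_small_at_infinity (A i).b_decay (A i).κ_lt (A i).b_smooth hδ
  have hann := eventually_dFun_interpFun_small (hV i) (hι i) C.F_smooth C.F_mono C.F_zero C.F_one
    C.α_pos C.α_lt_one (N₀.a_decay i) N₀.one_lt_μ N₀.ε'_pos (N₀.a_smooth i) (A i).b_decay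
    (A i).κ_lt (A i).b_smooth hδ
  obtain ⟨η, hη, hηa⟩ := N₀.exists_le_snd i (δ := min ra ε') (lt_min hra N₀.ε'_pos)
    (min_le_right _ _)
  obtain ⟨η', hη', hT⟩ := N₀.exists_mem_T i
  obtain ⟨σ, hσR, hσ⟩ := (A i).exists_notMem_H
  obtain ⟨τ, hτ⟩ := (A i).exists_le ρ hρ.le
  have hR := (Z i).R_pos
  have hR' : 0 < R' := hR.trans (A i).R_lt
  have hρ0 : 0 < ρ := hR'.trans hρ
  have hε := N₀.ε'_lt
  have T0 := tendsto_rpow_zero C.α_pos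
  have T1 := tendsto_rpow_div C.α_lt_one
  have T2 : Filter.Tendsto (fun t : ℝ ↦ 32 * t ^ C.α) (𝓝[>] 0) (𝓝 0) := by
    simpa using T0.const_mul 32
  filter_upwards [self_mem_nhdsWithin, hann, T2.eventually (gt_mem_nhds N₀.ε'_pos),
    T2.eventually (gt_mem_nhds hra), T2.eventually (gt_mem_nhds hη),
    T2.eventually (gt_mem_nhds hη'), T1.eventually (Filter.eventually_gt_atTop (16 * R)),
    T1.eventually (Filter.eventually_gt_atTop (16 * R')),
    T1.eventually (Filter.eventually_gt_atTop (8 * ρ)),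
    T1.eventually (Filter.eventually_gt_atTop (8 * σ)),
    T1.eventually (Filter.eventually_gt_atTop (4 * τ))]
    with t ht hmid b1 b2 b3 b4 c1 c2 c3 c4 c5
  have ht : 0 < t := ht
  have hs : 0 < t ^ C.α := Real.rpow_pos_of_pos ht _
  rw [lt_div_iff₀ ht] at c1 c2 c3 c4 c5
  set s := t ^ C.α with hsdef
  have htR := mul_pos ht hR
  have htR' := mul_pos ht hR'
  have hRR : t * R < t * R' := mul_lt_mul_of_pos_left (A i).R_lt ht
  have src : ∀ p : Sg i × ℝ, t * R' < p.2 → p.2 < ε' →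
      secD (coneModel 2) (uT C N₀ A t i) p ∈ (L i).Ψ.source := fun p h1 h2 ↦ by
    have h0 := htR'.trans h1
    rcases le_total p.2 s with h | h
    · exact (secD_uT_inner ht h0 h1 h2 h).1
    rcases le_total (2 * s) p.2 with h' | h'
    · rw [secD_uT_outer ht h0 h1 h2 h']
      exact N₀.mem_source h0 h2
    · exact (hsmall p (dFun (coneModel 2) (uT C N₀ A t i) p) h0 (hmid p h h')).1
  have bnd_a : ∀ p : Sg i × ℝ, 0 < p.2 → p.2 < ra →
      p.2 / 2 < ((L i).Ψ (secD (coneModel 2) (N₀.a i) p)).2 ∧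
        ((L i).Ψ (secD (coneModel 2) (N₀.a i) p)).2 < 2 * p.2 := fun p h0 h1 ↦
    (hsmall p (dFun (coneModel 2) (N₀.a i) p) h0 (hda p h0 h1)).2
  have bnd_b : ∀ q : Sg i × ℝ, ρ < q.2 →
      q.2 / 2 < ((L i).Ψ (secD (coneModel 2) (A i).b q)).2 ∧
        ((L i).Ψ (secD (coneModel 2) (A i).b q)).2 < 2 * q.2 := fun q h ↦
    (hsmall q (dFun (coneModel 2) (A i).b q) (hρ0.trans h) (hdb q (hρ0.trans h) h)).2
  have inn : ∀ p : Sg i × ℝ, t * R' < p.2 → p.2 ≤ s → neckPt C N₀ A t i p =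
      (((L i).Ψ (secD (coneModel 2) (A i).b (shrink t p))).1,
        t * ((L i).Ψ (secD (coneModel 2) (A i).b (shrink t p))).2) := fun p h1 h2 ↦
    (secD_uT_inner ht (htR'.trans h1) h1 (by linarith) h2).2
  have out : ∀ p : Sg i × ℝ, 2 * s ≤ p.2 → p.2 < ε' → neckPt C N₀ A t i p =
      (L i).Ψ (secD (coneModel 2) (N₀.a i) p) := fun p h1 h2 ↦
    congrArg (L i).Ψ (secD_uT_outer ht (by linarith) (by linarith) h2 h1)
  have hsh : ∀ p : Sg i × ℝ, t * (shrink t p).2 = p.2 := fun p ↦ by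
    change t * (t⁻¹ * p.2) = _
    rw [mul_inv_cancel_left₀ ht.ne']
  have inn_b : ∀ p : Sg i × ℝ, t * ρ < p.2 → p.2 ≤ s →
      p.2 / 2 < (neckPt C N₀ A t i p).2 ∧ (neckPt C N₀ A t i p).2 < 2 * p.2 := fun p h1 h2 ↦ by
    rw [inn p ((mul_lt_mul_of_pos_left hρ ht).trans h1) h2]
    have h := bnd_b (shrink t p) (lt_shrink ht h1)
    have h3 := mul_lt_mul_of_pos_left h.1 ht
    have h4 := mul_lt_mul_of_pos_left h.2 ht
    have h5 := hsh p
    constructor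
    · change p.2 / 2 < t * _
      linarith
    · change t * _ < 2 * p.2
      linarith
  have low : ∀ p : Sg i × ℝ, t * R' < p.2 → p.2 ≤ s / 8 → (neckPt C N₀ A t i p).2 ≤ s / 4 :=
    fun p h1 h2 ↦ by
      rcases lt_or_ge (t * ρ) p.2 with h | h
      · linarith [(inn_b p h (by linarith)).2]
      · rw [inn p h1 (by linarith)]
        have h3 := hτ (shrink t p) (lt_shrink ht h1)
          (le_of_mul_le_mul_left (by rw [hsh]; exact h) ht)
        have h4 := mul_le_mul_of_nonneg_left h3 ht.le
        change t * _ ≤ s / 4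
        linarith
  have mid : ∀ p : Sg i × ℝ, s / 8 ≤ p.2 → p.2 ≤ 16 * s →
      p.2 / 2 < (neckPt C N₀ A t i p).2 ∧ (neckPt C N₀ A t i p).2 < 2 * p.2 := fun p h1 h2 ↦ by
    rcases le_total p.2 s with h | h
    · exact inn_b p (by linarith) h
    rcases le_total (2 * s) p.2 with h' | h'
    · rw [out p h' (by linarith)]
      exact bnd_a p (by linarith) (by linarith)
    · exact (hsmall p (dFun (coneModel 2) (uT C N₀ A t i) p) (by linarith) (hmid p h h')).2
  have high : ∀ p : Sg i × ℝ, 16 * s ≤ p.2 → p.2 < ε' → 8 * s ≤ (neckPt C N₀ A t i p).2 :=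
    fun p h1 h2 ↦ by
      rw [out p (by linarith) h2]
      rcases lt_or_ge p.2 ra with h | h
      · linarith [(bnd_a p (by linarith) h).1]
      · linarith [hηa p ((min_le_left _ _).trans h) h2]
  refine
    { pos := ht
      R_lt := by linarith
      R'_lt := by linarith
      lt_ε' := by linarith
      mem_source := src
      low := low
      mid := mid
      high := high
      range := fun p h1 h2 ↦ ?_
      inner := fun p h1 h2 ↦ ?_
      outer := out
      a_lt := fun p h0 h1 ↦ ?_
      lt_b := fun q h ↦ ?_
      mem_T := fun p h0 h1 ↦ hT p h0 (by linarith)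
      notMem_H := fun p h ↦ ?_ }
  · rcases le_total p.2 s with h | h
    · constructor
      · rw [inn p h1 h]
        exact mul_lt_mul_of_pos_left ((A i).R_lt_snd (lt_shrink ht h1)) ht
      · rcases le_total p.2 (s / 8) with h' | h'
        · linarith [low p h1 h']
        · linarith [(mid p h' (by linarith)).2]
    rcases le_total (2 * s) p.2 with h' | h'
    · constructor
      · rcases le_total p.2 (16 * s) with h'' | h''
        · linarith [(mid p (by linarith) h'').1]
        · linarith [high p h'' h2]
      · rw [out p h' h2]
        exact (N₀.snd_pos_lt (by linarith) h2).2
    · have := mid p (by linarith) (by linarith)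
      constructor <;> linarith
  · rw [inn p h1 h2]
    exact Prod.ext rfl (inv_mul_cancel_left₀ ht.ne' _)
  · linarith [(bnd_a p h0 (by linarith)).2]
  · have h1 : ρ < q.2 := by
      have : t * ρ < t * q.2 := by linarith
      exact lt_of_mul_lt_mul_left this ht.le
    have := mul_lt_mul_of_pos_left (bnd_b q h1).1 ht
    linarith
  · exact hσ _ (lt_shrink ht (by linarith))

end Geometry

/-! ### The points of the glued 3-fold -/

theorem shrink_mk {T : Type*} {t : ℝ} (ht : 0 < t) (q : T × ℝ) : shrink t (q.1, t * q.2) = q :=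
  Prod.ext rfl (inv_mul_cancel_left₀ ht.ne' _)

section Geometry

variable {n : ℕ} {M₀ : Type*} [TopologicalSpace M₀] {x : Fin n → M₀} [ChartedSpace (Eu 6) (Reg x)]
  {Γ : Fin n → Type*} [∀ i, TopologicalSpace (Γ i)] [∀ i, ChartedSpace (Eu 5) (Γ i)]
  {Y : Fin n → Type*} [∀ i, TopologicalSpace (Y i)] [∀ i, ChartedSpace (Eu 6) (Y i)]
  {Sg : Fin n → Type*} [∀ i, TopologicalSpace (Sg i)] [∀ i, ChartedSpace (Eu 2) (Sg i)]
  [∀ i, IsManifold (𝓡 2) ∞ (Sg i)]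
  {V : ∀ i, Triple (coneModel 5) (Γ i × ℝ)} {ι : ∀ i, Sg i → Γ i} {R : ℝ}
  {X : ConicalCY x V} {Z : ∀ i, ACCY (V i) (Y i) R} {L : ∀ i, LagNbhd (V i) (ι i)}
  {ε' R' : ℝ} {C : Choices X Z} {N₀ : ConicalSL X L ε'} {A : ∀ i, ACSL (Z i) (L i) R'}
  [T2Space M₀] [∀ i, CompactSpace (Γ i)] [∀ i, T2Space (Y i)]
  [IsManifold (𝓡 6) ∞ (Reg x)] [∀ i, IsManifold (𝓡 5) ∞ (Γ i)] [∀ i, IsManifold (𝓡 6) ∞ (Y i)]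
  {t : ℝ} {ht : Admissible R X.ε C.α t} {i j : Fin n}

theorem Admissible.exists_of_jQ_eq_jP {q : (glueData X Z ht).Q} {y : (glueData X Z ht).P i}
    (h : (glueData X Z ht).jQ q = (glueData X Z ht).jP i y) :
    ∃ p ∈ annulus (Γ i) C.α t, X.Φ i p = q ∧ (Z i).Υt t p = y := by
  obtain ⟨h1, h2⟩ := (glueData X Z ht).jQ_eq_jP.1 h
  obtain ⟨p, hp, e⟩ := Admissible.mem_source_iff.1 h1
  exact ⟨p, hp, e, by rw [← h2, ← e, Admissible.φ_apply hp]⟩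

theorem Admissible.sigma_eq_of_jP_eq_jP {y : (glueData X Z ht).P i} {y' : (glueData X Z ht).P j}
    (h : (glueData X Z ht).jP i y = (glueData X Z ht).jP j y') :
    (⟨i, y⟩ : Σ i, (glueData X Z ht).P i) = ⟨j, y'⟩ := by
  by_cases hij : i = j
  · subst hij
    rw [(glueData X Z ht).jP_injective i h]
  · obtain ⟨q, hq⟩ := (glueData X Z ht).jP_eq_jP_of_ne hij h
    exact absurd ((glueData X Z ht).jQ_eq_jP.1 (hq.trans h)).1 (Set.disjoint_left.1
      (Admissible.disjoint_source i j hij) ((glueData X Z ht).jQ_eq_jP.1 hq).1)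

theorem Admissible.annulus_mem_Φ_source (ht : Admissible R X.ε C.α t) {p : Γ i × ℝ}
    (hp : p ∈ annulus (Γ i) C.α t) : p ∈ (X.Φ i).source :=
  X.mem_source (ht.scale_pos.trans hp.1) (hp.2.trans ht.right)

/-- A piece that is placed in `P i` is visible from `Q` through the annulus. A point of the graph
visible there is again listed as a point of the graph, so only `H i` gives a further alternative. -/
theorem mem_Nt_jQ_iff {q : (glueData X Z ht).Q} : (glueData X Z ht).jQ q ∈ Nt C N₀ A ht ↔
    ((q : Reg x) : M₀) ∈ N₀.N ∧ (∀ i, ((q : Reg x) : M₀) ∉ N₀.T i) ∨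
    (∃ i, ∃ p ∈ (L i).Ψ '' graphT C N₀ A t i, t ^ C.α < p.2 ∧ p.2 < X.ε ∧ X.Φ i p = q) ∨
    ∃ i, ∃ p ∈ annulus (Γ i) C.α t, X.Φ i p = q ∧ (Z i).Υt t p ∈ (A i).H := by
  constructor
  · rintro ((⟨q', h, e⟩ | h) | h)
    · rw [(glueData X Z ht).jQ_injective e] at h
      exact .inl h
    · obtain ⟨i, h⟩ := mem_iUnion.1 h
      obtain ⟨q', ⟨p, hp, h1, h2, h3⟩, e⟩ | ⟨y, ⟨p, hp, h1, h2, h3⟩, e⟩ := h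
      · rw [(glueData X Z ht).jQ_injective e] at h3
        exact .inr (.inl ⟨i, p, hp, h1, h2, h3⟩)
      · obtain ⟨p', hp', h4, h5⟩ := Admissible.exists_of_jQ_eq_jP e.symm
        have := (Z i).Υt_inj ht.pos h1 (ht.left.trans hp'.1) (h3.trans h5.symm)
        subst this
        exact .inr (.inl ⟨i, p, hp, hp'.1, hp'.2.trans ht.right, h4⟩)
    · obtain ⟨i, y, hy, e⟩ := mem_iUnion.1 h
      obtain ⟨p', hp', h4, h5⟩ := Admissible.exists_of_jQ_eq_jP e.symm
      exact .inr (.inr ⟨i, p', hp', h4, h5 ▸ hy⟩)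
  · rintro (h | ⟨i, p, hp, h1, h2, h3⟩ | ⟨i, p, hp, h1, h2⟩)
    · exact .inl (.inl ⟨q, h, rfl⟩)
    · exact .inl (.inr (mem_iUnion.2 ⟨i, .inl ⟨q, ⟨p, hp, h1, h2, h3⟩, rfl⟩⟩))
    · have hP : (Z i).Υt t p ∈ (glueData X Z ht).P i :=
        (Admissible.Υt_mem_P_iff (ht.left.trans hp.1)).2 hp.2
      exact .inr (mem_iUnion.2 ⟨i, ⟨_, hP⟩, h2, (Admissible.jQ_eq_jP hp h1 rfl).symm⟩)

theorem mem_Nt_jP_iff {y : (glueData X Z ht).P i} : (glueData X Z ht).jP i y ∈ Nt C N₀ A ht ↔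
    (∃ p ∈ annulus (Γ i) C.α t, (Z i).Υt t p = y ∧ (X.Φ i p : M₀) ∈ N₀.N ∧
      ∀ j, (X.Φ i p : M₀) ∉ N₀.T j) ∨
    (∃ p ∈ (L i).Ψ '' graphT C N₀ A t i, t * R < p.2 ∧ p.2 < 2 * t ^ C.α ∧ (Z i).Υt t p = y) ∨
    (y : Y i) ∈ (A i).H := by
  constructor
  · rintro ((⟨q', h, e⟩ | h) | h)
    · obtain ⟨p', hp', h4, h5⟩ := Admissible.exists_of_jQ_eq_jP e
      refine .inl ⟨p', hp', h5, ?_⟩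
      rw [h4]
      exact h
    · obtain ⟨j, h⟩ := mem_iUnion.1 h
      obtain ⟨q', ⟨p, hp, h1, h2, h3⟩, e⟩ | ⟨y, ⟨p, hp, h1, h2, h3⟩, e⟩ := h
      · obtain ⟨p', hp', h4, h5⟩ := Admissible.exists_of_jQ_eq_jP e
        have := X.Φ_inj (ht.annulus_mem_Φ_source hp')
          (X.mem_source (ht.scale_pos.trans h1) h2) (h4.trans h3.symm)
        cases this
        exact .inr (.inl ⟨_, hp, ht.left.trans h1, hp'.2, h5⟩)
      · cases Admissible.sigma_eq_of_jP_eq_jP e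
        exact .inr (.inl ⟨p, hp, h1, h2, h3⟩)
    · obtain ⟨j, y, hy, e⟩ := mem_iUnion.1 h
      cases Admissible.sigma_eq_of_jP_eq_jP e
      exact .inr (.inr hy)
  · rintro (⟨p, hp, h1, h2⟩ | ⟨p, hp, h1, h2, h3⟩ | h)
    · have hQ : X.Φ i p ∈ (glueData X Z ht).Q :=
        (Admissible.Φ_mem_Q_iff (ht.scale_pos.trans hp.1) (hp.2.trans ht.right)).2 hp.1
      exact .inl (.inl ⟨⟨_, hQ⟩, h2, Admissible.jQ_eq_jP hp rfl h1⟩)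
    · exact .inl (.inr (mem_iUnion.2 ⟨i, .inr ⟨y, ⟨p, hp, h1, h2, h3⟩, rfl⟩⟩))
    · exact .inr (mem_iUnion.2 ⟨i, y, h, rfl⟩)

namespace NeckBounds

theorem snd_pos (h : NeckBounds C N₀ A t i) {p : Sg i × ℝ} (hp : t * R' < p.2) : 0 < p.2 :=
  (mul_pos h.pos ((Z i).R_pos.trans (A i).R_lt)).trans hp

theorem lt_two_mul (h : NeckBounds C N₀ A t i) {p : Sg i × ℝ} (h1 : t * R' < p.2) {c : ℝ}
    (hc : t ^ C.α / 8 ≤ c) (hc' : c ≤ 16 * t ^ C.α) (hp : p.2 ≤ c) :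
    (neckPt C N₀ A t i p).2 ≤ 2 * c := by
  rcases le_total p.2 (t ^ C.α / 8) with h' | h'
  · linarith [h.low p h1 h']
  · linarith [(h.mid p h' (by linarith)).2]

theorem half_le (h : NeckBounds C N₀ A t i) {p : Sg i × ℝ} (h2 : p.2 < ε') {c : ℝ}
    (hc : t ^ C.α / 8 ≤ c) (hc' : c ≤ 16 * t ^ C.α) (hp : c ≤ p.2) :
    c / 2 ≤ (neckPt C N₀ A t i p).2 := by
  rcases le_total (16 * t ^ C.α) p.2 with h' | h'
  · linarith [h.high p h' h2]
  · linarith [(h.mid p (by linarith) h').1]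

/-- Away from the necks, the glued 3-fold is `N₀`. -/
theorem mem_Nt_jQ_iff (hN : ∀ i, NeckBounds C N₀ A t i) {q : (glueData X Z ht).Q}
    (hq : ∀ i, (q : Reg x) ∉ X.Φ i '' {p | 0 < p.2 ∧ p.2 ≤ 4 * t ^ C.α}) :
    (glueData X Z ht).jQ q ∈ Nt C N₀ A ht ↔ ((q : Reg x) : M₀) ∈ N₀.N := by
  have hs := ht.scale_pos
  rw [SLGluing.mem_Nt_jQ_iff]
  constructor
  · rintro (h | ⟨i, _, ⟨_, ⟨p, ⟨h1, h2⟩, rfl⟩, rfl⟩, h3, h4, h5⟩ | ⟨i, p, hp, h1, h2⟩)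
    · exact h.1
    · have h6 : 4 * t ^ C.α < (neckPt C N₀ A t i p).2 := by
        by_contra hc
        exact hq i ⟨_, ⟨hs.trans h3, not_lt.1 hc⟩, h5⟩
      -- An image radius greater than 4t^α forces the base radius beyond 2t^α, where u equals a.
      have h7 : 2 * t ^ C.α ≤ p.2 := by
        by_contra hc
        linarith [(hN i).lt_two_mul h1 (c := 2 * t ^ C.α) (by linarith) (by linarith)
          (not_le.1 hc).le]
      have h8 := (hN i).outer p h7 h2
      refine N₀.mem_of_mem_T (i := i) (N₀.mem_T_iff.2 ⟨p, by linarith, h2, ?_⟩)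
      rw [← h8]
      exact h5
    · exact absurd ⟨p, ⟨hs.trans hp.1, by linarith [hp.2]⟩, h1⟩ (hq i)
  · intro h
    by_cases hT : ∀ i, ((q : Reg x) : M₀) ∉ N₀.T i
    · exact .inl ⟨h, hT⟩
    · push Not at hT
      obtain ⟨i, hi⟩ := hT
      obtain ⟨p, h0, h1, e⟩ := N₀.mem_T_iff.1 hi
      have h2 := N₀.snd_pos_lt h0 h1
      have h6 : 4 * t ^ C.α < ((L i).Ψ (secD (coneModel 2) (N₀.a i) p)).2 := by
        by_contra hc
        exact hq i ⟨_, ⟨h2.1, not_lt.1 hc⟩, e⟩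
      have h7 : 2 * t ^ C.α ≤ p.2 := by
        by_contra hc
        linarith [(hN i).a_lt p h0 (not_le.1 hc).le]
      have h8 := (hN i).outer p h7 h1
      refine .inr (.inl ⟨i, neckPt C N₀ A t i p, ⟨_, ⟨p, ⟨?_, h1⟩, rfl⟩, rfl⟩, ?_⟩)
      · linarith [(hN i).R'_lt]
      · rw [h8]
        exact ⟨by linarith, h2.2, e⟩

/-- On the necks, the glued 3-fold is the graph. -/
theorem mem_Nt_jQ_Φ_iff (hN : ∀ i, NeckBounds C N₀ A t i) {p : Γ i × ℝ} (h1 : t ^ C.α < p.2) (h2 : p.2 ≤ 8 * t ^ C.α)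
    {q : (glueData X Z ht).Q} (hq : X.Φ i p = q) :
    (glueData X Z ht).jQ q ∈ Nt C N₀ A ht ↔ p ∈ (L i).Ψ '' graphT C N₀ A t i := by
  have hs := ht.scale_pos
  have hε := N₀.ε'_lt
  have hpε : p.2 < X.ε := by linarith [(hN i).lt_ε']
  have hsrc := X.mem_source (hs.trans h1) hpε
  rw [SLGluing.mem_Nt_jQ_iff]
  constructor
  · rintro (h | ⟨j, p', hp', h3, h4, h5⟩ | ⟨j, p', hp', h3, h4⟩)
    · rw [← hq] at h
      exact absurd ((hN i).mem_T p (hs.trans h1) (by linarith) h.1) (h.2 i)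
    · cases X.Φ_inj (X.mem_source (hs.trans h3) h4) hsrc (h5.trans hq.symm)
      exact hp'
    · cases X.Φ_inj (ht.annulus_mem_Φ_source hp') hsrc (h3.trans hq.symm)
      exact absurd h4 ((hN _).notMem_H p (by linarith))
  · exact fun h ↦ .inr (.inl ⟨i, p, h, h1, hpε, hq⟩)

theorem mem_Nt_jP_Υt_iff (hN : ∀ i, NeckBounds C N₀ A t i) {p : Γ i × ℝ} (h1 : t ^ C.α / 8 ≤ p.2) (h2 : p.2 < 2 * t ^ C.α)
    {y : (glueData X Z ht).P i} (hy : (Z i).Υt t p = y) :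
    (glueData X Z ht).jP i y ∈ Nt C N₀ A ht ↔ p ∈ (L i).Ψ '' graphT C N₀ A t i := by
  have hs := ht.scale_pos
  have hR : t * R < p.2 := by linarith [(hN i).R_lt]
  rw [SLGluing.mem_Nt_jP_iff]
  constructor
  · rintro (⟨p', hp', h3, h4, h5⟩ | ⟨p', hp', h3, h4, h5⟩ | h)
    · cases (Z i).Υt_inj ht.pos (ht.left.trans hp'.1) hR (h3.trans hy.symm)
      exact absurd ((hN i).mem_T p (by linarith) (by linarith) h4) (h5 i)
    · cases (Z i).Υt_inj ht.pos h3 hR (h5.trans hy.symm)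
      exact hp'
    · rw [← hy] at h
      exact absurd h ((hN i).notMem_H p h1)
  · exact fun h ↦ .inr (.inl ⟨p, h, hR, h2, hy⟩)

/-- On the inner parts, the glued 3-fold is `L i`. -/
theorem mem_Nt_jP_iff (hN : ∀ i, NeckBounds C N₀ A t i) {y : (glueData X Z ht).P i}
    (hy : (y : Y i) ∉ (Z i).Υt t '' {p | t ^ C.α / 2 ≤ p.2}) :
    (glueData X Z ht).jP i y ∈ Nt C N₀ A ht ↔ (y : Y i) ∈ (A i).carrier := by
  have hs := ht.scale_pos
  rw [SLGluing.mem_Nt_jP_iff]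
  constructor
  · rintro (⟨p', hp', h3, -⟩ | ⟨_, ⟨_, ⟨p, ⟨h1, h2⟩, rfl⟩, rfl⟩, h3, h4, h5⟩ | h)
    · exact absurd ⟨p', (by linarith [hp'.1] : t ^ C.α / 2 ≤ p'.2), h3⟩ hy
    · have h6 : (neckPt C N₀ A t i p).2 < t ^ C.α / 2 := by
        by_contra hc
        exact hy ⟨_, not_lt.1 hc, h5⟩
      have h7 : p.2 ≤ t ^ C.α := by
        by_contra hc
        linarith [(hN i).half_le h2 (c := t ^ C.α) (by linarith) (by linarith) (not_le.1 hc).le]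
      have h8 := (hN i).inner p h1 h7
      rw [← h5]
      change (Z i).Υ (shrink t (neckPt C N₀ A t i p)) ∈ _
      rw [h8]
      exact (A i).mem_carrier (lt_shrink ht.pos h1)
    · exact (A i).H_sub h
  · intro h
    by_cases hH : (y : Y i) ∈ (A i).H
    · exact .inr (.inr hH)
    · obtain ⟨q, hq, e⟩ := (A i).exists_of_notMem_H h hH
      set r := (L i).Ψ (secD (coneModel 2) (A i).b q) with hr
      have h6 : t * r.2 < t ^ C.α / 2 := by
        by_contra hc
        refine hy ⟨(r.1, t * r.2), not_lt.1 hc, ?_⟩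
        change (Z i).Υ (shrink t (r.1, t * r.2)) = y
        rw [shrink_mk ht.pos, e]
      have h7 : t * q.2 < t ^ C.α := by
        by_contra hc
        linarith [(hN i).lt_b q (not_lt.1 hc)]
      set p : Sg i × ℝ := (q.1, t * q.2) with hp
      have h1 : t * R' < p.2 := mul_lt_mul_of_pos_left hq ht.pos
      have h8 := (hN i).inner p h1 h7.le
      have h9 : p.2 < ε' := by linarith [(hN i).lt_ε', show p.2 = t * q.2 from rfl]
      rw [hp, shrink_mk ht.pos, ← hp, ← hr] at h8
      refine .inr (.inl ⟨neckPt C N₀ A t i p, ⟨_, ⟨p, ⟨h1, h9⟩, rfl⟩, rfl⟩,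
        ((hN i).range p h1 h9).1, ?_, ?_⟩)
      · have h10 : (neckPt C N₀ A t i p).2 = t * r.2 := by
          rw [← h8]
          exact (mul_inv_cancel_left₀ ht.pos.ne' _).symm
        linarith
      · change (Z i).Υ (shrink t (neckPt C N₀ A t i p)) = y
        rw [h8, e]

theorem piecesFit (hN : ∀ i, NeckBounds C N₀ A t i) (h1 : t * R' < t ^ C.α)
    (h2 : 2 * t ^ C.α < ε') : PiecesFit C N₀ A ht := by
  have hs := ht.scale_pos
  refine ⟨⟨h1, h2⟩, ?_, ?_, ?_, ?_⟩
  · rintro q hq hT i ⟨p, ⟨h3, h4⟩, rfl⟩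
    exact hT i ((hN i).mem_T p h3 (by linarith) hq)
  · rintro i _ ⟨p, ⟨h3, h4⟩, rfl⟩
    exact (hN i).mem_source p h3 h4
  · rintro i _ ⟨_, ⟨p, ⟨h3, h4⟩, rfl⟩, rfl⟩
    exact (hN i).range p h3 h4
  · intro i y hy
    by_cases hK : y ∈ (Z i).Υ.target
    · obtain ⟨p, hp, rfl⟩ := (Z i).exists_Υt ht.pos hK
      refine (Admissible.Υt_mem_P_iff hp).2 ?_
      by_contra hc
      exact (hN i).notMem_H p (by linarith) hy
    · exact .inl hK

end NeckBounds

end Geometry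

/-! ### The glued 3-fold is a compact Lagrangian submanifold -/

theorem notMem_nhds_of_eventually {A B : Type*} [TopologicalSpace A] [TopologicalSpace B]
    {e : OpenPartialHomeomorph A B} {p : A} (hp : p ∈ e.source) {N : Set B} {S : Set A}
    (h : ∀ᶠ q in 𝓝 p, e q ∈ N ↔ q ∈ S) (hS : p ∉ S → ∀ᶠ q in 𝓝 p, q ∉ S) (hN : e p ∉ N) :
    Nᶜ ∈ 𝓝 (e p) := by
  rw [← e.map_nhds_eq hp]
  change ∀ᶠ q in 𝓝 p, e q ∉ N
  filter_upwards [h, hS fun hpS ↦ hN (h.self_of_nhds.2 hpS)] with q h1 h2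
  exact fun h3 ↦ h2 (h1.1 h3)

section Geometry

variable {n : ℕ} {M₀ : Type*} [TopologicalSpace M₀] {x : Fin n → M₀} [ChartedSpace (Eu 6) (Reg x)]
  {Γ : Fin n → Type*} [∀ i, TopologicalSpace (Γ i)] [∀ i, ChartedSpace (Eu 5) (Γ i)]
  {Y : Fin n → Type*} [∀ i, TopologicalSpace (Y i)] [∀ i, ChartedSpace (Eu 6) (Y i)]
  {Sg : Fin n → Type*} [∀ i, TopologicalSpace (Sg i)] [∀ i, ChartedSpace (Eu 2) (Sg i)]
  [∀ i, IsManifold (𝓡 2) ∞ (Sg i)]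
  {V : ∀ i, Triple (coneModel 5) (Γ i × ℝ)} {ι : ∀ i, Sg i → Γ i} {R : ℝ}
  {X : ConicalCY x V} {Z : ∀ i, ACCY (V i) (Y i) R} {L : ∀ i, LagNbhd (V i) (ι i)}
  {ε' R' : ℝ} {C : Choices X Z} {N₀ : ConicalSL X L ε'} {A : ∀ i, ACSL (Z i) (L i) R'}
  [T2Space M₀] [∀ i, CompactSpace (Γ i)] [∀ i, T2Space (Y i)]
  [IsManifold (𝓡 6) ∞ (Reg x)] [∀ i, IsManifold (𝓡 5) ∞ (Γ i)] [∀ i, IsManifold (𝓡 6) ∞ (Y i)]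
  {t : ℝ} {ht : Admissible R X.ε C.α t} {i : Fin n}

namespace NeckBounds

/-- Near each point, the glued 3-fold is `N₀`, or the graph of `du_{t,i}`, or `L i`. -/
theorem local_model (hV : ∀ i, IsCalabiYauCone (V i)) (hN : ∀ i, NeckBounds C N₀ A t i)
    (z : Mt X Z ht) :
    (∃ (e : OpenPartialHomeomorph (Reg x) (Mt X Z ht)) (q : Reg x), IsDiffeo (𝓡 6) (𝓡 6) e ∧
      q ∈ e.source ∧ e q = z ∧ (omegaT X Z ht).pullback (I := 𝓡 6) e q = X.S.ω q ∧
      ∀ᶠ q' in 𝓝 q, e q' ∈ Nt C N₀ A ht ↔ q' ∈ {q : Reg x | (q : M₀) ∈ N₀.N}) ∨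
    (∃ (i : Fin n) (e : OpenPartialHomeomorph (Γ i × ℝ) (Mt X Z ht)) (p : Γ i × ℝ),
      IsDiffeo (coneModel 5) (𝓡 6) e ∧ p ∈ e.source ∧ e p = z ∧
      (omegaT X Z ht).pullback (I := coneModel 5) e p = (V i).ω p ∧
      (t ^ C.α / 4 < p.2 ∧ p.2 < 8 * t ^ C.α) ∧
      ∀ᶠ p' in 𝓝 p, e p' ∈ Nt C N₀ A ht ↔ p' ∈ (L i).Ψ '' graphT C N₀ A t i) ∨
    ∃ (i : Fin n) (e : OpenPartialHomeomorph (Y i) (Mt X Z ht)) (y : Y i),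
      IsDiffeo (𝓡 6) (𝓡 6) e ∧ y ∈ e.source ∧ e y = z ∧
      (omegaT X Z ht).pullback (I := 𝓡 6) e y = t ^ 2 • (Z i).S.ω y ∧
      (∀ᶠ y' in 𝓝 y, y' ∉ (Z i).Υt t '' {p | t ^ C.α / 2 ≤ p.2}) ∧
      ∀ᶠ y' in 𝓝 y, e y' ∈ Nt C N₀ A ht ↔ y' ∈ (A i).carrier := by
  have hs := ht.scale_pos
  have hε := N₀.ε'_lt
  have hQo : ∀ (hQ : Nonempty (glueData X Z ht).Q) (q : Reg x) (h : q ∈ (glueData X Z ht).Q),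
      (glueData X Z ht).inQ hQ q = (glueData X Z ht).jQ ⟨q, h⟩ := fun hQ q h ↦
    (glueData X Z ht).inQ_apply hQ ⟨q, h⟩
  have hPo : ∀ (i : Fin n) (hP : Nonempty ((glueData X Z ht).P i)) (y : Y i)
      (h : y ∈ (glueData X Z ht).P i),
      (glueData X Z ht).inP i hP y = (glueData X Z ht).jP i ⟨y, h⟩ := fun i hP y h ↦
    (glueData X Z ht).inP_apply i hP ⟨y, h⟩
  obtain ⟨q, rfl⟩ | ⟨⟨i, y⟩, rfl⟩ := (glueData X Z ht).exists_rep z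
  · have hQ : Nonempty (glueData X Z ht).Q := ⟨q⟩
    -- Seen from `Q`, the 3-fold is N₀ off r ≤ 4t^α and the graph for t^α < r ≤ 4t^α. Seen from `P
    -- i`, it is the graph for r ≥ t^α/2 and L i elsewhere. The membership lemmas for the graph hold
    -- on the larger range from t^α/8 to 8t^α, so each description is valid on a neighbourhood.
    by_cases hq : ∀ i, (q : Reg x) ∉ X.Φ i '' {p | 0 < p.2 ∧ p.2 ≤ 4 * t ^ C.α}
    · refine .inl ⟨(glueData X Z ht).inQ hQ, q, (glueData X Z ht).isDiffeo_inQ hQ, ?_,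
        (glueData X Z ht).inQ_apply hQ q, GlueData.form_pullback_inQ _ _ _ hQ q.2, ?_⟩
      · rw [GlueData.inQ_source]
        exact q.2
      · have h1 : ∀ i, ∀ᶠ q' in 𝓝 (q : Reg x),
            q' ∉ X.Φ i '' {p | 0 < p.2 ∧ p.2 ≤ 4 * t ^ C.α} := fun i ↦
          (X.isClosed_image i (by linarith [(hN i).lt_ε'])).isOpen_compl.mem_nhds (hq i)
        filter_upwards [Filter.eventually_all.2 h1,
          (glueData X Z ht).Q.isOpen.mem_nhds q.2] with q' h2 h3
        rw [hQo hQ q' h3]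
        exact NeckBounds.mem_Nt_jQ_iff hN h2
    · push Not at hq
      obtain ⟨i, p, ⟨h0, h1⟩, e⟩ := hq
      have hpε : p.2 < X.ε := by linarith [(hN i).lt_ε']
      have h2 : t ^ C.α < p.2 := by
        have h := q.2
        rw [← e] at h
        exact (Admissible.Φ_mem_Q_iff h0 hpε).1 h
      refine .inr (.inl ⟨i, ht.neckQ i hQ, p, ht.isDiffeo_neckQ i hQ,
        ht.mem_neckQ h2 hpε, ?_, omegaT_pullback_neckQ ht hQ h2 hpε,
        ⟨by linarith, by linarith⟩, ?_⟩)
      · change (glueData X Z ht).inQ hQ (X.Φ i p) = _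
        rw [e]
        exact (glueData X Z ht).inQ_apply hQ q
      · have c2 : ContinuousAt (fun q : Γ i × ℝ ↦ q.2) p := continuous_snd.continuousAt
        filter_upwards [c2.eventually (lt_mem_nhds h2),
          c2.eventually (gt_mem_nhds (show p.2 < 8 * t ^ C.α by linarith))] with p' h3 h4
        have h5 : X.Φ i p' ∈ (glueData X Z ht).Q :=
          (Admissible.Φ_mem_Q_iff (hs.trans h3) (by linarith [(hN i).lt_ε'])).2 h3
        change (glueData X Z ht).inQ hQ (X.Φ i p') ∈ _ ↔ _
        rw [hQo hQ _ h5, NeckBounds.mem_Nt_jQ_Φ_iff hN h3 h4.le rfl]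
  · have hP : Nonempty ((glueData X Z ht).P i) := ⟨y⟩
    have hR := (hN i).R_lt
    by_cases hy : (y : Y i) ∈ (Z i).Υt t '' {p | t ^ C.α / 2 ≤ p.2}
    · obtain ⟨p, hp, e⟩ := hy
      have hp : t ^ C.α / 2 ≤ p.2 := hp
      have hpR : t * R < p.2 := by linarith
      have h2 : p.2 < 2 * t ^ C.α := by
        have h := y.2
        rw [← e] at h
        exact (Admissible.Υt_mem_P_iff hpR).1 h
      refine .inr (.inl ⟨i, ht.neckP i hP, p, ht.isDiffeo_neckP i hP,
        ht.mem_neckP hpR h2, ?_, omegaT_pullback_neckP hV ht hP hpR h2,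
        ⟨by linarith, by linarith⟩, ?_⟩)
      · change (glueData X Z ht).inP i hP ((Z i).Υt t p) = _
        rw [e]
        exact (glueData X Z ht).inP_apply i hP y
      · have c2 : ContinuousAt (fun q : Γ i × ℝ ↦ q.2) p := continuous_snd.continuousAt
        filter_upwards [c2.eventually (lt_mem_nhds (show t ^ C.α / 8 < p.2 by linarith)),
          c2.eventually (gt_mem_nhds h2)] with p' h3 h4
        have h5 : (Z i).Υt t p' ∈ (glueData X Z ht).P i :=
          (Admissible.Υt_mem_P_iff (by linarith)).2 h4
        change (glueData X Z ht).inP i hP ((Z i).Υt t p') ∈ _ ↔ _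
        rw [hPo i hP _ h5, NeckBounds.mem_Nt_jP_Υt_iff hN h3.le h4 rfl]
    · have hR2 : R < t ^ C.α / 2 / t := by
        rw [lt_div_iff₀ ht.pos]
        nlinarith [mul_pos ht.pos (Z i).R_pos]
      have himg : (Z i).Υt t '' {p | t ^ C.α / 2 ≤ p.2} =
          (Z i).Υ '' {p | t ^ C.α / 2 / t ≤ p.2} := by
        ext y'
        constructor
        · rintro ⟨p, hp, rfl⟩
          refine ⟨shrink t p, ?_, rfl⟩
          change _ ≤ t⁻¹ * p.2
          rw [div_eq_inv_mul]
          exact mul_le_mul_of_nonneg_left hp (inv_pos.2 ht.pos).le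
        · rintro ⟨p, hp, rfl⟩
          refine ⟨(p.1, t * p.2), ?_, congrArg (Z i).Υ (shrink_mk ht.pos p)⟩
          have hp : t ^ C.α / 2 / t ≤ p.2 := hp
          change _ ≤ t * p.2
          rwa [div_le_iff₀' ht.pos] at hp
      have hev : ∀ᶠ y' in 𝓝 (y : Y i), y' ∉ (Z i).Υt t '' {p | t ^ C.α / 2 ≤ p.2} := by
        rw [himg] at hy ⊢
        exact ((Z i).isClosed_image hR2).isOpen_compl.mem_nhds hy
      refine .inr (.inr ⟨i, (glueData X Z ht).inP i hP, y, (glueData X Z ht).isDiffeo_inP i hP, ?_,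
        (glueData X Z ht).inP_apply i hP y,
        GlueData.form_pullback_inP _ _ _ i hP y.2 ?_, hev, ?_⟩)
      · rw [GlueData.inP_source]
        exact y.2
      · intro hyt
        obtain ⟨p, hp, e⟩ := Admissible.mem_target_iff.1 hyt
        exact hy ⟨p, (by linarith [hp.1] : t ^ C.α / 2 ≤ p.2), e⟩
      · filter_upwards [hev, ((glueData X Z ht).P i).isOpen.mem_nhds y.2] with y' h2 h3
        rw [hPo i hP y' h3, NeckBounds.mem_Nt_jP_iff hN h2]

/-- On the neck, the graph is closed. -/
theorem eventually_notMem_graph [∀ i, CompactSpace (Sg i)] [∀ i, T2Space (Γ i)]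
    (h : NeckBounds C N₀ A t i) {p : Γ i × ℝ}
    (hp : t ^ C.α / 4 < p.2 ∧ p.2 < 8 * t ^ C.α) (hpG : p ∉ (L i).Ψ '' graphT C N₀ A t i) :
    ∀ᶠ q in 𝓝 p, q ∉ (L i).Ψ '' graphT C N₀ A t i := by
  have hs : 0 < t ^ C.α := by linarith
  have hR' : ∀ p' : Sg i × ℝ, t ^ C.α / 8 ≤ p'.2 → t * R' < p'.2 := fun p' h1 ↦ by
    linarith [h.R'_lt]
  -- Image radii strictly between t^α/4 and 8t^α arise only from base radii in [t^α/8, 16t^α], by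
  -- `low` and `high`. So near p the graph is the image of a compact set.
  have hc : IsCompact (neckPt C N₀ A t i ''
      ((univ : Set (Sg i)) ×ˢ Icc (t ^ C.α / 8) (16 * t ^ C.α))) := by
    refine (isCompact_univ.prod isCompact_Icc).image_of_continuousOn fun p' hp' ↦ ?_
    have h1 := hR' p' hp'.2.1
    have h2 : p'.2 < ε' := by linarith [h.lt_ε', hp'.2.2]
    refine ContinuousAt.continuousWithinAt ?_
    exact ContinuousAt.comp (g := (L i).Ψ) ((L i).Ψ.continuousAt (h.mem_source p' h1 h2))
      (contMDiffAt_secD (uT_contMDiffAt h.pos (h.snd_pos h1) h1 h2)).continuousAt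
  have hpc : p ∉ neckPt C N₀ A t i '' ((univ : Set (Sg i)) ×ˢ Icc (t ^ C.α / 8) (16 * t ^ C.α)) := by
    rintro ⟨p', hp', rfl⟩
    exact hpG ⟨_, ⟨p', ⟨hR' p' hp'.2.1, by linarith [h.lt_ε', hp'.2.2]⟩, rfl⟩, rfl⟩
  have c2 : ContinuousAt (fun q : Γ i × ℝ ↦ q.2) p := continuous_snd.continuousAt
  filter_upwards [hc.isClosed.isOpen_compl.mem_nhds hpc, c2.eventually (lt_mem_nhds hp.1),
    c2.eventually (gt_mem_nhds hp.2)] with q h1 h2 h3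
  rintro ⟨_, ⟨p', ⟨h4, h5⟩, rfl⟩, rfl⟩
  refine h1 ⟨p', ⟨mem_univ _, ?_, ?_⟩, rfl⟩
  · by_contra hcon
    exact absurd h2 (not_lt.2 (h.low p' h4 (not_le.1 hcon).le))
  · by_contra hcon
    exact absurd h3 (not_lt.2 (h.high p' (not_le.1 hcon).le h5))

/-- A local question, settled in each of the three models: N₀ is compact, the graph is closed on the
neck, and the inner part of L i is compact. -/
theorem isClosed_Nt [∀ i, CompactSpace (Sg i)] [∀ i, T2Space (Γ i)]
    (hV : ∀ i, IsCalabiYauCone (V i)) (hN : ∀ i, NeckBounds C N₀ A t i) :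
    IsClosed (Nt C N₀ A ht) := by
  rw [← isOpen_compl_iff, isOpen_iff_mem_nhds]
  intro z hz
  obtain ⟨e, q, -, hq, rfl, -, h⟩ | ⟨i, e, p, -, hp, rfl, -, h1, h⟩ | ⟨i, e, y, -, hy, rfl, -, h1, h⟩ :=
    local_model hV hN z
  · refine notMem_nhds_of_eventually hq h (fun hqN ↦ ?_) hz
    exact (N₀.isCompact.isClosed.preimage continuous_subtype_val).isOpen_compl.mem_nhds hqN
  · exact notMem_nhds_of_eventually hp h ((hN i).eventually_notMem_graph h1) hz
  · refine notMem_nhds_of_eventually hy h (fun hyN ↦ ?_) hz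
    -- L i is cut at base radius t^α / t. The inner part is compact, hence closed; the discarded
    -- part has radius greater than t^α/2 after rescaling by t, by `lt_b`, and does not come near y.
    have hr : R' ≤ t ^ C.α / t := by
      rw [le_div_iff₀ ht.pos]
      have := (hN i).R'_lt
      have := mul_pos ht.pos ((Z i).R_pos.trans (A i).R_lt)
      linarith
    have hc := ((A i).compact _ hr).isClosed.isOpen_compl
    filter_upwards [h1, hc.mem_nhds fun hy' ↦ hyN hy'.1] with y' h2 h3 h4
    refine h3 ⟨h4, ?_⟩
    rintro ⟨_, ⟨_, ⟨q, hq, rfl⟩, rfl⟩, rfl⟩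
    have hq : t ^ C.α / t < q.2 := hq
    rw [div_lt_iff₀' ht.pos] at hq
    refine h2 ⟨(_, t * _), ?_, congrArg (Z i).Υ (shrink_mk ht.pos _)⟩
    exact ((hN i).lt_b q hq.le).le

/-- In the models N₀ and L i both properties are inherited; the factor t² in the 2-form does no
harm. On the neck the composite of `Ψ` with the neck chart pulls the 2-form back to the canonical
one, which vanishes on graphs of exact 1-forms. -/
theorem isLagrangian3_Nt (hV : ∀ i, IsCalabiYauCone (V i)) (hN : ∀ i, NeckBounds C N₀ A t i) :
    IsLagrangian3 (omegaT X Z ht) (Nt C N₀ A ht) := by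
  suffices h : ∀ z ∈ Nt C N₀ A ht, SubmanifoldAt (Nt C N₀ A ht) z ∧
      ∀ u ∈ tangentVectors (Nt C N₀ A ht) z, ∀ v ∈ tangentVectors (Nt C N₀ A ht) z,
        (omegaT X Z ht z : Eu 6 [⋀^Fin 2]→L[ℝ] ℝ) ![u, v] = 0 from
    ⟨fun z hz ↦ (h z hz).1, fun z hz ↦ (h z hz).2⟩
  intro z hz
  obtain ⟨e, q, he, hq, rfl, hω, h⟩ | ⟨i, e, p, he, hp, rfl, hω, h1, h⟩ |
    ⟨i, e, y, he, hy, rfl, hω, h1, h⟩ := local_model hV hN z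
  · have hqN := h.self_of_nhds.1 hz
    refine ⟨SubmanifoldAt.transfer he hq (N₀.isSL.1.1 q hqN) h,
      he.eq_zero_of_tangentVectors hq (h.mono fun _ h ↦ h.1) fun u hu v hv ↦ ?_⟩
    rw [hω]
    exact N₀.isSL.1.2 q hqN u hu v hv
  · obtain ⟨_, ⟨p', ⟨h2, h3⟩, rfl⟩, rfl⟩ := h.self_of_nhds.1 hz
    set u := uT C N₀ A t i with hu
    have hsrc := (hN i).mem_source p' h2 h3
    have h0 := (hN i).snd_pos h2
    have hdim : Module.finrank ℝ (Eu 2 × ℝ) = 3 := by simp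
    have hΨ : IsDiffeo ((coneModel 2).prod 𝓘(ℝ, (Eu 2 × ℝ) →L[ℝ] ℝ)) (coneModel 5) (L i).Ψ :=
      ⟨(L i).Ψ_smooth, (L i).Ψ_symm_smooth⟩
    have he' := hΨ.trans he
    have hx : secD (coneModel 2) u p' ∈ ((L i).Ψ.trans e).source := ⟨hsrc, hp⟩
    have c2 : ContinuousAt (fun q : Sg i × ℝ ↦ q.2) p' := continuous_snd.continuousAt
    have hev : ∀ᶠ q in 𝓝 p', t * R' < q.2 ∧ q.2 < ε' :=
      (c2.eventually (lt_mem_nhds h2)).and (c2.eventually (gt_mem_nhds h3))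
    have hus : ∀ᶠ q in 𝓝 p', ContMDiffAt (coneModel 2) 𝓘(ℝ, ℝ) ∞ u q := by
      filter_upwards [hev] with q hq
      exact uT_contMDiffAt ht.pos ((hN i).snd_pos hq.1) hq.1 hq.2
    have hproj : ContinuousAt (TotalSpace.proj : Cot (coneModel 2) (Sg i × ℝ) → Sg i × ℝ)
        (secD (coneModel 2) u p') :=
      (FiberBundle.continuous_proj ((Eu 2 × ℝ) →L[ℝ] ℝ)
        (fun x : Sg i × ℝ ↦ TangentSpace (coneModel 2) x →L[ℝ] ℝ)).continuousAt
    have hNt : ∀ᶠ q in 𝓝 (secD (coneModel 2) u p'), ((L i).Ψ.trans e) q ∈ Nt C N₀ A ht ↔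
        q = secD (coneModel 2) u q.proj := by
      filter_upwards [((L i).Ψ.continuousAt hsrc).eventually h, hproj.eventually hev,
        (L i).Ψ.open_source.mem_nhds hsrc] with q hq1 hq2 hq3
      refine hq1.trans ⟨?_, fun hq ↦ ⟨q, ⟨q.proj, hq2, hq.symm⟩, rfl⟩⟩
      rintro ⟨_, ⟨p'', ⟨h5, h6⟩, rfl⟩, e⟩
      have := (L i).Ψ.injOn ((hN i).mem_source p'' h5 h6) hq3 e
      rw [← this]
      rfl
    refine ⟨submanifoldAt_graph hdim he' hus hx hNt,
      eq_zero_of_tangentVectors_graph he' hus hx (hNt.mono fun _ h ↦ h.1) ?_⟩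
    have hcomp := DForm.pullback_comp (f := (L i).Ψ) (g := e) (omegaT X Z ht)
      (he.mdifferentiableAt hp) (hΨ.mdifferentiableAt hsrc)
    refine hcomp.trans ?_
    rw [DForm.pullback_congr_form hω]
    exact (L i).symplectic _ hsrc
  · have hyN := h.self_of_nhds.1 hz
    refine ⟨SubmanifoldAt.transfer he hy ((A i).isSL.1.1 y hyN) h,
      he.eq_zero_of_tangentVectors hy (h.mono fun _ h ↦ h.1) fun u hu v hv ↦ ?_⟩
    rw [hω]
    refine (congrArg (t ^ 2 * ·) ((A i).isSL.1.2 y hyN u hu v hv)).trans ?_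
    exact mul_zero _

end NeckBounds

end Geometry

end SLGluing

end

/-! ### The conclusions hold together for all small t. -/

theorem proposition7p1 {n : ℕ}
    -- the compact singular 6-fold `M₀` with singular points `x i`
    {M₀ : Type*} [TopologicalSpace M₀] [CompactSpace M₀] [T2Space M₀] {x : Fin n → M₀}
    [ChartedSpace (Eu 6) (Reg x)] [IsManifold (𝓡 6) ∞ (Reg x)]
    -- the links `Γ i` of the Calabi-Yau cones
    {Γ : Fin n → Type*} [∀ i, TopologicalSpace (Γ i)] [∀ i, CompactSpace (Γ i)]
    [∀ i, T2Space (Γ i)] [∀ i, ConnectedSpace (Γ i)] [∀ i, ChartedSpace (Eu 5) (Γ i)]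
    [∀ i, IsManifold (𝓡 5) ∞ (Γ i)]
    -- the links `Σ i` of the special Lagrangian cones
    {Sg : Fin n → Type*} [∀ i, TopologicalSpace (Sg i)] [∀ i, CompactSpace (Sg i)]
    [∀ i, T2Space (Sg i)] [∀ i, ChartedSpace (Eu 2) (Sg i)] [∀ i, IsManifold (𝓡 2) ∞ (Sg i)]
    -- the asymptotically conical 6-folds `Y i`
    {Y : Fin n → Type*} [∀ i, TopologicalSpace (Y i)] [∀ i, T2Space (Y i)]
    [∀ i, ChartedSpace (Eu 6) (Y i)] [∀ i, IsManifold (𝓡 6) ∞ (Y i)]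
    (V : ∀ i, Triple (coneModel 5) (Γ i × ℝ)) (hV : ∀ i, IsCalabiYauCone (V i))
    (X : ConicalCY x V) {R : ℝ} (Z : ∀ i, ACCY (V i) (Y i) R) (C : Choices X Z)
    (ι : ∀ i, Sg i → Γ i) (hι : ∀ i, IsSLCone (V i) (ι i)) (L : ∀ i, LagNbhd (V i) (ι i))
    {ε' R' : ℝ} (N₀ : ConicalSL X L ε') (A : ∀ i, ACSL (Z i) (L i) R')
    (ε₀ : ℝ) (hε₀ : 0 < ε₀) (hε₀' : ε₀ ≤ 1) :
    ∃ t₀ > 0, ∀ t, 0 < t → t < t₀ → ∃ ht : Admissible R X.ε C.α t,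
      (T2Space (Mt X Z ht) ∧ CompactSpace (Mt X Z ht) ∧ IsManifold (𝓡 6) ∞ (Mt X Z ht) ∧
        IsNearlyCalabiYau ε₀ (omegaT X Z ht) (C.OmegaT ht)) ∧
      PiecesFit C N₀ A ht ∧ IsCompact (Nt C N₀ A ht) ∧
      IsLagrangian3 (omegaT X Z ht) (Nt C N₀ A ht) := by
  have T0 := tendsto_rpow_zero C.α_pos
  have T1 := tendsto_rpow_div C.α_lt_one
  have T2 : Filter.Tendsto (fun t : ℝ ↦ 2 * t ^ C.α) (𝓝[>] 0) (𝓝 0) := by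
    simpa using T0.const_mul 2
  have key : ∀ᶠ t in 𝓝[>] (0 : ℝ), ∃ ht : Admissible R X.ε C.α t,
      (T2Space (Mt X Z ht) ∧ CompactSpace (Mt X Z ht) ∧ IsManifold (𝓡 6) ∞ (Mt X Z ht) ∧
        IsNearlyCalabiYau ε₀ (omegaT X Z ht) (C.OmegaT ht)) ∧
      PiecesFit C N₀ A ht ∧ IsCompact (Nt C N₀ A ht) ∧
      IsLagrangian3 (omegaT X Z ht) (Nt C N₀ A ht) := by
    filter_upwards [self_mem_nhdsWithin, T2.eventually (gt_mem_nhds X.ε_pos),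
      T2.eventually (gt_mem_nhds N₀.ε'_pos), T1.eventually (Filter.eventually_gt_atTop R),
      T1.eventually (Filter.eventually_gt_atTop R'), eventually_isNearlyCalabiYau hV C hε₀,
      Filter.eventually_all.2 fun i ↦ eventually_neckBounds C N₀ A hV hι i]
      with t ht h1 h2 h3 h4 hCY hN
    have ht : 0 < t := ht
    rw [lt_div_iff₀' ht] at h3 h4
    have hA : Admissible R X.ε C.α t := ⟨ht, h3, h1⟩
    have hT2 : T2Space (Mt X Z hA) := hA.t2Space_Mt
    have hcomp : CompactSpace (Mt X Z hA) := hA.compactSpace_Mt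
    exact ⟨hA, ⟨hT2, hcomp, hA.isManifold_Mt, hCY hA⟩, NeckBounds.piecesFit hN h4 h2,
      (NeckBounds.isClosed_Nt hV hN).isCompact, NeckBounds.isLagrangian3_Nt hV hN⟩
  obtain ⟨t₀, ht₀, h⟩ := mem_nhdsGT_iff_exists_Ioo_subset.1 key
  exact ⟨t₀, ht₀, fun t h1 h2 ↦ h ⟨h1, h2⟩⟩
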